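/- **Setting.** The model is a deterministic unit-cost word RAM with words of $O(\log n)$ bits, and $\omega$ is any real number such that two $n\times n$ matrices can be multiplied in $O(n^{\omega})$ time in this model. There is a vertex set $V$ of $n\ge 1$ vertices and an initially empty unweighted directed graph on $V$. The algorithm is first given, for preprocessing, a predicted sequence $\hat e_1,\dots,\hat e_m$ of distinct directed edges on $V$. Then it receives online an interleaved sequence of edge insertions and queries; the inserted edges are, in this order, $e_1,e_2,\dots$ (possibly stopping before $e_m$), where $(e_1,\dots,e_m)=(\hat e_{\Pi(1)},\dots,\hat e_{\Pi(m)})$ for a permutation $\Pi$ of $\{1,\dots,m\}$ that is unknown to the algorithm. For $0\le i\le m$ let $$\bar\eta_i = i-\max\bigl\{\,j \in\{0,\dots,m\} \bigm| \{\hat e_1,\dots,\hat e_j\}\subseteq\{e_1,\dots,e_i\}\bigr\},\qquad \eta_\infty=\max_{1\le j\le m}|j-\Pi(j)|$$ (with $\eta_\infty=0$ if $m=0$). In the time bounds, logarithms and iterated logarithms are understood to be at least $1$. **Theorem.** (1) For every fixed $\varepsilon>0$ there is a deterministic algorithm for incremental $(1+\varepsilon)$-approximate all-pairs shortest paths with predictions: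 a query $(s,t)$ is answered by a number in $[d(s,t),(1+\varepsilon)\,d(s,t)]$, where $d(s,t)$ is the distance from $s$ to $t$ in the current graph, and by $\infty$ if $t$ is not reachable from $s$. The preprocessing takes $O(n^{(3+\omega)/2}\log^2 n)$ time, each insertion takes $O(\log n)$ worst-case time, and each query asked between the $i$-th and the $(i+1)$-th insertion takes $O((\bar\eta_i+1)^2\log\log n)$ worst-case time. (2) The same holds, with the same bounds, for incremental transitive closure, where a query $(s,t)$ asks whether the current graph contains a path from $s$ to $t$. (3) $\bar\eta_i\le\eta_\infty$ for all $0\le i\le m$; hence the query time is also $O((\eta_\infty+1)^2\log\log n)$. The constants hidden in the $O$-notation depend only on $\omega$ (through the matrix multiplication algorithm) and on $\varepsilon$. -/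

import Mathlib

open scoped ENNReal

/-! ### A word RAM

Programs are structured (loops and branches instead of jumps) and work on finitely many word
variables and finitely many random-access arrays of words. Every operation has unit cost. The
semantics is relative to a word bound `W`: an execution exists only if all the numbers it computes,
among them all the addresses it accesses, are smaller than `W`. Words of `c * log n` bits are the
case `W = n ^ c`. -/

/-- The unit-cost binary operations on words. -/
inductive WordOp
  | add | sub | mul | div | mod | land | lor | xor | shl | shr | lt | eq

/-- Subtraction is truncated at `0`, division by `0` gives `0`, comparisons give `0` or `1`. -/
def WordOp.eval : WordOp → ℕ → ℕ → ℕ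
  | .add, a, b => a + b
  | .sub, a, b => a - b
  | .mul, a, b => a * b
  | .div, a, b => a / b
  | .mod, a, b => a % b
  | .land, a, b => a &&& b
  | .lor, a, b => a ||| b
  | .xor, a, b => a ^^^ b
  | .shl, a, b => a <<< b
  | .shr, a, b => a >>> b
  | .lt, a, b => if a < b then 1 else 0
  | .eq, a, b => if a = b then 1 else 0

/-- The memory of the machine: word variables and arrays of words. -/
@[ext] structure RamState where
  var : ℕ → ℕ
  arr : ℕ → ℕ → ℕ

/-- Expressions: constants, variables, array entries, binary operations. -/
inductive RamExpr
  | const (k : ℕ)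
  | var (x : ℕ)
  | read (a : ℕ) (idx : RamExpr)
  | op (o : WordOp) (e₁ e₂ : RamExpr)

/-- The value of an expression. -/
def RamExpr.eval (σ : RamState) : RamExpr → ℕ
  | .const k => k
  | .var x => σ.var x
  | .read a idx => σ.arr a (idx.eval σ)
  | .op o e₁ e₂ => o.eval (e₁.eval σ) (e₂.eval σ)

/-- The cost of evaluating an expression: its number of nodes. -/
def RamExpr.cost : RamExpr → ℕ
  | .const _ => 1
  | .var _ => 1
  | .read _ idx => idx.cost + 1
  | .op _ e₁ e₂ => e₁.cost + e₂.cost + 1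

/-- All values that occur in the evaluation of an expression (hence all addresses that are read)
are smaller than the word bound `W`. -/
def RamExpr.Fits (W : ℕ) (σ : RamState) : RamExpr → Prop
  | .const k => k < W
  | .var x => σ.var x < W
  | .read a idx => idx.Fits W σ ∧ σ.arr a (idx.eval σ) < W
  | .op o e₁ e₂ => e₁.Fits W σ ∧ e₂.Fits W σ ∧ o.eval (e₁.eval σ) (e₂.eval σ) < W

/-- Programs. Conditions of `ite` and `loop` count as true if their value is not `0`. -/
inductive RamProg
  | skip
  | assign (x : ℕ) (e : RamExpr)
  | write (a : ℕ) (idx e : RamExpr)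
  | seq (p q : RamProg)
  | ite (e : RamExpr) (p q : RamProg)
  | loop (e : RamExpr) (p : RamProg)

/-- Set variable `x` to `v`. -/
def RamState.setVar (σ : RamState) (x v : ℕ) : RamState :=
  { σ with var := Function.update σ.var x v }

/-- Set entry `i` of array `a` to `v`. -/
def RamState.setArr (σ : RamState) (a i v : ℕ) : RamState :=
  { σ with arr := Function.update σ.arr a (Function.update (σ.arr a) i v) }

/-- `RamExec W p σ t σ'`: with word bound `W`, program `p` started in state `σ` halts in state `σ'`
after exactly `t` steps, and no number outside the word range is ever computed. -/
inductive RamExec (W : ℕ) : RamProg → RamState → ℕ → RamState → Prop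
  | skip (σ : RamState) : RamExec W .skip σ 1 σ
  | assign (x : ℕ) (e : RamExpr) (σ : RamState) (he : e.Fits W σ) :
      RamExec W (.assign x e) σ (e.cost + 1) (σ.setVar x (e.eval σ))
  | write (a : ℕ) (idx e : RamExpr) (σ : RamState) (hi : idx.Fits W σ) (he : e.Fits W σ) :
      RamExec W (.write a idx e) σ (idx.cost + e.cost + 1) (σ.setArr a (idx.eval σ) (e.eval σ))
  | seq (p q : RamProg) (σ₁ σ₂ σ₃ : RamState) (t₁ t₂ : ℕ)
      (hp : RamExec W p σ₁ t₁ σ₂) (hq : RamExec W q σ₂ t₂ σ₃) :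
      RamExec W (.seq p q) σ₁ (t₁ + t₂) σ₃
  | iteTrue (e : RamExpr) (p q : RamProg) (σ σ' : RamState) (t : ℕ) (he : e.Fits W σ)
      (hc : e.eval σ ≠ 0) (hp : RamExec W p σ t σ') :
      RamExec W (.ite e p q) σ (e.cost + 1 + t) σ'
  | iteFalse (e : RamExpr) (p q : RamProg) (σ σ' : RamState) (t : ℕ) (he : e.Fits W σ)
      (hc : e.eval σ = 0) (hq : RamExec W q σ t σ') :
      RamExec W (.ite e p q) σ (e.cost + 1 + t) σ'
  | loopTrue (e : RamExpr) (p : RamProg) (σ₁ σ₂ σ₃ : RamState) (t₁ t₂ : ℕ) (he : e.Fits W σ₁)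
      (hc : e.eval σ₁ ≠ 0) (hp : RamExec W p σ₁ t₁ σ₂) (hl : RamExec W (.loop e p) σ₂ t₂ σ₃) :
      RamExec W (.loop e p) σ₁ (e.cost + 1 + t₁ + t₂) σ₃
  | loopFalse (e : RamExpr) (p : RamProg) (σ : RamState) (he : e.Fits W σ) (hc : e.eval σ = 0) :
      RamExec W (.loop e p) σ (e.cost + 1) σ

/-- The machine is deterministic: program and initial state determine the running time and the
final state. -/
theorem RamExec.deterministic {W : ℕ} {p : RamProg} {σ σ₁ σ₂ : RamState} {t₁ t₂ : ℕ}
    (h₁ : RamExec W p σ t₁ σ₁) (h₂ : RamExec W p σ t₂ σ₂) : t₁ = t₂ ∧ σ₁ = σ₂ := by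
  induction h₁ generalizing t₂ σ₂ with
  | skip σ => cases h₂; exact ⟨rfl, rfl⟩
  | assign x e σ he => cases h₂; exact ⟨rfl, rfl⟩
  | write a idx e σ hi he => cases h₂; exact ⟨rfl, rfl⟩
  | seq p q s₁ s₂ s₃ t t' hp hq ihp ihq =>
    cases h₂ with
    | seq _ _ _ _ _ _ _ hp' hq' =>
      obtain ⟨rfl, rfl⟩ := ihp hp'
      obtain ⟨rfl, rfl⟩ := ihq hq'
      exact ⟨rfl, rfl⟩
  | iteTrue e p q s s' t he hc hp ih =>
    cases h₂ with
    | iteTrue _ _ _ _ _ _ _ _ hp' => obtain ⟨rfl, rfl⟩ := ih hp'; exact ⟨rfl, rfl⟩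
    | iteFalse _ _ _ _ _ _ _ hc' _ => exact absurd hc' hc
  | iteFalse e p q s s' t he hc hp ih =>
    cases h₂ with
    | iteTrue _ _ _ _ _ _ _ hc' _ => exact absurd hc hc'
    | iteFalse _ _ _ _ _ _ _ _ hp' => obtain ⟨rfl, rfl⟩ := ih hp'; exact ⟨rfl, rfl⟩
  | loopTrue e p s₁ s₂ s₃ t t' he hc hp hl ihp ihl =>
    cases h₂ with
    | loopTrue _ _ _ _ _ _ _ _ _ hp' hl' =>
      obtain ⟨rfl, rfl⟩ := ihp hp'
      obtain ⟨rfl, rfl⟩ := ihl hl'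
      exact ⟨rfl, rfl⟩
    | loopFalse _ _ _ _ hc' => exact absurd hc' hc
  | loopFalse e p s he hc =>
    cases h₂ with
    | loopTrue _ _ _ _ _ _ _ _ hc' _ _ => exact absurd hc hc'
    | loopFalse _ _ _ _ _ => exact ⟨rfl, rfl⟩

/-- Words of `O(log n)` bits: numbers below `(n + 2) ^ c`, for a constant `c`. -/
def wordBound (c n : ℕ) : ℕ := (n + 2) ^ c

/-! ### The time of matrix multiplication -/

/-- Input of matrix multiplication: the dimension in variable `0`, the two matrices row by row in
the arrays `0` and `1`, and zeros elsewhere. -/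
def matMulInput {n : ℕ} (A B : Matrix (Fin n) (Fin n) ℕ) : RamState where
  var x := if x = 0 then n else 0
  arr a k :=
    if h : k < n * n then
      let i : Fin n := (finProdFinEquiv.symm ⟨k, h⟩).1
      let j : Fin n := (finProdFinEquiv.symm ⟨k, h⟩).2
      if a = 0 then A i j else if a = 1 then B i j else 0
    else 0

/-- Two `n × n` matrices can be multiplied in time `O(n ^ ω)`: some program computes the integer
product of any two `0`-`1` matrices of any dimension `n ≥ 1` in at most `C * n ^ ω` steps, and
leaves it, row by row, in array `2`. Only matrices with entries `0` and `1` have to be handled, so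
every `ω` that is admissible for integer matrices with larger entries is admissible here. -/
def MatMulInTime (ω : ℝ) : Prop :=
  ∃ (P : RamProg) (c C : ℕ), ∀ n : ℕ, 1 ≤ n →
    ∀ A B : Matrix (Fin n) (Fin n) ℕ, (∀ i j, A i j ≤ 1) → (∀ i j, B i j ≤ 1) →
      ∃ (t : ℕ) (σ : RamState), RamExec (wordBound c n) P (matMulInput A B) t σ ∧
        (t : ℝ) ≤ C * (n : ℝ) ^ ω ∧
        ∀ i j : Fin n, σ.arr 2 (i * n + j) = (A * B) i j

/-! ### Graphs and distances -/

/-- The graph after the first `i` insertions of the sequence `e`. -/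
def graphAt {V : Type*} {m : ℕ} (e : Fin m → V × V) (i : ℕ) : Digraph V where
  Adj u v := ∃ k : Fin m, (k : ℕ) < i ∧ e k = (u, v)

/-- There is a walk with exactly `k` edges from `s` to `t`. -/
def HasWalk {V : Type*} (G : Digraph V) (s t : V) (k : ℕ) : Prop :=
  ∃ p : Fin (k + 1) → V, p 0 = s ∧ p (Fin.last k) = t ∧
    ∀ l : Fin k, G.Adj (p l.castSucc) (p l.succ)

/-- The distance from `s` to `t`; it is `⊤` if `t` cannot be reached from `s`. -/
noncomputable def ddist {V : Type*} (G : Digraph V) (s t : V) : ℕ∞ :=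
  ⨅ (k : ℕ) (_ : HasWalk G s t k), (k : ℕ∞)

/-! ### Prediction errors -/

/-- The length of the longest prefix of the predicted sequence `ê` all of whose edges are among the
first `i` edges of the actual sequence `e`. (The set is bounded by `m` and contains `0`.) -/
noncomputable def insertedPrefix {V : Type*} {m : ℕ} (ê e : Fin m → V × V) (i : ℕ) : ℕ :=
  sSup {j : ℕ | j ≤ m ∧ ∀ k : Fin m, (k : ℕ) < j → ∃ l : Fin m, (l : ℕ) < i ∧ e l = ê k}

/-- The number of edges that are present after `i` insertions and do not belong to the longest
inserted prefix of the predicted sequence. -/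
noncomputable def etaBar {V : Type*} {m : ℕ} (ê e : Fin m → V × V) (i : ℕ) : ℕ :=
  i - insertedPrefix ê e i

/-- The largest difference between the actual and the predicted position of an edge, where the edge
at position `j` of the actual sequence is predicted to be at position `τ j`. -/
def etaInf {m : ℕ} (τ : Equiv.Perm (Fin m)) : ℕ :=
  Finset.univ.sup fun j : Fin m => ((j : ℤ) - (τ j : ℤ)).natAbs

/-! ### Incremental data structures with a predicted sequence of insertions -/

/-- A dynamic algorithm: three programs that work on a common memory. -/
structure DynAlg where
  preprocess : RamProg
  insert : RamProg
  query : RamProg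

/-- Input of the preprocessing: `n` in variable `0`, `m` in variable `1`, the tails and the heads of
the predicted edges in the arrays `0` and `1`, and zeros elsewhere. -/
def predictionInput {n m : ℕ} (ê : Fin m → Fin n × Fin n) : RamState where
  var x := if x = 0 then n else if x = 1 then m else 0
  arr a k :=
    if h : k < m then
      if a = 0 then ((ê ⟨k, h⟩).1 : ℕ) else if a = 1 then ((ê ⟨k, h⟩).2 : ℕ) else 0
    else 0

/-- A request is handed over by writing a pair of vertices into the variables `0` and `1`; the rest
of the memory is as the previous operation left it. -/
def RamState.withPair {n : ℕ} (σ : RamState) (e : Fin n × Fin n) : RamState :=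
  (σ.setVar 0 e.1).setVar 1 e.2

/-- The answer to a query: variable `0` tells whether the answer is finite, and then variable `1` is
the answer. -/
def RamState.answer (σ : RamState) : ℕ∞ :=
  if σ.var 0 = 0 then ⊤ else (σ.var 1 : ℕ∞)

/-- A request: insert the next edge of the actual sequence, or answer a query about `(s, t)`. -/
inductive Request (n : ℕ)
  | insert
  | query (s t : Fin n)

/-- From memory `σ`, at which `i` edges of the actual sequence `e` have been inserted, algorithm `D`
serves the requests in the given order, one after the other. An insertion takes at most `tIns`
steps; a query after `i` insertions takes at most `tQry i` steps and its answer is right in the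
sense of `ok G s t`, where `G` is the graph at that moment. At most `m` edges are inserted. -/
def Serves {n m : ℕ} (D : DynAlg) (W : ℕ) (e : Fin m → Fin n × Fin n)
    (tIns : ℝ) (tQry : ℕ → ℝ) (ok : Digraph (Fin n) → Fin n → Fin n → ℕ∞ → Prop) :
    ℕ → RamState → List (Request n) → Prop
  | _, _, [] => True
  | i, σ, .insert :: rs => ∀ h : i < m, ∃ (t : ℕ) (σ' : RamState),
      RamExec W D.insert (σ.withPair (e ⟨i, h⟩)) t σ' ∧ (t : ℝ) ≤ tIns ∧
        Serves D W e tIns tQry ok (i + 1) σ' rs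
  | i, σ, .query u v :: rs => ∃ (t : ℕ) (σ' : RamState),
      RamExec W D.query (σ.withPair (u, v)) t σ' ∧ (t : ℝ) ≤ tQry i ∧
        ok (graphAt e i) u v σ'.answer ∧ Serves D W e tIns tQry ok i σ' rs

/-- `D` solves the incremental problem with predictions given by `ok`, within the given bounds: on
`n ≥ 1` vertices, for each predicted sequence `ê` of `m` distinct edges, for each actual sequence
`ê ∘ τ` of the same edges, and for each interleaving with queries. The preprocessing sees only `ê`;
the bound for a query depends on `n` and on the current prediction error. -/
def SolvesIncremental (D : DynAlg) (c : ℕ) (tPre tIns : ℕ → ℝ) (tQry : ℕ → ℕ → ℝ)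
    (ok : ∀ {n : ℕ}, Digraph (Fin n) → Fin n → Fin n → ℕ∞ → Prop) : Prop :=
  ∀ n m : ℕ, 1 ≤ n → ∀ ê : Fin m → Fin n × Fin n, Function.Injective ê →
    ∃ (t : ℕ) (σ : RamState),
      RamExec (wordBound c n) D.preprocess (predictionInput ê) t σ ∧ (t : ℝ) ≤ tPre n ∧
      ∀ (τ : Equiv.Perm (Fin m)) (rs : List (Request n)),
        Serves D (wordBound c n) (ê ∘ τ) (tIns n) (fun i => tQry n (etaBar ê (ê ∘ τ) i)) ok 0 σ rs

/-- The answer lies between `d(s, t)` and `(1 + ε) * d(s, t)`. -/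
def ApproxDistOk (ε : ℝ) {n : ℕ} (G : Digraph (Fin n)) (s t : Fin n) (a : ℕ∞) : Prop :=
  ((ddist G s t : ℕ∞) : ℝ≥0∞) ≤ (a : ℝ≥0∞) ∧
    (a : ℝ≥0∞) ≤ ENNReal.ofReal (1 + ε) * ((ddist G s t : ℕ∞) : ℝ≥0∞)

/-- The answer is finite (YES) if there is a path from `s` to `t`, and infinite (NO) otherwise. -/
def ReachabilityOk {n : ℕ} (G : Digraph (Fin n)) (s t : Fin n) (a : ℕ∞) : Prop :=
  a ≠ ⊤ ↔ Relation.ReflTransGen G.Adj s t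

/-- The logarithm in the running times: `⌊log₂ n⌋ + 1`, which is `Θ(log n)` for `n ≥ 2` and never smaller
than `1`. -/
def lg (n : ℕ) : ℕ := Nat.log 2 n + 1

/-! The predicted insertions turn the approximate distances of all prefixes of the predicted sequence
into a static object. For a length `ℓ`, let `T_ℓ (u, v)` be the number of predicted insertions after
which there is a walk from `u` to `v` of at most `ℓ` edges. Then `T_(a + b)` is the (min,max)-product
of `T_a` and `T_b` (`IsLevel.mul`), and `O(log n)` lengths suffice: `gridLen` lists lengths whose
neighbours differ by a factor of at most `1 + 1 / K`, and each of them, from the third on, is the sum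
of two earlier ones.
The tables are all that the preprocessing computes, apart from some initializations. For a prefix of
length `j`, an approximate distance is the least tabulated length `ℓ` with `T_ℓ (u, v) ≤ j`; binary
search finds it in `O(log log n)` steps (`Tables.estimates`).

A (min,max)-product is the minimum of two half products, in which the maximum is known to be attained
by the left, or by the right, factor (`MinMaxProduct.of_half`). A half product of `X` and `Y` is
computed by a sweep over the entries of both matrices in increasing order (`wp_runProg`). The entries
of each row are collected in slots of `s` entries. At most `2 * n` slots are in use; when they are
exhausted, the 0-1 matrices that relate the slots are multiplied, the product tells for each slot and
column whether the slot contains a sufficient entry, and in that case the slot is scanned for the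
first one. Each result is decided by one scan, and each product is paid for by `n * s` entries, so
with products of cost `D` the sweep takes time `O(n² * s + (n / s) * D)`. The capacity `s` that
balances both terms depends on the running time of the given multiplication program `P`, which no
program can look up. Therefore a run of `P` is simulated with a step counter (`wp_relocate`), a sweep
that exceeds its budget is abandoned, and `s` is doubled (`capacity_lt`, `wp_halfProg`). Since `P` may
rely on zeros in its initial memory, each run gets a region of memory that has not been used before.
With `D = O(n ^ ω)` this is `O(n ^ ((3 + ω) / 2) * log n)` for each table. It is used here that
`2 ≤ ω`, because `P` has to write `n²` entries (`MatMulInTime.two_le`), and `ω ≤ 3`, which is no loss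
because of schoolbook multiplication (`matMulInTime_three`).

After `i` insertions, the inserted edges are stored in the slots `< i` of an array, where an edge that
is predicted at a position `< i` has the slot of that number (`Slots`). If the predicted prefix of
length `j` has been inserted, the other inserted edges thus fill the slots from `j` to `i - 1`, and
their number is the error `η` at that time if `j` is maximal. An insertion moves a bounded number of
edges. A query finds `j` by going through the array downwards, estimates the distances between the
ends of the `η` remaining edges with respect to the prefix, and runs Dijkstra's algorithm with
these edges as nodes. All errors are relative, so the result is an approximation with the same factor
(`estimates_of_fixpoint`). Reachability is read off an approximate distance
(`ApproxDistOk.reachabilityOk`), and `etaBar_le_etaInf` compares the two measures of the prediction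
error.

All programs share a fixed layout of the memory.
* Variables: `10` is `n`, `11` is `m`, `12` the number of tables, `14` the number `i` of insertions,
  `15` the number of predicted positions `< i` whose edges are missing, `16` is `n²`, `17` is `2 * n`
  (the number of slots, and infinity in queries), `18` is the bound `M` of the matrix entries, `19`
  the size `B` of a memory region, `20` is `2 * n²`, `21` is `2 * M + 2`. Variables from `30` on belong
  to the half product; among them, `60` is the base address of the current memory region, `61` the
  next slot, `62` the step counter, and `63` is set when a sweep has been abandoned.
* Arrays: `0` and `1` contain the ends of the predicted edges, `2` the tables, `3` their lengths, `4`
  the predicted position of each edge, `5` the slots, `6` the slot of each position plus one, `7` and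
  `8` are used by Dijkstra's algorithm, `10` to `31` by the half product, and arrays from `40` on by
  the simulated program. -/

/-! ### Weakest preconditions with elapsed time -/

/-- Sequential composition of programs. -/
infixr:60 " ;; " => RamProg.seq

instance : Add RamExpr := ⟨.op .add⟩
instance : Sub RamExpr := ⟨.op .sub⟩
instance : Mul RamExpr := ⟨.op .mul⟩
instance : Div RamExpr := ⟨.op .div⟩
instance : Mod RamExpr := ⟨.op .mod⟩

/-- The comparison `e < f` as an expression. -/
def RamExpr.less (e f : RamExpr) : RamExpr := .op .lt e f

/-- The comparison `e = f` as an expression. -/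
def RamExpr.same (e f : RamExpr) : RamExpr := .op .eq e f

namespace RamExpr
variable (σ : RamState) (W : ℕ) (e f : RamExpr)

@[simp] theorem eval_add : (e + f).eval σ = e.eval σ + f.eval σ := (rfl)
@[simp] theorem eval_sub : (e - f).eval σ = e.eval σ - f.eval σ := (rfl)
@[simp] theorem eval_mul : (e * f).eval σ = e.eval σ * f.eval σ := (rfl)
@[simp] theorem eval_div : (e / f).eval σ = e.eval σ / f.eval σ := (rfl)
@[simp] theorem eval_mod : (e % f).eval σ = e.eval σ % f.eval σ := (rfl)
@[simp] theorem eval_less : (e.less f).eval σ = if e.eval σ < f.eval σ then 1 else 0 := (rfl)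
@[simp] theorem eval_same : (e.same f).eval σ = if e.eval σ = f.eval σ then 1 else 0 := (rfl)
@[simp] theorem eval_const (k : ℕ) : (const k).eval σ = k := (rfl)
@[simp] theorem eval_var (x : ℕ) : (var x).eval σ = σ.var x := (rfl)
@[simp] theorem eval_read (a : ℕ) : (read a e).eval σ = σ.arr a (e.eval σ) := (rfl)
@[simp] theorem cost_add : (e + f).cost = e.cost + f.cost + 1 := rfl
@[simp] theorem cost_sub : (e - f).cost = e.cost + f.cost + 1 := rfl
@[simp] theorem cost_mul : (e * f).cost = e.cost + f.cost + 1 := rfl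
@[simp] theorem cost_div : (e / f).cost = e.cost + f.cost + 1 := rfl
@[simp] theorem cost_mod : (e % f).cost = e.cost + f.cost + 1 := rfl
@[simp] theorem cost_less : (e.less f).cost = e.cost + f.cost + 1 := rfl
@[simp] theorem cost_same : (e.same f).cost = e.cost + f.cost + 1 := rfl
@[simp] theorem cost_const (k : ℕ) : (const k).cost = 1 := rfl
@[simp] theorem cost_var (x : ℕ) : (var x).cost = 1 := rfl
@[simp] theorem cost_read (a : ℕ) : (read a e).cost = e.cost + 1 := rfl
@[simp] theorem fits_add :
    (e + f).Fits W σ ↔ e.Fits W σ ∧ f.Fits W σ ∧ e.eval σ + f.eval σ < W := Iff.rfl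
@[simp] theorem fits_sub :
    (e - f).Fits W σ ↔ e.Fits W σ ∧ f.Fits W σ ∧ e.eval σ - f.eval σ < W := Iff.rfl
@[simp] theorem fits_mul :
    (e * f).Fits W σ ↔ e.Fits W σ ∧ f.Fits W σ ∧ e.eval σ * f.eval σ < W := Iff.rfl
@[simp] theorem fits_div :
    (e / f).Fits W σ ↔ e.Fits W σ ∧ f.Fits W σ ∧ e.eval σ / f.eval σ < W := Iff.rfl
@[simp] theorem fits_mod :
    (e % f).Fits W σ ↔ e.Fits W σ ∧ f.Fits W σ ∧ e.eval σ % f.eval σ < W := Iff.rfl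
@[simp] theorem fits_less : (e.less f).Fits W σ ↔
    e.Fits W σ ∧ f.Fits W σ ∧ (if e.eval σ < f.eval σ then 1 else 0) < W := Iff.rfl
@[simp] theorem fits_same : (e.same f).Fits W σ ↔
    e.Fits W σ ∧ f.Fits W σ ∧ (if e.eval σ = f.eval σ then 1 else 0) < W := Iff.rfl
@[simp] theorem fits_const (k : ℕ) : (const k).Fits W σ ↔ k < W := Iff.rfl
@[simp] theorem fits_var (x : ℕ) : (var x).Fits W σ ↔ σ.var x < W := Iff.rfl
@[simp] theorem fits_read (a : ℕ) :
    (read a e).Fits W σ ↔ e.Fits W σ ∧ σ.arr a (e.eval σ) < W := Iff.rfl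

theorem Fits.eval_lt {σ : RamState} {W : ℕ} {e : RamExpr} (h : e.Fits W σ) : e.eval σ < W := by
  cases e with
  | const k => exact h
  | var x => exact h
  | read a i => exact h.2
  | op o e f => exact h.2.2

end RamExpr

@[simp] theorem ite_one_zero_lt (p : Prop) [Decidable p] (W : ℕ) (hW : 1 < W) :
    (if p then 1 else 0) < W := by split_ifs <;> omega

namespace RamState
variable (σ : RamState)

@[simp] theorem var_setVar (x v y : ℕ) :
    (σ.setVar x v).var y = if y = x then v else σ.var y := by
  simp [setVar, Function.update_apply]
@[simp] theorem arr_setVar (x v : ℕ) : (σ.setVar x v).arr = σ.arr := rfl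
@[simp] theorem var_setArr (a i v : ℕ) : (σ.setArr a i v).var = σ.var := rfl
@[simp] theorem arr_setArr (a i v b : ℕ) : (σ.setArr a i v).arr b =
    if b = a then Function.update (σ.arr a) i v else σ.arr b := by
  simp only [setArr, Function.update_apply]

end RamState

/-- Program `p`, started in `σ` when `τ` steps have elapsed, halts, and `Q` holds of the final
state and the number of steps elapsed by then. -/
def wp (W : ℕ) (p : RamProg) (Q : RamState → ℕ → Prop) (σ : RamState) (τ : ℕ) : Prop :=
  ∃ t σ', RamExec W p σ t σ' ∧ Q σ' (τ + t)

section
variable {W : ℕ} {p q : RamProg} {Q Q' : RamState → ℕ → Prop} {σ : RamState} {τ : ℕ} {e : RamExpr}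

theorem wp.mono (h : wp W p Q σ τ) (hQ : ∀ σ' τ', Q σ' τ' → Q' σ' τ') : wp W p Q' σ τ :=
  let ⟨t, σ', h₁, h₂⟩ := h
  ⟨t, σ', h₁, hQ _ _ h₂⟩

@[simp] theorem wp_skip : wp W .skip Q σ τ ↔ Q σ (τ + 1) :=
  ⟨fun ⟨_, _, h₁, h₂⟩ => by cases h₁; exact h₂, fun h => ⟨_, _, .skip _, h⟩⟩

@[simp] theorem wp_assign {x : ℕ} :
    wp W (.assign x e) Q σ τ ↔ e.Fits W σ ∧ Q (σ.setVar x (e.eval σ)) (τ + (e.cost + 1)) :=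
  ⟨fun ⟨_, _, h₁, h₂⟩ => by cases h₁ with | assign _ _ _ h => exact ⟨h, h₂⟩,
    fun h => ⟨_, _, .assign _ _ _ h.1, h.2⟩⟩

@[simp] theorem wp_write {a : ℕ} {i : RamExpr} :
    wp W (.write a i e) Q σ τ ↔ i.Fits W σ ∧ e.Fits W σ ∧
      Q (σ.setArr a (i.eval σ) (e.eval σ)) (τ + (i.cost + e.cost + 1)) :=
  ⟨fun ⟨_, _, h₁, h₂⟩ => by cases h₁ with | write _ _ _ _ h h' => exact ⟨h, h', h₂⟩,
    fun h => ⟨_, _, .write _ _ _ _ h.1 h.2.1, h.2.2⟩⟩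

@[simp] theorem wp_seq : wp W (p ;; q) Q σ τ ↔ wp W p (wp W q Q) σ τ := by
  constructor
  · rintro ⟨_, _, h₁, h₂⟩
    cases h₁ with
    | seq _ _ _ σ' _ t t' hp hq =>
      exact ⟨t, σ', hp, t', _, hq, by rw [add_assoc]; exact h₂⟩
  · rintro ⟨t, σ', hp, t', σ'', hq, h⟩
    exact ⟨_, _, .seq _ _ _ _ _ _ _ hp hq, by rw [← add_assoc]; exact h⟩

@[simp] theorem wp_ite : wp W (.ite e p q) Q σ τ ↔ e.Fits W σ ∧
    (e.eval σ ≠ 0 → wp W p Q σ (τ + (e.cost + 1))) ∧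
    (e.eval σ = 0 → wp W q Q σ (τ + (e.cost + 1))) := by
  constructor
  · rintro ⟨_, _, h₁, h₂⟩
    cases h₁ with
    | iteTrue _ _ _ _ _ t he hc hp =>
      exact ⟨he, fun _ => ⟨t, _, hp, by rw [add_assoc]; exact h₂⟩, fun h => absurd h hc⟩
    | iteFalse _ _ _ _ _ t he hc hp =>
      exact ⟨he, fun h => absurd hc h, fun _ => ⟨t, _, hp, by rw [add_assoc]; exact h₂⟩⟩
  · rintro ⟨he, h₁, h₂⟩
    by_cases hc : e.eval σ = 0
    · obtain ⟨t, σ', hp, h⟩ := h₂ hc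
      exact ⟨_, _, .iteFalse _ _ _ _ _ _ he hc hp, by rw [← add_assoc]; exact h⟩
    · obtain ⟨t, σ', hp, h⟩ := h₁ hc
      exact ⟨_, _, .iteTrue _ _ _ _ _ _ he hc hp, by rw [← add_assoc]; exact h⟩

end

/-- The program writes only to variables `≥ v` and to arrays `≥ a`. -/
def RamProg.Above (v a : ℕ) : RamProg → Prop
  | .skip => True
  | .assign x _ => v ≤ x
  | .write b _ _ => a ≤ b
  | .seq p q => p.Above v a ∧ q.Above v a
  | .ite _ p q => p.Above v a ∧ q.Above v a
  | .loop _ p => p.Above v a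

/-- The two states agree on the variables `< v` and on the arrays `< a`. -/
def Agree (v a : ℕ) (σ σ' : RamState) : Prop :=
  (∀ x, x < v → σ'.var x = σ.var x) ∧ ∀ b, b < a → σ'.arr b = σ.arr b

theorem Agree.refl (v a : ℕ) (σ : RamState) : Agree v a σ σ := ⟨fun _ _ => rfl, fun _ _ => rfl⟩

theorem Agree.trans {v a : ℕ} {σ₁ σ₂ σ₃ : RamState} (h : Agree v a σ₁ σ₂) (h' : Agree v a σ₂ σ₃) :
    Agree v a σ₁ σ₃ :=
  ⟨fun x hx => (h'.1 x hx).trans (h.1 x hx), fun x hx => (h'.2 x hx).trans (h.2 x hx)⟩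

theorem RamExec.agree {W : ℕ} {p : RamProg} {σ σ' : RamState} {t v a : ℕ}
    (h : RamExec W p σ t σ') (hp : p.Above v a) : Agree v a σ σ' := by
  induction h with
  | skip => exact .refl _ _ _
  | assign x e σ he =>
    refine ⟨fun y hy => ?_, fun _ _ => rfl⟩
    have : y ≠ x := fun h => absurd (h ▸ hy) (not_lt.2 hp)
    simp [this]
  | write b i e σ hi he =>
    refine ⟨fun _ _ => rfl, fun y hy => ?_⟩
    have : y ≠ b := fun h => absurd (h ▸ hy) (not_lt.2 hp)
    simp [this]
  | seq _ _ _ _ _ _ _ _ _ ih₁ ih₂ => exact (ih₁ hp.1).trans (ih₂ hp.2)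
  | iteTrue _ _ _ _ _ _ _ _ _ ih => exact ih hp.1
  | iteFalse _ _ _ _ _ _ _ _ _ ih => exact ih hp.2
  | loopTrue _ _ _ _ _ _ _ _ _ _ _ ih₁ ih₂ => exact (ih₁ hp).trans (ih₂ hp)
  | loopFalse => exact .refl _ _ _

section
variable {W : ℕ} {p body : RamProg} {Q Q' : RamState → ℕ → Prop} {σ : RamState} {τ : ℕ}
  {e : RamExpr} {v a : ℕ}

/-- The frame rule: everything outside of the write set of `p` is unchanged. -/
theorem wp.frame (h : wp W p Q σ τ) (hp : p.Above v a)
    (hQ : ∀ σ' τ', Agree v a σ σ' → Q σ' τ' → Q' σ' τ') : wp W p Q' σ τ :=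
  let ⟨t, σ', h₁, h₂⟩ := h
  ⟨t, σ', h₁, hQ _ _ (h₁.agree hp) h₂⟩

/-- The rule for loops, with an invariant `I` and a decreasing measure `V`. The body may rely on what
it does not write, since that part of the memory is as it was before the loop. -/
theorem wp_loop (I : RamState → ℕ → Prop) (V : RamState → ℕ) (hA : body.Above v a)
    (h0 : I σ τ)
    (hs : ∀ σ' τ', Agree v a σ σ' → I σ' τ' → e.Fits W σ' ∧
      (e.eval σ' ≠ 0 →
        wp W body (fun σ'' τ'' => I σ'' τ'' ∧ V σ'' < V σ') σ' (τ' + (e.cost + 1))) ∧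
      (e.eval σ' = 0 → Q σ' (τ' + (e.cost + 1)))) :
    wp W (.loop e body) Q σ τ := by
  have key : ∀ k σ' τ', V σ' = k → Agree v a σ σ' → I σ' τ' → wp W (.loop e body) Q σ' τ' := by
    intro k
    induction k using Nat.strong_induction_on with
    | _ k ih =>
      intro σ' τ' hV hag hI
      obtain ⟨hf, h1, h2⟩ := hs σ' τ' hag hI
      by_cases hc : e.eval σ' = 0
      · exact ⟨_, _, .loopFalse _ _ _ hf hc, h2 hc⟩
      · obtain ⟨t, σ'', hx, hI', hlt⟩ := h1 hc
        obtain ⟨t', σ₃, hx', hq⟩ := ih _ (hV ▸ hlt) σ'' _ rfl (hag.trans (hx.agree hA)) hI'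
        refine ⟨_, _, .loopTrue _ _ _ _ _ _ _ hf hc hx hx', ?_⟩
        simpa only [add_assoc] using hq
  exact key _ _ _ rfl (.refl _ _ _) h0

/-- `for x := 0, …, h - 1 do body`; the bound is the value of variable `h`. -/
def forLoop (x h : ℕ) (body : RamProg) : RamProg :=
  .assign x (.const 0) ;; .loop ((RamExpr.var x).less (.var h))
    (body ;; .assign x (.var x + .const 1))

theorem forLoop_above {x h : ℕ} : (forLoop x h body).Above v a ↔ v ≤ x ∧ body.Above v a := by
  simp only [forLoop, RamProg.Above]; tauto

/-- The rule for loops with a counter. The invariant is stated at the loop head. -/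
theorem wp_forLoop {x h : ℕ} (I : ℕ → RamState → ℕ → Prop) (H : ℕ)
    (hA : body.Above v a) (hx : v ≤ x) (hh : h < v) (hH : σ.var h = H) (hW : H < W) (hW1 : 1 < W)
    (h0 : I 0 (σ.setVar x 0) (τ + 2))
    (hs : ∀ i, i < H → ∀ σ' τ', σ'.var x = i → Agree v a σ σ' → I i σ' τ' →
      wp W body (fun σ'' τ'' => σ''.var x = i ∧ I (i + 1) (σ''.setVar x (i + 1)) (τ'' + 4))
        σ' (τ' + 4))
    (hQ : ∀ σ' τ', σ'.var x = H → Agree v a σ σ' → I H σ' τ' → Q σ' (τ' + 4)) :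
    wp W (forLoop x h body) Q σ τ := by
  have hne : h ≠ x := by omega
  have hag0 : Agree v a σ (σ.setVar x 0) := by
    refine ⟨fun y hy => ?_, fun _ _ => rfl⟩
    have : y ≠ x := by omega
    simp [this]
  rw [forLoop, wp_seq, wp_assign]
  refine ⟨by simp; omega, ?_⟩
  simp only [RamExpr.eval_const, RamExpr.cost_const]
  refine wp_loop (v := v) (a := a)
    (fun σ' τ' => σ'.var x ≤ H ∧ I (σ'.var x) σ' τ') (fun σ' => H - σ'.var x)
    ⟨hA, hx⟩ ⟨by simp, by simpa using h0⟩ ?_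
  rintro σ' τ' hag ⟨hle, hI⟩
  have hag' := hag0.trans hag
  have hh' : σ'.var h = H := by rw [hag'.1 h hh, hH]
  refine ⟨by simp [hh', hW1]; omega, ?_, ?_⟩
  · intro hc
    have hlt : σ'.var x < H := by
      by_contra hcon
      simp [hh', hcon] at hc
    rw [wp_seq]
    refine (hs _ hlt σ' τ' rfl hag' hI).mono ?_
    rintro σ'' τ'' ⟨h1, h2⟩
    rw [wp_assign]
    refine ⟨by simp [h1, hW1]; omega, ?_⟩
    simp only [RamExpr.eval_add, RamExpr.eval_var, RamExpr.eval_const, h1, RamState.var_setVar,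
      if_true, RamExpr.cost_add, RamExpr.cost_var, RamExpr.cost_const]
    exact ⟨⟨hlt, h2⟩, by omega⟩
  · intro hc
    have hlt : ¬ σ'.var x < H := by
      intro hcon
      simp [hh', hcon] at hc
    have heq : σ'.var x = H := by omega
    have := hQ σ' τ' heq hag' (heq ▸ hI)
    simpa using this

/-- A loop whose body only writes one array entry. -/
def mapLoop (x h b : ℕ) (idx e : RamExpr) : RamProg := forLoop x h (.write b idx e)

/-- Effect of a `mapLoop` that writes the values `f i` to the entries `ι i`. In iteration `i` the
entries `ι i'` with `i' < i` are already written. -/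
theorem wp_mapLoop {x h b : ℕ} {idx : RamExpr} (H : ℕ) (ι f : ℕ → ℕ)
    (hH : σ.var h = H) (hhx : h < x) (hW : H < W) (hW1 : 1 < W)
    (hι : ∀ i < H, ∀ i' < H, ι i = ι i' → i = i')
    (hs : ∀ i < H, ∀ σ' : RamState, σ'.var x = i → (∀ y, y ≠ x → σ'.var y = σ.var y) →
      (∀ c, c ≠ b → σ'.arr c = σ.arr c) → (∀ i' < i, σ'.arr b (ι i') = f i') →
      (∀ y, (∀ i' < i, y ≠ ι i') → σ'.arr b y = σ.arr b y) →
      idx.Fits W σ' ∧ e.Fits W σ' ∧ idx.eval σ' = ι i ∧ e.eval σ' = f i)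
    (hQ : ∀ σ' τ', (∀ y, y ≠ x → σ'.var y = σ.var y) → σ'.var x = H →
      (∀ c, c ≠ b → σ'.arr c = σ.arr c) → (∀ i < H, σ'.arr b (ι i) = f i) →
      (∀ y, (∀ i < H, y ≠ ι i) → σ'.arr b y = σ.arr b y) →
      τ' = τ + H * (idx.cost + e.cost + 9) + 6 → Q σ' τ') :
    wp W (mapLoop x h b idx e) Q σ τ := by
  refine wp_forLoop (v := x) (a := 0) (fun i σ' τ' => (∀ y, y ≠ x → σ'.var y = σ.var y) ∧
      (∀ c, c ≠ b → σ'.arr c = σ.arr c) ∧ (∀ i' < i, σ'.arr b (ι i') = f i') ∧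
      (∀ y, (∀ i' < i, y ≠ ι i') → σ'.arr b y = σ.arr b y) ∧
      τ' = τ + i * (idx.cost + e.cost + 9) + 2) H (Nat.zero_le b) le_rfl hhx hH hW hW1 ?_ ?_ ?_
  · refine ⟨fun y hy => by simp [hy], fun _ _ => rfl, by simp, by simp, by simp⟩
  · rintro i hi σ' τ' hx hag ⟨h1, h2, h3, h4, h5⟩
    obtain ⟨f1, f2, e1, e2⟩ := hs i hi σ' hx h1 h2 h3 h4
    rw [wp_write]
    refine ⟨f1, f2, by simpa using hx, ?_, ?_, ?_, ?_, ?_⟩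
    · intro y hy; simp [hy, h1 y hy]
    · intro c hc; simp [hc, h2 c hc]
    · intro i' hi'
      simp only [RamState.arr_setVar, RamState.arr_setArr, if_true, e1, e2, Function.update_apply]
      split_ifs with hc
      · rw [hι _ (by omega) _ hi hc]
      · exact h3 i' (by rcases Nat.lt_succ_iff_lt_or_eq.1 hi' with h | h
                        · exact h
                        · exact absurd (by rw [h]) hc)
    · intro y hy
      simp only [RamState.arr_setVar, RamState.arr_setArr, if_true, e1, Function.update_apply,
        if_neg (hy i (Nat.lt_succ_self i))]
      exact h4 y fun i' hi' => hy i' (by omega)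
    · rw [h5]; ring
  · rintro σ' τ' hx hag ⟨h1, h2, h3, h4, h5⟩
    exact hQ σ' _ h1 hx h2 h3 h4 (by rw [h5])

theorem mapLoop_above {x h b : ℕ} {idx : RamExpr} :
    (mapLoop x h b idx e).Above v a ↔ v ≤ x ∧ a ≤ b := by
  simp [mapLoop, forLoop_above, RamProg.Above]

end

/-! ### Running a program in a fresh memory region, with a step counter -/

/-- Upper bound (exclusive) of the variables that occur. -/
def RamExpr.vars : RamExpr → ℕ
  | .const _ => 0
  | .var x => x + 1
  | .read _ i => i.vars
  | .op _ e f => max e.vars f.vars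

/-- Upper bound (exclusive) of the variables that occur. -/
def RamProg.vars : RamProg → ℕ
  | .skip => 0
  | .assign x e => max (x + 1) e.vars
  | .write _ i e => max i.vars e.vars
  | .seq p q => max p.vars q.vars
  | .ite e p q => max e.vars (max p.vars q.vars)
  | .loop e p => max e.vars p.vars

section
variable (kv ka base cnt : ℕ)

/-- The expression with its variables shifted by `kv`, its arrays shifted by `ka`, and all
addresses shifted by the value of the variable `base`. -/
def RamExpr.relocate : RamExpr → RamExpr
  | .const k => .const k
  | .var x => .var (x + kv)
  | .read a i => .read (a + ka) (.op .add (.var base) i.relocate)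
  | .op o e f => .op o e.relocate f.relocate

/-- Increment the step counter. -/
def tick : RamProg := .assign cnt (.op .add (.var cnt) (.const 1))

/-- The relocated program, which also counts its steps in the variable `cnt`. -/
def RamProg.relocate : RamProg → RamProg
  | .skip => tick cnt
  | .assign x e => .assign (x + kv) (e.relocate kv ka base) ;; tick cnt
  | .write a i e => .write (a + ka) (.op .add (.var base) (i.relocate kv ka base))
      (e.relocate kv ka base) ;; tick cnt
  | .seq p q => p.relocate ;; q.relocate
  | .ite e p q => tick cnt ;; .ite (e.relocate kv ka base) p.relocate q.relocate
  | .loop e p => .loop (e.relocate kv ka base) (p.relocate ;; tick cnt) ;; tick cnt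

/-- A bound for the number of steps of the relocated program per increment of the counter. -/
def RamProg.tickCost : RamProg → ℕ
  | .skip => 4
  | .assign _ e => (e.relocate kv ka base).cost + 5
  | .write _ i e => (i.relocate kv ka base).cost + (e.relocate kv ka base).cost + 7
  | .seq p q => p.tickCost + q.tickCost
  | .ite e p q => (e.relocate kv ka base).cost + 5 + p.tickCost + q.tickCost
  | .loop e p => (e.relocate kv ka base).cost + 5 + p.tickCost

end

/-- The memory `ρ` is found in the memory `σ`, with the variables `< b` shifted by `kv`, the arrays
shifted by `ka` and the addresses `< B` shifted by `β`. -/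
structure Embeds (kv ka b β B : ℕ) (ρ σ : RamState) : Prop where
  var : ∀ x < b, σ.var (x + kv) = ρ.var x
  arr : ∀ a, ∀ y < B, σ.arr (a + ka) (β + y) = ρ.arr a y

theorem RamExpr.eval_relocate {kv ka b β B base : ℕ} {ρ σ : RamState} {e : RamExpr}
    (hR : Embeds kv ka b β B ρ σ) (hβ : σ.var base = β) (hb : e.vars ≤ b) (hf : e.Fits B ρ) :
    (e.relocate kv ka base).eval σ = e.eval ρ := by
  induction e with
  | const k => rfl
  | var x => exact hR.var x hb
  | read a i ih =>
    have := ih hb hf.1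
    have h2 := hR.arr a _ hf.1.eval_lt
    simp only [relocate, eval, WordOp.eval, this, hβ, h2]
  | op o e f ihe ihf =>
    simp only [vars, sup_le_iff] at hb
    simp only [relocate, eval, ihe hb.1 hf.1, ihf hb.2 hf.2.1]

theorem RamExpr.fits_relocate {kv ka b β B base W : ℕ} {ρ σ : RamState} {e : RamExpr}
    (hR : Embeds kv ka b β B ρ σ) (hβ : σ.var base = β) (hb : e.vars ≤ b) (hf : e.Fits B ρ)
    (hW : β + B ≤ W) : (e.relocate kv ka base).Fits W σ := by
  induction e with
  | const k => exact lt_of_lt_of_le hf (by omega)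
  | var x => exact (hR.var x hb).trans_lt (lt_of_lt_of_le hf (by omega))
  | read a i ih =>
    have h1 := ih hb hf.1
    have h2 := eval_relocate (e := i) hR hβ hb hf.1
    have h3 := hf.1.eval_lt
    have h4 := hR.arr a _ hf.1.eval_lt
    have h5 : ρ.arr a (i.eval ρ) < B := hf.2
    refine ⟨⟨?_, h1, ?_⟩, ?_⟩
    · simp only [Fits, hβ]; omega
    · simp only [WordOp.eval, eval, hβ, h2]; omega
    · simp only [WordOp.eval, eval, hβ, h2, h4]; omega
  | op o e f ihe ihf =>
    simp only [vars, sup_le_iff] at hb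
    refine ⟨ihe hb.1 hf.1, ihf hb.2 hf.2.1, ?_⟩
    rw [eval_relocate hR hβ hb.1 hf.1, eval_relocate hR hβ hb.2 hf.2.1]
    exact lt_of_lt_of_le hf.2.2 (by omega)

theorem RamProg.above_relocate {kv ka base cnt v a : ℕ} (hv : v ≤ kv) (ha : a ≤ ka) (hc : v ≤ cnt)
    (p : RamProg) : (p.relocate kv ka base cnt).Above v a := by
  induction p <;> simp_all [relocate, Above, tick] <;> omega

/-- The postcondition of a relocated program: it ends in an embedding of the final memory of the
original program, the counter has grown by at most the number `t` of steps of the original program,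
its own running time is proportional to this growth, and it did not leave its memory region. -/
structure Simulated (kv ka b β B cnt κ t τ : ℕ) (ρ' σ σ' : RamState) (τ' : ℕ) : Prop where
  embeds : Embeds kv ka b β B ρ' σ'
  le_cnt : σ.var cnt ≤ σ'.var cnt
  cnt_le : σ'.var cnt ≤ σ.var cnt + t
  time : τ' + κ * σ.var cnt ≤ τ + κ * σ'.var cnt
  outside : ∀ a y, β + B ≤ y → σ'.arr a y = σ.arr a y
  low : ∀ x < kv, x ≠ cnt → σ'.var x = σ.var x

theorem wp_tick {W cnt : ℕ} {Q : RamState → ℕ → Prop} {σ : RamState} {τ : ℕ}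
    (h : σ.var cnt + 1 < W) (hQ : Q (σ.setVar cnt (σ.var cnt + 1)) (τ + 4)) :
    wp W (tick cnt) Q σ τ := by
  rw [tick, wp_assign]
  exact ⟨⟨Nat.lt_of_succ_lt h, lt_of_le_of_lt (Nat.le_add_left 1 _) h, h⟩, hQ⟩

theorem Embeds.setVar_low {kv ka b β B x v : ℕ} {ρ σ : RamState} (h : Embeds kv ka b β B ρ σ)
    (hx : x < kv) : Embeds kv ka b β B ρ (σ.setVar x v) := by
  refine ⟨fun y hy => ?_, h.arr⟩
  have : y + kv ≠ x := by omega
  simp [this, h.var y hy]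

/-- The relocated program simulates a run of `p` with word bound `B`: the variables are shifted by `kv`,
and the arrays by `ka` in their numbers and by `β` in their addresses. The counter `cnt` grows by the
time `t` of the run, and the simulation takes at most `κ` units of time for each unit of `t`. -/
theorem wp_relocate {kv ka b β B base cnt W : ℕ} (hbase : base < kv) (hcnt : cnt < kv)
    (hne : base ≠ cnt) {p : RamProg} {ρ ρ' : RamState} {t : ℕ} (h : RamExec B p ρ t ρ')
    {σ : RamState} (hb : p.vars ≤ b) (hR : Embeds kv ka b β B ρ σ) (hβ : σ.var base = β)
    (hW : β + B ≤ W) (hq : σ.var cnt + t < W) (τ κ : ℕ) (hκ : p.tickCost kv ka base ≤ κ) :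
    wp W (p.relocate kv ka base cnt)
      (Simulated kv ka b β B cnt κ t τ ρ' σ) σ τ := by
  induction h generalizing σ τ κ with
  | skip ρ =>
    simp only [RamProg.tickCost] at hκ
    refine wp_tick hq ⟨hR.setVar_low hcnt, by simp, by simp, by simp; nlinarith,
      fun a y _ => rfl, fun x _ hx => by simp [hx]⟩
  | assign x e ρ he =>
    simp only [RamProg.vars, sup_le_iff] at hb
    simp only [RamProg.tickCost] at hκ
    have h1 := RamExpr.eval_relocate hR hβ hb.2 he
    have hx : cnt ≠ x + kv := by omega
    rw [RamProg.relocate, wp_seq, wp_assign]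
    refine ⟨RamExpr.fits_relocate hR hβ hb.2 he hW, wp_tick (by simp [hx]; omega) ?_⟩
    refine ⟨⟨fun y hy => ?_, hR.arr⟩, by simp [hx], by simp [hx], by simp [hx]; nlinarith,
      fun a y _ => rfl, fun y hy hy' => ?_⟩
    · have h2 : y + kv ≠ cnt := by omega
      by_cases h3 : y = x
      · subst h3; simp [h2, h1]
      · simp [h2, h3, hR.var y hy]
    · have : y ≠ x + kv := by omega
      simp [hy', this]
  | write c i e ρ hi he =>
    simp only [RamProg.vars, sup_le_iff] at hb
    simp only [RamProg.tickCost] at hκ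
    have h1 := RamExpr.eval_relocate hR hβ hb.2 he
    have h2 := RamExpr.eval_relocate hR hβ hb.1 hi
    have h3 := hi.eval_lt
    rw [RamProg.relocate, wp_seq, wp_write]
    refine ⟨⟨by simp only [RamExpr.Fits, hβ]; omega, RamExpr.fits_relocate hR hβ hb.1 hi hW, ?_⟩,
      RamExpr.fits_relocate hR hβ hb.2 he hW, wp_tick (by simp; omega) ?_⟩
    · simp only [WordOp.eval, RamExpr.eval, hβ, h2]; omega
    refine ⟨⟨fun y hy => ?_, fun a y hy => ?_⟩, by simp, by simp, ?_,
      fun a y hy => ?_, fun y hy hy' => by simp [hy']⟩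
    · have h2 : y + kv ≠ cnt := by omega
      simpa [h2] using hR.var y hy
    · by_cases h4 : a = c
      · subst h4
        simp only [RamState.arr_setVar, RamState.arr_setArr, if_true, RamExpr.eval, WordOp.eval,
          hβ, h2, h1, Function.update_apply, add_right_inj, hR.arr a y hy]
      · simp [h4, hR.arr a y hy]
    · simp only [RamState.var_setVar, RamState.var_setArr, if_true, RamExpr.cost]; nlinarith
    · by_cases h4 : a = c + ka
      · have : y ≠ β + i.eval ρ := by omega
        simp [h4, RamExpr.eval, WordOp.eval, hβ, h2, this]
      · simp [h4]
  | seq p q ρ₁ ρ₂ ρ₃ t₁ t₂ _ _ ihp ihq =>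
    simp only [RamProg.vars, sup_le_iff] at hb
    simp only [RamProg.tickCost] at hκ
    rw [RamProg.relocate, wp_seq]
    refine (ihp hb.1 hR hβ (by omega) τ κ (by omega)).mono ?_
    intro σ' τ' s
    have := s.cnt_le
    refine (ihq hb.2 s.embeds (by rw [s.low _ hbase hne, hβ]) (by omega) τ' κ (by omega)).mono ?_
    intro σ'' τ'' s'
    have h1 := s.le_cnt; have h2 := s'.cnt_le; have h3 := s.time; have h4 := s'.time
    exact ⟨s'.embeds, h1.trans s'.le_cnt, by omega, by omega,
      fun a y hy => (s'.outside a y hy).trans (s.outside a y hy),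
      fun x hx hx' => (s'.low x hx hx').trans (s.low x hx hx')⟩
  | iteTrue e p q ρ ρ' t he hc _ ih =>
    simp only [RamProg.vars, sup_le_iff] at hb
    simp only [RamProg.tickCost] at hκ
    have hR' := hR.setVar_low (v := σ.var cnt + 1) hcnt
    have hβ' : (σ.setVar cnt (σ.var cnt + 1)).var base = β := by simp [hne, hβ]
    rw [RamProg.relocate, wp_seq]
    refine wp_tick (by omega) ?_
    rw [wp_ite, RamExpr.eval_relocate hR' hβ' hb.1 he]
    refine ⟨RamExpr.fits_relocate hR' hβ' hb.1 he hW, fun _ => ?_, fun h => absurd h hc⟩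
    refine (ih hb.2.1 hR' hβ' (by simp; omega) _ κ (by omega)).mono ?_
    rintro σ'' τ'' ⟨h1, h2, h3, h4, h5, h6⟩
    simp only [RamState.var_setVar, if_true] at h2 h3 h4
    refine ⟨h1, by omega, by omega, by nlinarith, fun a y hy => h5 a y hy,
      fun x hx hx' => by rw [h6 x hx hx']; simp [hx']⟩
  | iteFalse e p q ρ ρ' t he hc _ ih =>
    simp only [RamProg.vars, sup_le_iff] at hb
    simp only [RamProg.tickCost] at hκ
    have hR' := hR.setVar_low (v := σ.var cnt + 1) hcnt
    have hβ' : (σ.setVar cnt (σ.var cnt + 1)).var base = β := by simp [hne, hβ]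
    rw [RamProg.relocate, wp_seq]
    refine wp_tick (by omega) ?_
    rw [wp_ite, RamExpr.eval_relocate hR' hβ' hb.1 he]
    refine ⟨RamExpr.fits_relocate hR' hβ' hb.1 he hW, fun h => absurd hc h, fun _ => ?_⟩
    refine (ih hb.2.2 hR' hβ' (by simp; omega) _ κ (by omega)).mono ?_
    rintro σ'' τ'' ⟨h1, h2, h3, h4, h5, h6⟩
    simp only [RamState.var_setVar, if_true] at h2 h3 h4
    refine ⟨h1, by omega, by omega, by nlinarith, fun a y hy => h5 a y hy,
      fun x hx hx' => by rw [h6 x hx hx']; simp [hx']⟩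
  | loopTrue e p ρ₁ ρ₂ ρ₃ t₁ t₂ he hc _ _ ihp ihl =>
    have hb' := hb
    have hκ' := hκ
    simp only [RamProg.vars, sup_le_iff] at hb
    simp only [RamProg.tickCost] at hκ
    -- One round of the loop, followed by the loop itself, which the induction hypothesis treats.
    obtain ⟨u, σ₁, x₁, s₁⟩ := ihp hb.2 hR hβ (by omega) 0 (p.tickCost kv ka base) le_rfl
    have h1 := s₁.cnt_le; have h2 := s₁.le_cnt; have h3 := s₁.time
    obtain ⟨u', σ₂, x₂, h4⟩ : wp W (tick cnt)
        (fun σ₂ u' => σ₂ = σ₁.setVar cnt (σ₁.var cnt + 1) ∧ u' = 4) σ₁ 0 :=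
      wp_tick (by omega) ⟨rfl, rfl⟩
    obtain ⟨rfl, h4⟩ := h4
    have hR₂ := s₁.embeds.setVar_low (v := σ₁.var cnt + 1) hcnt
    have hβ₂ : (σ₁.setVar cnt (σ₁.var cnt + 1)).var base = β := by
      simp [hne, s₁.low _ hbase hne, hβ]
    obtain ⟨u'', σ₃, x₃, s₃⟩ := ihl hb' hR₂ hβ₂ (by simp; omega) 0 κ hκ'
    cases x₃ with
    | seq _ _ _ σ₄ _ v v' x₄ x₅ =>
      refine ⟨_, σ₃, .seq _ _ _ _ _ _ _ (.loopTrue _ _ _ _ _ _ _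
        (RamExpr.fits_relocate hR hβ hb.1 he hW)
        (by rw [RamExpr.eval_relocate hR hβ hb.1 he]; exact hc) (.seq _ _ _ _ _ _ _ x₁ x₂) x₄) x₅, ?_⟩
      obtain ⟨i1, i2, i3, i4, i5, i6⟩ := s₃
      simp only [RamState.var_setVar, if_true] at i2 i3 i4
      refine ⟨i1, by omega, by omega, ?_, fun a y hy => (i5 a y hy).trans (s₁.outside a y hy),
        fun x hx hx' => by rw [i6 x hx hx']; simp [hx', s₁.low x hx hx']⟩
      obtain ⟨d, hd⟩ := Nat.exists_eq_add_of_le h2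
      have h5 : p.tickCost kv ka base * d ≤ κ * d := Nat.mul_le_mul_right _ (by omega)
      rw [hd] at h3 i4
      nlinarith
  | loopFalse e p ρ he hc =>
    simp only [RamProg.vars, sup_le_iff] at hb
    simp only [RamProg.tickCost] at hκ
    rw [RamProg.relocate, wp_seq]
    refine ⟨_, _, .loopFalse _ _ _ (RamExpr.fits_relocate hR hβ hb.1 he hW)
        (by rw [RamExpr.eval_relocate hR hβ hb.1 he]; exact hc), wp_tick (by omega) ?_⟩
    refine ⟨hR.setVar_low hcnt, by simp, by simp, by simp; nlinarith,
      fun a y _ => rfl, fun x _ hx => by simp [hx]⟩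

/-- Set the first `b` relocated variables to `0`. -/
def clearVars (kv : ℕ) : ℕ → RamProg
  | 0 => .skip
  | b + 1 => clearVars kv b ;; .assign (b + kv) (.const 0)

theorem wp_clearVars {kv b W : ℕ} {Q : RamState → ℕ → Prop} {σ : RamState} {τ : ℕ} (hW : 0 < W)
    (hQ : ∀ σ' : RamState, (∀ x < b, σ'.var (x + kv) = 0) →
      (∀ x, x < kv → σ'.var x = σ.var x) → σ'.arr = σ.arr → Q σ' (τ + (2 * b + 1))) :
    wp W (clearVars kv b) Q σ τ := by
  induction b generalizing Q with
  | zero => exact wp_skip.2 (hQ σ (by simp) (fun _ _ => rfl) rfl)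
  | succ b ih =>
    rw [clearVars, wp_seq]
    refine ih fun σ' h1 h2 h3 => ?_
    rw [wp_assign]
    refine ⟨hW, hQ _ (fun x hx => ?_) (fun x hx => ?_) h3⟩
    · by_cases h : x = b
      · simp [h]
      · simp [h, h1 x (by omega)]
    · have : x ≠ b + kv := by omega
      simp [this, h2 x hx]

theorem clearVars_above {kv v a : ℕ} (h : v ≤ kv) (b : ℕ) : (clearVars kv b).Above v a := by
  induction b with
  | zero => trivial
  | succ b ih => exact ⟨ih, by simp only [RamProg.Above]; omega⟩

/-! ### Sorting the matrix entries by value -/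

theorem Finset.sum_add_eq_of_bump {ι : Type*} [DecidableEq ι] {s : Finset ι} {f g : ι → ℕ} {i : ι}
    (hi : i ∈ s) (h : ∀ j ∈ s, j ≠ i → g j = f j) : ∑ j ∈ s, g j + f i = ∑ j ∈ s, f j + g i := by
  rw [← Finset.add_sum_erase s g hi, ← Finset.add_sum_erase s f hi,
    Finset.sum_congr rfl fun j hj => h j (Finset.mem_of_mem_erase hj) (Finset.ne_of_mem_erase hj)]
  ring

/-- The sort key of an event: entries of `Y` are the events `< k`, entries of `X` the events
`k, …, 2 * k - 1`. Entries are compared by value, and entries of `Y` come before equal entries of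
`X`. -/
def eventKey (k : ℕ) (X Y : ℕ → ℕ) (e : ℕ) : ℕ := if e < k then 2 * Y e else 2 * X (e - k) + 1

/-- The sequence `ord` of length `E` lists all events `< E`, with increasing keys. -/
structure SortedBy (key : ℕ → ℕ) (E : ℕ) (ord : ℕ → ℕ) : Prop where
  lt : ∀ p < E, ord p < E
  surj : ∀ e < E, ∃ p < E, ord p = e
  mono : ∀ p p', p ≤ p' → p' < E → key (ord p) ≤ key (ord p')

/-- After the distribution of the events `< i` to buckets. -/
structure Buckets (key : ℕ → ℕ) (R E i : ℕ) (cnt tbl : ℕ → ℕ) : Prop where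
  mem : ∀ x < R, ∀ c < cnt x, tbl (x * E + c) < i ∧ key (tbl (x * E + c)) = x
  surj : ∀ e < i, ∃ c < cnt (key e), tbl (key e * E + c) = e
  sum : ∑ x ∈ Finset.range R, cnt x = i

theorem Buckets.step {key : ℕ → ℕ} {R E i : ℕ} {cnt tbl : ℕ → ℕ} (h : Buckets key R E i cnt tbl)
    (hi : i < E) (hR : ∀ e < E, key e < R) :
    Buckets key R E (i + 1) (Function.update cnt (key i) (cnt (key i) + 1))
      (Function.update tbl (key i * E + cnt (key i)) i) := by
  have hk := hR i hi
  have hc : ∀ x < R, cnt x ≤ i := fun x hx =>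
    h.sum ▸ Finset.single_le_sum (f := cnt) (fun _ _ => Nat.zero_le _) (Finset.mem_range.2 hx)
  have hne : ∀ x < R, ∀ c < cnt x, x * E + c ≠ key i * E + cnt (key i) := by
    intro x hx c hcx heq
    have h1 := hc x hx; have h2 := hc _ hk
    have : x = key i := by
      have h3 : (x * E + c) / E = x := by
        rw [mul_comm, Nat.mul_add_div (by omega), Nat.div_eq_of_lt (by omega), add_zero]
      have h4 : (key i * E + cnt (key i)) / E = key i := by
        rw [mul_comm, Nat.mul_add_div (by omega), Nat.div_eq_of_lt (by omega), add_zero]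
      rw [← h3, ← h4, heq]
    subst this
    omega
  refine ⟨fun x hx c hcx => ?_, fun e he => ?_, ?_⟩
  · by_cases hxk : x = key i
    · subst hxk
      rw [Function.update_self] at hcx
      by_cases hcc : c = cnt (key i)
      · subst hcc; simp
      · rw [Function.update_of_ne (hne _ hx c (by omega))]
        obtain ⟨h1, h2⟩ := h.mem _ hx c (by omega)
        exact ⟨by omega, h2⟩
    · rw [Function.update_of_ne hxk] at hcx
      rw [Function.update_of_ne (hne _ hx c hcx)]
      obtain ⟨h1, h2⟩ := h.mem _ hx c hcx
      exact ⟨by omega, h2⟩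
  · by_cases hei : e = i
    · subst hei
      exact ⟨cnt (key e), by simp, by simp⟩
    · obtain ⟨c, hcx, hce⟩ := h.surj e (by omega)
      have hlt : key e < R := hR e (by omega)
      refine ⟨c, ?_, ?_⟩
      · by_cases hx : key e = key i
        · rw [hx, Function.update_self]; rw [hx] at hcx; omega
        · rwa [Function.update_of_ne hx]
      · rwa [Function.update_of_ne (hne _ hlt c hcx)]
  · have := Finset.sum_add_eq_of_bump (f := cnt)
      (g := Function.update cnt (key i) (cnt (key i) + 1)) (Finset.mem_range.2 hk)
      (fun j _ hj => Function.update_of_ne hj _ _)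
    rw [h.sum, Function.update_self] at this
    omega


/-- While the buckets are emptied into the list `ord`, which has length `P`: the buckets before `x`
and the first `c` entries of bucket `x` have been moved. -/
structure Emptied (key : ℕ → ℕ) (E : ℕ) (cnt tbl : ℕ → ℕ) (x c P : ℕ) (ord : ℕ → ℕ) : Prop where
  lt : ∀ p < P, ord p < E
  le : ∀ p < P, key (ord p) ≤ x
  mono : ∀ p p', p ≤ p' → p' < P → key (ord p) ≤ key (ord p')
  prev : ∀ e < E, key e < x → ∃ p < P, ord p = e
  curr : ∀ c' < c, ∃ p < P, ord p = tbl (x * E + c')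
  len : P = ∑ x' ∈ Finset.range x, cnt x' + c

theorem Emptied.append {key : ℕ → ℕ} {R E : ℕ} {cnt tbl : ℕ → ℕ} {x c P : ℕ} {ord : ℕ → ℕ}
    (h : Emptied key E cnt tbl x c P ord) (hb : Buckets key R E E cnt tbl) (hx : x < R)
    (hc : c < cnt x) :
    Emptied key E cnt tbl x (c + 1) (P + 1) (Function.update ord P (tbl (x * E + c))) := by
  obtain ⟨h1, h2⟩ := hb.mem x hx c hc
  have old : ∀ p < P, Function.update ord P (tbl (x * E + c)) p = ord p := fun p hp =>
    Function.update_of_ne (by omega) _ _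
  have new : Function.update ord P (tbl (x * E + c)) P = tbl (x * E + c) :=
    Function.update_self _ _ _
  have cs : ∀ p < P + 1, p < P ∨ p = P := fun p hp => by omega
  refine ⟨fun p hp => ?_, fun p hp => ?_, fun p p' hpp hp' => ?_, fun e he hk => ?_,
    fun c' hc' => ?_, by have := h.len; omega⟩
  · obtain h | rfl := cs p hp
    · rw [old p h]; exact Emptied.lt ‹_› p h
    · rwa [new]
  · obtain h | rfl := cs p hp
    · rw [old p h]; exact Emptied.le ‹_› p h
    · rw [new, h2]
  · obtain h3 | rfl := cs p' hp'
    · rw [old p (by omega), old p' h3]; exact h.mono p p' hpp h3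
    · obtain h3 | rfl := cs p (by omega)
      · rw [old p h3, new, h2]; exact h.le p h3
      · exact le_rfl
  · obtain ⟨p, hp, rfl⟩ := h.prev e he hk
    exact ⟨p, by omega, old p hp⟩
  · by_cases hcc : c' = c
    · subst hcc; exact ⟨P, by omega, new⟩
    · obtain ⟨p, hp, hpe⟩ := h.curr c' (by omega)
      exact ⟨p, by omega, (old p hp).trans hpe⟩

theorem Emptied.next {key : ℕ → ℕ} {R E : ℕ} {cnt tbl : ℕ → ℕ} {x P : ℕ} {ord : ℕ → ℕ}
    (h : Emptied key E cnt tbl x (cnt x) P ord) (hb : Buckets key R E E cnt tbl) :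
    Emptied key E cnt tbl (x + 1) 0 P ord := by
  refine ⟨h.lt, fun p hp => (h.le p hp).trans (Nat.le_succ _), h.mono, fun e he hk => ?_,
    by simp, by rw [Finset.sum_range_succ, add_zero]; exact h.len⟩
  obtain hk | hk : key e < x ∨ key e = x := by omega
  · exact h.prev e he hk
  · subst hk
    obtain ⟨c, hc, hce⟩ := hb.surj e he
    obtain ⟨p, hp, hpe⟩ := h.curr c hc
    exact ⟨p, hp, hpe.trans hce⟩

theorem Emptied.sortedBy {key : ℕ → ℕ} {R E : ℕ} {cnt tbl : ℕ → ℕ} {P : ℕ} {ord : ℕ → ℕ}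
    (h : Emptied key E cnt tbl R 0 P ord) (hb : Buckets key R E E cnt tbl)
    (hR : ∀ e < E, key e < R) : SortedBy key E ord := by
  have hP : P = E := by rw [h.len, hb.sum, add_zero]
  subst hP
  exact ⟨h.lt, fun e he => h.prev e he (hR e he), h.mono⟩

open RamExpr in
/-- Compute the keys (array `12`) of the events given by the arrays `10` and `11` and sort them
into array `13`. -/
def sortProg : RamProg :=
  mapLoop 30 16 12 (var 30) (const 2 * read 11 (var 30)) ;;
  mapLoop 30 16 12 (var 16 + var 30) (const 2 * read 10 (var 30) + const 1) ;;
  mapLoop 30 21 14 (var 30) (const 0) ;;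
  forLoop 30 20
    (.assign 31 (read 12 (var 30)) ;;
     .write 15 (var 31 * var 20 + read 14 (var 31)) (var 30) ;;
     .write 14 (var 31) (read 14 (var 31) + const 1)) ;;
  .assign 35 (const 0) ;;
  forLoop 30 21
    (.assign 33 (read 14 (var 30)) ;;
     forLoop 34 33
      (.write 13 (var 35) (read 15 (var 30 * var 20 + var 34)) ;;
       .assign 35 (var 35 + const 1)))

theorem sortProg_above : sortProg.Above 30 12 := by
  simp [sortProg, RamProg.Above, mapLoop_above, forLoop_above]

/-- Bucket sort of the `2 * k` entries of two matrices; there are `2 * M + 2` possible keys. -/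
theorem wp_sortProg {W k M : ℕ} {σ : RamState} {τ : ℕ}
    (h16 : σ.var 16 = k) (h20 : σ.var 20 = 2 * k) (h21 : σ.var 21 = 2 * M + 2)
    (hX : ∀ e < k, σ.arr 10 e ≤ M) (hY : ∀ e < k, σ.arr 11 e ≤ M)
    (hW : (2 * M + 2) * (2 * k) + 2 * M + 2 * k + 3 < W) :
    wp W sortProg (fun σ' τ' =>
      SortedBy (eventKey k (σ.arr 10) (σ.arr 11)) (2 * k) (σ'.arr 13) ∧
      τ' ≤ τ + 200 * (k + M + 1)) σ τ := by
  set X := σ.arr 10 with hXd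
  set Y := σ.arr 11 with hYd
  set key := eventKey k X Y with hkey
  have hR : ∀ e < 2 * k, key e < 2 * M + 2 := by
    intro e he
    simp only [hkey, eventKey]
    split_ifs with h
    · have := hY e h; omega
    · have := hX (e - k) (by omega); omega
  have hmul : ∀ x < 2 * M + 2, x * (2 * k) + 2 * k ≤ (2 * M + 2) * (2 * k) := by
    intro x hx
    calc x * (2 * k) + 2 * k = (x + 1) * (2 * k) := by ring
      _ ≤ _ := Nat.mul_le_mul_right _ hx
  rw [sortProg, wp_seq]
  refine wp_mapLoop k id (fun e => 2 * Y e) h16 (by norm_num) (by omega) (by omega)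
    (fun _ _ _ _ h => h) ?_ ?_
  · intro i hi σ' h1 h2 h3 h4 h5
    have := hY i hi
    simp [h1, h3, ← hYd]; omega
  intro σ₁ τ₁ v1 _ a1 b1 c1 t1
  rw [wp_seq]
  refine wp_mapLoop k (fun e => k + e) (fun e => 2 * X e + 1) (by simp [v1, h16]) (by norm_num)
    (by omega) (by omega) (fun _ _ _ _ h => by simpa using h) ?_ ?_
  · intro i hi σ' h1 h2 h3 h4 h5
    have := hX i hi
    simp [h1, h2, h3, v1, a1, h16, ← hXd]; omega
  intro σ₂ τ₂ v2 _ a2 b2 c2 t2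
  have hK : ∀ e < 2 * k, σ₂.arr 12 e = key e := by
    intro e he
    simp only [hkey, eventKey]
    split_ifs with h
    · rw [c2 e (fun i _ => by omega)]; exact b1 e h
    · have := b2 (e - k) (by omega)
      rwa [Nat.add_sub_cancel' (by omega)] at this
  rw [wp_seq]
  refine wp_mapLoop (2 * M + 2) id (fun _ => 0) (by simp [v1, v2, h21]) (by norm_num)
    (by omega) (by omega) (fun _ _ _ _ h => h) ?_ ?_
  · intro i hi σ' h1 h2 h3 h4 h5
    simp [h1]; omega
  intro σ₃ τ₃ v3 _ a3 b3 c3 t3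
  have e20 : σ₃.var 20 = 2 * k := by simp [v1, v2, v3, h20]
  have e21 : σ₃.var 21 = 2 * M + 2 := by simp [v1, v2, v3, h21]
  rw [wp_seq]
  refine wp_forLoop (v := 30) (a := 13)
    (fun i σ' τ' => Buckets key (2 * M + 2) (2 * k) i (σ'.arr 14) (σ'.arr 15) ∧
      τ' = τ₃ + 2 + 25 * i) (2 * k) (by simp [RamProg.Above]) le_rfl (by norm_num) e20
      (by omega) (by omega) ?_ ?_ ?_
  · refine ⟨⟨fun x hx c hc => ?_, by simp, ?_⟩, rfl⟩
    · have h0 : σ₃.arr 14 x = 0 := b3 x hx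
      have hc' : c < σ₃.arr 14 x := hc
      omega
    · exact Finset.sum_eq_zero fun x hx => b3 x (Finset.mem_range.1 hx)
  · rintro i hi σ' τ' hx hag ⟨hI, rfl⟩
    have hk := hR i hi
    have hm := hmul _ hk
    have hc : σ'.arr 14 (key i) ≤ i := (Finset.single_le_sum (f := σ'.arr 14)
      (fun _ _ => Nat.zero_le _) (Finset.mem_range.2 hk)).trans_eq hI.sum
    have e12 : σ'.arr 12 i = key i := by rw [hag.2 12 (by norm_num), a3 12 (by norm_num), hK i hi]
    have := hI.step hi hR
    simp [hx, e12, hag.1, e20, this]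
    omega
  rintro σ₄ τ₄ - ag4 ⟨hB, rfl⟩
  simp only [wp_seq, wp_assign]
  refine ⟨by simp; omega, ?_⟩
  have f20 : σ₄.var 20 = 2 * k := by rw [ag4.1 20 (by norm_num), e20]
  have f21 : σ₄.var 21 = 2 * M + 2 := by rw [ag4.1 21 (by norm_num), e21]
  set cnt := σ₄.arr 14 with hcnt
  set tbl := σ₄.arr 15 with htbl
  have hcE : ∀ x < 2 * M + 2, ∑ x' ∈ Finset.range x, cnt x' + cnt x ≤ 2 * k := by
    intro x hx
    rw [← Finset.sum_range_succ, ← hB.sum]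
    exact Finset.sum_le_sum_of_subset (Finset.range_mono hx)
  refine wp_forLoop (v := 30) (a := 0)
    (fun i σ' τ' => Emptied key (2 * k) cnt tbl i 0 (σ'.var 35) (σ'.arr 13) ∧
      σ'.arr 14 = cnt ∧ σ'.arr 15 = tbl ∧
      τ' = τ₃ + 10 + 50 * k + 17 * i + 20 * σ'.var 35) (2 * M + 2)
      (by simp [RamProg.Above, forLoop_above]) le_rfl (by norm_num) (by simp [f21])
      (by omega) (by omega) ?_ ?_ ?_
  · refine ⟨⟨?_, ?_, ?_, ?_, ?_, ?_⟩, rfl, rfl, ?_⟩ <;> simp <;> omega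
  · rintro i hi σ' τ' hx hag ⟨hI, ha, hb, rfl⟩
    have hm := hmul i hi
    have hs := hcE i hi
    have g20 : σ'.var 20 = 2 * k := by simp [hag.1, f20]
    simp only [wp_seq, wp_assign]
    refine ⟨by simp [hx, ha]; omega, ?_⟩
    refine wp_forLoop (v := 34) (a := 0)
      (fun c σ'' τ'' => Emptied key (2 * k) cnt tbl i c (σ''.var 35) (σ''.arr 13) ∧
      σ''.arr 14 = cnt ∧ σ''.arr 15 = tbl ∧
      τ'' = τ₃ + 10 + 50 * k + 17 * i + 9 + 20 * σ''.var 35) (cnt i)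
      (by simp [RamProg.Above]) le_rfl (by norm_num) (by simp [hx, ha])
      (by omega) (by omega) ?_ ?_ ?_
    · refine ⟨?_, ha, hb, by simp; ring⟩
      simpa using hI
    · rintro c hc σ'' τ'' hx' hag' ⟨hI', ha', hb', rfl⟩
      have g20' : σ''.var 20 = 2 * k := by simp [hag'.1, g20]
      have g30' : σ''.var 30 = i := by simp [hag'.1, hx]
      obtain ⟨m1, m2⟩ := hB.mem i hi c hc
      have := hI'.append hB hi hc
      have hl := hI'.len
      simp [hx', g20', g30', hb', ha', this]
      omega
    · rintro σ'' τ'' - hag' ⟨hI', ha', hb', rfl⟩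
      have g30' : σ''.var 30 = i := by simp [hag'.1, hx]
      refine ⟨g30', ?_, ha', hb', ?_⟩
      · simpa using hI'.next hB
      · simp; ring
  · rintro σ₅ τ₅ - ag5 ⟨hI, ha, hb, rfl⟩
    have hl := hI.len
    rw [hB.sum] at hl
    refine ⟨hI.sortedBy hB hR, ?_⟩
    simp at t1 t2 t3
    omega

/-! ### Invariants of the sweep -/

theorem flat_inj {N a b a' b' : ℕ} (hb : b < N) (hb' : b' < N) (h : a * N + b = a' * N + b') :
    a = a' ∧ b = b' := by
  have h1 : (a * N + b) / N = a := by
    rw [mul_comm, Nat.mul_add_div (by omega), Nat.div_eq_of_lt hb, add_zero]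
  have h2 : (a' * N + b') / N = a' := by
    rw [mul_comm, Nat.mul_add_div (by omega), Nat.div_eq_of_lt hb', add_zero]
  have : a = a' := by rw [← h1, ← h2, h]
  subst this
  exact ⟨rfl, by omega⟩

theorem flat_lt {N A a b : ℕ} (ha : a < A) (hb : b < N) : a * N + b < A * N :=
  calc a * N + b < a * N + N := by omega
    _ = (a + 1) * N := by ring
    _ ≤ A * N := Nat.mul_le_mul_right _ ha

theorem flat_div {N a b : ℕ} (hb : b < N) : (a * N + b) / N = a := by
  rw [mul_comm, Nat.mul_add_div (by omega), Nat.div_eq_of_lt hb, add_zero]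

theorem flat_mod {N a b : ℕ} (hb : b < N) : (a * N + b) % N = b := by
  rw [mul_comm, Nat.mul_add_mod, Nat.mod_eq_of_lt hb]

theorem div_lt_of_lt_sq {n e : ℕ} (he : e < n * n) : e / n < n := Nat.div_lt_of_lt_mul he

theorem mod_lt_of_lt_sq {n e : ℕ} (he : e < n * n) : e % n < n :=
  Nat.mod_lt _ (by rcases Nat.eq_zero_or_pos n with h | h
                   · subst h; simp at he
                   · exact h)

/-- The data of the sweep over all entries of `X` and `Y` in increasing order. `cur` is the value
reached. The entries of each row of `X` are collected in slots of `s` entries; the slot in use for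
row `i` is `Rsl i`, and slot `ρ` holds the `Fil ρ` entries `Ent (ρ * s + c)` of row `Row ρ`. Row `k`
of `Y` also has a slot in use, `Isl k`; the `Lft k` columns `Lst (k * s + c)` have been met since
that slot was opened. Slots `≥ sc` are unused. The matrix `m1` records which slots of `X` and `Y`
are related by an entry of `X`, and row `κ` of `m2` holds the columns covered by the slot `κ` of
`Y`. `Z` is the result, and `Flg` marks the results that a matrix product has contributed to. -/
structure SweepState where
  (cur sc : ℕ)
  (Lst Lft Rsl Isl Fil Row Ent Z Flg m1 m2 : ℕ → ℕ)

/-- The results are right as far as the events in `done` are concerned, and no matrix product is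
pending. -/
structure Settled (n M : ℕ) (X Y : ℕ → ℕ) (done : ℕ → Prop) (S : SweepState) : Prop where
  zle : ∀ y < n * n, S.Z y ≤ M
  sound : ∀ i < n, ∀ j < n, S.Z (i * n + j) < M →
    ∃ k < n, X (i * n + k) ≤ S.Z (i * n + j) ∧ Y (k * n + j) ≤ S.Z (i * n + j)
  complete : ∀ e < n * n, done (n * n + e) → ∀ j < n, Y (e % n * n + j) ≤ X e →
    S.Z (e / n * n + j) ≤ X e
  flg : ∀ i < n, ∀ j < n, S.Flg (i * n + j) ≠ 0 → S.Z (i * n + j) ≤ S.cur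

/-- The invariant of the sweep. -/
structure Sweep (n s N M : ℕ) (X Y : ℕ → ℕ) (done : ℕ → Prop) (S : SweepState) : Prop where
  zle : ∀ y < n * n, S.Z y ≤ M
  sound : ∀ i < n, ∀ j < n, S.Z (i * n + j) < M →
    ∃ k < n, X (i * n + k) ≤ S.Z (i * n + j) ∧ Y (k * n + j) ≤ S.Z (i * n + j)
  lft_le : ∀ k < n, S.Lft k ≤ s
  lst : ∀ k < n, ∀ c < S.Lft k, S.Lst (k * s + c) < n ∧ Y (k * n + S.Lst (k * s + c)) ≤ S.cur
  isl : ∀ k < n, S.Isl k < S.sc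
  m2_le : ∀ k < n, ∀ j < n, S.m2 (S.Isl k * N + j) ≠ 0 → Y (k * n + j) ≤ S.cur
  covered : ∀ k < n, ∀ j < n, done (k * n + j) →
    S.m2 (S.Isl k * N + j) ≠ 0 ∨ ∃ c < S.Lft k, S.Lst (k * s + c) = j
  rsl : ∀ i < n, S.Rsl i < S.sc ∧ S.Row (S.Rsl i) = i
  fil_le : ∀ ρ < N, S.Fil ρ ≤ s
  rsl_max : ∀ ρ < N, ∀ i < n, S.Row ρ = i → 0 < S.Fil ρ → ρ ≤ S.Rsl i
  fil_fresh : ∀ ρ < N, S.sc ≤ ρ → S.Fil ρ = 0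
  m1_fresh : ∀ ρ < N, ∀ κ < N, S.sc ≤ κ → S.m1 (ρ * N + κ) = 0
  ent : ∀ ρ < N, ∀ c < S.Fil ρ, S.Ent (ρ * s + c) < n * n ∧ S.Ent (ρ * s + c) / n = S.Row ρ ∧
    X (S.Ent (ρ * s + c)) ≤ S.cur
  ord : ∀ ρ ρ', ρ < ρ' → ρ' < N → S.Row ρ = S.Row ρ' → ∀ c < S.Fil ρ, ∀ c' < S.Fil ρ',
    X (S.Ent (ρ * s + c)) ≤ X (S.Ent (ρ' * s + c'))
  witness : ∀ ρ < N, ∀ κ < N, S.m1 (ρ * N + κ) ≠ 0 → ∃ c < S.Fil ρ, ∀ j < n,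
    S.m2 (κ * N + j) ≠ 0 → Y (S.Ent (ρ * s + c) % n * n + j) ≤ X (S.Ent (ρ * s + c))
  pending : ∀ e < n * n, done (n * n + e) → ∀ j < n, Y (e % n * n + j) ≤ X e →
    S.Z (e / n * n + j) ≤ X e ∨ ∃ ρ < N, ∃ κ < N, ∃ c < S.Fil ρ, S.Ent (ρ * s + c) = e ∧
      S.m1 (ρ * N + κ) ≠ 0 ∧ S.m2 (κ * N + j) ≠ 0
  flg : ∀ i < n, ∀ j < n, S.Flg (i * n + j) ≠ 0 → S.Z (i * n + j) ≤ S.cur ∧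
    ∀ ρ < N, ∀ c < S.Fil ρ, S.Row ρ = i → S.Z (i * n + j) ≤ X (S.Ent (ρ * s + c))
  m1_le : ∀ y < N * N, S.m1 y ≤ 1
  m2_bit : ∀ y < N * N, S.m2 y ≤ 1

section
variable {n s N M : ℕ} {X Y : ℕ → ℕ} {done done' : ℕ → Prop} {S S' : SweepState}

/-- The sweep goes on to a larger value. -/
theorem Sweep.advance (h : Sweep n s N M X Y done S) {c : ℕ} (hc : S.cur ≤ c) :
    Sweep n s N M X Y done { S with cur := c } where
  zle := h.zle
  sound := h.sound
  lft_le := h.lft_le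
  lst k hk c' hc' := ⟨(h.lst k hk c' hc').1, (h.lst k hk c' hc').2.trans hc⟩
  isl := h.isl
  m2_le k hk j hj hm := (h.m2_le k hk j hj hm).trans hc
  covered := h.covered
  rsl := h.rsl
  fil_le := h.fil_le
  rsl_max := h.rsl_max
  fil_fresh := h.fil_fresh
  m1_fresh := h.m1_fresh
  ent ρ hρ c' hc' := ⟨(h.ent ρ hρ c' hc').1, (h.ent ρ hρ c' hc').2.1,
    (h.ent ρ hρ c' hc').2.2.trans hc⟩
  ord := h.ord
  witness := h.witness
  pending := h.pending
  flg i hi j hj hf := ⟨(h.flg i hi j hj hf).1.trans hc, (h.flg i hi j hj hf).2⟩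
  m1_le := h.m1_le
  m2_bit := h.m2_bit

/-- The next event is the entry `(k, j)` of `Y`. -/
theorem Sweep.addY (h : Sweep n s N M X Y done S) {k j : ℕ} (hk : k < n) (hj : j < n)
    (hcur : Y (k * n + j) ≤ S.cur) (hlt : S.Lft k < s)
    (hdone : ∀ e, done' e → done e ∨ e = k * n + j) {Lst Lft : ℕ → ℕ}
    (hLst : Lst = Function.update S.Lst (k * s + S.Lft k) j)
    (hLft : Lft = Function.update S.Lft k (S.Lft k + 1)) :
    Sweep n s N M X Y done' { S with Lst := Lst, Lft := Lft } := by
  have hL : ∀ k' < n, ∀ c < S.Lft k', Lst (k' * s + c) = S.Lst (k' * s + c) := by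
    intro k' hk' c hc
    rw [hLst, Function.update_of_ne]
    intro heq
    have := h.lft_le k' hk'
    obtain ⟨rfl, h2⟩ := flat_inj (by omega) hlt heq
    omega
  have hL2 : Lst (k * s + S.Lft k) = j := by rw [hLst, Function.update_self]
  refine ⟨h.zle, h.sound, fun k' hk' => ?_, fun k' hk' c hc => ?_, h.isl, h.m2_le,
    fun k' hk' j' hj' hd => ?_, h.rsl, h.fil_le, h.rsl_max, h.fil_fresh, h.m1_fresh, h.ent, h.ord,
    h.witness, fun e he hd => ?_, h.flg, h.m1_le, h.m2_bit⟩
  · simp only [hLft, Function.update_apply]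
    split_ifs with heq
    · subst heq; omega
    · exact h.lft_le k' hk'
  · simp only [hLft, Function.update_apply] at hc ⊢
    by_cases heq : k' = k
    · subst heq
      simp only [if_true] at hc
      by_cases hc' : c = S.Lft k'
      · subst hc'; rw [hL2]; exact ⟨hj, hcur⟩
      · rw [hL k' hk' c (by omega)]; exact h.lst k' hk' c (by omega)
    · simp only [if_neg heq] at hc
      rw [hL k' hk' c hc]; exact h.lst k' hk' c hc
  · have hle : S.Lft k' ≤ Lft k' := by
      simp only [hLft, Function.update_apply]; split_ifs with heq
      · subst heq; omega
      · exact le_rfl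
    rcases hdone _ hd with hd | hd
    · rcases h.covered k' hk' j' hj' hd with h1 | ⟨c, hc, h1⟩
      · exact Or.inl h1
      · exact Or.inr ⟨c, hc.trans_le hle, (hL k' hk' c hc).trans h1⟩
    · obtain ⟨rfl, rfl⟩ := flat_inj hj' hj hd
      exact Or.inr ⟨S.Lft k', by simp [hLft], hL2⟩
  · rcases hdone _ hd with hd | hd
    · exact h.pending e he hd
    · have := flat_lt hk hj; omega

/-- Open a new slot for row `k` of `Y`. -/
theorem Sweep.allocY (h : Sweep n s N M X Y done S) {k : ℕ} (hk : k < n) (hsc : S.sc < N)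
    (hnN : n ≤ N) (hY : ∀ j < n, done (k * n + j) → Y (k * n + j) ≤ S.cur)
    {Lft Isl m2 : ℕ → ℕ} (hLft : Lft = Function.update S.Lft k 0)
    (hIsl : Isl = Function.update S.Isl k S.sc)
    (hm : ∀ j < n, m2 (S.sc * N + j) = if Y (k * n + j) ≤ S.cur then 1 else 0)
    (hm' : ∀ y < N * N, (∀ j < n, y ≠ S.sc * N + j) → m2 y = S.m2 y) :
    Sweep n s N M X Y done { S with Lft := Lft, Isl := Isl, m2 := m2, sc := S.sc + 1 } := by
  have hold : ∀ κ < N, κ ≠ S.sc → ∀ j < n, m2 (κ * N + j) = S.m2 (κ * N + j) := by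
    intro κ hκ hne j hj
    exact hm' _ (flat_lt hκ (by omega)) fun j' hj' heq =>
      hne (flat_inj (by omega) (by omega) heq).1
  have hIk : Isl k = S.sc := by rw [hIsl, Function.update_self]
  have hIo : ∀ k', k' ≠ k → Isl k' = S.Isl k' := fun k' hne => by
    rw [hIsl, Function.update_of_ne hne]
  have hLk : Lft k = 0 := by rw [hLft, Function.update_self]
  have hLo : ∀ k', k' ≠ k → Lft k' = S.Lft k' := fun k' hne => by
    rw [hLft, Function.update_of_ne hne]
  refine ⟨h.zle, h.sound, fun k' hk' => ?_, fun k' hk' c hc => ?_, fun k' hk' => ?_,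
    fun k' hk' j hj hmj => ?_, fun k' hk' j' hj' hd => ?_,
    fun i hi => ⟨(h.rsl i hi).1.trans (Nat.lt_succ_self _), (h.rsl i hi).2⟩, h.fil_le, h.rsl_max,
    fun ρ hρ hle => h.fil_fresh ρ hρ (Nat.le_of_succ_le hle),
    fun ρ hρ κ hκ hle => h.m1_fresh ρ hρ κ hκ (Nat.le_of_succ_le hle), h.ent, h.ord,
    fun ρ hρ κ hκ hne => ?_, fun e he hd j hj hle => ?_, h.flg, h.m1_le, fun y hy => ?_⟩
  · by_cases heq : k' = k
    · subst heq; simp [hLk]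
    · simp only [hLo k' heq]; exact h.lft_le k' hk'
  · by_cases heq : k' = k
    · subst heq; simp [hLk] at hc
    · simp only [hLo k' heq] at hc; exact h.lst k' hk' c hc
  · by_cases heq : k' = k
    · subst heq; simp [hIk]
    · simp only [hIo k' heq]; exact (h.isl k' hk').trans (Nat.lt_succ_self _)
  · by_cases heq : k' = k
    · subst heq
      simp only [hIk, hm j hj] at hmj
      by_contra hcon
      simp [hcon] at hmj
    · have := h.isl k' hk'
      simp only [hIo k' heq] at hmj
      rw [hold _ (by omega) (by omega) j hj] at hmj
      exact h.m2_le k' hk' j hj hmj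
  · by_cases heq : k' = k
    · subst heq
      left
      simp [hIk, hm j' hj', hY j' hj' hd]
    · have := h.isl k' hk'
      simp only [hIo k' heq, hLo k' heq]
      rw [hold _ (by omega) (by omega) j' hj']
      exact h.covered k' hk' j' hj' hd
  · obtain ⟨c, hc, h1⟩ := h.witness ρ hρ κ hκ hne
    have hlt : κ ≠ S.sc := fun heq => hne (h.m1_fresh ρ hρ κ hκ heq.ge)
    exact ⟨c, hc, fun j hj hmj => h1 j hj (by simpa only [hold κ hκ hlt j hj] using hmj)⟩
  · rcases h.pending e he hd j hj hle with h1 | ⟨ρ, hρ, κ, hκ, c, hc, h1, h2, h3⟩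
    · exact Or.inl h1
    · have hlt : κ ≠ S.sc := fun heq => h2 (h.m1_fresh ρ hρ κ hκ heq.ge)
      exact Or.inr ⟨ρ, hρ, κ, hκ, c, hc, h1, h2, by simpa only [hold κ hκ hlt j hj] using h3⟩
  · by_cases hex : ∃ j < n, y = S.sc * N + j
    · obtain ⟨j, hj, rfl⟩ := hex
      simp only [hm j hj]; split_ifs <;> omega
    · push Not at hex
      simp only [hm' y hy hex]; exact h.m2_bit y hy

/-- The next event is the entry `e` of `X`. It joins the slot of its row, and it is combined with
the columns that are not covered by the slot of row `e % n` of `Y`. -/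
theorem Sweep.addX (h : Sweep n s N M X Y done S) {e : ℕ} (he : e < n * n) (hscN : S.sc ≤ N)
    (hcur : X e = S.cur) (hlt : S.Fil (S.Rsl (e / n)) < s)
    (hY : ∀ j < n, Y (e % n * n + j) ≤ X e → done (e % n * n + j))
    (hdone : ∀ e', done' e' → done e' ∨ e' = n * n + e)
    {m1 Ent Fil Z : ℕ → ℕ}
    (hm1 : m1 (S.Rsl (e / n) * N + S.Isl (e % n)) = 1)
    (hm1' : ∀ y < N * N, y ≠ S.Rsl (e / n) * N + S.Isl (e % n) → m1 y = S.m1 y)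
    (hEnt : Ent = Function.update S.Ent (S.Rsl (e / n) * s + S.Fil (S.Rsl (e / n))) e)
    (hFil : Fil = Function.update S.Fil (S.Rsl (e / n)) (S.Fil (S.Rsl (e / n)) + 1))
    (hZle : ∀ y < n * n, Z y ≤ S.Z y)
    (hZ : ∀ i < n, ∀ j < n, Z (i * n + j) = S.Z (i * n + j) ∨
      i = e / n ∧ Z (i * n + j) = X e ∧ Y (e % n * n + j) ≤ X e)
    (hZL : ∀ c < S.Lft (e % n), Z (e / n * n + S.Lst (e % n * s + c)) ≤ X e) :
    Sweep n s N M X Y done' { S with m1 := m1, Ent := Ent, Fil := Fil, Z := Z } := by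
  have hi := div_lt_of_lt_sq he
  have hk := mod_lt_of_lt_sq he
  set i := e / n with hid
  set k := e % n with hkd
  have heik : i * n + k = e := by rw [hid, hkd, mul_comm]; exact Nat.div_add_mod e n
  set ρ₀ := S.Rsl i with hρd
  have hρ₀ : ρ₀ < N := (h.rsl i hi).1.trans_le hscN
  have hκ₀ : S.Isl k < N := (h.isl k hk).trans_le hscN
  have hrow : S.Row ρ₀ = i := (h.rsl i hi).2
  have hEold : ∀ ρ < N, ∀ c < S.Fil ρ, Ent (ρ * s + c) = S.Ent (ρ * s + c) := by
    intro ρ hρ c hc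
    have := h.fil_le ρ hρ
    rw [hEnt, Function.update_of_ne]
    intro heq
    obtain ⟨rfl, h2⟩ := flat_inj (by omega) hlt heq
    omega
  have hEnew : Ent (ρ₀ * s + S.Fil ρ₀) = e := by rw [hEnt, Function.update_self]
  have hF : ∀ ρ, S.Fil ρ ≤ Fil ρ := by
    intro ρ; simp only [hFil, Function.update_apply]; split_ifs with heq
    · subst heq; omega
    · exact le_rfl
  have hcs : ∀ ρ, ∀ c < Fil ρ, c < S.Fil ρ ∨ (ρ = ρ₀ ∧ c = S.Fil ρ₀) := by
    intro ρ c hc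
    simp only [hFil, Function.update_apply] at hc
    split_ifs at hc with heq
    · subst heq; omega
    · exact Or.inl hc
  have hFnew : S.Fil ρ₀ < Fil ρ₀ := by rw [hFil, Function.update_self]; omega
  have hbnd : ∀ ρ < N, ∀ κ < N, ρ * N + κ < N * N := fun ρ hρ κ hκ => flat_lt hρ hκ
  have hm1old : ∀ ρ < N, ∀ κ < N, S.m1 (ρ * N + κ) ≠ 0 → m1 (ρ * N + κ) ≠ 0 := by
    intro ρ hρ κ hκ hne
    by_cases heq : ρ * N + κ = ρ₀ * N + S.Isl k
    · rw [heq, hm1]; exact one_ne_zero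
    · rwa [hm1' _ (hbnd ρ hρ κ hκ) heq]
  have hb : ∀ i < n, ∀ j < n, i * n + j < n * n := fun i hi j hj => flat_lt hi hj
  refine ⟨fun y hy => (hZle y hy).trans (h.zle y hy), fun i' hi' j hj hz => ?_, h.lft_le, h.lst,
    h.isl, h.m2_le, fun k' hk' j' hj' hd => ?_, h.rsl, fun ρ hρ => ?_, fun ρ hρ i' hi' hr hf => ?_,
    fun ρ hρ hle => ?_, fun ρ hρ κ hκ hle => ?_, fun ρ hρ c hc => ?_,
    fun ρ ρ' hlt' hρ' hr c hc c' hc' => ?_, fun ρ hρ κ hκ hne => ?_, fun e' he' hd j hj hle => ?_,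
    fun i' hi' j hj hf => ⟨?_, fun ρ hρ c hc hr => ?_⟩, fun y hy => ?_, h.m2_bit⟩
  · rcases hZ i' hi' j hj with h1 | ⟨rfl, h1, h2⟩
    · simp only [h1] at hz ⊢; exact h.sound i' hi' j hj hz
    · exact ⟨k, hk, by simp only [h1, heik]; exact le_rfl, by simp only [h1]; exact h2⟩
  · rcases hdone _ hd with hd | hd
    · exact h.covered k' hk' j' hj' hd
    · have := hb k' hk' j' hj'; omega
  · have := h.fil_le ρ hρ
    simp only [hFil, Function.update_apply]; split_ifs with heq <;> omega
  · have h1 : 0 < S.Fil ρ ∨ ρ = ρ₀ := by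
      rcases hcs ρ 0 hf with h1 | h1
      · exact Or.inl h1
      · exact Or.inr h1.1
    rcases h1 with h1 | rfl
    · exact h.rsl_max ρ hρ i' hi' hr h1
    · have : i' = i := by rw [← hr, ← hrow]
      subst this; exact le_rfl
  · have : ρ ≠ ρ₀ := fun heq => by
      have := (h.rsl i hi).1
      simp only at hle; omega
    simp only [hFil, Function.update_of_ne this]
    exact h.fil_fresh ρ hρ hle
  · simp only
    rw [hm1' _ (hbnd ρ hρ κ hκ)]
    · exact h.m1_fresh ρ hρ κ hκ hle
    · intro heq
      have h1 := (flat_inj hκ hκ₀ heq).2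
      have h2 := h.isl k hk
      simp only at hle; omega
  · rcases hcs ρ c hc with h1 | ⟨rfl, rfl⟩
    · simp only [hEold ρ hρ c h1]; exact h.ent ρ hρ c h1
    · simp only [hEnew]; exact ⟨he, by rw [hrow], hcur.le⟩
  · rcases hcs ρ' c' hc' with h1 | ⟨rfl, rfl⟩
    · simp only [hEold ρ' hρ' c' h1]
      rcases hcs ρ c hc with h2 | ⟨rfl, rfl⟩
      · simp only [hEold ρ (by omega) c h2]; exact h.ord ρ ρ' hlt' hρ' hr c h2 c' h1
      · -- The slot in use is the last slot of its row.
        have hr' : S.Row ρ' = i := by rw [← hrow]; exact hr.symm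
        have := h.rsl_max ρ' hρ' i hi hr' (by omega)
        omega
    · have h2 : c < S.Fil ρ := by
        rcases hcs ρ c hc with h2 | ⟨h2, -⟩
        · exact h2
        · omega
      simp only [hEnew, hEold ρ (by omega) c h2, hcur]
      exact (h.ent ρ (by omega) c h2).2.2
  · simp only at hne
    by_cases heq : ρ * N + κ = ρ₀ * N + S.Isl k
    · obtain ⟨rfl, rfl⟩ := flat_inj hκ hκ₀ heq
      refine ⟨_, hFnew, fun j hj hm => ?_⟩
      simp only [hEnew, hcur]
      exact h.m2_le k hk j hj hm
    · rw [hm1' _ (hbnd ρ hρ κ hκ) heq] at hne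
      obtain ⟨c, hc, h1⟩ := h.witness ρ hρ κ hκ hne
      refine ⟨c, hc.trans_le (hF ρ), ?_⟩
      simp only [hEold ρ hρ c hc]; exact h1
  · rcases hdone _ hd with hd | hd
    · have h0 : e' / n * n + j < n * n := hb _ (div_lt_of_lt_sq he') j hj
      rcases h.pending e' he' hd j hj hle with h1 | ⟨ρ, hρ, κ, hκ, c, hc, h1, h2, h3⟩
      · exact Or.inl ((hZle _ h0).trans h1)
      · exact Or.inr ⟨ρ, hρ, κ, hκ, c, hc.trans_le (hF ρ), by simp only [hEold ρ hρ c hc, h1],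
          hm1old ρ hρ κ hκ h2, h3⟩
    · have : e' = e := by omega
      subst this
      rcases h.covered k hk j hj (hY j hj hle) with h1 | ⟨c, hc, h1⟩
      · exact Or.inr ⟨ρ₀, hρ₀, _, hκ₀, _, hFnew, hEnew, by simp only [hm1]; exact one_ne_zero, h1⟩
      · left
        have := hZL c hc
        rwa [h1] at this
  · exact (hZle _ (hb i' hi' j hj)).trans (h.flg i' hi' j hj hf).1
  · have h0 := h.flg i' hi' j hj hf
    refine (hZle _ (hb i' hi' j hj)).trans ?_
    rcases hcs ρ c hc with h1 | ⟨rfl, rfl⟩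
    · simp only [hEold ρ hρ c h1]; exact h0.2 ρ hρ c h1 hr
    · simp only [hEnew, hcur]; exact h0.1
  · by_cases heq : y = ρ₀ * N + S.Isl k
    · simp [heq, hm1]
    · simp only [hm1' y hy heq]; exact h.m1_le y hy

/-- Open a new slot for row `i` of `X`. -/
theorem Sweep.allocX (h : Sweep n s N M X Y done S) {i : ℕ} (hi : i < n) (hsc : S.sc < N)
    {Rsl Row : ℕ → ℕ} (hRsl : Rsl = Function.update S.Rsl i S.sc)
    (hRow : Row = Function.update S.Row S.sc i) :
    Sweep n s N M X Y done { S with Rsl := Rsl, Row := Row, sc := S.sc + 1 } := by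
  have hRo : ∀ ρ, ρ ≠ S.sc → Row ρ = S.Row ρ := fun ρ hne => by
    rw [hRow, Function.update_of_ne hne]
  have hRn : Row S.sc = i := by rw [hRow, Function.update_self]
  have hf0 : S.Fil S.sc = 0 := h.fil_fresh _ hsc le_rfl
  have hne : ∀ ρ, ∀ c < S.Fil ρ, ρ ≠ S.sc := by
    rintro ρ c hc rfl; omega
  refine ⟨h.zle, h.sound, h.lft_le, h.lst, fun k hk => (h.isl k hk).trans (Nat.lt_succ_self _),
    h.m2_le, h.covered, fun i' hi' => ?_, h.fil_le, fun ρ hρ i' hi' hr hf => ?_,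
    fun ρ hρ hle => h.fil_fresh ρ hρ (Nat.le_of_succ_le hle),
    fun ρ hρ κ hκ hle => h.m1_fresh ρ hρ κ hκ (Nat.le_of_succ_le hle), fun ρ hρ c hc => ?_,
    fun ρ ρ' hlt hρ' hr c hc c' hc' => ?_, h.witness, h.pending, fun i' hi' j hj hf => ?_,
    h.m1_le, h.m2_bit⟩
  · by_cases heq : i' = i
    · subst heq; simp [hRsl, hRn]
    · have := h.rsl i' hi'
      simp only [hRsl, Function.update_of_ne heq]
      exact ⟨by omega, by rw [hRo _ (by omega)]; exact this.2⟩
  · have hn := hne ρ 0 hf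
    simp only [hRo ρ hn] at hr
    have h1 := h.rsl_max ρ hρ i' hi' hr hf
    have h2 := (h.rsl i' hi').1
    simp only [hRsl, Function.update_apply]
    split_ifs <;> omega
  · simp only [hRo ρ (hne ρ c hc)]; exact h.ent ρ hρ c hc
  · simp only [hRo ρ (hne ρ c hc), hRo ρ' (hne ρ' c' hc')] at hr
    exact h.ord ρ ρ' hlt hρ' hr c hc c' hc'
  · have h0 := h.flg i' hi' j hj hf
    refine ⟨h0.1, fun ρ hρ c hc hr => h0.2 ρ hρ c hc ?_⟩
    simpa only [hRo ρ (hne ρ c hc)] using hr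

/-- With all slots empty and one slot for each row in use, the sweep can go on. -/
theorem Settled.reopen (h : Settled n M X Y done S) (hs : 0 < s)
    (hY : ∀ k < n, ∀ j < n, done (k * n + j) → Y (k * n + j) ≤ S.cur)
    (hcur : S'.cur = S.cur) (hZ : S'.Z = S.Z) (hFlg : S'.Flg = S.Flg)
    (hsc : S'.sc = n) (hLft : ∀ k < n, S'.Lft k = 0) (hFil : ∀ ρ < N, S'.Fil ρ = 0)
    (hRsl : ∀ i < n, S'.Rsl i = i) (hIsl : ∀ i < n, S'.Isl i = i) (hRow : ∀ i < n, S'.Row i = i)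
    (hm1 : ∀ y < N * N, S'.m1 y = 0) (hm2 : ∀ y < N * N, S'.m2 y ≤ 1)
    (hm2' : ∀ k < n, ∀ j < n, S'.m2 (k * N + j) = if Y (k * n + j) ≤ S.cur then 1 else 0) :
    Sweep n s N M X Y done S' where
  zle := by rw [hZ]; exact h.zle
  sound := by rw [hZ]; exact h.sound
  lft_le k hk := by rw [hLft k hk]; exact hs.le
  lst k hk c hc := by rw [hLft k hk] at hc; omega
  isl k hk := by rw [hIsl k hk, hsc]; exact hk
  m2_le k hk j hj hm := by
    rw [hIsl k hk, hm2' k hk j hj] at hm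
    by_contra hcon
    rw [hcur] at hcon
    simp [hcon] at hm
  covered k hk j hj hd := by
    left
    rw [hIsl k hk, hm2' k hk j hj]
    simp [hY k hk j hj hd]
  rsl i hi := by rw [hRsl i hi, hsc]; exact ⟨hi, hRow i hi⟩
  fil_le ρ hρ := by rw [hFil ρ hρ]; exact hs.le
  rsl_max ρ hρ i hi _ hf := by rw [hFil ρ hρ] at hf; omega
  fil_fresh ρ hρ _ := hFil ρ hρ
  m1_fresh ρ hρ κ hκ _ := hm1 _ (flat_lt hρ hκ)
  ent ρ hρ c hc := by rw [hFil ρ hρ] at hc; omega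
  ord ρ ρ' hlt hρ' _ c hc := by rw [hFil ρ (hlt.trans hρ')] at hc; omega
  witness ρ hρ κ hκ hne := absurd (hm1 _ (flat_lt hρ hκ)) hne
  pending e he hd j hj hle := by rw [hZ]; exact Or.inl (h.complete e he hd j hj hle)
  flg i hi j hj hf := by
    rw [hFlg] at hf
    rw [hZ, hcur]
    exact ⟨h.flg i hi j hj hf, fun ρ hρ c hc => by rw [hFil ρ hρ] at hc; omega⟩
  m1_le y hy := by rw [hm1 y hy]; exact Nat.zero_le _
  m2_bit := hm2

/-- While the slots are combined with the nonzero entries of the matrix product: the entries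
`(ρ, j)` with `ρ * n + j < y` of the product have been dealt with. -/
structure Combining (n s N M : ℕ) (X Y : ℕ → ℕ) (S : SweepState) (Pr : ℕ → ℕ) (y : ℕ)
    (Z Flg : ℕ → ℕ) : Prop where
  mono : ∀ z < n * n, Z z ≤ S.Z z
  sound : ∀ i < n, ∀ j < n, Z (i * n + j) < M →
    ∃ k < n, X (i * n + k) ≤ Z (i * n + j) ∧ Y (k * n + j) ≤ Z (i * n + j)
  past : ∀ ρ < N, ∀ j < n, ρ * n + j < y → Pr (ρ * N + j) ≠ 0 → ∀ c < S.Fil ρ,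
    Y (S.Ent (ρ * s + c) % n * n + j) ≤ X (S.Ent (ρ * s + c)) →
    Z (S.Row ρ * n + j) ≤ X (S.Ent (ρ * s + c))
  future : ∀ i < n, ∀ j < n, Flg (i * n + j) ≠ 0 → Z (i * n + j) ≤ S.cur ∧
    ∀ ρ < N, y ≤ ρ * n + j → S.Row ρ = i → ∀ c < S.Fil ρ, Z (i * n + j) ≤ X (S.Ent (ρ * s + c))

variable {Pr Z Flg Z' Flg' : ℕ → ℕ} {ρ₀ j₀ : ℕ}

theorem Sweep.combining (h : Sweep n s N M X Y done S) : Combining n s N M X Y S Pr 0 S.Z S.Flg where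
  mono _ _ := le_rfl
  sound := h.sound
  past _ _ _ _ hy := absurd hy (Nat.not_lt_zero _)
  future i hi j hj hf :=
    ⟨(h.flg i hi j hj hf).1, fun ρ hρ _ hr c hc => (h.flg i hi j hj hf).2 ρ hρ c hc hr⟩

theorem Combining.skip (h : Combining n s N M X Y S Pr (ρ₀ * n + j₀) Z Flg) (hj : j₀ < n)
    (hP : Pr (ρ₀ * N + j₀) = 0) : Combining n s N M X Y S Pr (ρ₀ * n + j₀ + 1) Z Flg := by
  refine ⟨h.mono, h.sound, fun ρ hρ j hj' hy hp c hc hle => ?_, fun i hi j hj' hf =>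
    ⟨(h.future i hi j hj' hf).1, fun ρ hρ hy => (h.future i hi j hj' hf).2 ρ hρ (by omega)⟩⟩
  by_cases heq : ρ * n + j = ρ₀ * n + j₀
  · obtain ⟨rfl, rfl⟩ := flat_inj hj' hj heq
    exact absurd hP hp
  · exact h.past ρ hρ j hj' (by omega) hp c hc hle

/-- An earlier slot of the same row has already given a result that cannot be improved. -/
theorem Combining.flagged (h : Combining n s N M X Y S Pr (ρ₀ * n + j₀) Z Flg) (hj : j₀ < n)
    (hr : S.Row ρ₀ < n) (hF : Flg (S.Row ρ₀ * n + j₀) ≠ 0) :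
    Combining n s N M X Y S Pr (ρ₀ * n + j₀ + 1) Z Flg := by
  refine ⟨h.mono, h.sound, fun ρ hρ j hj' hy hp c hc hle => ?_, fun i hi j hj' hf =>
    ⟨(h.future i hi j hj' hf).1, fun ρ hρ hy => (h.future i hi j hj' hf).2 ρ hρ (by omega)⟩⟩
  by_cases heq : ρ * n + j = ρ₀ * n + j₀
  · obtain ⟨rfl, rfl⟩ := flat_inj hj' hj heq
    exact (h.future _ hr _ hj' hF).2 ρ hρ le_rfl rfl c hc
  · exact h.past ρ hρ j hj' (by omega) hp c hc hle

/-- The slot `ρ₀` is searched for the results at column `j₀`. As the slots of a row hold increasing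
values, later slots of the row need not be searched for `j₀`. -/
theorem Combining.scan (h : Combining n s N M X Y S Pr (ρ₀ * n + j₀) Z Flg)
    (hS : Sweep n s N M X Y done S) (hρ₀ : ρ₀ < N) (hj : j₀ < n) (hr : S.Row ρ₀ < n)
    (hex : ∃ c < S.Fil ρ₀,
      Y (S.Ent (ρ₀ * s + c) % n * n + j₀) ≤ X (S.Ent (ρ₀ * s + c)))
    (hF : Flg' = Function.update Flg (S.Row ρ₀ * n + j₀) 1)
    (hZo : ∀ y, y ≠ S.Row ρ₀ * n + j₀ → Z' y = Z y)
    (hZle : Z' (S.Row ρ₀ * n + j₀) ≤ Z (S.Row ρ₀ * n + j₀))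
    (hZn : ∀ c < S.Fil ρ₀, Y (S.Ent (ρ₀ * s + c) % n * n + j₀) ≤ X (S.Ent (ρ₀ * s + c)) →
      Z' (S.Row ρ₀ * n + j₀) ≤ X (S.Ent (ρ₀ * s + c)))
    (hZs : Z' (S.Row ρ₀ * n + j₀) = Z (S.Row ρ₀ * n + j₀) ∨
      ∃ c < S.Fil ρ₀, Y (S.Ent (ρ₀ * s + c) % n * n + j₀) ≤ X (S.Ent (ρ₀ * s + c)) ∧
        Z' (S.Row ρ₀ * n + j₀) = X (S.Ent (ρ₀ * s + c))) :
    Combining n s N M X Y S Pr (ρ₀ * n + j₀ + 1) Z' Flg' := by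
  have hle : ∀ y, Z' y ≤ Z y := by
    intro y
    by_cases heq : y = S.Row ρ₀ * n + j₀
    · rw [heq]; exact hZle
    · rw [hZo y heq]
  refine ⟨fun z hz => (hle z).trans (h.mono z hz), fun i hi j hj' hz => ?_,
    fun ρ hρ j hj' hy hp c hc hYX => ?_, fun i hi j hj' hf => ?_⟩
  · by_cases heq : i * n + j = S.Row ρ₀ * n + j₀
    · rcases hZs with h1 | ⟨c, hc, h1, h2⟩
      · rw [heq, h1, ← heq] at hz ⊢
        exact h.sound i hi j hj' hz
      · obtain ⟨rfl, rfl⟩ := flat_inj hj' hj heq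
        obtain ⟨e1, e2, -⟩ := hS.ent ρ₀ hρ₀ c hc
        refine ⟨_, mod_lt_of_lt_sq e1, ?_, by rw [h2]; exact h1⟩
        rw [h2, ← e2, mul_comm, Nat.div_add_mod]
    · rw [hZo _ heq] at hz ⊢
      exact h.sound i hi j hj' hz
  · by_cases heq : ρ * n + j = ρ₀ * n + j₀
    · obtain ⟨rfl, rfl⟩ := flat_inj hj' hj heq
      exact hZn c hc hYX
    · exact (hle _).trans (h.past ρ hρ j hj' (by omega) hp c hc hYX)
  · by_cases heq : i * n + j = S.Row ρ₀ * n + j₀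
    · obtain ⟨rfl, rfl⟩ := flat_inj hj' hj heq
      obtain ⟨c, hc, h1⟩ := hex
      have h2 := hZn c hc h1
      refine ⟨h2.trans (hS.ent ρ₀ hρ₀ c hc).2.2, fun ρ hρ hy hr' c' hc' => h2.trans ?_⟩
      have : ρ₀ < ρ := by
        by_contra hcon
        have := Nat.mul_le_mul_right n (not_lt.1 hcon)
        omega
      exact hS.ord ρ₀ ρ this hρ hr'.symm c hc c' hc'
    · rw [hF, Function.update_of_ne heq] at hf
      obtain ⟨h1, h2⟩ := h.future i hi j hj' hf
      exact ⟨(hle _).trans h1, fun ρ hρ hy hr' c hc => (hle _).trans (h2 ρ hρ (by omega) hr' c hc)⟩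

/-- When the whole product has been dealt with, nothing is pending. -/
theorem Combining.settled (h : Combining n s N M X Y S Pr (N * n) Z Flg)
    (hS : Sweep n s N M X Y done S)
    (hP : ∀ ρ < N, ∀ j < n, (∃ κ < N, S.m1 (ρ * N + κ) ≠ 0 ∧ S.m2 (κ * N + j) ≠ 0) →
      Pr (ρ * N + j) ≠ 0) : Settled n M X Y done { S with Z := Z, Flg := Flg } where
  zle y hy := (h.mono y hy).trans (hS.zle y hy)
  sound := h.sound
  complete e he hd j hj hle := by
    have h0 : e / n * n + j < n * n := flat_lt (div_lt_of_lt_sq he) hj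
    rcases hS.pending e he hd j hj hle with h1 | ⟨ρ, hρ, κ, hκ, c, hc, rfl, h2, h3⟩
    · exact (h.mono _ h0).trans h1
    · have := h.past ρ hρ j hj (flat_lt hρ hj) (hP ρ hρ j hj ⟨κ, hκ, h2, h3⟩) c hc hle
      rwa [← (hS.ent ρ hρ c hc).2.1] at this
  flg i hi j hj hf := (h.future i hi j hj hf).1

end

/-! ### Multiplying the slot matrices -/

theorem RamExpr.Fits.mono {W W' : ℕ} (h : W ≤ W') {σ : RamState} {e : RamExpr}
    (he : e.Fits W σ) : e.Fits W' σ := by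
  induction e with
  | const k => exact lt_of_lt_of_le he h
  | var x => exact lt_of_lt_of_le he h
  | read a i ih => exact ⟨ih he.1, he.2.trans_le h⟩
  | op o e f ihe ihf => exact ⟨ihe he.1, ihf he.2.1, he.2.2.trans_le h⟩

theorem RamExec.mono {W W' : ℕ} (h : W ≤ W') {p : RamProg} {σ σ' : RamState} {t : ℕ}
    (hx : RamExec W p σ t σ') : RamExec W' p σ t σ' := by
  induction hx with
  | skip σ => exact .skip σ
  | assign x e σ he => exact .assign x e σ (he.mono h)
  | write a i e σ hi he => exact .write a i e σ (hi.mono h) (he.mono h)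
  | seq _ _ _ _ _ _ _ _ _ ih ih' => exact .seq _ _ _ _ _ _ _ ih ih'
  | iteTrue e _ _ _ _ _ he hc _ ih => exact .iteTrue _ _ _ _ _ _ (he.mono h) hc ih
  | iteFalse e _ _ _ _ _ he hc _ ih => exact .iteFalse _ _ _ _ _ _ (he.mono h) hc ih
  | loopTrue e _ _ _ _ _ _ he hc _ _ ih ih' =>
    exact .loopTrue _ _ _ _ _ _ _ (he.mono h) hc ih ih'
  | loopFalse e _ _ he hc => exact .loopFalse _ _ _ (he.mono h) hc

/-- `P` multiplies 0-1 matrices of dimension `N` within `T` steps, with word bound `B`. -/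
def Multiplies (P : RamProg) (N B T : ℕ) : Prop :=
  ∀ A C : Matrix (Fin N) (Fin N) ℕ, (∀ i j, A i j ≤ 1) → (∀ i j, C i j ≤ 1) →
    ∃ (t : ℕ) (σ : RamState), RamExec B P (matMulInput A C) t σ ∧ t ≤ T ∧
      ∀ i j : Fin N, σ.arr 2 (i * N + j) = (A * C) i j

/-- The memory of the relocated program, beyond the two input matrices of dimension `N`, is zero
from address `σ.var 60` on. -/
structure Region (N B : ℕ) (σ : RamState) : Prop where
  beyond : ∀ a y, σ.var 60 + B ≤ y → σ.arr (a + 40) y = 0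
  inside : ∀ a y, y < B → (1 < a ∨ N * N ≤ y) → σ.arr (a + 40) (σ.var 60 + y) = 0

open RamExpr in
/-- Run `P` on the two matrices that have been written at address `var 60`, and count its steps in
variable `62`. -/
def productProg (P : RamProg) : RamProg :=
  clearVars 100 (max P.vars 1) ;; .assign 100 (var 17) ;; P.relocate 100 40 60 62 ;;
  .assign 62 (var 62 + var 17 * var 17)

theorem productProg_above (P : RamProg) : (productProg P).Above 62 40 :=
  ⟨clearVars_above (by norm_num) _, by simp [RamProg.Above],
    RamProg.above_relocate (by norm_num) (by norm_num) (by norm_num) P, by simp [RamProg.Above]⟩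

/-- Time of the product per unit of the step counter. -/
def productCost (P : RamProg) : ℕ := P.tickCost 100 40 60 + 2 * (max P.vars 1) + 20

theorem matMulInput_arr {N : ℕ} (A C : Matrix (Fin N) (Fin N) ℕ) (f : ℕ → ℕ)
    {a : ℕ} (hA : a = 0 → ∀ i j, A i j = f (i * N + j)) (hC : a = 1 → ∀ i j, C i j = f (i * N + j))
    (h2 : 1 < a → ∀ y < N * N, f y = 0) {y : ℕ} :
    (matMulInput A C).arr a y = if y < N * N then f y else 0 := by
  simp only [matMulInput]
  split_ifs with h h0 h1
  · rw [hA h0]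
    congr 1
    simp only [finProdFinEquiv, Equiv.coe_fn_symm_mk, Fin.coe_divNat, Fin.coe_modNat]
    rw [mul_comm]; exact Nat.div_add_mod y N
  · rw [hC h1]
    congr 1
    simp only [finProdFinEquiv, Equiv.coe_fn_symm_mk, Fin.coe_divNat, Fin.coe_modNat]
    rw [mul_comm]; exact Nat.div_add_mod y N
  · rw [h2 (by omega) y h]
  · rfl

/-- The product of the slot matrices. Its running time is not known, but it is proportional to the
growth of the step counter `62`. -/
theorem wp_productProg {P : RamProg} {N B T W : ℕ} (hP : Multiplies P N B T) {σ : RamState}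
    {τ : ℕ} (h17 : σ.var 17 = N) (hN : 1 ≤ N) (hR : Region N B σ) (hB : N * N ≤ B)
    (hW : σ.var 60 + B ≤ W) (hc : σ.var 62 + T + N * N < W)
    (h1 : ∀ y < N * N, σ.arr 40 (σ.var 60 + y) ≤ 1)
    (h2 : ∀ y < N * N, σ.arr 41 (σ.var 60 + y) ≤ 1) :
    wp W (productProg P) (fun σ' τ' =>
      (∀ ρ < N, ∀ j < N, σ'.arr 42 (σ.var 60 + (ρ * N + j)) = ∑ κ ∈ Finset.range N,
        σ.arr 40 (σ.var 60 + (ρ * N + κ)) * σ.arr 41 (σ.var 60 + (κ * N + j))) ∧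
      (∀ x < 100, x ≠ 62 → σ'.var x = σ.var x) ∧
      (∀ a y, σ.var 60 + B ≤ y → σ'.arr (a + 40) y = 0) ∧
      σ.var 62 + N * N ≤ σ'.var 62 ∧ σ'.var 62 ≤ σ.var 62 + T + N * N ∧
      τ' + productCost P * σ.var 62 ≤ τ + productCost P * σ'.var 62) σ τ := by
  have hNN : N ≤ N * N := Nat.le_mul_self N
  let A : Matrix (Fin N) (Fin N) ℕ := fun i j => σ.arr 40 (σ.var 60 + (i * N + j))
  let C : Matrix (Fin N) (Fin N) ℕ := fun i j => σ.arr 41 (σ.var 60 + (i * N + j))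
  obtain ⟨t, ρ', hx, ht, hres⟩ := hP A C (fun i j => h1 _ (flat_lt i.2 j.2))
    (fun i j => h2 _ (flat_lt i.2 j.2))
  rw [productProg, wp_seq]
  refine wp_clearVars (by omega) fun σ₁ v1 w1 a1 => ?_
  rw [wp_seq, wp_assign]
  refine ⟨by simp [w1, h17]; omega, ?_⟩
  set σ₂ := σ₁.setVar 100 ((RamExpr.var 17).eval σ₁) with hσ₂
  have w2 : ∀ x < 100, σ₂.var x = σ.var x := fun x hx => by
    have : x ≠ 100 := by omega
    simp [hσ₂, this, w1 x hx]
  have a2 : σ₂.arr = σ.arr := a1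
  have hE : Embeds 100 40 (max P.vars 1) (σ.var 60) B (matMulInput A C) σ₂ := by
    refine ⟨fun x hx => ?_, fun a y hy => ?_⟩
    · by_cases h0 : x = 0
      · subst h0; simp [hσ₂, w1, h17, matMulInput]
      · simp [hσ₂, h0, v1 x hx, matMulInput]
    · rw [matMulInput_arr A C (fun z => σ.arr (a + 40) (σ.var 60 + z)) (by rintro rfl _ _; rfl)
        (by rintro rfl _ _; rfl) (fun ha z hz => hR.inside a z (by omega) (Or.inl ha)), a2]
      split_ifs with hlt
      · rfl
      · exact hR.inside a y hy (Or.inr (not_lt.1 hlt))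
  rw [wp_seq]
  refine (wp_relocate (by norm_num) (by norm_num) (by norm_num) hx (le_max_left _ _) hE
    (w2 60 (by norm_num)) hW (by rw [w2 62 (by norm_num)]; omega) _ _ le_rfl).mono ?_
  intro σ₃ τ₃ s
  have c1 := s.le_cnt
  have c2 := s.cnt_le
  have c3 := s.time
  rw [w2 62 (by norm_num)] at c1 c2 c3
  have w3 : ∀ x < 100, x ≠ 62 → σ₃.var x = σ.var x := fun x hx hx' => by
    rw [s.low x hx hx', w2 x hx]
  have e17 : σ₃.var 17 = N := by rw [w3 17 (by norm_num) (by norm_num), h17]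
  rw [wp_assign]
  refine ⟨by simp [e17]; omega, fun ρ hρ j hj => ?_, fun x hx hx' => ?_, fun a y hy => ?_, ?_, ?_, ?_⟩
  · have := s.embeds.arr 2 (ρ * N + j) ((flat_lt hρ hj).trans_le hB)
    simp only [RamState.arr_setVar]
    rw [this, hres ⟨ρ, hρ⟩ ⟨j, hj⟩, Matrix.mul_apply, Finset.sum_range]
  · simp [hx', w3 x hx hx']
  · simp only [RamState.arr_setVar, s.outside _ y hy, a2, hR.beyond a y hy]
  · simp [e17]; omega
  · simp [e17]; omega
  · simp only [RamExpr.eval_add, RamExpr.eval_mul, RamExpr.eval_var, e17, RamState.var_setVar,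
      if_true, RamExpr.cost_add, RamExpr.cost_mul, RamExpr.cost_var, productCost]
    simp only [RamExpr.cost_var] at c3
    obtain ⟨d, hd⟩ := Nat.exists_eq_add_of_le c1
    rw [hd] at c3 ⊢
    nlinarith [Nat.zero_le (P.tickCost 100 40 60 * (N * N)), Nat.zero_le (max P.vars 1 * d),
      Nat.mul_le_mul_left (max P.vars 1) (hN.trans hNN)]

/-! ### Combining the slots with the product -/

/-- The sweep data in memory. -/
def sweepOf (σ : RamState) : SweepState where
  cur := σ.var 41
  sc := σ.var 61
  Lst := σ.arr 18
  Lft := σ.arr 21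
  Rsl := σ.arr 22
  Isl := σ.arr 23
  Fil := σ.arr 24
  Row := σ.arr 25
  Ent := σ.arr 19
  Z := σ.arr 30
  Flg := σ.arr 31
  m1 y := σ.arr 40 (σ.var 60 + y)
  m2 y := σ.arr 41 (σ.var 60 + y)

/-- The variables and arrays that stay fixed during a sweep. -/
structure SweepEnv (n s N M B : ℕ) (X Y : ℕ → ℕ) (σ : RamState) : Prop where
  v10 : σ.var 10 = n
  v16 : σ.var 16 = n * n
  v17 : σ.var 17 = N
  v18 : σ.var 18 = M
  v19 : σ.var 19 = B
  v20 : σ.var 20 = 2 * (n * n)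
  v36 : σ.var 36 = s
  a10 : σ.arr 10 = X
  a11 : σ.arr 11 = Y

theorem SweepEnv.agree {n s N M B v a : ℕ} {X Y : ℕ → ℕ} {σ σ' : RamState}
    (h : SweepEnv n s N M B X Y σ) (hv : 37 ≤ v) (ha : 12 ≤ a) (h' : Agree v a σ σ') :
    SweepEnv n s N M B X Y σ' where
  v10 := by rw [h'.1 _ (by omega), h.v10]
  v16 := by rw [h'.1 _ (by omega), h.v16]
  v17 := by rw [h'.1 _ (by omega), h.v17]
  v18 := by rw [h'.1 _ (by omega), h.v18]
  v19 := by rw [h'.1 _ (by omega), h.v19]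
  v20 := by rw [h'.1 _ (by omega), h.v20]
  v36 := by rw [h'.1 _ (by omega), h.v36]
  a10 := by rw [h'.2 _ (by omega), h.a10]
  a11 := by rw [h'.2 _ (by omega), h.a11]

open RamExpr in
/-- Search slot `var 66` for results at column `var 67`; `var 68` is the place of the result. -/
def scanProg : RamProg :=
  .assign 69 (read 24 (var 66)) ;;
  forLoop 70 69
    (.assign 71 (read 19 (var 66 * var 36 + var 70)) ;;
     .ite ((read 11 (var 71 % var 10 * var 10 + var 67)).less (read 10 (var 71) + const 1))
      (.write 30 (var 68) (read 30 (var 68) - (read 30 (var 68) - read 10 (var 71)))) .skip)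

theorem scanProg_above : scanProg.Above 69 30 := by
  simp [scanProg, RamProg.Above, forLoop_above]

section
variable {n s N M B W : ℕ} {X Y : ℕ → ℕ} {σ : RamState} {τ : ℕ}

theorem wp_scanProg (hE : SweepEnv n s N M B X Y σ) {ρ j z : ℕ} (h66 : σ.var 66 = ρ)
    (h67 : σ.var 67 = j) (h68 : σ.var 68 = z) (hj : j < n) (hz : z < n * n)
    (hF : σ.arr 24 ρ ≤ s) (hEnt : ∀ c < σ.arr 24 ρ, σ.arr 19 (ρ * s + c) < n * n)
    (hX : ∀ e < n * n, X e ≤ M) (hY : ∀ e < n * n, Y e ≤ M) (hZ : σ.arr 30 z ≤ M)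
    (hW : ρ * s + s < W) (hW' : n * n + M + 1 < W) (hWρ : ρ < W) :
    wp W scanProg (fun σ' τ' =>
      (∀ y, y ≠ z → σ'.arr 30 y = σ.arr 30 y) ∧ σ'.arr 30 z ≤ σ.arr 30 z ∧
      (∀ c < σ.arr 24 ρ, Y (σ.arr 19 (ρ * s + c) % n * n + j) ≤ X (σ.arr 19 (ρ * s + c)) →
        σ'.arr 30 z ≤ X (σ.arr 19 (ρ * s + c))) ∧
      (σ'.arr 30 z = σ.arr 30 z ∨ ∃ c < σ.arr 24 ρ,
        Y (σ.arr 19 (ρ * s + c) % n * n + j) ≤ X (σ.arr 19 (ρ * s + c)) ∧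
        σ'.arr 30 z = X (σ.arr 19 (ρ * s + c))) ∧
      (∀ b, b ≠ 30 → σ'.arr b = σ.arr b) ∧ τ' ≤ τ + 9 + 45 * s) σ τ := by
  have hn : n ≤ n * n := Nat.le_mul_self n
  have hW1 : 1 < W := by omega
  rw [scanProg, wp_seq, wp_assign]
  refine ⟨by simp [h66]; omega, ?_⟩
  refine wp_forLoop (v := 70) (a := 30)
    (fun i σ' τ' => (∀ y, y ≠ z → σ'.arr 30 y = σ.arr 30 y) ∧ σ'.arr 30 z ≤ σ.arr 30 z ∧
      (∀ c < i, Y (σ.arr 19 (ρ * s + c) % n * n + j) ≤ X (σ.arr 19 (ρ * s + c)) →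
        σ'.arr 30 z ≤ X (σ.arr 19 (ρ * s + c))) ∧
      (σ'.arr 30 z = σ.arr 30 z ∨ ∃ c < i,
        Y (σ.arr 19 (ρ * s + c) % n * n + j) ≤ X (σ.arr 19 (ρ * s + c)) ∧
        σ'.arr 30 z = X (σ.arr 19 (ρ * s + c))) ∧
      (∀ b, b ≠ 30 → σ'.arr b = σ.arr b) ∧ τ' ≤ τ + 5 + 45 * i) (σ.arr 24 ρ)
      (by simp [RamProg.Above]) le_rfl (by norm_num) (by simp [h66]) (by omega) (by omega) ?_ ?_ ?_
  · simp
  · rintro c hc σ' τ' hx hag ⟨i1, i2, i3, i4, i5, i6⟩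
    have hE' : SweepEnv n s N M B X Y σ' := hE.agree (v := 69) (a := 30) (by norm_num) (by norm_num)
      (⟨fun x hx => by rw [hag.1 x (by omega)]; simp; omega, fun b hb => hag.2 b hb⟩)
    have e66 : σ'.var 66 = ρ := by rw [hag.1 66 (by norm_num)]; simpa using h66
    have e67 : σ'.var 67 = j := by rw [hag.1 67 (by norm_num)]; simpa using h67
    have e68 : σ'.var 68 = z := by rw [hag.1 68 (by norm_num)]; simpa using h68
    have e19 : σ'.arr 19 = σ.arr 19 := i5 19 (by norm_num)
    have he := hEnt c hc
    set e := σ.arr 19 (ρ * s + c) with hed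
    have hb := flat_lt (mod_lt_of_lt_sq he) hj
    have h1 := hX e he
    have h2 := hY _ hb
    have h3 := i2.trans hZ
    have hdm : e % n < n := mod_lt_of_lt_sq he
    simp only [wp_seq, wp_assign]
    refine ⟨by simp [e66, hx, hE'.v36, e19, ← hed]; omega, ?_⟩
    rw [wp_ite]
    refine ⟨?_, fun hne => ?_, fun heq => ?_⟩
    · simp [e66, e67, hx, hE'.v36, hE'.v10, hE'.a10, hE'.a11, e19, ← hed, hW1]; omega
    · simp [e66, e67, hx, hE'.v36, hE'.v10, hE'.a10, hE'.a11, e19, ← hed] at hne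
      have hYX : Y (e % n * n + j) ≤ X e := by omega
      rw [wp_write]
      have hv : σ'.arr 30 z - (σ'.arr 30 z - X e) = min (σ'.arr 30 z) (X e) := by omega
      refine ⟨by simp [e68]; omega, by simp [e68, e66, hx, hE'.v36, hE'.a10, e19, ← hed]; omega,
        by simpa using hx, ?_⟩
      simp only [RamState.arr_setVar, RamState.arr_setArr, if_true, RamExpr.eval_var,
        RamState.var_setVar, e68, RamExpr.eval_sub, RamExpr.eval_read, RamExpr.eval_add,
        RamExpr.eval_mul, e66, hx, hE'.v36, hE'.a10, e19, ← hed, hv,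
        show (68 : ℕ) ≠ 71 by norm_num, if_false, Function.update_self]
      refine ⟨fun y hy => by rw [Function.update_of_ne hy, i1 y hy], (min_le_left _ _).trans i2,
        fun c' hc' hle => ?_, ?_, fun b hb => by rw [if_neg hb, i5 b hb], ?_⟩
      · by_cases hcc : c' = c
        · subst hcc; exact min_le_right _ _
        · exact (min_le_left _ _).trans (i3 c' (by omega) hle)
      · rcases min_choice (σ'.arr 30 z) (X e) with h | h
        · rw [h]
          rcases i4 with i4 | ⟨c', hc', i4⟩
          · exact Or.inl i4
          · exact Or.inr ⟨c', by omega, i4⟩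
        · exact Or.inr ⟨c, by omega, hYX, h⟩
      · simp; omega
    · simp [e66, e67, hx, hE'.v36, hE'.v10, hE'.a10, hE'.a11, e19, ← hed] at heq
      rw [wp_skip]
      refine ⟨by simpa using hx, i1, i2, fun c' hc' hle => ?_, ?_, i5, by simp; omega⟩
      · simp only [RamState.arr_setVar]
        by_cases hcc : c' = c
        · rw [hcc, ← hed] at hle ⊢
          omega
        · exact i3 c' (by omega) hle
      · rcases i4 with i4 | ⟨c', hc', i4⟩
        · exact Or.inl i4
        · exact Or.inr ⟨c', by omega, i4⟩
  · rintro σ' τ' - hag ⟨i1, i2, i3, i4, i5, i6⟩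
    exact ⟨i1, i2, i3, i4, i5, by omega⟩

/-- The number of marked results. -/
def marks (k : ℕ) (Flg : ℕ → ℕ) : ℕ := ∑ y ∈ Finset.range k, if Flg y = 0 then 0 else 1

theorem marks_le (k : ℕ) (Flg : ℕ → ℕ) : marks k Flg ≤ k := by
  calc marks k Flg ≤ ∑ y ∈ Finset.range k, 1 :=
        Finset.sum_le_sum fun y _ => by split_ifs <;> omega
    _ = k := by simp

theorem marks_update {k y : ℕ} {Flg : ℕ → ℕ} (hy : y < k) (h0 : Flg y = 0) :
    marks k (Function.update Flg y 1) = marks k Flg + 1 := by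
  have := Finset.sum_add_eq_of_bump (f := fun y => if Flg y = 0 then 0 else 1)
    (g := fun z => if Function.update Flg y 1 z = 0 then 0 else 1) (Finset.mem_range.2 hy)
    (fun j _ hj => by simp only [Function.update_of_ne hj])
  simpa [marks, h0] using this

open RamExpr in
/-- Combine all slots with the product in array `42`. -/
def combineProg : RamProg :=
  .assign 64 (var 17 * var 10) ;;
  forLoop 65 64
    (.assign 66 (var 65 / var 10) ;;
     .assign 67 (var 65 % var 10) ;;
     .ite (read 42 (var 60 + (var 66 * var 17 + var 67)))
      (.assign 68 (read 25 (var 66) * var 10 + var 67) ;;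
       .ite (read 31 (var 68)) .skip (.write 31 (var 68) (const 1) ;; scanProg))
      .skip)

theorem combineProg_above : combineProg.Above 64 30 := by
  simp [combineProg, RamProg.Above, forLoop_above]
  simp [scanProg, RamProg.Above, forLoop_above]

/-- A slot is scanned only for a result that is not yet marked, so the time of the scans is bounded by
the number of new marks. -/
theorem wp_combineProg {S : SweepState} {done : ℕ → Prop} {Pr : ℕ → ℕ}
    (hE : SweepEnv n s N M B X Y σ) (hS : Sweep n s N M X Y done S)
    (hFil : σ.arr 24 = S.Fil) (hRow : σ.arr 25 = S.Row) (hEnt : σ.arr 19 = S.Ent)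
    (hZ : σ.arr 30 = S.Z) (hFlg : σ.arr 31 = S.Flg) (hn : 0 < n) (hnN : n ≤ N)
    (hPr : ∀ ρ < N, ∀ j < n, σ.arr 42 (σ.var 60 + (ρ * N + j)) = Pr (ρ * N + j))
    (hP : ∀ ρ < N, ∀ j < n, Pr (ρ * N + j) ≠ 0 →
      ∃ κ < N, S.m1 (ρ * N + κ) ≠ 0 ∧ S.m2 (κ * N + j) ≠ 0)
    (hPle : ∀ ρ < N, ∀ j < n, Pr (ρ * N + j) ≤ N)
    (hX : ∀ e < n * n, X e ≤ M) (hY : ∀ e < n * n, Y e ≤ M) (hFb : ∀ y < n * n, S.Flg y < W)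
    (hW : N * s + s < W) (hW' : n * n + M + 1 < W) (hW3 : σ.var 60 + N * N < W) :
    wp W combineProg (fun σ' τ' => Combining n s N M X Y S Pr (N * n) (σ'.arr 30) (σ'.arr 31) ∧
      (∀ y < n * n, σ'.arr 31 y < W) ∧
      (∀ b, b ≠ 30 → b ≠ 31 → σ'.arr b = σ.arr b) ∧
      τ' + 60 * (s * marks (n * n) S.Flg) ≤
        τ + 100 * (N * n) + 20 + 60 * (s * marks (n * n) (σ'.arr 31))) σ τ := by
  have hnn : n ≤ n * n := Nat.le_mul_self n
  have hNN : N * n ≤ N * N := Nat.mul_le_mul_left _ hnN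
  have hN' : N ≤ N * N := Nat.le_mul_self N
  rw [combineProg, wp_seq, wp_assign]
  refine ⟨by simp [hE.v17, hE.v10]; omega, ?_⟩
  refine wp_forLoop (v := 65) (a := 30) (fun y σ' τ' =>
      Combining n s N M X Y S Pr y (σ'.arr 30) (σ'.arr 31) ∧
      (∀ y < n * n, σ'.arr 31 y < W) ∧
      (∀ b, b ≠ 30 → b ≠ 31 → σ'.arr b = σ.arr b) ∧
      τ' + 60 * (s * marks (n * n) S.Flg) ≤
        τ + 100 * y + 6 + 60 * (s * marks (n * n) (σ'.arr 31))) (N * n)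
    (by simp [RamProg.Above, scanProg, forLoop_above]) le_rfl (by norm_num)
    (by simp [hE.v17, hE.v10]) (by omega) (by omega) ?_ ?_ ?_
  · refine ⟨?_, ?_, fun _ _ _ => rfl, ?_⟩
    · simpa [hZ, hFlg] using hS.combining
    · simpa [hFlg] using hFb
    · simp [hFlg]
  · rintro y hy σ' τ' hx hag ⟨hC, i1, i2, i3⟩
    have hag' : Agree 64 30 σ σ' := ⟨fun x hx => by
      rw [hag.1 x (by omega)]
      have : x ≠ 64 := by omega
      simp [this], fun b hb => hag.2 b hb⟩
    have hE' := hE.agree (by norm_num) (by norm_num) hag'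
    have e60 : σ'.var 60 = σ.var 60 := hag'.1 60 (by norm_num)
    have e42 : σ'.arr 42 = σ.arr 42 := i2 42 (by norm_num) (by norm_num)
    set ρ := y / n with hρd
    set j := y % n with hjd
    have hρ : ρ < N := Nat.div_lt_of_lt_mul (by rwa [mul_comm] at hy)
    have hj : j < n := Nat.mod_lt _ hn
    have hyd : y = ρ * n + j := by rw [hρd, hjd, mul_comm]; exact (Nat.div_add_mod y n).symm
    have hb := flat_lt hρ (hj.trans_le hnN)
    have hb2 := Nat.mul_le_mul_right s hρ.le
    simp only [wp_seq, wp_assign]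
    refine ⟨by simp [hx, hE'.v10, ← hρd]; omega, by simp [hx, hE'.v10, ← hjd]; omega, ?_⟩
    have hp := hPr ρ hρ j hj
    have hp' := hPle ρ hρ j hj
    rw [wp_ite]
    refine ⟨?_, fun hne => ?_, fun heq => ?_⟩
    · simp [hx, hE'.v10, hE'.v17, ← hρd, ← hjd, e60, e42, hp]; omega
    · simp [hx, hE'.v10, hE'.v17, ← hρd, ← hjd, e60, e42, hp] at hne
      -- A nonzero entry of the product comes with an entry of the slot that yields a result.
      obtain ⟨κ, hκ, w1, w2⟩ := hP ρ hρ j hj hne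
      obtain ⟨c₀, hc₀, w3⟩ := hS.witness ρ hρ κ hκ w1
      have w4 := w3 j hj w2
      obtain ⟨e1, e2, e3⟩ := hS.ent ρ hρ c₀ hc₀
      have hr : S.Row ρ < n := by rw [← e2]; exact div_lt_of_lt_sq e1
      have hrz := flat_lt hr hj
      have e25 : σ'.arr 25 = S.Row := by rw [i2 25 (by norm_num) (by norm_num), hRow]
      have e24 : σ'.arr 24 = S.Fil := by rw [i2 24 (by norm_num) (by norm_num), hFil]
      have e19 : σ'.arr 19 = S.Ent := by rw [i2 19 (by norm_num) (by norm_num), hEnt]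
      set z := S.Row ρ * n + j with hzd
      simp only [wp_seq, wp_assign]
      refine ⟨by simp [hx, hE'.v10, ← hρd, ← hjd, e25]; omega, ?_⟩
      rw [wp_ite]
      have := i1 z hrz
      refine ⟨by simp [hx, hE'.v10, ← hρd, ← hjd, e25, ← hzd]; omega, fun hf => ?_, fun hf => ?_⟩
      · simp [hx, hE'.v10, ← hρd, ← hjd, e25, ← hzd] at hf
        rw [wp_skip]
        refine ⟨by simpa using hx, ?_, i1, i2, by simp; omega⟩
        rw [hyd] at hC ⊢
        exact hC.flagged hj hr hf
      · simp [hx, hE'.v10, ← hρd, ← hjd, e25, ← hzd] at hf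
        simp only [wp_seq, wp_write]
        refine ⟨by simp [hx, hE'.v10, ← hρd, ← hjd, e25, ← hzd]; omega, by simp; omega, ?_⟩
        set σ₂ := RamState.setArr _ _ _ _ with hσ₂
        have a30 : σ₂.arr 30 = σ'.arr 30 := by simp [hσ₂]
        have a31 : σ₂.arr 31 = Function.update (σ'.arr 31) z 1 := by
          simp [hσ₂, hx, hE'.v10, ← hρd, ← hjd, e25, ← hzd]
        have ao : ∀ b, b ≠ 31 → σ₂.arr b = σ'.arr b := fun b hb => by simp [hσ₂, hb]
        have g19 : σ₂.arr 19 = S.Ent := by rw [ao 19 (by norm_num), e19]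
        have g24 : σ₂.arr 24 = S.Fil := by rw [ao 24 (by norm_num), e24]
        have hE₂ : SweepEnv n s N M B X Y σ₂ := hE'.agree (v := 64) (a := 30) (by norm_num)
          (by norm_num) ⟨fun x hx => by simp [hσ₂]; split_ifs <;> omega,
            fun b hb => ao b (by omega)⟩
        have hz := hC.mono z hrz
        refine (wp_scanProg (ρ := ρ) (j := j) (z := z) hE₂ (by simp [hσ₂, hx, hE'.v10, ← hρd])
          (by simp [hσ₂, hx, hE'.v10, ← hjd])
          (by simp [hσ₂, hx, hE'.v10, ← hρd, ← hjd, e25, ← hzd]) hj hrz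
          (by rw [g24]; exact hS.fil_le ρ hρ)
          (by rw [g24, g19]; exact fun c hc => (hS.ent ρ hρ c hc).1) hX hY
          (by rw [a30]; exact hz.trans (hS.zle z hrz)) (by omega) hW' (by omega)).frame
          scanProg_above ?_
        rintro σ₃ τ₃ hag₃ ⟨j1, j2, j3, j4, j5, j6⟩
        rw [g24, g19] at j3 j4
        rw [a30] at j1 j2 j4
        have e31 : σ₃.arr 31 = Function.update (σ'.arr 31) z 1 := by
          rw [j5 31 (by norm_num), a31]
        have hm := marks_update (k := n * n) hrz hf
        refine ⟨?_, ?_, ?_, ?_, ?_⟩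
        · rw [hag₃.1 65 (by norm_num)]; simpa [hσ₂] using hx
        · rw [hyd] at hC ⊢
          simp only [RamState.arr_setVar]
          exact hC.scan hS hρ hj hr ⟨c₀, hc₀, w4⟩ e31 j1 j2 j3 j4
        · intro y' hy'
          simp only [RamState.arr_setVar, e31, Function.update_apply]
          split_ifs
          · omega
          · exact i1 y' hy'
        · intro b hb hb'
          simp only [RamState.arr_setVar]
          rw [j5 b hb, ao b hb', i2 b hb hb']
        · simp only [RamState.arr_setVar, e31, hm]
          simp at j6
          rw [Nat.mul_succ s]
          omega
    · simp [hx, hE'.v10, hE'.v17, ← hρd, ← hjd, e60, e42, hp] at heq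
      rw [wp_skip]
      refine ⟨by simpa using hx, ?_, i1, i2, by simp; omega⟩
      rw [hyd] at hC ⊢
      exact hC.skip hj heq
  · rintro σ' τ' - hag ⟨i1, i2, i3, i4⟩
    exact ⟨i1, i2, i3, by omega⟩

end

/-! ### Opening and closing a batch of slots -/

open RamExpr in
/-- Move to a fresh memory region and open one slot for every row. -/
def openProg : RamProg :=
  .assign 60 (var 60 + var 19) ;;
  mapLoop 64 17 24 (var 64) (const 0) ;;
  mapLoop 64 10 21 (var 64) (const 0) ;;
  mapLoop 64 10 22 (var 64) (var 64) ;;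
  mapLoop 64 10 23 (var 64) (var 64) ;;
  mapLoop 64 10 25 (var 64) (var 64) ;;
  mapLoop 64 16 41 (var 60 + (var 64 / var 10 * var 17 + var 64 % var 10))
    ((read 11 (var 64)).less (var 41 + const 1)) ;;
  .assign 61 (var 10)

theorem openProg_above : openProg.Above 60 21 := by
  simp [openProg, RamProg.Above, mapLoop_above]

/-- Multiply and combine, unless the step counter exceeds the budget `var 38`; in that case set
`var 63`. -/
def flushProg (P : RamProg) : RamProg :=
  .ite ((RamExpr.var 38).less (.var 62)) (.assign 63 (.const 1)) (productProg P ;; combineProg)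

theorem RamProg.Above.mono {v v' a a' : ℕ} (hv : v' ≤ v) (ha : a' ≤ a) {p : RamProg}
    (h : p.Above v a) : p.Above v' a' := by
  induction p with
  | skip => trivial
  | assign x e => exact hv.trans h
  | write b i e => exact ha.trans h
  | seq p q ihp ihq => exact ⟨ihp h.1, ihq h.2⟩
  | ite e p q ihp ihq => exact ⟨ihp h.1, ihq h.2⟩
  | loop e p ih => exact ih h

theorem flushProg_above (P : RamProg) : (flushProg P).Above 62 30 :=
  ⟨by simp [RamProg.Above], (productProg_above P).mono le_rfl (by norm_num),
    combineProg_above.mono (by norm_num) le_rfl⟩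

section
variable {n s N M B W T : ℕ} {X Y : ℕ → ℕ} {σ : RamState} {τ : ℕ} {done : ℕ → Prop}

theorem wp_openProg (hE : SweepEnv n s N M B X Y σ) (hS : Settled n M X Y done (sweepOf σ))
    (hR : ∀ a y, σ.var 60 + B ≤ y → σ.arr (a + 40) y = 0) (hn : 0 < n) (hs : 0 < s) (hnN : n ≤ N)
    (hB : N * N ≤ B) (hdone : ∀ k < n, ∀ j < n, done (k * n + j) → Y (k * n + j) ≤ σ.var 41)
    (hY : ∀ e < n * n, Y e ≤ M) (hc : σ.var 41 ≤ M) (hW : M + 1 < W)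
    (hW2 : σ.var 60 + 2 * B < W) :
    wp W openProg (fun σ' τ' => SweepEnv n s N M B X Y σ' ∧
      Sweep n s N M X Y done (sweepOf σ') ∧ Region N B σ' ∧
      (∀ ρ < N, σ'.arr 24 ρ = 0) ∧ (∀ k < n, σ'.arr 21 k = 0) ∧ (∀ i < n, σ'.arr 22 i = i) ∧
      σ'.var 61 = n ∧ σ'.var 60 = σ.var 60 + B ∧ σ'.var 41 = σ.var 41 ∧
      σ'.var 62 = σ.var 62 ∧ σ'.var 63 = σ.var 63 ∧ σ'.arr 31 = σ.arr 31 ∧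
      τ' ≤ τ + 130 * (N * N)) σ τ := by
  have hN : 0 < N := hn.trans_le hnN
  have hNN : 0 < N * N := Nat.mul_pos hN hN
  have hN' : N ≤ N * N := Nat.le_mul_self N
  have hn' : n * n ≤ N * N := Nat.mul_le_mul hnN hnN
  have hn'' : n ≤ n * n := Nat.le_mul_self n
  have inj : ∀ m : ℕ, ∀ i < m, ∀ i' < m, id i = id i' → i = i' := fun _ _ _ _ _ h => h
  rw [openProg, wp_seq, wp_assign]
  refine ⟨by simp [hE.v19]; omega, ?_⟩
  rw [wp_seq]
  refine wp_mapLoop N id (fun _ => 0) (by simp [hE.v17]) (by norm_num) (by omega) (by omega)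
    (inj _) (fun i hi σ' h1 h2 h3 h4 h5 => by simp [h1]; omega) ?_
  intro σ₁ τ₁ v1 _ a1 b1 _ t1
  rw [wp_seq]
  refine wp_mapLoop n id (fun _ => 0) (by simp [v1, hE.v10]) (by norm_num) (by omega) (by omega)
    (inj _) (fun i hi σ' h1 h2 h3 h4 h5 => by simp [h1]; omega) ?_
  intro σ₂ τ₂ v2 _ a2 b2 _ t2
  rw [wp_seq]
  refine wp_mapLoop n id id (by simp [v1, v2, hE.v10]) (by norm_num) (by omega) (by omega)
    (inj _) (fun i hi σ' h1 h2 h3 h4 h5 => by simp [h1]; omega) ?_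
  intro σ₃ τ₃ v3 _ a3 b3 _ t3
  rw [wp_seq]
  refine wp_mapLoop n id id (by simp [v1, v2, v3, hE.v10]) (by norm_num) (by omega) (by omega)
    (inj _) (fun i hi σ' h1 h2 h3 h4 h5 => by simp [h1]; omega) ?_
  intro σ₄ τ₄ v4 _ a4 b4 _ t4
  rw [wp_seq]
  refine wp_mapLoop n id id (by simp [v1, v2, v3, v4, hE.v10]) (by norm_num) (by omega) (by omega)
    (inj _) (fun i hi σ' h1 h2 h3 h4 h5 => by simp [h1]; omega) ?_
  intro σ₅ τ₅ v5 _ a5 b5 _ t5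
  have w60 : σ₅.var 60 = σ.var 60 + B := by simp [v1, v2, v3, v4, v5, hE.v19]
  have w5 : ∀ y, y ≠ 60 → y ≠ 64 → σ₅.var y = σ.var y := fun y hy hy' => by
    simp [v1, v2, v3, v4, v5, hy, hy']
  have a5' : ∀ c, c < 21 ∨ 25 < c → σ₅.arr c = σ.arr c := fun c hc => by
    rw [a5 c (by omega), a4 c (by omega), a3 c (by omega), a2 c (by omega), a1 c (by omega)]
    rfl
  have hlt : ∀ i < n * n, i / n * N + i % n < N * N := fun i hi =>
    flat_lt ((div_lt_of_lt_sq hi).trans_le hnN) ((mod_lt_of_lt_sq hi).trans_le hnN)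
  rw [wp_seq]
  refine wp_mapLoop (n * n) (fun i => σ.var 60 + B + (i / n * N + i % n))
    (fun i => if Y i < σ.var 41 + 1 then 1 else 0) (by simp [w5, hE.v16]) (by norm_num) (by omega)
    (by omega) ?_ ?_ ?_
  · intro i hi i' hi' h
    simp only [add_right_inj] at h
    obtain ⟨h1, h2⟩ := flat_inj ((mod_lt_of_lt_sq hi).trans_le hnN)
      ((mod_lt_of_lt_sq hi').trans_le hnN) h
    rw [← Nat.div_add_mod i n, ← Nat.div_add_mod i' n, h1, h2]
  · intro i hi σ' h1 h2 h3 h4 h5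
    have e1 := hlt i hi
    have e2 := div_lt_of_lt_sq hi
    have e3 := mod_lt_of_lt_sq hi
    have hW1 : 1 < W := by omega
    simp [h1, h2, h3, w5, w60, a5', hE.v10, hE.v17, hE.a11, hW1]
    have := hY i hi
    omega
  intro σ₆ τ₆ v6 _ a6 b6 c6 t6
  have w6 : ∀ y, y ≠ 60 → y ≠ 64 → σ₆.var y = σ.var y := fun y hy hy' => by
    rw [v6 y hy', w5 y hy hy']
  have w60' : σ₆.var 60 = σ.var 60 + B := by rw [v6 60 (by norm_num), w60]
  have a6' : ∀ c, c < 21 ∨ 25 < c → c ≠ 41 → σ₆.arr c = σ.arr c := fun c hc hc' => by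
    rw [a6 c hc', a5' c hc]
  rw [wp_assign]
  refine ⟨by simp [w6, hE.v10]; omega, ?_⟩
  set σ' := σ₆.setVar 61 ((RamExpr.var 10).eval σ₆) with hσ'
  have z60 : σ'.var 60 = σ.var 60 + B := by simp [hσ', w60']
  have z61 : σ'.var 61 = n := by simp [hσ', w6, hE.v10]
  have zv : ∀ y, y ≠ 60 → y ≠ 61 → y ≠ 64 → σ'.var y = σ.var y := fun y h1 h2 h3 => by
    simp [hσ', h2, w6 y h1 h3]
  have z24 : ∀ ρ < N, σ'.arr 24 ρ = 0 := fun ρ hρ => by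
    simp only [hσ', RamState.arr_setVar]
    rw [a6 24 (by norm_num), a5 24 (by norm_num), a4 24 (by norm_num), a3 24 (by norm_num),
      a2 24 (by norm_num)]
    exact b1 ρ hρ
  have z21 : ∀ k < n, σ'.arr 21 k = 0 := fun k hk => by
    simp only [hσ', RamState.arr_setVar]
    rw [a6 21 (by norm_num), a5 21 (by norm_num), a4 21 (by norm_num), a3 21 (by norm_num)]
    exact b2 k hk
  have z22 : ∀ k < n, σ'.arr 22 k = k := fun k hk => by
    simp only [hσ', RamState.arr_setVar]
    rw [a6 22 (by norm_num), a5 22 (by norm_num), a4 22 (by norm_num)]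
    exact b3 k hk
  have z23 : ∀ k < n, σ'.arr 23 k = k := fun k hk => by
    simp only [hσ', RamState.arr_setVar]
    rw [a6 23 (by norm_num), a5 23 (by norm_num)]
    exact b4 k hk
  have z25 : ∀ k < n, σ'.arr 25 k = k := fun k hk => by
    simp only [hσ', RamState.arr_setVar]
    rw [a6 25 (by norm_num)]
    exact b5 k hk
  have z41 : ∀ k < n, ∀ j < n, σ'.arr 41 (σ.var 60 + B + (k * N + j)) =
      if Y (k * n + j) ≤ σ.var 41 then 1 else 0 := fun k hk j hj => by
    have := b6 (k * n + j) (flat_lt hk hj)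
    simp only [flat_div hj, flat_mod hj, Nat.lt_succ_iff] at this
    exact this
  have z41' : ∀ y, σ.var 60 + B ≤ y → (∀ i < n * n, y ≠ σ.var 60 + B + (i / n * N + i % n)) →
      σ'.arr 41 y = 0 := fun y hy hne => by
    simp only [hσ', RamState.arr_setVar]
    rw [c6 y hne, a5' 41 (by norm_num)]
    exact hR 1 y hy
  have z40 : ∀ a y, a ≠ 1 → σ.var 60 + B ≤ y → σ'.arr (a + 40) y = 0 := fun a y ha hy => by
    simp only [hσ', RamState.arr_setVar]
    rw [a6' (a + 40) (by omega) (by omega)]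
    exact hR a y hy
  have za : ∀ c, c < 21 ∨ 25 < c → c ≠ 41 → σ'.arr c = σ.arr c := a6'
  refine ⟨?_, ?_, ⟨fun a y hy => ?_, fun a y hy h => ?_⟩, z24, z21, z22, z61, z60,
    zv 41 (by norm_num) (by norm_num) (by norm_num), zv 62 (by norm_num) (by norm_num) (by norm_num),
    zv 63 (by norm_num) (by norm_num) (by norm_num), za 31 (by norm_num) (by norm_num), ?_⟩
  · exact hE.agree (v := 60) (a := 21) (by norm_num) (by norm_num)
      ⟨fun x hx => zv x (by omega) (by omega) (by omega), fun b hb => za b (by omega) (by omega)⟩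
  · refine hS.reopen hs hdone (zv 41 (by norm_num) (by norm_num) (by norm_num))
      (za 30 (by norm_num) (by norm_num)) (za 31 (by norm_num) (by norm_num)) z61 z21 z24 z22 z23 z25
      (fun y hy => ?_) (fun y hy => ?_) (fun k hk j hj => ?_)
    · simp only [sweepOf, z60]; exact z40 0 _ (by norm_num) (by omega)
    · simp only [sweepOf, z60]
      by_cases hex : ∃ i < n * n, y = i / n * N + i % n
      · obtain ⟨i, hi, rfl⟩ := hex
        rw [z41 _ (div_lt_of_lt_sq hi) _ (mod_lt_of_lt_sq hi)]
        split_ifs <;> omega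
      · push Not at hex
        rw [z41' _ (by omega) fun i hi h => hex i hi (by omega)]
        omega
    · simp only [sweepOf, z60]; exact z41 k hk j hj
  · rw [z60] at hy
    by_cases ha : a = 1
    · subst ha
      exact z41' y (by omega) fun i hi h => by have := hlt i hi; omega
    · exact z40 a y ha (by omega)
  · rw [z60]
    by_cases ha : a = 1
    · subst ha
      exact z41' _ (by omega) fun i hi h => by have := hlt i hi; omega
    · exact z40 a _ ha (by omega)
  · simp at t1 t2 t3 t4 t5 t6
    simp
    omega

/-- Either the budget is exceeded, or everything collected in the slots is combined. -/
theorem wp_flushProg {P : RamProg} (hP : Multiplies P N B T) (hE : SweepEnv n s N M B X Y σ)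
    (hS : Sweep n s N M X Y done (sweepOf σ)) (hR : Region N B σ) (hn : 0 < n) (hnN : n ≤ N)
    (hB : N * N ≤ B) (h63 : σ.var 63 = 0)
    (hX : ∀ e < n * n, X e ≤ M) (hY : ∀ e < n * n, Y e ≤ M) (hF : ∀ y < n * n, σ.arr 31 y < W)
    (hW1 : N * s + s < W) (hW2 : n * n + M + 1 < W) (hW3 : σ.var 60 + B < W)
    (hW4 : σ.var 38 + T + N * N + 1 < W) (hW5 : σ.var 62 < W) :
    wp W (flushProg P) (fun σ' τ' => SweepEnv n s N M B X Y σ' ∧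
      (∀ a y, σ.var 60 + B ≤ y → σ'.arr (a + 40) y = 0) ∧
      σ'.var 60 = σ.var 60 ∧ σ'.var 41 = σ.var 41 ∧ (∀ y < n * n, σ'.arr 31 y < W) ∧
      ((σ.var 38 < σ.var 62 ∧ σ'.var 63 = 1 ∧ σ'.var 62 = σ.var 62 ∧ σ'.arr 31 = σ.arr 31 ∧
        τ' ≤ τ + 6) ∨
      (σ.var 62 ≤ σ.var 38 ∧ σ'.var 63 = 0 ∧ σ.var 62 + N * N ≤ σ'.var 62 ∧
        σ'.var 62 ≤ σ.var 62 + (T + N * N) ∧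
        Settled n M X Y done (sweepOf σ') ∧
        τ' + (productCost P + 130) * σ.var 62 + 60 * (s * marks (n * n) (σ.arr 31)) ≤
          τ + (productCost P + 130) * σ'.var 62 + 60 * (s * marks (n * n) (σ'.arr 31))))) σ τ := by
  have hN : 0 < N := hn.trans_le hnN
  have hNN : 0 < N * N := Nat.mul_pos hN hN
  have hnN' : N * n ≤ N * N := Nat.mul_le_mul_left _ hnN
  have hN' : N ≤ N * N := Nat.le_mul_self N
  have h1W : 1 < W := by omega
  rw [flushProg, wp_ite]
  refine ⟨by simp [h1W]; omega, fun hlt => ?_, fun hle => ?_⟩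
  · simp at hlt
    rw [wp_assign]
    refine ⟨h1W, hE.agree (v := 63) (a := 63) (by norm_num) (by norm_num) ⟨fun x hx => ?_, ?_⟩,
      hR.beyond, by simp, by simp, hF, Or.inl ⟨hlt, by simp, by simp, by simp, by simp⟩⟩
    · have : x ≠ 63 := by omega
      simp [this]
    · intro _ _; rfl
  · simp at hle
    rw [wp_seq]
    refine (wp_productProg hP hE.v17 hN hR hB (by omega) (by omega) hS.m1_le hS.m2_bit).frame
      (productProg_above P) ?_
    rintro σ₁ τ₁ ag₁ ⟨p1, p2, p3, p4, p5, p6⟩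
    have hE₁ := hE.agree (by norm_num) (by norm_num) ag₁
    have e60 : σ₁.var 60 = σ.var 60 := p2 60 (by norm_num) (by norm_num)
    have e41 : σ₁.var 41 = σ.var 41 := p2 41 (by norm_num) (by norm_num)
    refine (wp_combineProg (S := sweepOf σ)
      (Pr := fun y => ∑ κ ∈ Finset.range N, σ.arr 40 (σ.var 60 + (y / N * N + κ)) *
        σ.arr 41 (σ.var 60 + (κ * N + y % N))) hE₁ hS (ag₁.2 _ (by norm_num)) (ag₁.2 _ (by norm_num))
      (ag₁.2 _ (by norm_num)) (ag₁.2 _ (by norm_num)) (ag₁.2 _ (by norm_num)) hn hnN ?_ ?_ ?_ hX hY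
      hF hW1 hW2 (by omega)).frame combineProg_above ?_
    · intro ρ hρ j hj
      rw [e60, p1 ρ hρ j (hj.trans_le hnN)]
      simp only [flat_div (hj.trans_le hnN), flat_mod (hj.trans_le hnN)]
    · intro ρ hρ j hj hne
      simp only [flat_div (hj.trans_le hnN), flat_mod (hj.trans_le hnN)] at hne
      obtain ⟨κ, hκ, h⟩ := Finset.exists_ne_zero_of_sum_ne_zero hne
      exact ⟨κ, Finset.mem_range.1 hκ, left_ne_zero_of_mul h, right_ne_zero_of_mul h⟩
    · intro ρ hρ j hj
      simp only [flat_div (hj.trans_le hnN), flat_mod (hj.trans_le hnN)]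
      calc _ ≤ ∑ κ ∈ Finset.range N, 1 := Finset.sum_le_sum fun κ hκ => by
            have i1 := hS.m1_le _ (flat_lt hρ (Finset.mem_range.1 hκ))
            have i2 := hS.m2_bit _ (flat_lt (Finset.mem_range.1 hκ) (hj.trans_le hnN))
            exact Nat.mul_le_mul i1 i2
        _ = N := by simp
    rintro σ₂ τ₂ ag₂ ⟨q1, q2, q3, q4⟩
    have hE₂ := hE₁.agree (by norm_num) (by norm_num) ag₂
    have f60 : σ₂.var 60 = σ.var 60 := by rw [ag₂.1 60 (by norm_num), e60]
    have f41 : σ₂.var 41 = σ.var 41 := by rw [ag₂.1 41 (by norm_num), e41]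
    have f62 : σ₂.var 62 = σ₁.var 62 := ag₂.1 62 (by norm_num)
    have f63 : σ₂.var 63 = 0 := by
      rw [ag₂.1 63 (by norm_num), p2 63 (by norm_num) (by norm_num), h63]
    refine ⟨hE₂, fun a y hy => ?_, f60, f41, q2, Or.inr ⟨hle, f63, by omega, by omega, ?_, ?_⟩⟩
    · rw [q3 _ (by omega) (by omega)]; exact p3 a y hy
    · have := q1.settled hS fun ρ hρ j hj ⟨κ, hκ, h1, h2⟩ => by
        simp only [flat_div (hj.trans_le hnN), flat_mod (hj.trans_le hnN)]
        intro h0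
        exact absurd (Finset.sum_eq_zero_iff.1 h0 κ (Finset.mem_range.2 hκ))
          (Nat.mul_ne_zero h1 h2)
      exact ⟨this.zle, this.sound, this.complete, by rw [sweepOf, f41]; exact this.flg⟩
    · rw [f62]
      simp only [sweepOf] at q4
      simp only [RamExpr.cost_less, RamExpr.cost_var] at p6
      obtain ⟨d, hd⟩ := Nat.exists_eq_add_of_le p4
      rw [hd] at p6 ⊢
      nlinarith

end

/-! ### The sweep -/

open RamExpr in
/-- Open a new slot for row `var 42` of `Y`. -/
def allocYProg : RamProg :=
  .write 23 (var 42) (var 61) ;;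
  .write 21 (var 42) (const 0) ;;
  mapLoop 44 10 41 (var 60 + (var 61 * var 17 + var 44))
    ((read 11 (var 42 * var 10 + var 44)).less (var 41 + const 1)) ;;
  .assign 61 (var 61 + const 1)

open RamExpr in
/-- Process the entry `var 40` of `Y`. -/
def eventYProg : RamProg :=
  .assign 41 (read 11 (var 40)) ;;
  .assign 42 (var 40 / var 10) ;;
  .write 18 (var 42 * var 36 + read 21 (var 42)) (var 40 % var 10) ;;
  .write 21 (var 42) (read 21 (var 42) + const 1) ;;
  .ite ((read 21 (var 42)).less (var 36)) .skip allocYProg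

open RamExpr in
/-- Process the entry `var 40` of `X`. -/
def eventXProg : RamProg :=
  .assign 41 (read 10 (var 40)) ;;
  .assign 42 (var 40 / var 10) ;;
  .assign 43 (var 40 % var 10) ;;
  .assign 44 (read 22 (var 42)) ;;
  .write 40 (var 60 + (var 44 * var 17 + read 23 (var 43))) (const 1) ;;
  .write 19 (var 44 * var 36 + read 24 (var 44)) (var 40) ;;
  .write 24 (var 44) (read 24 (var 44) + const 1) ;;
  .assign 45 (read 21 (var 43)) ;;
  forLoop 46 45
    (.assign 47 (var 42 * var 10 + read 18 (var 43 * var 36 + var 46)) ;;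
     .write 30 (var 47) (read 30 (var 47) - (read 30 (var 47) - var 41))) ;;
  .ite ((read 24 (var 44)).less (var 36)) .skip
    (.write 22 (var 42) (var 61) ;;
     .write 25 (var 61) (var 42) ;;
     .assign 61 (var 61 + const 1))

/-- How far the slots in use are filled: what will be charged for the next slots to be opened. -/
def slotLoad (n s : ℕ) (S : SweepState) : ℕ :=
  s * (S.sc - n) + ∑ i ∈ Finset.range n, S.Fil (S.Rsl i) + ∑ k ∈ Finset.range n, S.Lft k

/-- The state between two events. -/
structure Ready (n s N M B W : ℕ) (X Y : ℕ → ℕ) (done : ℕ → Prop) (σ : RamState) : Prop where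
  env : SweepEnv n s N M B X Y σ
  sweep : Sweep n s N M X Y done (sweepOf σ)
  region : Region N B σ
  lft_lt : ∀ k < n, σ.arr 21 k < s
  fil_lt : ∀ i < n, σ.arr 24 (σ.arr 22 i) < s
  le_sc : n ≤ σ.var 61
  flg : ∀ y < n * n, σ.arr 31 y < W
  cur_le : σ.var 41 ≤ M

section
variable {n s N M B W T : ℕ} {X Y : ℕ → ℕ} {σ : RamState} {τ : ℕ} {done done' : ℕ → Prop}

theorem wp_eventYProg (h : Ready n s N M B W X Y done σ) (hnN : n ≤ N) (hs : 0 < s)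
    (hB : N * N ≤ B) {e : ℕ} (he : e < n * n) (h40 : σ.var 40 = e) (hsc : σ.var 61 < N)
    (hcur : σ.var 41 ≤ Y e) (hY : ∀ e < n * n, Y e ≤ M)
    (hdone : ∀ e', done' e' → done e' ∨ e' = e)
    (hle : ∀ e' < n * n, done' e' → Y e' ≤ Y e)
    (hW1 : N * s + s < W) (hW2 : n * n + M + 1 < W) (hW3 : σ.var 60 + B < W) :
    wp W eventYProg (fun σ' τ' => Ready n s N M B W X Y done' σ' ∧ σ'.var 41 = Y e ∧
      (∀ x, x < 40 ∨ 62 ≤ x → σ'.var x = σ.var x) ∧ σ'.var 60 = σ.var 60 ∧ σ'.var 61 ≤ N ∧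
      σ'.arr 13 = σ.arr 13 ∧ σ'.arr 31 = σ.arr 31 ∧
      slotLoad n s (sweepOf σ') ≤ slotLoad n s (sweepOf σ) + 1 ∧
      σ.var 61 ≤ σ'.var 61 ∧
      τ' ≤ τ + 60 + 60 * (n * (σ'.var 61 - σ.var 61))) σ τ := by
  have hE := h.env
  have hn : 0 < n := Nat.pos_of_ne_zero fun h0 => by subst h0; simp at he
  have hnn : n ≤ n * n := Nat.le_mul_self n
  have hNN : N ≤ N * N := Nat.le_mul_self N
  set k := e / n with hkd
  set j := e % n with hjd
  have hk : k < n := div_lt_of_lt_sq he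
  have hj : j < n := mod_lt_of_lt_sq he
  have hkj : k * n + j = e := by rw [hkd, hjd, mul_comm]; exact Nat.div_add_mod e n
  have hl := h.lft_lt k hk
  have hks : k * s + s ≤ N * s + s := by
    have := Nat.mul_le_mul_right s (hk.le.trans hnN); omega
  have hYe := hY e he
  have h1W : 1 < W := by omega
  -- The state after the entry has been recorded.
  have hsw := (h.sweep.advance (c := Y e) hcur).addY hk hj (by rw [hkj]) hl
    (hdone := fun e' hd => by rw [hkj]; exact hdone e' hd) rfl rfl
  have hload : ∑ k' ∈ Finset.range n, Function.update (σ.arr 21) k (σ.arr 21 k + 1) k' =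
      ∑ k' ∈ Finset.range n, σ.arr 21 k' + 1 := by
    have := Finset.sum_add_eq_of_bump (f := σ.arr 21)
      (g := Function.update (σ.arr 21) k (σ.arr 21 k + 1)) (Finset.mem_range.2 hk)
      (fun j _ hj => Function.update_of_ne hj _ _)
    rw [Function.update_self] at this
    omega
  simp only [eventYProg, wp_seq, wp_assign, wp_write]
  refine ⟨by simp [h40, hE.a11]; omega, by simp [h40, hE.v10, ← hkd]; omega,
    by simp [h40, hE.v10, hE.v36, ← hkd]; omega, by simp [h40, hE.v10, ← hjd]; omega,
    by simp [h40, hE.v10, ← hkd]; omega, by simp [h40, hE.v10, ← hkd]; omega, ?_⟩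
  set σ₁ := RamState.setArr _ 21 _ _ with hσ₁
  have v1 : ∀ x, x < 41 ∨ 42 < x → σ₁.var x = σ.var x := fun x hx => by
    have i1 : x ≠ 41 := by omega
    have i2 : x ≠ 42 := by omega
    simp [hσ₁, i1, i2]
  have v41 : σ₁.var 41 = Y e := by simp [hσ₁, h40, hE.a11]
  have v42 : σ₁.var 42 = k := by simp [hσ₁, h40, hE.v10, hkd]
  have a18 : σ₁.arr 18 = Function.update (σ.arr 18) (k * s + σ.arr 21 k) j := by
    simp [hσ₁, h40, hE.v10, hE.v36, hkd, hjd]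
  have a21 : σ₁.arr 21 = Function.update (σ.arr 21) k (σ.arr 21 k + 1) := by
    simp [hσ₁, h40, hE.v10, hkd]
  have ao : ∀ b, b ≠ 18 → b ≠ 21 → σ₁.arr b = σ.arr b := fun b h1 h2 => by simp [hσ₁, h1, h2]
  have hE₁ : SweepEnv n s N M B X Y σ₁ := hE.agree (v := 41) (a := 18) (by norm_num) (by norm_num)
    ⟨fun x hx => v1 x (Or.inl hx), fun b hb => ao b (by omega) (by omega)⟩
  have e60 : σ₁.var 60 = σ.var 60 := v1 60 (by norm_num)
  have e61 : σ₁.var 61 = σ.var 61 := v1 61 (by norm_num)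
  have hsw₁ : Sweep n s N M X Y done' (sweepOf σ₁) := by
    convert hsw using 1
    simp only [sweepOf, v41, a18, a21, e60, e61, ao 22 (by norm_num) (by norm_num),
      ao 23 (by norm_num) (by norm_num), ao 24 (by norm_num) (by norm_num),
      ao 25 (by norm_num) (by norm_num), ao 19 (by norm_num) (by norm_num),
      ao 30 (by norm_num) (by norm_num), ao 31 (by norm_num) (by norm_num),
      ao 40 (by norm_num) (by norm_num), ao 41 (by norm_num) (by norm_num)]
  have hR₁ : Region N B σ₁ := ⟨fun a y hy => by
      rw [ao _ (by omega) (by omega)]; exact h.region.beyond a y (by omega),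
    fun a y hy hc => by rw [ao _ (by omega) (by omega), e60]; exact h.region.inside a y hy hc⟩
  rw [wp_ite]
  refine ⟨by simp [v42, a21, hE₁.v36, h1W]; omega, fun hlt => ?_, fun hge => ?_⟩
  · simp [v42, a21, hE₁.v36] at hlt
    rw [wp_skip]
    refine ⟨⟨hE₁, hsw₁, hR₁, fun k' hk' => ?_, ?_, ?_, ?_, ?_⟩, v41, fun x hx => v1 x (by omega), e60, by omega,
      ao 13 (by norm_num) (by norm_num), ao 31 (by norm_num) (by norm_num), ?_, by omega, ?_⟩
    · rw [a21, Function.update_apply]; split_ifs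
      · exact hlt
      · exact h.lft_lt k' hk'
    · rw [ao 24 (by norm_num) (by norm_num), ao 22 (by norm_num) (by norm_num)]; exact h.fil_lt
    · rw [e61]; exact h.le_sc
    · rw [ao 31 (by norm_num) (by norm_num)]; exact h.flg
    · rw [v41]; exact hYe
    · simp only [slotLoad, sweepOf, a21, e61, ao 22 (by norm_num) (by norm_num),
        ao 24 (by norm_num) (by norm_num), hload]
      omega
    · simp; omega
  · simp [v42, a21, hE₁.v36] at hge
    have hfull : σ.arr 21 k + 1 = s := by omega
    have hflat : σ.var 61 * N + n ≤ N * N := by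
      calc σ.var 61 * N + n ≤ σ.var 61 * N + N := by omega
        _ = (σ.var 61 + 1) * N := by ring
        _ ≤ N * N := Nat.mul_le_mul_right _ hsc
    have hlt : ∀ i < n, k * n + i < n * n := fun i hi => flat_lt hk hi
    simp only [allocYProg, wp_seq, wp_write]
    refine ⟨by simp [v42]; omega, by simp [e61]; omega, by simp [v42]; omega, by simp; omega, ?_⟩
    refine wp_mapLoop n (fun i => σ.var 60 + (σ.var 61 * N + i))
      (fun i => if Y (k * n + i) < Y e + 1 then 1 else 0) (by simp [hE₁.v10]) (by norm_num)
      (by omega) (by omega) (fun i _ i' _ h => by omega) ?_ ?_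
    · intro i hi σ' h1 h2 h3 h4 h5
      have i1 := hlt i hi
      have i2 := hY _ i1
      simp [h1, h2, h3, e60, e61, v42, v41, hE₁.v10, hE₁.v17, hE₁.a11, h1W]
      omega
    intro σ₂ τ₂ v2 _ a2 b2 c2 t2
    have ao2 : ∀ b, b ≠ 21 → b ≠ 23 → b ≠ 41 → σ₂.arr b = σ₁.arr b := fun b i1 i2 i3 => by
      rw [a2 b i3]; simp [i1, i2]
    have w2 : ∀ x, x ≠ 44 → σ₂.var x = σ₁.var x := fun x hx => by rw [v2 x hx]; rfl
    have f21 : σ₂.arr 21 = Function.update (σ₁.arr 21) k 0 := by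
      rw [a2 21 (by norm_num)]; simp [v42]
    have f23 : σ₂.arr 23 = Function.update (σ₁.arr 23) k (σ₁.var 61) := by
      rw [a2 23 (by norm_num)]; simp [v42]
    have c2' : ∀ y, (∀ i < n, y ≠ σ.var 60 + (σ.var 61 * N + i)) → σ₂.arr 41 y = σ₁.arr 41 y :=
      fun y hy => by rw [c2 y hy]; simp
    rw [wp_assign]
    refine ⟨by simp [w2, e61]; omega, ?_⟩
    set σ₃ := σ₂.setVar 61 ((RamExpr.var 61 + RamExpr.const 1).eval σ₂) with hσ₃
    have x61 : σ₃.var 61 = σ.var 61 + 1 := by simp [hσ₃, w2, e61]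
    have xo : ∀ x, x ≠ 61 → x ≠ 44 → σ₃.var x = σ₁.var x := fun x i1 i2 => by
      simp [hσ₃, i1, w2 x i2]
    have xa : ∀ b, b ≠ 21 → b ≠ 23 → b ≠ 41 → σ₃.arr b = σ₁.arr b := ao2
    have x60 : σ₃.var 60 = σ.var 60 := by rw [xo 60 (by norm_num) (by norm_num), e60]
    have x41 : σ₃.var 41 = Y e := by rw [xo 41 (by norm_num) (by norm_num), v41]
    have hE₃ : SweepEnv n s N M B X Y σ₃ := hE₁.agree (v := 44) (a := 18) (by norm_num)
      (by norm_num) ⟨fun x hx => xo x (by omega) (by omega),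
        fun b hb => xa b (by omega) (by omega) (by omega)⟩
    have x24 : σ₃.arr 24 = σ.arr 24 := by
      rw [xa 24 (by norm_num) (by norm_num) (by norm_num), ao 24 (by norm_num) (by norm_num)]
    have x22 : σ₃.arr 22 = σ.arr 22 := by
      rw [xa 22 (by norm_num) (by norm_num) (by norm_num), ao 22 (by norm_num) (by norm_num)]
    have x31 : σ₃.arr 31 = σ.arr 31 := by
      rw [xa 31 (by norm_num) (by norm_num) (by norm_num), ao 31 (by norm_num) (by norm_num)]
    have hsw₃ : Sweep n s N M X Y done' (sweepOf σ₃) := by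
      have := hsw₁.allocY (Lft := σ₃.arr 21) (Isl := σ₃.arr 23)
        (m2 := fun y => σ₃.arr 41 (σ.var 60 + y)) hk (by simp only [sweepOf, e61]; exact hsc) hnN
        (fun j' hj' hd => by simp only [sweepOf, v41]; exact hle _ (hlt j' hj') hd)
        (by simp only [hσ₃, RamState.arr_setVar, f21]; rfl)
        (by simp only [hσ₃, RamState.arr_setVar, f23]; rfl)
        (fun j' hj' => by
          have := b2 j' hj'
          simp only [sweepOf, v41, e61, hσ₃, RamState.arr_setVar]
          simpa [Nat.lt_succ_iff] using this)
        (fun y hy hne => by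
          simp only [sweepOf, e61] at hne
          simp only [sweepOf, e60, hσ₃, RamState.arr_setVar]
          exact c2' _ fun i hi heq => hne i hi (by omega))
      convert this using 1
      simp only [sweepOf, x61, x60, x41, v41, e61, e60, xa 22 (by norm_num) (by norm_num) (by norm_num),
        xa 18 (by norm_num) (by norm_num) (by norm_num),
        xa 24 (by norm_num) (by norm_num) (by norm_num), xa 25 (by norm_num) (by norm_num) (by norm_num),
        xa 19 (by norm_num) (by norm_num) (by norm_num), xa 30 (by norm_num) (by norm_num) (by norm_num),
        xa 31 (by norm_num) (by norm_num) (by norm_num), xa 40 (by norm_num) (by norm_num) (by norm_num)]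
    refine ⟨⟨hE₃, hsw₃, ⟨fun a y hy => ?_, fun a y hy hc => ?_⟩, fun k' hk' => ?_, ?_, ?_, ?_, ?_⟩,
      x41, fun x hx => ?_, x60, by omega, ?_, x31, ?_, by omega, ?_⟩
    · rw [x60] at hy
      by_cases ha : a = 1
      · subst ha
        have := c2' y fun i hi => by omega
        simp only [hσ₃, RamState.arr_setVar]
        rw [this]; exact hR₁.beyond 1 y (by omega)
      · rw [xa _ (by omega) (by omega) (by omega)]; exact hR₁.beyond a y (by omega)
    · rw [x60]
      by_cases ha : a = 1
      · subst ha
        have := c2' (σ.var 60 + y) fun i hi => by omega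
        simp only [hσ₃, RamState.arr_setVar]
        rw [this]; have := hR₁.inside 1 y hy (by omega); rwa [e60] at this
      · rw [xa _ (by omega) (by omega) (by omega)]
        have := hR₁.inside a y hy hc; rwa [e60] at this
    · simp only [hσ₃, RamState.arr_setVar, f21, a21, Function.update_apply]
      split_ifs
      · exact hs
      · exact h.lft_lt k' hk'
    · rw [x24, x22]; exact h.fil_lt
    · rw [x61]; exact h.le_sc.trans (Nat.le_succ _)
    · rw [x31]; exact h.flg
    · rw [x41]; exact hYe
    · rw [xo x (by omega) (by omega)]; exact v1 x (by omega)
    · rw [xa 13 (by norm_num) (by norm_num) (by norm_num)]; exact ao 13 (by norm_num) (by norm_num)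
    · -- Closing a full slot of `s` columns pays for the new slot.
      have h2 : ∑ k' ∈ Finset.range n, σ₃.arr 21 k' + (σ.arr 21 k + 1) =
          ∑ k' ∈ Finset.range n, σ.arr 21 k' + 1 := by
        have := Finset.sum_add_eq_of_bump (f := σ₁.arr 21) (g := σ₃.arr 21) (Finset.mem_range.2 hk)
          (fun j _ hj => by
            simp only [hσ₃, RamState.arr_setVar, f21]; exact Function.update_of_ne hj _ _)
        have i1 : σ₃.arr 21 k = 0 := by simp [hσ₃, f21]
        have i2 : σ₁.arr 21 k = σ.arr 21 k + 1 := by simp [a21]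
        rw [i1, i2, a21, hload] at this
        omega
      have h3 : s * (σ.var 61 + 1 - n) = s * (σ.var 61 - n) + s := by
        rw [Nat.succ_sub h.le_sc, Nat.mul_succ]
      simp only [slotLoad, sweepOf, x61, x22, x24, h3]
      omega
    · rw [x61, Nat.add_sub_cancel_left, mul_one]
      simp at t2 ⊢
      omega

end

section
variable {n s N M B W T : ℕ} {X Y : ℕ → ℕ} {σ : RamState} {τ : ℕ} {done done' : ℕ → Prop}

theorem wp_eventXProg (h : Ready n s N M B W X Y done σ) (hB : N * N ≤ B) {e : ℕ}
    (he : e < n * n) (h40 : σ.var 40 = e) (hsc : σ.var 61 < N)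
    (hcur : σ.var 41 ≤ X e) (hX : ∀ e < n * n, X e ≤ M)
    (hdone : ∀ e', done' e' → done e' ∨ e' = n * n + e)
    (hY : ∀ j < n, Y (e % n * n + j) ≤ X e → done (e % n * n + j))
    (hW1 : N * s + s < W) (hW2 : n * n + M + 1 < W) (hW3 : σ.var 60 + B < W) :
    wp W eventXProg (fun σ' τ' => Ready n s N M B W X Y done' σ' ∧ σ'.var 41 = X e ∧
      (∀ x, x < 40 ∨ 62 ≤ x → σ'.var x = σ.var x) ∧ σ'.var 60 = σ.var 60 ∧ σ'.var 61 ≤ N ∧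
      σ'.arr 13 = σ.arr 13 ∧ σ'.arr 31 = σ.arr 31 ∧
      slotLoad n s (sweepOf σ') ≤ slotLoad n s (sweepOf σ) + 1 ∧
      σ.var 61 ≤ σ'.var 61 ∧
      τ' ≤ τ + 90 + 40 * s) σ τ := by
  have hE := h.env
  have hS := h.sweep
  have hnn : n ≤ n * n := Nat.le_mul_self n
  have hNN : N ≤ N * N := Nat.le_mul_self N
  set i := e / n with hid
  set k := e % n with hkd
  have hi : i < n := div_lt_of_lt_sq he
  have hk : k < n := mod_lt_of_lt_sq he
  have hl := h.lft_lt k hk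
  have hXe := hX e he
  have h1W : 1 < W := by omega
  obtain ⟨hρ', hrow⟩ := hS.rsl i hi
  have hκ' := hS.isl k hk
  simp only [sweepOf] at hρ' hκ' hrow
  set ρ := σ.arr 22 i with hρd
  set κ := σ.arr 23 k with hκd
  have hρ : ρ < N := by omega
  have hκ : κ < N := by omega
  have hf : σ.arr 24 ρ < s := h.fil_lt i hi
  have hρκ := flat_lt hρ hκ
  have hρs : ρ * s + s ≤ N * s + s := by
    have := Nat.mul_le_mul_right s hρ.le; omega
  have hks : k * s + s ≤ N * s + s := by
    have hnN := h.le_sc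
    have := Nat.mul_le_mul_right s (show k ≤ N by omega); omega
  have hload : ∑ i' ∈ Finset.range n, Function.update (σ.arr 24) ρ (σ.arr 24 ρ + 1) (σ.arr 22 i') =
      ∑ i' ∈ Finset.range n, σ.arr 24 (σ.arr 22 i') + 1 := by
    have := Finset.sum_add_eq_of_bump (f := fun i' => σ.arr 24 (σ.arr 22 i'))
      (g := fun i' => Function.update (σ.arr 24) ρ (σ.arr 24 ρ + 1) (σ.arr 22 i'))
      (Finset.mem_range.2 hi) (fun i' hi' hne => Function.update_of_ne (fun heq => hne (by
        have h1 := (hS.rsl i' (Finset.mem_range.1 hi')).2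
        simp only [sweepOf] at h1
        rw [← h1, heq, hrow])) _ _)
    rw [← hρd, Function.update_self] at this
    omega
  simp only [eventXProg, wp_seq, wp_assign, wp_write]
  refine ⟨by simp [h40, hE.a10]; omega, by simp [h40, hE.v10, ← hid]; omega,
    by simp [h40, hE.v10, ← hkd]; omega, by simp [h40, hE.v10, ← hid, ← hρd]; omega,
    by simp [h40, hE.v10, hE.v17, ← hid, ← hρd, ← hkd, ← hκd]; omega, by simp; omega,
    by simp [h40, hE.v10, hE.v36, ← hid, ← hρd]; omega,
    by simp [h40]; omega,
    by simp [h40, hE.v10, ← hid, ← hρd]; omega, by simp [h40, hE.v10, ← hid, ← hρd]; omega,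
    by simp [h40, hE.v10, ← hkd]; omega, ?_⟩
  set σ₁ := RamState.setVar _ 45 _ with hσ₁
  have v1 : ∀ x, x < 41 ∨ 45 < x → σ₁.var x = σ.var x := fun x hx => by
    have i1 : x ≠ 41 := by omega
    have i2 : x ≠ 42 := by omega
    have i3 : x ≠ 43 := by omega
    have i4 : x ≠ 44 := by omega
    have i5 : x ≠ 45 := by omega
    simp [hσ₁, i1, i2, i3, i4, i5]
  have v41 : σ₁.var 41 = X e := by simp [hσ₁, h40, hE.a10]
  have v42 : σ₁.var 42 = i := by simp [hσ₁, h40, hE.v10, hid]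
  have v43 : σ₁.var 43 = k := by simp [hσ₁, h40, hE.v10, hkd]
  have v44 : σ₁.var 44 = ρ := by simp [hσ₁, h40, hE.v10, ← hid, hρd]
  have v45 : σ₁.var 45 = σ.arr 21 k := by simp [hσ₁, h40, hE.v10, ← hkd]
  have a40 : σ₁.arr 40 = Function.update (σ.arr 40) (σ.var 60 + (ρ * N + κ)) 1 := by
    simp [hσ₁, h40, hE.v10, hE.v17, ← hid, ← hρd, ← hkd, ← hκd]
  have a19 : σ₁.arr 19 = Function.update (σ.arr 19) (ρ * s + σ.arr 24 ρ) e := by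
    simp [hσ₁, h40, hE.v10, hE.v36, ← hid, ← hρd]
  have a24 : σ₁.arr 24 = Function.update (σ.arr 24) ρ (σ.arr 24 ρ + 1) := by
    simp [hσ₁, h40, hE.v10, ← hid, ← hρd]
  have ao : ∀ b, b ≠ 40 → b ≠ 19 → b ≠ 24 → σ₁.arr b = σ.arr b := fun b h1 h2 h3 => by
    simp [hσ₁, h1, h2, h3]
  have hE₁ : SweepEnv n s N M B X Y σ₁ := hE.agree (v := 41) (a := 19) (by norm_num) (by norm_num)
    ⟨fun x hx => v1 x (Or.inl hx), fun b hb => ao b (by omega) (by omega) (by omega)⟩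
  refine wp_forLoop (v := 46) (a := 30) (fun c σ' τ' => (∀ b, b ≠ 30 → σ'.arr b = σ₁.arr b) ∧
      (∀ y < n * n, σ'.arr 30 y ≤ σ.arr 30 y) ∧
      (∀ i' < n, ∀ j < n, σ'.arr 30 (i' * n + j) = σ.arr 30 (i' * n + j) ∨
        i' = i ∧ σ'.arr 30 (i' * n + j) = X e ∧ Y (k * n + j) ≤ X e) ∧
      (∀ c' < c, σ'.arr 30 (i * n + σ.arr 18 (k * s + c')) ≤ X e) ∧
      (∀ x, x ≠ 46 → x ≠ 47 → σ'.var x = σ₁.var x) ∧ τ' ≤ τ + 60 + 40 * c)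
    (σ.arr 21 k) (by simp [RamProg.Above]) le_rfl (by norm_num) v45 (by omega) h1W ?_ ?_ ?_
  · refine ⟨fun b _ => rfl, fun y _ => ?_, fun i' _ j _ => Or.inl ?_, by simp, fun x h1 _ => by simp [h1], by simp⟩
    · simp only [RamState.arr_setVar, ao 30 (by norm_num) (by norm_num) (by norm_num)]; exact le_rfl
    · simp only [RamState.arr_setVar, ao 30 (by norm_num) (by norm_num) (by norm_num)]
  · rintro c hc σ' τ' hx hag ⟨j1, j2, j3, j4, jv, j5⟩
    have hE' := hE₁.agree (by norm_num) (by norm_num) hag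
    have e42 : σ'.var 42 = i := by rw [hag.1 42 (by norm_num), v42]
    have e43 : σ'.var 43 = k := by rw [hag.1 43 (by norm_num), v43]
    have e41 : σ'.var 41 = X e := by rw [hag.1 41 (by norm_num), v41]
    have e18 : σ'.arr 18 = σ.arr 18 := by
      rw [j1 18 (by norm_num), ao 18 (by norm_num) (by norm_num) (by norm_num)]
    obtain ⟨hjn, hjY⟩ := hS.lst k hk c hc
    simp only [sweepOf] at hjn hjY
    set j := σ.arr 18 (k * s + c) with hjd
    have hz := flat_lt hi hjn
    have hzM := (j2 _ hz).trans (hS.zle _ hz)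
    have hmin : σ'.arr 30 (i * n + j) - (σ'.arr 30 (i * n + j) - X e) =
      min (σ'.arr 30 (i * n + j)) (X e) := by omega
    simp only [wp_seq, wp_assign, wp_write]
    refine ⟨by simp [e42, e43, hE'.v10, hE'.v36, hx, e18, ← hjd]; omega,
      by simp [e42, e43, hE'.v10, hE'.v36, hx, e18, ← hjd]; omega,
      by simp [e42, e43, e41, hE'.v10, hE'.v36, hx, e18, ← hjd]; omega, ?_⟩
    have a30 : ∀ v, ((((σ'.setVar 47 ((RamExpr.var 42 * RamExpr.var 10 + RamExpr.read 18
        (RamExpr.var 43 * RamExpr.var 36 + RamExpr.var 46)).eval σ')).setArr 30 (i * n + j)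
        v).setVar 46 (c + 1)).arr 30) = Function.update (σ'.arr 30) (i * n + j) v := by simp
    simp only [RamExpr.eval_var, RamExpr.eval_sub, RamExpr.eval_read, RamExpr.eval_add,
      RamExpr.eval_mul, e42, e43, e41, hE'.v10, hE'.v36, hx, e18, ← hjd, RamState.var_setVar,
      RamState.arr_setVar, RamState.arr_setArr, if_true, RamState.var_setArr,
      show (41 : ℕ) ≠ 47 by norm_num, show (46 : ℕ) ≠ 47 by norm_num, if_false, hmin]
    refine ⟨trivial, fun b hb => by rw [if_neg hb, j1 b hb], fun y hy => ?_, fun i' hi' j' hj' => ?_,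
      fun c' hc' => ?_, fun x h1 h2 => by simp [h1, h2, jv], by simp; omega⟩
    · rw [Function.update_apply]; split_ifs with heq
      · rw [heq]; exact (min_le_left _ _).trans (j2 _ hz)
      · exact j2 y hy
    · rw [Function.update_apply]; split_ifs with heq
      · obtain ⟨hii, hjj⟩ := flat_inj hj' hjn heq
        rw [hii, hjj]
        rcases min_choice (σ'.arr 30 (i * n + j)) (X e) with hm | hm
        · rw [hm]; exact j3 i hi j hjn
        · rw [hm]; exact Or.inr ⟨rfl, rfl, hjY.trans hcur⟩
      · exact j3 i' hi' j' hj'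
    · rw [Function.update_apply]; split_ifs with heq
      · exact min_le_right _ _
      · by_cases hcc : c' = c
        · rw [hcc] at heq; exact absurd rfl heq
        · exact j4 c' (by omega)
  · rintro σ₂ τ₂ - ag₂ ⟨j1, j2, j3, j4, jv, j5⟩
    have hE₂ := hE₁.agree (by norm_num) (by norm_num) ag₂
    have w42 : σ₂.var 42 = i := by rw [ag₂.1 42 (by norm_num), v42]
    have w44 : σ₂.var 44 = ρ := by rw [ag₂.1 44 (by norm_num), v44]
    have b24 : σ₂.arr 24 = Function.update (σ.arr 24) ρ (σ.arr 24 ρ + 1) := by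
      rw [j1 24 (by norm_num), a24]
    have bo : ∀ b, b ≠ 40 → b ≠ 19 → b ≠ 24 → b ≠ 30 → σ₂.arr b = σ.arr b :=
      fun b h1 h2 h3 h4 => by rw [j1 b h4, ao b h1 h2 h3]
    have b40 : σ₂.arr 40 = Function.update (σ.arr 40) (σ.var 60 + (ρ * N + κ)) 1 := by
      rw [j1 40 (by norm_num), a40]
    have b19 : σ₂.arr 19 = Function.update (σ.arr 19) (ρ * s + σ.arr 24 ρ) e := by
      rw [j1 19 (by norm_num), a19]
    have hag60 : ∀ x, x < 40 ∨ 60 ≤ x → σ₂.var x = σ.var x := fun x hx => by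
      rw [jv x (by omega) (by omega), v1 x (by omega)]
    have w41 : σ₂.var 41 = X e := by rw [jv 41 (by norm_num) (by norm_num), v41]
    have w60 := hag60 60 (by norm_num)
    have w61 := hag60 61 (by norm_num)
    have w21 := bo 21 (by norm_num) (by norm_num) (by norm_num) (by norm_num)
    have w22 := bo 22 (by norm_num) (by norm_num) (by norm_num) (by norm_num)
    have w31 := bo 31 (by norm_num) (by norm_num) (by norm_num) (by norm_num)
    have w25 := bo 25 (by norm_num) (by norm_num) (by norm_num) (by norm_num)
    have hρκo : ∀ y, y ≠ σ.var 60 + (ρ * N + κ) → σ₂.arr 40 y = σ.arr 40 y := fun y hy => by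
      rw [b40, Function.update_of_ne hy]
    have hsw : Sweep n s N M X Y done' (sweepOf σ₂) := by
      have := (hS.advance (c := X e) hcur).addX (m1 := fun y => σ₂.arr 40 (σ.var 60 + y))
        (Ent := σ₂.arr 19) (Fil := σ₂.arr 24) (Z := σ₂.arr 30) he hsc.le rfl
        (by simp only [sweepOf, ← hid, ← hρd]; exact hf) hY hdone
        (by simp only [sweepOf, ← hid, ← hkd, ← hρd, ← hκd, b40, Function.update_self])
        (fun y _ hne => by
          simp only [sweepOf, ← hid, ← hkd, ← hρd, ← hκd] at hne ⊢
          exact hρκo _ (by omega))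
        (by simp only [sweepOf, ← hid, ← hρd, b19])
        (by simp only [sweepOf, ← hid, ← hρd, b24])
        j2 (by simp only [sweepOf, ← hid, ← hkd]; exact j3)
        (by simp only [sweepOf, ← hid, ← hkd]; exact j4)
      convert this using 1
      simp only [sweepOf, w41, w60, w61, w21, w22, w31, w25,
        bo 18 (by norm_num) (by norm_num) (by norm_num) (by norm_num),
        bo 23 (by norm_num) (by norm_num) (by norm_num) (by norm_num),
        bo 41 (by norm_num) (by norm_num) (by norm_num) (by norm_num)]
    have hreg : Region N B σ₂ := ⟨fun a y hy => by
        by_cases ha : a = 0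
        · subst ha; rw [hρκo y (by omega)]; exact h.region.beyond 0 y (by omega)
        · rw [bo _ (by omega) (by omega) (by omega) (by omega)]
          exact h.region.beyond a y (by omega),
      fun a y hy hc => by
        rw [w60]
        by_cases ha : a = 0
        · subst ha; rw [hρκo _ (by omega)]; exact h.region.inside 0 y hy hc
        · rw [bo _ (by omega) (by omega) (by omega) (by omega)]
          exact h.region.inside a y hy hc⟩
    rw [wp_ite]
    refine ⟨by simp [w44, b24, hE₂.v36, h1W]; omega, fun hlt => ?_, fun hge => ?_⟩
    · simp [w44, b24, hE₂.v36] at hlt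
      rw [wp_skip]
      refine ⟨⟨hE₂, hsw, hreg, ?_, fun i' hi' => ?_, ?_, ?_, ?_⟩, w41, fun x hx => hag60 x (by omega),
        w60, by omega, bo 13 (by norm_num) (by norm_num) (by norm_num) (by norm_num), w31, ?_,
        by omega, ?_⟩
      · rw [w21]; exact h.lft_lt
      · rw [w22, b24, Function.update_apply]; split_ifs
        · exact hlt
        · exact h.fil_lt i' hi'
      · rw [w61]; exact h.le_sc
      · rw [w31]; exact h.flg
      · rw [w41]; exact hXe
      · simp only [slotLoad, sweepOf, w61, w21, w22, b24, hload]
        omega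
      · have := Nat.mul_le_mul_left 40 hl.le
        simp; omega
    · simp [w44, b24, hE₂.v36] at hge
      have hfull : σ.arr 24 ρ + 1 = s := by omega
      simp only [wp_seq, wp_write, wp_assign]
      refine ⟨by simp [w42]; omega, by simp [w61]; omega, by simp [w61]; omega, by simp [w42]; omega,
        by simp [w61]; omega, ?_⟩
      set σ₃ := RamState.setVar _ 61 _ with hσ₃
      have x61 : σ₃.var 61 = σ.var 61 + 1 := by simp [hσ₃, w61]
      have xv : ∀ x, x ≠ 61 → σ₃.var x = σ₂.var x := fun x hx => by simp [hσ₃, hx]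
      have xa : ∀ b, b ≠ 22 → b ≠ 25 → σ₃.arr b = σ₂.arr b := fun b h1 h2 => by
        simp [hσ₃, h1, h2]
      have x22 : σ₃.arr 22 = Function.update (σ₂.arr 22) i (σ₂.var 61) := by
        simp [hσ₃, w42]
      have x25 : σ₃.arr 25 = Function.update (σ₂.arr 25) (σ₂.var 61) i := by
        simp [hσ₃, w42]
      have x60 : σ₃.var 60 = σ.var 60 := by rw [xv 60 (by norm_num), w60]
      have x41 : σ₃.var 41 = X e := by rw [xv 41 (by norm_num), w41]
      have x21 : σ₃.arr 21 = σ.arr 21 := by rw [xa 21 (by norm_num) (by norm_num), w21]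
      have x24 : σ₃.arr 24 = σ₂.arr 24 := xa 24 (by norm_num) (by norm_num)
      have x31 : σ₃.arr 31 = σ.arr 31 := by rw [xa 31 (by norm_num) (by norm_num), w31]
      have hfresh : σ₂.arr 24 (σ.var 61) = 0 := by
        rw [b24, Function.update_of_ne (by omega)]
        exact hS.fil_fresh _ hsc le_rfl
      have hsw₃ : Sweep n s N M X Y done' (sweepOf σ₃) := by
        have := hsw.allocX (Rsl := σ₃.arr 22) (Row := σ₃.arr 25) hi
          (by simp only [sweepOf, w61]; exact hsc) x22 x25
        convert this using 1
        simp only [sweepOf, x61, w61, xv 41 (by norm_num), xv 60 (by norm_num),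
          xa 18 (by norm_num) (by norm_num), xa 19 (by norm_num) (by norm_num),
          xa 21 (by norm_num) (by norm_num), xa 23 (by norm_num) (by norm_num),
          xa 24 (by norm_num) (by norm_num), xa 30 (by norm_num) (by norm_num),
          xa 31 (by norm_num) (by norm_num), xa 40 (by norm_num) (by norm_num),
          xa 41 (by norm_num) (by norm_num)]
      refine ⟨⟨hE₂.agree (v := 61) (a := 22) (by norm_num) (by norm_num)
          ⟨fun x hx => xv x (by omega), fun b hb => xa b (by omega) (by omega)⟩, hsw₃,
          ⟨fun a y hy => ?_, fun a y hy hc => ?_⟩, ?_, fun i' hi' => ?_, ?_, ?_, ?_⟩, x41,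
        fun x hx => ?_, x60, by omega, ?_, x31, ?_, by omega, ?_⟩
      · rw [xa _ (by omega) (by omega)]; exact hreg.beyond a y (by omega)
      · rw [xa _ (by omega) (by omega), x60]
        have := hreg.inside a y hy hc; rwa [w60] at this
      · rw [x21]; exact h.lft_lt
      · rw [x24, x22, Function.update_apply, w61, w22]
        split_ifs with heq
        · rw [hfresh]; omega
        · rw [b24, Function.update_of_ne]
          · exact h.fil_lt i' hi'
          · intro hc
            have h1 := (hS.rsl i' hi').2
            simp only [sweepOf] at h1
            exact heq (by rw [← h1, hc, hrow])
      · rw [x61]; exact h.le_sc.trans (Nat.le_succ _)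
      · rw [x31]; exact h.flg
      · rw [x41]; exact hXe
      · rw [xv x (by omega)]; exact hag60 x (by omega)
      · rw [xa 13 (by norm_num) (by norm_num)]
        exact bo 13 (by norm_num) (by norm_num) (by norm_num) (by norm_num)
      · -- Closing a full slot of `s` entries pays for the new slot.
        have h2 : ∑ i' ∈ Finset.range n, σ₃.arr 24 (σ₃.arr 22 i') + s =
            ∑ i' ∈ Finset.range n, σ₂.arr 24 (σ.arr 22 i') := by
          have := Finset.sum_add_eq_of_bump (f := fun i' => σ₂.arr 24 (σ.arr 22 i'))
            (g := fun i' => σ₃.arr 24 (σ₃.arr 22 i')) (Finset.mem_range.2 hi)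
            (fun j _ hj => by
              simp only [x24, x22, w22]; rw [Function.update_of_ne hj])
          have i1 : σ₃.arr 24 (σ₃.arr 22 i) = 0 := by
            rw [x24, x22, Function.update_self, w61, hfresh]
          have i2 : σ₂.arr 24 (σ.arr 22 i) = s := by
            rw [← hρd, b24, Function.update_self, hfull]
          simp only [i1, i2] at this
          omega
        have h3 : s * (σ.var 61 + 1 - n) = s * (σ.var 61 - n) + s := by
          rw [Nat.succ_sub h.le_sc, Nat.mul_succ]
        have h4 : ∑ i' ∈ Finset.range n, σ₂.arr 24 (σ.arr 22 i') =
            ∑ i' ∈ Finset.range n, σ.arr 24 (σ.arr 22 i') + 1 := by rw [b24, hload]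
        simp only [slotLoad, sweepOf, x61, x21, h3]
        omega
      · have := Nat.mul_le_mul_left 40 hl.le
        simp; omega

end

open RamExpr in
/-- Process the event of index `var 37`; if no slot is left afterwards, multiply and start over with
new slots. -/
def eventProg (P : RamProg) : RamProg :=
  .assign 40 (read 13 (var 37)) ;;
  .ite ((var 40).less (var 16)) eventYProg (.assign 40 (var 40 - var 16) ;; eventXProg) ;;
  .ite ((var 61).less (var 17)) .skip (flushProg P ;; .ite (var 63) .skip openProg)

theorem eventYProg_above : eventYProg.Above 40 18 := by
  simp [eventYProg, allocYProg, RamProg.Above, mapLoop_above]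

theorem eventXProg_above : eventXProg.Above 40 18 := by
  simp [eventXProg, RamProg.Above, forLoop_above]

theorem eventProg_above (P : RamProg) : (eventProg P).Above 40 18 :=
  ⟨by simp [RamProg.Above], ⟨eventYProg_above, by simp [RamProg.Above],
    eventXProg_above⟩, trivial,
    (flushProg_above P).mono (by norm_num) (by norm_num), trivial,
    openProg_above.mono (by norm_num) (by norm_num)⟩

/-- The first `p` events have been processed. -/
def Before (ord : ℕ → ℕ) (p e : ℕ) : Prop := ∃ p' < p, ord p' = e

/-- The part of the state of the sweep that survives an abortion. The number `cl` counts the slot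
generations that have been used up, and `b₀` is the base address at the start. -/
structure Tracking (n s N M B W T κ : ℕ) (X Y : ℕ → ℕ) (b₀ p cl : ℕ) (σ : RamState) : Prop where
  env : SweepEnv n s N M B X Y σ
  budget : σ.var 38 = n * n * s
  beyond : ∀ a y, σ.var 60 + B ≤ y → σ.arr (a + 40) y = 0
  base : σ.var 60 ≤ b₀ + (cl + 1) * B
  gens : s * (n * cl) ≤ p
  count_le : σ.var 62 ≤ cl * (T + N * N)
  count_le' : σ.var 62 ≤ n * n * s + (T + N * N)
  flg : ∀ y < n * n, σ.arr 31 y < W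

/-- The sweep before the event of index `p`, if it has not been aborted. In the bound of the time, `κ`
is charged for each unit of the step counter. -/
structure Running (n s N M B W T κ : ℕ) (X Y ord : ℕ → ℕ) (b₀ τ₀ p cl : ℕ) (σ : RamState)
    (τ : ℕ) : Prop extends Tracking n s N M B W T κ X Y b₀ p cl σ where
  order : σ.arr 13 = ord
  live : σ.var 63 = 0
  ready : Ready n s N M B W X Y (Before ord p) σ
  space : σ.var 61 < N
  load : s * (n * cl) + slotLoad n s (sweepOf σ) ≤ p
  cur_key : ∀ p', p ≤ p' → p' < 2 * (n * n) → 2 * σ.var 41 ≤ eventKey (n * n) X Y (ord p')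
  time : τ ≤ τ₀ + 200 * (s + 1) * p + κ * σ.var 62 + 60 * (s * marks (n * n) (σ.arr 31)) +
    60 * (n * (σ.var 61 - n))

/-- The sweep has been aborted, since the budget was exceeded. -/
structure Aborted (n s N M B W T κ : ℕ) (X Y : ℕ → ℕ) (b₀ τ₀ p cl : ℕ) (σ : RamState)
    (τ : ℕ) : Prop extends Tracking n s N M B W T κ X Y b₀ p cl σ where
  dead : σ.var 63 = 1
  exceeded : n * n * s < σ.var 62
  time : τ ≤ τ₀ + 200 * (s + 1) * p + κ * σ.var 62 + 60 * (s * marks (n * n) (σ.arr 31)) +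
    60 * (n * n)

section
variable {n s N M B W T κ : ℕ} {X Y ord : ℕ → ℕ} {σ : RamState} {τ b₀ τ₀ p cl : ℕ}

theorem Ready.setVar {done : ℕ → Prop} (h : Ready n s N M B W X Y done σ) (v : ℕ) :
    Ready n s N M B W X Y done (σ.setVar 37 v) := by
  have hvar : ∀ x, x ≠ 37 → (σ.setVar 37 v).var x = σ.var x := fun x hx => by simp [hx]
  have hsw : sweepOf (σ.setVar 37 v) = sweepOf σ := by simp [sweepOf]
  exact ⟨h.env.agree (v := 37) (a := 13) le_rfl (by norm_num)
      ⟨fun x hx => hvar x (by omega), fun _ _ => rfl⟩, by rw [hsw]; exact h.sweep,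
    ⟨by rw [hvar 60 (by norm_num)]; exact h.region.beyond,
      by rw [hvar 60 (by norm_num)]; exact h.region.inside⟩, h.lft_lt, h.fil_lt,
    by rw [hvar 61 (by norm_num)]; exact h.le_sc, h.flg, by rw [hvar 41 (by norm_num)]; exact h.cur_le⟩

theorem Tracking.setVar (h : Tracking n s N M B W T κ X Y b₀ p cl σ) (v : ℕ) :
    Tracking n s N M B W T κ X Y b₀ p cl (σ.setVar 37 v) := by
  have hvar : ∀ x, x ≠ 37 → (σ.setVar 37 v).var x = σ.var x := fun x hx => by simp [hx]
  exact ⟨h.env.agree (v := 37) (a := 13) le_rfl (by norm_num)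
      ⟨fun x hx => hvar x (by omega), fun _ _ => rfl⟩, by rw [hvar 38 (by norm_num)]; exact h.budget,
    by rw [hvar 60 (by norm_num)]; exact h.beyond, by rw [hvar 60 (by norm_num)]; exact h.base,
    h.gens, by rw [hvar 62 (by norm_num)]; exact h.count_le,
    by rw [hvar 62 (by norm_num)]; exact h.count_le', h.flg⟩

theorem Running.setVar (h : Running n s N M B W T κ X Y ord b₀ τ₀ p cl σ τ) (v : ℕ) {τ' : ℕ}
    (hτ : τ' ≤ τ) : Running n s N M B W T κ X Y ord b₀ τ₀ p cl (σ.setVar 37 v) τ' := by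
  have hvar : ∀ x, x ≠ 37 → (σ.setVar 37 v).var x = σ.var x := fun x hx => by simp [hx]
  have hsw : sweepOf (σ.setVar 37 v) = sweepOf σ := by simp [sweepOf]
  exact ⟨h.toTracking.setVar v, h.order, by rw [hvar 63 (by norm_num)]; exact h.live,
    h.ready.setVar v, by rw [hvar 61 (by norm_num)]; exact h.space, by rw [hsw]; exact h.load,
    by rw [hvar 41 (by norm_num)]; exact h.cur_key,
    by rw [hvar 61 (by norm_num), hvar 62 (by norm_num)]; exact hτ.trans h.time⟩

theorem Aborted.setVar (h : Aborted n s N M B W T κ X Y b₀ τ₀ p cl σ τ) (v : ℕ) {τ' : ℕ}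
    (hτ : τ' ≤ τ) : Aborted n s N M B W T κ X Y b₀ τ₀ p cl (σ.setVar 37 v) τ' := by
  have hvar : ∀ x, x ≠ 37 → (σ.setVar 37 v).var x = σ.var x := fun x hx => by simp [hx]
  exact ⟨h.toTracking.setVar v, by rw [hvar 63 (by norm_num)]; exact h.dead,
    by rw [hvar 62 (by norm_num)]; exact h.exceeded,
    by rw [hvar 62 (by norm_num)]; exact hτ.trans h.time⟩

/-- One event of the sweep. The time is charged to the event itself, to the step counter, to the new
marks, and to the new slots, as laid down in `Running`. -/
theorem wp_eventProg {P : RamProg} (hP : Multiplies P N B T)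
    (hκ : productCost P + 330 ≤ κ)
    (h : Running n s N M B W T κ X Y ord b₀ τ₀ p cl σ τ) (hN : N = 2 * n) (hs : 0 < s)
    (hB : N * N ≤ B) (hp : p < 2 * (n * n)) (h37 : σ.var 37 = p)
    (hord : SortedBy (eventKey (n * n) X Y) (2 * (n * n)) ord)
    (hX : ∀ e < n * n, X e ≤ M) (hY : ∀ e < n * n, Y e ≤ M)
    (hW1 : N * s + s < W) (hW2 : 2 * (n * n) + M + 1 < W) (hW3 : b₀ + (2 * n + 4) * B < W)
    (hW4 : n * n * s + T + N * N + 1 < W) :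
    wp W (eventProg P) (fun σ' τ' => ∃ cl',
      Running n s N M B W T κ X Y ord b₀ τ₀ (p + 1) cl' σ' (τ' + 20) ∨
      Aborted n s N M B W T κ X Y b₀ τ₀ (p + 1) cl' σ' (τ' + 20)) σ (τ + 6) := by
  have hE := h.env
  have hn : 0 < n := Nat.pos_of_ne_zero fun h0 => by subst h0; simp at hp
  have hnn : n ≤ n * n := Nat.le_mul_self n
  have hNN : N * N = 4 * (n * n) := by rw [hN]; ring
  have h1W : 1 < W := by omega
  have hcl : cl ≤ 2 * n := by
    have h1 := h.gens
    have h2 : n * cl ≤ s * (n * cl) := Nat.le_mul_of_pos_left _ hs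
    by_contra hc
    have h3 : n * (2 * n + 1) ≤ n * cl := Nat.mul_le_mul_left _ (by omega)
    have h4 : n * (2 * n + 1) = 2 * (n * n) + n := by ring
    omega
  have hbase : σ.var 60 + 3 * B < W := by
    have h1 := h.base
    have h2 : (cl + 1) * B ≤ (2 * n + 1) * B := Nat.mul_le_mul_right _ (by omega)
    have h3 : (2 * n + 4) * B = (2 * n + 1) * B + 3 * B := by ring
    omega
  have h62 : σ.var 62 < W := by have := h.count_le'; omega
  set e₀ := ord p with he₀
  have he : e₀ < 2 * (n * n) := hord.lt p hp
  set key := eventKey (n * n) X Y with hkey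
  have hmono : ∀ e, Before ord (p + 1) e → key e ≤ key e₀ := by
    rintro e ⟨p', hp', rfl⟩; exact hord.mono p' p (by omega) hp
  have hnew : ∀ e, Before ord (p + 1) e → Before ord p e ∨ e = e₀ := by
    rintro e ⟨p', hp', rfl⟩
    by_cases hq : p' = p
    · right; rw [hq]
    · left; exact ⟨p', by omega, rfl⟩
  have hkeyY : ∀ e < n * n, key e = 2 * Y e := fun e h => by simp [hkey, eventKey, h]
  have hkeyX : ∀ e, n * n ≤ e → key e = 2 * X (e - n * n) + 1 := fun e h => by
    simp [hkey, eventKey, Nat.not_lt.2 h]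
  have hcur : 2 * σ.var 41 ≤ key e₀ := h.cur_key p le_rfl hp
  rw [eventProg, wp_seq, wp_assign]
  refine ⟨by simp [h37, h.order, ← he₀]; omega, ?_⟩
  rw [wp_seq]
  set σ₁ := σ.setVar 40 ((RamExpr.read 13 (RamExpr.var 37)).eval σ) with hσ₁
  have v40 : σ₁.var 40 = e₀ := by simp [hσ₁, h37, h.order, he₀]
  have v1 : ∀ x, x ≠ 40 → σ₁.var x = σ.var x := fun x hx => by simp [hσ₁, hx]
  have ready_of : ∀ σ₂ : RamState, (∀ x, x ≠ 40 → σ₂.var x = σ.var x) → σ₂.arr = σ.arr →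
      Ready n s N M B W X Y (Before ord p) σ₂ := fun σ₂ hv ha => by
    have hw : sweepOf σ₂ = sweepOf σ := by
      simp only [sweepOf, ha, hv 60 (by norm_num), hv 61 (by norm_num), hv 41 (by norm_num)]
    exact ⟨hE.agree (v := 40) (a := 12) (by norm_num) le_rfl ⟨fun x hx => hv x (by omega),
        fun b _ => by rw [ha]⟩, by rw [hw]; exact h.ready.sweep,
      ⟨by rw [hv 60 (by norm_num), ha]; exact h.ready.region.beyond,
        by rw [hv 60 (by norm_num), ha]; exact h.ready.region.inside⟩,
      by rw [ha]; exact h.ready.lft_lt, by rw [ha]; exact h.ready.fil_lt,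
      by rw [hv 61 (by norm_num)]; exact h.ready.le_sc, by rw [ha]; exact h.ready.flg,
      by rw [hv 41 (by norm_num)]; exact h.ready.cur_le⟩
  have load_of : ∀ σ₂ : RamState, (∀ x, x ≠ 40 → σ₂.var x = σ.var x) → σ₂.arr = σ.arr →
      slotLoad n s (sweepOf σ₂) = slotLoad n s (sweepOf σ) := fun σ₂ hv ha => by
    simp only [slotLoad, sweepOf, ha, hv 61 (by norm_num)]
  -- Both kinds of events lead to the same kind of state.
  suffices hmid : wp W (.ite ((RamExpr.var 40).less (RamExpr.var 16)) eventYProg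
      (.assign 40 (RamExpr.var 40 - RamExpr.var 16) ;; eventXProg)) (fun σ' τ' =>
      Ready n s N M B W X Y (Before ord (p + 1)) σ' ∧ 2 * σ'.var 41 ≤ key e₀ ∧
      key e₀ ≤ 2 * σ'.var 41 + 1 ∧
      (∀ x, x < 40 ∨ 62 ≤ x → σ'.var x = σ.var x) ∧ σ'.var 60 = σ.var 60 ∧ σ'.var 61 ≤ N ∧
      σ'.arr 13 = σ.arr 13 ∧ σ'.arr 31 = σ.arr 31 ∧
      slotLoad n s (sweepOf σ') ≤ slotLoad n s (sweepOf σ) + 1 ∧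
      σ.var 61 ≤ σ'.var 61 ∧
      τ' ≤ τ + 120 + 40 * s + 60 * (n * (σ'.var 61 - σ.var 61))) σ₁
      (τ + 6 + ((RamExpr.read 13 (RamExpr.var 37)).cost + 1)) by
    refine hmid.mono ?_
    rintro σ₂ τ₂ ⟨r2, c2, c2', v2, b2, s2, o2, f2, l2, m2, t2⟩
    have hcur2 : ∀ p', p + 1 ≤ p' → p' < 2 * (n * n) → 2 * σ₂.var 41 ≤ key (ord p') :=
      fun p' h1 h2 => c2.trans (hord.mono p p' (by omega) h2)
    have hload := h.load
    have htime := h.time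
    have hgens := h.gens
    have w62 := v2 62 (by norm_num)
    have w63 := v2 63 (by norm_num)
    have w38 := v2 38 (by norm_num)
    have hcount := h.count_le
    have hcount' := h.count_le'
    rw [wp_ite]
    have hp200 : 200 * (s + 1) * (p + 1) = 200 * (s + 1) * p + 200 * s + 200 := by ring
    have hsub : n * (σ₂.var 61 - n) = n * (σ₂.var 61 - σ.var 61) + n * (σ.var 61 - n) := by
      have := h.ready.le_sc
      rw [← Nat.mul_add]; congr 1; omega
    have hEv2 := r2.env
    refine ⟨by simp [hEv2.v17, h1W]; omega, fun hlt => ?_, fun hge => ?_⟩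
    · simp [hEv2.v17] at hlt
      rw [wp_skip]
      refine ⟨cl, Or.inl ⟨⟨hEv2, by rw [w38]; exact h.budget, r2.region.beyond,
        by rw [b2]; exact h.base, hgens.trans (by omega), by rw [w62]; exact hcount,
        by rw [w62]; exact hcount', r2.flg⟩, by rw [o2]; exact h.order, by rw [w63]; exact h.live,
        r2, hlt, by omega, hcur2, ?_⟩⟩
      rw [w62, f2, hp200, hsub]
      simp
      omega
    · simp [hEv2.v17] at hge
      have hfull : σ₂.var 61 = N := by omega
      have hgen : s * (n * (cl + 1)) ≤ p + 1 := by
        have h1 : s * (σ₂.var 61 - n) ≤ slotLoad n s (sweepOf σ₂) := by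
          simp only [slotLoad, sweepOf]; omega
        have h2 : s * (n * (cl + 1)) = s * (n * cl) + s * n := by ring
        have h3 : σ₂.var 61 - n = n := by omega
        rw [h3] at h1
        omega
      have hmulc : (cl + 1) * (T + N * N) = cl * (T + N * N) + (T + N * N) := by ring
      rw [wp_seq]
      refine (wp_flushProg hP hEv2 r2.sweep r2.region hn (by omega) hB (by rw [w63]; exact h.live)
        hX hY r2.flg hW1 (by omega) (by omega) (by rw [w38, h.budget]; omega)
        (by rw [w62]; exact h62)).frame (flushProg_above P) ?_
      rintro σ₃ τ₃ ag3 ⟨E3, be3, b3, c3, f3, h3⟩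
      have o3 : σ₃.arr 13 = ord := by rw [ag3.2 13 (by norm_num), o2, h.order]
      have w3 : σ₃.var 38 = n * n * s := by rw [ag3.1 38 (by norm_num), w38, h.budget]
      have hb3 : σ₃.var 60 = σ.var 60 := by rw [b3, b2]
      rw [w38, w62, h.budget, f2] at h3
      have hx60 : n * (σ₂.var 61 - n) = n * n := by congr 1; omega
      rw [wp_ite]
      rcases h3 with ⟨a1, a2, a3, a4, a5⟩ | ⟨a1, a2, a3, a4, a5, a6⟩
      · refine ⟨by rw [RamExpr.fits_var, a2]; exact h1W, fun _ => ?_, fun h0 => ?_⟩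
        · rw [wp_skip]
          refine ⟨cl, Or.inr ⟨⟨E3, w3, fun a y hy => be3 a y (by rw [b2]; rw [hb3] at hy; exact hy),
            by rw [hb3]; exact h.base,
            hgens.trans (by omega), by rw [a3]; exact hcount, by rw [a3]; exact hcount', f3⟩,
            a2, by rw [a3]; exact a1, ?_⟩⟩
          rw [a3, a4, hp200]
          simp at a5 ⊢
          omega
        · simp [a2] at h0
      · refine ⟨by rw [RamExpr.fits_var, a2]; omega, fun h0 => absurd a2 h0, fun _ => ?_⟩
        have hbe3 : ∀ a y, σ₃.var 60 + B ≤ y → σ₃.arr (a + 40) y = 0 := fun a y hy =>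
          be3 a y (by rw [b2]; rw [hb3] at hy; exact hy)
        refine (wp_openProg E3 a5 hbe3 hn hs (by omega) hB (fun k hk j hj hd => ?_) hY ?_ (by omega)
          (by rw [hb3]; omega)).frame openProg_above ?_
        · have h1 := hmono _ hd
          rw [hkeyY _ (flat_lt hk hj)] at h1
          rw [c3]; omega
        · rw [c3]; exact r2.cur_le
        rintro σ₄ τ₄ ag4 ⟨E4, S4, R4, z24, z21, z22, x61, x60, x41, x62, x63, x31, t4⟩
        have hl0 : slotLoad n s (sweepOf σ₄) = 0 := by
          have h1 : ∑ i ∈ Finset.range n, σ₄.arr 24 (σ₄.arr 22 i) = 0 :=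
            Finset.sum_eq_zero fun i hi => by
              have hi' := Finset.mem_range.1 hi
              rw [z22 i hi', z24 i (by omega)]
          have h2 : ∑ k ∈ Finset.range n, σ₄.arr 21 k = 0 :=
            Finset.sum_eq_zero fun k hk => z21 k (Finset.mem_range.1 hk)
          simp only [slotLoad, sweepOf, x61, h1, h2, Nat.sub_self, Nat.mul_zero]
        have hf4 : ∀ y < n * n, σ₄.arr 31 y < W := by rw [x31]; exact f3
        refine ⟨cl + 1, Or.inl ⟨⟨E4, by rw [ag4.1 38 (by norm_num), w3], R4.beyond, ?_, hgen, ?_, ?_,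
          hf4⟩, by rw [ag4.2 13 (by norm_num), o3], by rw [x63, a2], ⟨E4, S4, R4, fun k hk => ?_,
          fun i hi => ?_, x61.ge, hf4, ?_⟩, by omega, by omega, fun p' h1 h2 => ?_, ?_⟩⟩
        · rw [x60, hb3]
          have h1 := h.base
          have h2 : (cl + 1 + 1) * B = (cl + 1) * B + B := by ring
          omega
        · rw [x62, hmulc]; omega
        · rw [x62]; omega
        · rw [z21 k hk]; exact hs
        · rw [z22 i hi, z24 i (by omega)]; exact hs
        · rw [x41, c3]; exact r2.cur_le
        · rw [x41, c3]; exact hcur2 p' h1 h2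
        · rw [x62, x31, x61, hp200]
          obtain ⟨d, rfl⟩ := Nat.exists_eq_add_of_le hκ
          obtain ⟨w, hw⟩ := Nat.exists_eq_add_of_le a3
          rw [hw] at a6 ⊢
          have e1 : (productCost P + 330 + d) * (σ.var 62 + N * N + w) =
              (productCost P + 130) * (σ.var 62 + N * N + w) + (200 + d) * σ.var 62 +
              200 * (N * N) + d * (N * N) + (200 + d) * w := by ring
          have e2 : (productCost P + 330 + d) * σ.var 62 =
            (productCost P + 130) * σ.var 62 + (200 + d) * σ.var 62 := by ring
          rw [e1]
          rw [e2] at htime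
          simp at t2 a6 t4 ⊢
          omega
  have hready1 := ready_of σ₁ v1 rfl
  have hload1 := load_of σ₁ v1 rfl
  have v16 : σ₁.var 16 = n * n := hready1.env.v16
  rw [wp_ite]
  refine ⟨by simp [v40, v16, h1W]; omega, fun hlt => ?_, fun hge => ?_⟩
  · simp [v40, v16] at hlt
    have hk := hkeyY e₀ hlt
    refine (wp_eventYProg hready1 (by omega) hs hB hlt v40 (by rw [v1 61 (by norm_num)]; exact h.space)
      (by rw [v1 41 (by norm_num)]; omega) hY hnew (fun e he' hd => ?_) hW1 (by omega)
      (by rw [v1 60 (by norm_num)]; omega)).mono ?_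
    · have := hmono e hd
      rw [hkeyY e he'] at this
      omega
    · rintro σ₂ τ₂ ⟨r2, c2, v2, b2, s2, o2, f2, l2, m2, t2⟩
      rw [v1 60 (by norm_num)] at b2
      rw [v1 61 (by norm_num)] at m2 t2
      refine ⟨r2, by omega, by omega, fun x hx => by rw [v2 x hx, v1 x (by omega)], b2, s2, o2, f2,
        by omega, m2, ?_⟩
      simp at t2 ⊢
      omega
  · simp [v40, v16] at hge
    have hk := hkeyX e₀ hge
    rw [wp_seq, wp_assign]
    refine ⟨by simp [v40, v16]; omega, ?_⟩
    set σ₂ := σ₁.setVar 40 ((RamExpr.var 40 - RamExpr.var 16).eval σ₁) with hσ₂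
    have u1 : ∀ x, x ≠ 40 → σ₂.var x = σ.var x := fun x hx => by simp [hσ₂, hx, v1 x hx]
    have u40 : σ₂.var 40 = e₀ - n * n := by simp [hσ₂, v40, v16]
    have hready2 := ready_of σ₂ u1 rfl
    have hload2 := load_of σ₂ u1 rfl
    have hel : e₀ - n * n < n * n := by omega
    refine (wp_eventXProg hready2 hB hel u40
      (by rw [u1 61 (by norm_num)]; exact h.space)
      (by rw [u1 41 (by norm_num)]; omega) hX
      (fun e hd => by rw [Nat.add_sub_cancel' hge]; exact hnew e hd)
      (fun j hj hle => ?_) hW1 (by omega)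
      (by rw [u1 60 (by norm_num)]; omega)).mono ?_
    · have hlt' := flat_lt (mod_lt_of_lt_sq hel) hj
      obtain ⟨p', hp', hpe⟩ := hord.surj ((e₀ - n * n) % n * n + j) (by omega)
      refine ⟨p', ?_, hpe⟩
      by_contra hc
      have h1 := hord.mono p p' (by omega) hp'
      rw [hpe, hkeyY _ hlt', ← he₀, hk] at h1
      omega
    · rintro σ₃ τ₃ ⟨r2, c2, v2, b2, s2, o2, f2, l2, m2, t2⟩
      rw [u1 60 (by norm_num)] at b2
      rw [u1 61 (by norm_num)] at m2
      refine ⟨r2, by omega, by omega, fun x hx => by rw [v2 x hx, u1 x (by omega)], b2, s2, o2, f2,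
        by omega, m2, ?_⟩
      simp at t2 ⊢
      omega

end

/-! ### A sweep with a budget -/

open RamExpr in
/-- Sweep over all events with slots of capacity `var 36`, with a budget of `var 36` steps per entry
of the result. If the budget is exceeded, the sweep is abandoned and `var 63` is set. -/
def runProg (P : RamProg) : RamProg :=
  mapLoop 64 16 30 (var 64) (var 18) ;;
  mapLoop 64 16 31 (var 64) (const 0) ;;
  .assign 41 (const 0) ;; .assign 62 (const 0) ;; .assign 63 (const 0) ;;
  .assign 38 (var 16 * var 36) ;;
  openProg ;;
  forLoop 37 20 (.ite (var 63) .skip (eventProg P)) ;;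
  .ite (var 63) .skip (flushProg P)

theorem runProg_above (P : RamProg) : (runProg P).Above 37 18 := by
  have h1 := openProg_above.mono (v' := 37) (a' := 18) (by norm_num) (by norm_num)
  have h2 := (eventProg_above P).mono (v' := 37) (a' := 18) (by norm_num) (by norm_num)
  have h3 := (flushProg_above P).mono (v' := 37) (a' := 18) (by norm_num) (by norm_num)
  simp [runProg, RamProg.Above, mapLoop_above, forLoop_above, h1, h2, h3]

/-- One half of the (min,max)-product of `X` and `Y`: the least `X (i, k)` with `Y (k, j) ≤ X (i, k)`
is an upper bound, and every value below `M` is justified. -/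
structure HalfProduct (n M : ℕ) (X Y Z : ℕ → ℕ) : Prop where
  le : ∀ y < n * n, Z y ≤ M
  sound : ∀ i < n, ∀ j < n, Z (i * n + j) < M →
    ∃ k < n, X (i * n + k) ≤ Z (i * n + j) ∧ Y (k * n + j) ≤ Z (i * n + j)
  complete : ∀ i < n, ∀ k < n, ∀ j < n, Y (k * n + j) ≤ X (i * n + k) →
    Z (i * n + j) ≤ X (i * n + k)

section
variable {n s N M B W T κ : ℕ} {X Y ord : ℕ → ℕ} {σ : RamState} {τ b₀ τ₀ p cl : ℕ}

theorem sweep_time_le {a T q c m : ℕ} (hc : c ≤ a * s + 2 * T + 8 * a) (hm : m ≤ a) :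
    200 * (s + 1) * (2 * a) + (q + 330) * c + 60 * (s * m) + 900 * a ≤
      (8 * q + 6000) * (a * (s + 1) + T) := by
  have i1 := Nat.mul_le_mul_left (q + 330) hc
  have i2 := Nat.mul_le_mul_left s hm
  have e1 : (q + 330) * (a * s + 2 * T + 8 * a) = q * (a * s) + 2 * (q * T) + 8 * (q * a) +
    330 * (a * s) + 660 * T + 2640 * a := by ring
  have e2 : (8 * q + 6000) * (a * (s + 1) + T) = 8 * (q * (a * s)) + 8 * (q * a) + 8 * (q * T) +
    6000 * (a * s) + 6000 * a + 6000 * T := by ring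
  have e3 : 200 * (s + 1) * (2 * a) = 400 * (a * s) + 400 * a := by ring
  rw [mul_comm s a] at i2
  omega

/-- A sweep with capacity `s` succeeds or exceeds its budget, within the same time. The number `cl` of
batches of slots is at most `2 * n / s` in both cases. -/
theorem wp_runProg {P : RamProg} (hP : Multiplies P N B T) (hE : SweepEnv n s N M B X Y σ)
    (hR : ∀ a y, σ.var 60 + B ≤ y → σ.arr (a + 40) y = 0)
    (hn : 0 < n) (hN : N = 2 * n) (hs : 0 < s) (hB : N * N ≤ B)
    (h13 : σ.arr 13 = ord) (hord : SortedBy (eventKey (n * n) X Y) (2 * (n * n)) ord)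
    (hX : ∀ e < n * n, X e ≤ M) (hY : ∀ e < n * n, Y e ≤ M)
    (hW1 : N * s + s < W) (hW2 : 2 * (n * n) + M + 1 < W) (hW3 : σ.var 60 + (2 * n + 4) * B < W)
    (hW4 : n * n * s + T + N * N + 1 < W) :
    wp W (runProg P) (fun σ' τ' =>
      (∀ a y, σ'.var 60 + B ≤ y → σ'.arr (a + 40) y = 0) ∧
      (∃ cl, s * (n * cl) ≤ 2 * (n * n) ∧ σ'.var 60 ≤ σ.var 60 + (cl + 1) * B ∧
        (σ'.var 63 = 0 ∧ HalfProduct n M X Y (σ'.arr 30) ∨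
          σ'.var 63 = 1 ∧ n * n * s < cl * (T + N * N))) ∧
      τ' ≤ τ + (8 * productCost P + 6000) * (n * n * (s + 1) + T)) σ τ := by
  have hnn : n ≤ n * n := Nat.le_mul_self n
  have hn2 : 0 < n * n := Nat.mul_pos hn hn
  have hNN : N * N = 4 * (n * n) := by rw [hN]; ring
  have h1W : 1 < W := by omega
  set b₀ := σ.var 60 with hb₀
  set κ := productCost P + 330 with hκ
  have h4B : (2 * n + 4) * B = 2 * n * B + 4 * B := by ring
  rw [runProg, wp_seq]
  refine wp_mapLoop (n * n) id (fun _ => M) (by simp [hE.v16]) (by norm_num) (by omega) h1W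
    (fun _ _ _ _ h => h) (fun i hi σ' h1 h2 h3 h4 h5 => by
      simp [h1, h2, hE.v18]; omega) ?_
  intro σ₁ τ₁ v1 _ a1 b1 _ t1
  rw [wp_seq]
  refine wp_mapLoop (n * n) id (fun _ => 0) (by simp [v1, hE.v16]) (by norm_num) (by omega) h1W
    (fun _ _ _ _ h => h) (fun i hi σ' h1 h2 h3 h4 h5 => by simp [h1]; omega) ?_
  intro σ₂ τ₂ v2 _ a2 b2 _ t2
  have hE2 : SweepEnv n s N M B X Y σ₂ := hE.agree (v := 64) (a := 30) (by norm_num) (by norm_num)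
    ⟨fun x hx => by rw [v2 x (by omega), v1 x (by omega)],
      fun b hb => by rw [a2 b (by omega), a1 b (by omega)]⟩
  simp only [wp_seq, wp_assign]
  refine ⟨by simp; omega, by simp; omega, by simp; omega, by simp [hE2.v16, hE2.v36]; omega, ?_⟩
  set σ₃ := RamState.setVar _ 38 _ with hσ₃
  have v3 : ∀ x, x < 37 ∨ x = 60 → σ₃.var x = σ.var x := fun x hx => by
    have i1 : x ≠ 38 := by omega
    have i2 : x ≠ 41 := by omega
    have i3 : x ≠ 62 := by omega
    have i4 : x ≠ 63 := by omega
    simp [hσ₃, i1, i2, i3, i4, v2 x (by omega), v1 x (by omega)]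
  have a3 : ∀ b, b ≠ 30 → b ≠ 31 → σ₃.arr b = σ.arr b := fun b h1 h2 => by
    simp [hσ₃, a2 b h2, a1 b h1]
  have w38 : σ₃.var 38 = n * n * s := by simp [hσ₃, hE2.v16, hE2.v36]
  have w41 : σ₃.var 41 = 0 := by simp [hσ₃]
  have w62 : σ₃.var 62 = 0 := by simp [hσ₃]
  have w63 : σ₃.var 63 = 0 := by simp [hσ₃]
  have hZ : ∀ y < n * n, σ₃.arr 30 y = M := fun y hy => by
    simp only [hσ₃, RamState.arr_setVar]
    rw [a2 30 (by norm_num)]; exact b1 y hy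
  have hF : ∀ y < n * n, σ₃.arr 31 y = 0 := fun y hy => by
    simp only [hσ₃, RamState.arr_setVar]; exact b2 y hy
  have hE3 : SweepEnv n s N M B X Y σ₃ := hE.agree (v := 37) (a := 30) (by norm_num) (by norm_num)
    ⟨fun x hx => v3 x (Or.inl hx), fun b hb => a3 b (by omega) (by omega)⟩
  have hb3 : σ₃.var 60 = b₀ := v3 60 (Or.inr rfl)
  have hS3 : Settled n M X Y (Before ord 0) (sweepOf σ₃) :=
    ⟨fun y hy => (hZ y hy).le, fun i hi j hj h => absurd (hZ _ (flat_lt hi hj)) h.ne,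
      fun e _ ⟨p', hp', _⟩ => absurd hp' (Nat.not_lt_zero _),
      fun i hi j hj h => absurd (hF _ (flat_lt hi hj)) h⟩
  have hR3 : ∀ a y, σ₃.var 60 + B ≤ y → σ₃.arr (a + 40) y = 0 := fun a y hy => by
    rw [a3 _ (by omega) (by omega)]; exact hR a y (by rw [hb3] at hy; exact hy)
  have hmark : marks (n * n) (σ₃.arr 31) = 0 :=
    Finset.sum_eq_zero fun y hy => by rw [hF y (Finset.mem_range.1 hy)]; rfl
  refine (wp_openProg hE3 hS3 hR3 hn hs (by omega) hB
    (fun k hk j hj ⟨p', hp', _⟩ => absurd hp' (Nat.not_lt_zero _)) hY (by omega) (by omega)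
    (by rw [hb3]; omega)).frame openProg_above ?_
  rintro σ₄ τ₄ ag4 ⟨E4, S4, R4, z24, z21, z22, x61, x60, x41, x62, x63, x31, t4⟩
  have hl0 : slotLoad n s (sweepOf σ₄) = 0 := by
    have h1 : ∑ i ∈ Finset.range n, σ₄.arr 24 (σ₄.arr 22 i) = 0 :=
      Finset.sum_eq_zero fun i hi => by
        have hi' := Finset.mem_range.1 hi
        rw [z22 i hi', z24 i (by omega)]
    have h2 : ∑ k ∈ Finset.range n, σ₄.arr 21 k = 0 :=
      Finset.sum_eq_zero fun k hk => z21 k (Finset.mem_range.1 hk)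
    simp only [slotLoad, sweepOf, x61, h1, h2, Nat.sub_self, Nat.mul_zero]
  have hf4 : ∀ y < n * n, σ₄.arr 31 y < W := fun y hy => by rw [x31, hF y hy]; omega
  have h24 : σ₄.var 20 = 2 * (n * n) := E4.v20
  rw [wp_seq]
  refine wp_forLoop (v := 37) (a := 13) (fun p σ' τ' => ∃ cl,
      Running n s N M B W T κ X Y ord b₀ (τ₄ + 6) p cl σ' τ' ∨
      Aborted n s N M B W T κ X Y b₀ (τ₄ + 6) p cl σ' τ')
    (2 * (n * n)) ?_ le_rfl (by norm_num) h24 (by omega) h1W ?_ ?_ ?_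
  · exact ⟨trivial, (eventProg_above P).mono (by norm_num) (by norm_num)⟩
  · refine ⟨0, Or.inl (Running.setVar ⟨⟨E4, by rw [ag4.1 38 (by norm_num), w38], R4.beyond,
      by rw [x60, hb3]; omega, by simp, by rw [x62, w62]; omega, by rw [x62, w62]; omega, hf4⟩,
      by rw [ag4.2 13 (by norm_num), a3 13 (by norm_num) (by norm_num), h13], by rw [x63, w63],
      ⟨E4, S4, R4, fun k hk => ?_, fun i hi => ?_, x61.ge, hf4, ?_⟩, by omega, by rw [hl0]; simp,
      fun p' _ _ => ?_, ?_⟩ 0 le_rfl)⟩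
    · rw [z21 k hk]; exact hs
    · rw [z22 i hi, z24 i (by omega)]; exact hs
    · omega
    · rw [x41, w41]; omega
    · omega
  · rintro p hp σ' τ' hx37 ag' ⟨cl, h | h⟩
    · rw [wp_ite]
      have hl := h.live
      refine ⟨by rw [RamExpr.fits_var, hl]; omega, fun h0 => absurd hl h0, fun _ => ?_⟩
      refine (wp_eventProg hP (by omega) h hN hs hB hp hx37 hord hX hY hW1 hW2 (by omega)
        hW4).frame (eventProg_above P) ?_
      rintro σ'' τ'' ag'' ⟨cl', h' | h'⟩
      · exact ⟨by rw [ag''.1 37 (by norm_num), hx37], cl', Or.inl (h'.setVar _ (by omega))⟩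
      · exact ⟨by rw [ag''.1 37 (by norm_num), hx37], cl', Or.inr (h'.setVar _ (by omega))⟩
    · rw [wp_ite]
      have hl := h.dead
      refine ⟨by rw [RamExpr.fits_var, hl]; omega, fun _ => ?_, fun h0 => by simp [hl] at h0⟩
      rw [wp_skip]
      refine ⟨hx37, cl, Or.inr (Aborted.setVar (τ := τ' + 20) { h with
        gens := h.gens.trans (Nat.le_succ _), time := ?_ } _ (by simp))⟩
      have := h.time
      have e1 : 200 * (s + 1) * (p + 1) = 200 * (s + 1) * p + 200 * s + 200 := by ring
      rw [e1]; omega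
  · have fin : ∀ c m, c ≤ n * n * s + (T + N * N) + (T + N * N) → m ≤ n * n →
        200 * (s + 1) * (2 * (n * n)) + κ * c + 60 * (s * m) + 900 * (n * n) ≤
          (8 * productCost P + 6000) * (n * n * (s + 1) + T) := fun c m hc hm => by
      rw [hκ]; exact sweep_time_le (by omega) hm
    rintro σ₅ τ₅ hx37 ag5 ⟨cl, h | h⟩
    · have hl := h.live
      have E5 := h.env
      rw [wp_ite]
      refine ⟨by rw [RamExpr.fits_var, hl]; omega, fun h0 => absurd hl h0, fun _ => ?_⟩
      have hcl : (cl + 1) * B ≤ (2 * n + 1) * B := by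
        refine Nat.mul_le_mul_right _ ?_
        have h1 := h.gens
        have h2 : n * cl ≤ s * (n * cl) := Nat.le_mul_of_pos_left _ hs
        by_contra hc
        have h3 : n * (2 * n + 1) ≤ n * cl := Nat.mul_le_mul_left _ (by omega)
        have h4 : n * (2 * n + 1) = 2 * (n * n) + n := by ring
        omega
      have hb5 := h.base
      have hcount := h.count_le
      have hcount' := h.count_le'
      have htime := h.time
      have hsp := h.space
      have hmul : (2 * n + 1) * B = 2 * n * B + B := by ring
      refine (wp_flushProg hP E5 h.ready.sweep h.ready.region hn (by omega) hB hl hX hY h.flg hW1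
        (by omega) (by omega) (by rw [h.budget]; omega) (by omega)).mono ?_
      rintro σ₆ τ₆ ⟨E6, be6, b6, c6, f6, h6⟩
      rw [h.budget] at h6
      have hx : n * (σ₅.var 61 - n) ≤ n * n := Nat.mul_le_mul_left _ (by omega)
      refine ⟨fun a y hy => be6 a y (by rwa [b6] at hy), ⟨cl, h.gens, by rw [b6]; exact hb5, ?_⟩, ?_⟩
      · rcases h6 with ⟨i1, i2, i3, i4, i5⟩ | ⟨i1, i2, i3, i4, i5, i6⟩
        · exact Or.inr ⟨i2, i1.trans_le hcount⟩
        · refine Or.inl ⟨i2, i5.zle, i5.sound, fun i hi k hk j hj hle => ?_⟩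
          have hik := flat_lt hi hk
          obtain ⟨p', hp', hpe⟩ := hord.surj (n * n + (i * n + k)) (by omega)
          have := i5.complete (i * n + k) hik ⟨p', hp', hpe⟩ j hj
          rw [flat_mod hk, flat_div hk] at this
          exact this hle
      · rcases h6 with ⟨i1, i2, i3, i4, i5⟩ | ⟨i1, i2, i3, i4, i5, i6⟩
        · have := fin (σ₅.var 62) _ (by omega) (marks_le (n * n) (σ₅.arr 31))
          simp at t1 t2 t4 i5 htime
          omega
        · have := fin (σ₆.var 62) _ (by omega) (marks_le (n * n) (σ₆.arr 31))
          have e1 : ∀ c, κ * c = (productCost P + 130) * c + 200 * c := fun c => by rw [hκ]; ring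
          have e2 := e1 (σ₅.var 62)
          have e3 := e1 (σ₆.var 62)
          simp at t1 t2 t4 i6 htime
          omega
    · have hl := h.dead
      rw [wp_ite]
      refine ⟨by rw [RamExpr.fits_var, hl]; omega, fun _ => ?_, fun h0 => by simp [hl] at h0⟩
      rw [wp_skip]
      have htime := h.time
      refine ⟨h.beyond, ⟨cl, h.gens, h.base, Or.inr ⟨hl, h.exceeded.trans_le h.count_le⟩⟩, ?_⟩
      have := fin (σ₅.var 62) _ (by have := h.count_le'; omega) (marks_le (n * n) (σ₅.arr 31))
      simp at t1 t2 t4 htime ⊢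
      omega

end

/-! ### Half products -/

/-- The program writes only to variables `< v` and to arrays `< a`. -/
def RamProg.Below (v a : ℕ) : RamProg → Prop
  | .skip => True
  | .assign x _ => x < v
  | .write b _ _ => b < a
  | .seq p q => p.Below v a ∧ q.Below v a
  | .ite _ p q => p.Below v a ∧ q.Below v a
  | .loop _ p => p.Below v a

theorem RamExec.unchanged {W : ℕ} {p : RamProg} {σ σ' : RamState} {t v a : ℕ}
    (h : RamExec W p σ t σ') (hp : p.Below v a) :
    (∀ x, v ≤ x → σ'.var x = σ.var x) ∧ ∀ b, a ≤ b → σ'.arr b = σ.arr b := by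
  induction h with
  | skip => exact ⟨fun _ _ => rfl, fun _ _ => rfl⟩
  | assign x e σ he =>
    refine ⟨fun y hy => ?_, fun _ _ => rfl⟩
    have : y ≠ x := fun h => absurd hp (not_lt.2 (h ▸ hy))
    simp [this]
  | write b i e σ hi he =>
    refine ⟨fun _ _ => rfl, fun y hy => ?_⟩
    have : y ≠ b := fun h => absurd hp (not_lt.2 (h ▸ hy))
    simp [this]
  | seq _ _ _ _ _ _ _ _ _ ih₁ ih₂ =>
    exact ⟨fun x hx => ((ih₂ hp.2).1 x hx).trans ((ih₁ hp.1).1 x hx),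
      fun x hx => ((ih₂ hp.2).2 x hx).trans ((ih₁ hp.1).2 x hx)⟩
  | iteTrue _ _ _ _ _ _ _ _ _ ih => exact ih hp.1
  | iteFalse _ _ _ _ _ _ _ _ _ ih => exact ih hp.2
  | loopTrue _ _ _ _ _ _ _ _ _ _ _ ih₁ ih₂ =>
    exact ⟨fun x hx => ((ih₂ hp).1 x hx).trans ((ih₁ hp).1 x hx),
      fun x hx => ((ih₂ hp).2 x hx).trans ((ih₁ hp).2 x hx)⟩
  | loopFalse => exact ⟨fun _ _ => rfl, fun _ _ => rfl⟩

theorem wp.frame_above {W : ℕ} {p : RamProg} {Q Q' : RamState → ℕ → Prop} {σ : RamState}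
    {τ v a : ℕ} (h : wp W p Q σ τ) (hp : p.Below v a)
    (hQ : ∀ σ' τ', (∀ x, v ≤ x → σ'.var x = σ.var x) → (∀ b, a ≤ b → σ'.arr b = σ.arr b) →
      Q σ' τ' → Q' σ' τ') : wp W p Q' σ τ :=
  let ⟨t, σ', h₁, h₂⟩ := h
  ⟨t, σ', h₁, hQ _ _ (h₁.unchanged hp).1 (h₁.unchanged hp).2 h₂⟩

theorem sortProg_below : sortProg.Below 36 16 := by
  simp [sortProg, mapLoop, forLoop, RamProg.Below]

open RamExpr in
/-- Half of the (min,max)-product of the arrays `10` and `11`, into array `30`. The right capacity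
of the slots depends on the running time of `P`; it is found by doubling. -/
def halfProg (P : RamProg) : RamProg :=
  sortProg ;; .assign 36 (const 1) ;; runProg P ;;
  .loop (var 63) (.assign 36 (var 36 + var 36) ;; runProg P)

theorem halfProg_above (P : RamProg) : (halfProg P).Above 30 12 := by
  have h1 := (runProg_above P).mono (v' := 30) (a' := 12) (by norm_num) (by norm_num)
  simp [halfProg, RamProg.Above, h1, sortProg_above]

section
variable {n s N M B W T F R : ℕ} {X Y : ℕ → ℕ} {σ : RamState} {τ : ℕ}

/-- With the budget exceeded, the capacity was small: at most `2 * n / s` products were computed. -/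
theorem capacity_lt {cl D : ℕ} (hn : 0 < n) (hs : 0 < s) (h1 : s * (n * cl) ≤ 2 * (n * n))
    (h2 : n * n * s < cl * D) : n * (s * s) < 2 * D := by
  have h3 : s * cl ≤ 2 * n := by
    refine Nat.le_of_mul_le_mul_left ?_ hn
    calc n * (s * cl) = s * (n * cl) := by ring
      _ ≤ 2 * (n * n) := h1
      _ = n * (2 * n) := by ring
  have h4 : n * (n * (s * s)) < n * (2 * D) := by
    calc n * (n * (s * s)) = (n * n * s) * s := by ring
      _ < cl * D * s := Nat.mul_lt_mul_of_pos_right h2 hs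
      _ = (s * cl) * D := by ring
      _ ≤ 2 * n * D := Nat.mul_le_mul_right _ h3
      _ = n * (2 * D) := by ring
  exact Nat.lt_of_mul_lt_mul_left h4

/-- The bound `F` plays the role of `n ^ ((3 + ω) / 2)`. A capacity of `2 ^ J` that is reached by doubling
a capacity which was too small, in the sense of `capacity_lt`, is affordable. -/
theorem capacity_cost {J : ℕ} (hF : n * n * n * (8 * (T + 4 * (n * n))) ≤ F * F)
    (hF' : n * n ≤ F) (hJ : J = 0 ∨ n * 4 ^ J < 8 * (T + 4 * (n * n))) : n * n * 2 ^ J ≤ F := by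
  rcases hJ with rfl | hJ
  · simpa using hF'
  · refine Nat.mul_self_le_mul_self_iff.1 (le_trans ?_ hF)
    calc n * n * 2 ^ J * (n * n * 2 ^ J) = n * n * n * (n * 4 ^ J) := by
          rw [show (4 : ℕ) = 2 * 2 by norm_num, mul_pow]; ring
      _ ≤ _ := Nat.mul_le_mul_left _ hJ.le

/-- The half product, for all matrices with entries `≤ M`. At most `R` doublings lead to a capacity for
which the sweep is within its budget, and each attempt takes time `O(F)`. -/
theorem wp_halfProg {P : RamProg} (hP : Multiplies P N B T) (hE : SweepEnv n s N M B X Y σ)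
    (h21 : σ.var 21 = 2 * M + 2)
    (hR : ∀ a y, σ.var 60 + B ≤ y → σ.arr (a + 40) y = 0)
    (hn : 0 < n) (hN : N = 2 * n) (hB : N * N ≤ B)
    (hX : ∀ e < n * n, X e ≤ M) (hY : ∀ e < n * n, Y e ≤ M)
    (hF : n * n * n * (8 * (T + 4 * (n * n))) ≤ F * F) (hF' : n * n ≤ F) (hFT : T ≤ F)
    (hRT : 8 * (T + 4 * (n * n)) ≤ 2 ^ R)
    (hW0 : (2 * M + 2) * (2 * (n * n)) + 2 * M + 2 * (n * n) + 3 < W)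
    (hW1 : (N + n * n + 2) * (8 * (T + 4 * (n * n)) + 1) < W)
    (hW3 : σ.var 60 + (R + 2) * ((2 * n + 4) * B) < W) :
    wp W (halfProg P) (fun σ' τ' =>
      (∀ a y, σ'.var 60 + B ≤ y → σ'.arr (a + 40) y = 0) ∧
      σ'.var 60 ≤ σ.var 60 + (R + 1) * ((2 * n + 4) * B) ∧ HalfProduct n M X Y (σ'.arr 30) ∧
      τ' ≤ τ + 200 * (M + 1) + 5 * (8 * productCost P + 6000) * ((R + 1) * F)) σ τ := by
  have hn2 : 0 < n * n := Nat.mul_pos hn hn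
  have hnn : n ≤ n * n := Nat.le_mul_self n
  have hNN : N * N = 4 * (n * n) := by rw [hN]; ring
  set S := 8 * (T + 4 * (n * n)) with hS
  set b₀ := σ.var 60 with hb₀
  set G := (2 * n + 4) * B with hG
  set Q := 8 * productCost P + 6000 with hQ
  have hS0 : 0 < S := by omega
  have hR1 : 0 < R := Nat.pos_of_ne_zero fun h0 => by subst h0; simp at hRT; omega
  have hpow : ∀ J, J = 0 ∨ n * 4 ^ J < S → 2 ^ J ≤ S ∧ J < R := by
    rintro J (rfl | hJ)
    · exact ⟨hS0, hR1⟩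
    · have h1 : 2 ^ J ≤ n * 4 ^ J :=
        (Nat.pow_le_pow_left (by norm_num) J).trans (Nat.le_mul_of_pos_left _ hn)
      exact ⟨by omega, (Nat.pow_lt_pow_iff_right (by norm_num : 1 < 2)).1 (by omega)⟩
  have hWs : ∀ s, s ≤ S → N * s + s < W ∧ n * n * s + T + N * N + 1 < W := fun s hs => by
    have h1 : N * s ≤ N * S := Nat.mul_le_mul_left _ hs
    have h2 : n * n * s ≤ n * n * S := Nat.mul_le_mul_left _ hs
    have h3 : (N + n * n + 2) * (S + 1) = N * S + n * n * S + 2 * S + N + n * n + 2 := by ring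
    have h4 := Nat.zero_le (n * n * S)
    have h5 := Nat.zero_le (N * S)
    constructor <;> omega
  have h1W : 1 < W := by omega
  have hbase : ∀ J b, J < R → b ≤ b₀ + J * G → b + G < W := fun J b hJ hb => by
    have h1 : J * G ≤ R * G := Nat.mul_le_mul_right _ hJ.le
    have h2 : (R + 2) * G = R * G + 2 * G := by ring
    omega
  rw [halfProg, wp_seq]
  refine ((wp_sortProg hE.v16 hE.v20 h21 (by rw [hE.a10]; exact hX) (by rw [hE.a11]; exact hY)
    hW0).frame_above (Q' := fun σ' τ' => ((∀ x, 36 ≤ x → σ'.var x = σ.var x) ∧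
      ∀ b, 16 ≤ b → σ'.arr b = σ.arr b) ∧ _) sortProg_below
    (fun _ _ h1 h2 h3 => ⟨⟨h1, h2⟩, h3⟩)).frame sortProg_above ?_
  rintro σ₁ τ₁ ag1 ⟨⟨u1, u2⟩, hord, t1⟩
  rw [hE.a10, hE.a11] at hord
  simp only [wp_seq, wp_assign]
  refine ⟨by simp; omega, ?_⟩
  set σ₂ := σ₁.setVar 36 ((RamExpr.const 1).eval σ₁) with hσ₂
  set ord := σ₁.arr 13 with hordd
  have env_of : ∀ (s' s'' : ℕ) (σ' : RamState), SweepEnv n s' N M B X Y σ' →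
      SweepEnv n s'' N M B X Y (σ'.setVar 36 s'') := fun s' s'' σ' h => by
    exact ⟨by simp [h.v10], by simp [h.v16], by simp [h.v17], by simp [h.v18], by simp [h.v19],
      by simp [h.v20], by simp, h.a10, h.a11⟩
  have hE1 : SweepEnv n (σ₁.var 36) N M B X Y σ₁ :=
    ⟨by rw [ag1.1 10 (by norm_num), hE.v10], by rw [ag1.1 16 (by norm_num), hE.v16],
      by rw [ag1.1 17 (by norm_num), hE.v17], by rw [ag1.1 18 (by norm_num), hE.v18],
      by rw [ag1.1 19 (by norm_num), hE.v19], by rw [ag1.1 20 (by norm_num), hE.v20], rfl,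
      by rw [ag1.2 10 (by norm_num), hE.a10], by rw [ag1.2 11 (by norm_num), hE.a11]⟩
  have hb2 : σ₂.var 60 = b₀ := by simp [hσ₂, u1, hb₀]
  have hE2 : SweepEnv n 1 N M B X Y σ₂ := env_of _ 1 _ hE1
  have hR2 : ∀ a y, σ₂.var 60 + B ≤ y → σ₂.arr (a + 40) y = 0 := fun a y hy => by
    rw [hb2] at hy
    simp only [hσ₂, RamState.arr_setVar]
    rw [u2 _ (by omega)]
    exact hR a y hy
  -- The effect of one run, with the growth of the base address bounded uniformly.
  have run : ∀ (s' : ℕ) (σ' : RamState) (τ' b : ℕ), 0 < s' → s' ≤ S →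
      SweepEnv n s' N M B X Y σ' → σ'.arr 13 = ord →
      (∀ a y, σ'.var 60 + B ≤ y → σ'.arr (a + 40) y = 0) → σ'.var 60 ≤ b → b + G < W →
      wp W (runProg P) (fun σ'' τ'' => SweepEnv n s' N M B X Y σ'' ∧ σ''.arr 13 = ord ∧
        (∀ a y, σ''.var 60 + B ≤ y → σ''.arr (a + 40) y = 0) ∧ σ''.var 60 ≤ b + G ∧
        (σ''.var 63 = 0 ∧ HalfProduct n M X Y (σ''.arr 30) ∨
          σ''.var 63 = 1 ∧ n * (s' * s') < 2 * (T + N * N)) ∧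
        τ'' ≤ τ' + Q * (n * n * (s' + 1) + T)) σ' τ' := by
    intro s' σ' τ' b h1 h2 h3 h4 h5 h6 h7
    obtain ⟨w1, w2⟩ := hWs s' h2
    have ag13 : ∀ σ'', Agree 37 13 σ' σ'' → σ''.var 36 = s' := fun σ'' ag => by
      rw [ag.1 36 (by norm_num), h3.v36]
    have hGe : (2 * n + 4) * B = 2 * n * B + 4 * B := by ring
    refine (wp_runProg hP h3 h5 hn hN h1 hB h4 hord hX hY w1 (by omega) (by omega) w2).frame
      (runProg_above P) ?_
    rintro σ'' τ'' ag ⟨r1, ⟨cl, r2, r3, r4⟩, r5⟩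
    refine ⟨h3.agree (v := 37) (a := 18) le_rfl (by norm_num) ag, by rw [ag.2 13 (by norm_num), h4],
      r1, ?_, ?_, r5⟩
    · have k1 : n * cl ≤ s' * (n * cl) := Nat.le_mul_of_pos_left _ h1
      have k2 : cl ≤ 2 * n := by
        by_contra hc
        have k3 : n * (2 * n + 1) ≤ n * cl := Nat.mul_le_mul_left _ (by omega)
        have k4 : n * (2 * n + 1) = 2 * (n * n) + n := by ring
        omega
      have k5 : (cl + 1) * B ≤ (2 * n + 1) * B := Nat.mul_le_mul_right _ (by omega)
      have k6 : (2 * n + 1) * B = 2 * n * B + B := by ring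
      omega
    · exact r4.imp_right fun h => ⟨h.1, capacity_lt hn h1 r2 h.2⟩
  have hsq : ∀ J : ℕ, 2 ^ J * 2 ^ J = 4 ^ J := fun J => by
    rw [← mul_pow]; norm_num
  refine (run 1 σ₂ _ b₀ one_pos hS0 hE2 (by simp [hσ₂, hordd]) hR2 hb2.le
    (hbase 0 b₀ hR1 (by omega))).mono ?_
  rintro σ₃ τ₃ ⟨E3, o3, be3, b3, r3, t3⟩
  refine wp_loop (v := 36) (a := 18) (fun σ' τ' => ∃ J, SweepEnv n (2 ^ J) N M B X Y σ' ∧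
      σ'.arr 13 = ord ∧ (∀ a y, σ'.var 60 + B ≤ y → σ'.arr (a + 40) y = 0) ∧
      σ'.var 60 ≤ b₀ + (J + 1) * G ∧ (J = 0 ∨ n * 4 ^ J < S) ∧
      (σ'.var 63 = 0 ∧ HalfProduct n M X Y (σ'.arr 30) ∨
        σ'.var 63 = 1 ∧ n * 4 ^ J < 2 * (T + N * N)) ∧
      τ' ≤ τ + 10 + 200 * (n * n + M + 1) + Q * (2 * (n * n * 2 ^ J) + (J + 1) * (n * n + T)) +
        10 * J) (fun σ' => 2 * S - σ'.var 36) ?_ ?_ ?_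
  · exact ⟨by simp [RamProg.Above], (runProg_above P).mono (by norm_num) le_rfl⟩
  · refine ⟨0, E3, o3, be3, by omega, Or.inl rfl, by simpa using r3, ?_⟩
    simp at t3 ⊢
    have e1 : Q * (2 * (n * n) + (n * n + T)) = Q * (n * n * 2 + T) + Q * (n * n) := by ring
    rw [e1]
    simp at t3 ⊢
    omega
  · rintro σ' τ' ag ⟨J, E, o, be, b, hJ, hr, t⟩
    have hJ' := hpow J hJ
    refine ⟨?_, fun hne => ?_, fun h0 => ?_⟩
    · rw [RamExpr.fits_var]; rcases hr with hr | hr <;> omega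
    · rcases hr with hr | ⟨hr1, hr2⟩
      · simp [hr.1] at hne
      · have hJn : n * 4 ^ (J + 1) < S := by
          rw [show n * 4 ^ (J + 1) = 4 * (n * 4 ^ J) by rw [pow_succ]; ring]; omega
        have hJ1 := hpow (J + 1) (Or.inr hJn)
        have hp2 : 2 ^ J + 2 ^ J = 2 ^ (J + 1) := by rw [pow_succ]; ring
        have hSW := (hWs S le_rfl).1
        rw [wp_seq, wp_assign]
        refine ⟨by simp [E.v36]; omega, ?_⟩
        have hev : (RamExpr.var 36 + RamExpr.var 36).eval σ' = 2 ^ (J + 1) := by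
          simp [E.v36, hp2]
        rw [hev]
        have hb' : σ'.var 60 ≤ b₀ + (J + 1) * G := b
        refine (run (2 ^ (J + 1)) _ _ (b₀ + (J + 1) * G) (by positivity) hJ1.1
          (env_of _ (2 ^ (J + 1)) _ E) o be (by simpa using b) (hbase _ _ hJ1.2 le_rfl)).mono ?_
        rintro σ'' τ'' ⟨E', o', be', b', r', t'⟩
        refine ⟨⟨J + 1, E', o', be', ?_, Or.inr hJn, by rw [hsq] at r'; exact r', ?_⟩, ?_⟩
        · have e1 : (J + 1 + 1) * G = (J + 1) * G + G := by ring
          omega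
        · have e1 : Q * (2 * (n * n * 2 ^ (J + 1)) + (J + 1 + 1) * (n * n + T)) =
              Q * (2 * (n * n * 2 ^ J) + (J + 1) * (n * n + T)) +
              Q * (n * n * (2 ^ (J + 1) + 1) + T) := by rw [← hp2]; ring
          rw [e1]
          simp at t' t ⊢
          omega
        · rw [E'.v36, E.v36]
          have := Nat.one_le_two_pow (n := J)
          omega
    · simp at h0
      rcases hr with ⟨hr1, hr2⟩ | hr
      · refine ⟨be, ?_, hr2, ?_⟩
        · have : (J + 1) * G ≤ (R + 1) * G := Nat.mul_le_mul_right _ (by omega)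
          omega
        · have c1 := capacity_cost hF hF' hJ
          have c2 : (J + 1) * (n * n + T) ≤ (R + 1) * (2 * F) :=
            Nat.mul_le_mul (by omega) (by omega)
          have c3 : F ≤ (R + 1) * F := Nat.le_mul_of_pos_left _ (by omega)
          have c4 : Q * (2 * (n * n * 2 ^ J) + (J + 1) * (n * n + T)) ≤ Q * (4 * ((R + 1) * F)) :=
            Nat.mul_le_mul_left _ (by rw [show (R + 1) * (2 * F) = 2 * ((R + 1) * F) by ring] at c2; omega)
          have c5 : R ≤ (R + 1) * F := (Nat.le_succ R).trans (Nat.le_mul_of_pos_right _ (by omega))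
          have c6 : 6000 * ((R + 1) * F) ≤ Q * ((R + 1) * F) := Nat.mul_le_mul_right _ (by omega)
          have e1 : 5 * Q * ((R + 1) * F) = Q * (4 * ((R + 1) * F)) + Q * ((R + 1) * F) := by ring
          rw [e1]
          simp
          omega
      · omega

end

/-! ### The (min,max)-product -/

open RamExpr in
/-- The index of the transposed entry. -/
def transposed : RamExpr := var 27 % var 10 * var 10 + var 27 / var 10

open RamExpr in
/-- The (min,max)-product of the two matrices at the addresses `var 22` and `var 23` of array `2`;
the result is written to address `var 24`. -/
def minMaxProg (P : RamProg) : RamProg :=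
  mapLoop 27 16 10 (var 27) (read 2 (var 22 + var 27)) ;;
  mapLoop 27 16 11 (var 27) (read 2 (var 23 + var 27)) ;;
  halfProg P ;;
  mapLoop 27 16 2 (var 24 + var 27) (read 30 (var 27)) ;;
  mapLoop 27 16 10 (var 27) (read 2 (var 23 + transposed)) ;;
  mapLoop 27 16 11 (var 27) (read 2 (var 22 + transposed)) ;;
  halfProg P ;;
  mapLoop 27 16 2 (var 24 + var 27)
    (read 2 (var 24 + var 27) - (read 2 (var 24 + var 27) - read 30 transposed))

/-- The (min,max)-product `Z` of `L` and `R`, where values are cut off at `M`. -/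
structure MinMaxProduct (n M : ℕ) (L R Z : ℕ → ℕ) : Prop where
  le : ∀ y < n * n, Z y ≤ M
  sound : ∀ i < n, ∀ j < n, Z (i * n + j) < M →
    ∃ k < n, L (i * n + k) ≤ Z (i * n + j) ∧ R (k * n + j) ≤ Z (i * n + j)
  complete : ∀ i < n, ∀ k < n, ∀ j < n, Z (i * n + j) ≤ max (L (i * n + k)) (R (k * n + j))

/-- A (min,max)-product is the minimum of two half products. -/
theorem MinMaxProduct.of_half {n M : ℕ} {L R Lt Rt Z Z₁ Z₂ : ℕ → ℕ}
    (hLt : ∀ i < n, ∀ k < n, Lt (k * n + i) = L (i * n + k))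
    (hRt : ∀ k < n, ∀ j < n, Rt (j * n + k) = R (k * n + j))
    (h₁ : HalfProduct n M L R Z₁) (h₂ : HalfProduct n M Rt Lt Z₂)
    (hZ : ∀ i < n, ∀ j < n, Z (i * n + j) = min (Z₁ (i * n + j)) (Z₂ (j * n + i))) :
    MinMaxProduct n M L R Z where
  le y hy := by
    have h := hZ (y / n) (div_lt_of_lt_sq hy) (y % n) (mod_lt_of_lt_sq hy)
    have e : y / n * n + y % n = y := by rw [mul_comm]; exact Nat.div_add_mod y n
    rw [e] at h
    exact (h.le.trans (min_le_left _ _)).trans (h₁.le y hy)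
  sound i hi j hj h := by
    rw [hZ i hi j hj] at h ⊢
    rcases min_choice (Z₁ (i * n + j)) (Z₂ (j * n + i)) with hm | hm
    · rw [hm] at h ⊢; exact h₁.sound i hi j hj h
    · rw [hm] at h ⊢
      obtain ⟨k, hk, h1, h2⟩ := h₂.sound j hj i hi h
      exact ⟨k, hk, by rwa [← hLt i hi k hk], by rwa [← hRt k hk j hj]⟩
  complete i hi k hk j hj := by
    rw [hZ i hi j hj]
    rcases le_total (R (k * n + j)) (L (i * n + k)) with h | h
    · rw [max_eq_left h]; exact (min_le_left _ _).trans (h₁.complete i hi k hk j hj h)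
    · rw [max_eq_right h]
      refine (min_le_right _ _).trans ?_
      rw [← hRt k hk j hj]
      exact h₂.complete j hj k hk i hi (by rwa [hLt i hi k hk, hRt k hk j hj])

/-- The variables that hold the dimensions. -/
structure Dims (n N M B : ℕ) (σ : RamState) : Prop where
  v10 : σ.var 10 = n
  v16 : σ.var 16 = n * n
  v17 : σ.var 17 = N
  v18 : σ.var 18 = M
  v19 : σ.var 19 = B
  v20 : σ.var 20 = 2 * (n * n)
  v21 : σ.var 21 = 2 * M + 2

theorem Dims.agree {n N M B v a : ℕ} {σ σ' : RamState} (h : Dims n N M B σ) (hv : 22 ≤ v)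
    (h' : Agree v a σ σ') : Dims n N M B σ' :=
  ⟨by rw [h'.1 _ (by omega), h.v10], by rw [h'.1 _ (by omega), h.v16],
    by rw [h'.1 _ (by omega), h.v17], by rw [h'.1 _ (by omega), h.v18],
    by rw [h'.1 _ (by omega), h.v19], by rw [h'.1 _ (by omega), h.v20],
    by rw [h'.1 _ (by omega), h.v21]⟩

/-- The hypotheses on the numbers involved in a half product, apart from the base address `b`. -/
structure HalfParams (P : RamProg) (n N M B W T F R : ℕ) : Prop where
  mul : Multiplies P N B T
  pos : 0 < n
  dim : N = 2 * n
  sq_le : N * N ≤ B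
  sq_F : n * n * n * (8 * (T + 4 * (n * n))) ≤ F * F
  le_F : n * n ≤ F
  T_le : T ≤ F
  le_two_pow : 8 * (T + 4 * (n * n)) ≤ 2 ^ R
  sort_lt : (2 * M + 2) * (2 * (n * n)) + 2 * M + 2 * (n * n) + 3 < W
  lt : (N + n * n + 2) * (8 * (T + 4 * (n * n)) + 1) < W

/-- The growth of the base address in a half product. -/
def growth (n B R : ℕ) : ℕ := (R + 2) * ((2 * n + 4) * B)

/-- The time of a half product. -/
def halfTime (P : RamProg) (M F R : ℕ) : ℕ :=
  200 * (M + 1) + 5 * (8 * productCost P + 6000) * ((R + 1) * F)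

section
variable {n N M B W T F R : ℕ} {σ : RamState} {τ o₁ o₂ o₃ : ℕ} {P : RamProg}

theorem HalfParams.wp_halfProg (h : HalfParams P n N M B W T F R) (hD : Dims n N M B σ)
    (hR : ∀ a y, σ.var 60 + B ≤ y → σ.arr (a + 40) y = 0)
    (hX : ∀ e < n * n, σ.arr 10 e ≤ M) (hY : ∀ e < n * n, σ.arr 11 e ≤ M)
    (hW3 : σ.var 60 + growth n B R < W) :
    wp W (halfProg P) (fun σ' τ' => Agree 30 12 σ σ' ∧
      (∀ a y, σ'.var 60 + B ≤ y → σ'.arr (a + 40) y = 0) ∧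
      σ'.var 60 ≤ σ.var 60 + growth n B R ∧
      HalfProduct n M (σ.arr 10) (σ.arr 11) (σ'.arr 30) ∧ τ' ≤ τ + halfTime P M F R) σ τ := by
  refine (_root_.wp_halfProg (s := σ.var 36) h.mul ⟨hD.v10, hD.v16, hD.v17, hD.v18, hD.v19, hD.v20,
    rfl, rfl, rfl⟩ hD.v21 hR h.pos h.dim h.sq_le hX hY h.sq_F h.le_F h.T_le h.le_two_pow h.sort_lt
    h.lt hW3).frame (halfProg_above P) ?_
  rintro σ' τ' ag ⟨h1, h2, h3, h4⟩
  refine ⟨ag, h1, h2.trans ?_, h3, by rw [halfTime]; omega⟩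
  rw [growth]
  exact Nat.add_le_add_left (Nat.mul_le_mul_right _ (by omega)) _

/-- The second half product is that of the transposed matrices in reverse order. The last loop takes the
minimum of both: with truncated subtraction, `a - (a - b)` is `min a b`. -/
theorem wp_minMaxProg (h : HalfParams P n N M B W T F R) (hD : Dims n N M B σ)
    (hR : ∀ a y, σ.var 60 + B ≤ y → σ.arr (a + 40) y = 0)
    (h22 : σ.var 22 = o₁) (h23 : σ.var 23 = o₂) (h24 : σ.var 24 = o₃)
    (hL : ∀ y < n * n, σ.arr 2 (o₁ + y) ≤ M) (hRr : ∀ y < n * n, σ.arr 2 (o₂ + y) ≤ M)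
    (hd₁ : o₁ + n * n ≤ o₃) (hd₂ : o₂ + n * n ≤ o₃)
    (hW : σ.var 60 + 2 * growth n B R < W) (hW3 : o₃ + n * n < W) :
    wp W (minMaxProg P) (fun σ' τ' => (∀ x < 27, σ'.var x = σ.var x) ∧
      (∀ b < 10, b ≠ 2 → σ'.arr b = σ.arr b) ∧
      (∀ y, y < o₃ ∨ o₃ + n * n ≤ y → σ'.arr 2 y = σ.arr 2 y) ∧
      (∀ a y, σ'.var 60 + B ≤ y → σ'.arr (a + 40) y = 0) ∧
      σ'.var 60 ≤ σ.var 60 + 2 * growth n B R ∧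
      MinMaxProduct n M (fun y => σ.arr 2 (o₁ + y)) (fun y => σ.arr 2 (o₂ + y))
        (fun y => σ'.arr 2 (o₃ + y)) ∧
      τ' ≤ τ + 2 * halfTime P M F R + 250 * (n * n)) σ τ := by
  have hn := h.pos
  have hn2 : 0 < n * n := Nat.mul_pos hn hn
  have hnn : n ≤ n * n := Nat.le_mul_self n
  have hsW := h.sort_lt
  have h1W : 1 < W := by omega
  have hM : 2 * M + 2 * (n * n) + 3 < W := by omega
  rw [minMaxProg, wp_seq]
  refine wp_mapLoop (n * n) id (fun y => σ.arr 2 (o₁ + y)) hD.v16 (by norm_num) (by omega) h1W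
    (fun _ _ _ _ h => h) (fun i hi σ' h1 h2 h3 h4 h5 => by
      have := hL i hi
      simp [h1, h2, h3, h22]; omega) ?_
  intro σ₁ τ₁ v1 _ a1 b1 _ t1
  rw [wp_seq]
  refine wp_mapLoop (n * n) id (fun y => σ.arr 2 (o₂ + y)) (by simp [v1, hD.v16]) (by norm_num)
    (by omega) h1W (fun _ _ _ _ h => h) (fun i hi σ' h1 h2 h3 h4 h5 => by
      have := hRr i hi
      simp [h1, h2, h3, v1, a1, h23]; omega) ?_
  intro σ₂ τ₂ v2 _ a2 b2 _ t2
  have v2' : ∀ x, x ≠ 27 → σ₂.var x = σ.var x := fun x hx => by rw [v2 x hx, v1 x hx]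
  have a2' : ∀ b, b ≠ 10 → b ≠ 11 → σ₂.arr b = σ.arr b := fun b h1 h2 => by rw [a2 b h2, a1 b h1]
  have x10 : ∀ y < n * n, σ₂.arr 10 y = σ.arr 2 (o₁ + y) := fun y hy => by
    rw [a2 10 (by norm_num)]; exact b1 y hy
  have x11 : ∀ y < n * n, σ₂.arr 11 y = σ.arr 2 (o₂ + y) := b2
  have b60 : σ₂.var 60 = σ.var 60 := v2' 60 (by norm_num)
  rw [wp_seq]
  refine (h.wp_halfProg (hD.agree (v := 27) (a := 0) (by norm_num)
      ⟨fun x hx => v2' x (by omega), fun b hb => absurd hb (Nat.not_lt_zero _)⟩)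
    (fun a y hy => by rw [a2' _ (by omega) (by omega)]; exact hR a y (by omega))
    (fun e he => by rw [x10 e he]; exact hL e he) (fun e he => by rw [x11 e he]; exact hRr e he)
    (by omega)).mono ?_
  rintro σ₃ τ₃ ⟨ag3, be3, b3, hp3, t3⟩
  have v3 : ∀ x, x < 27 → σ₃.var x = σ.var x := fun x hx => by
    rw [ag3.1 x (by omega), v2' x (by omega)]
  have a3 : ∀ b, b < 10 → σ₃.arr b = σ.arr b := fun b hb => by
    rw [ag3.2 b (by omega), a2' b (by omega) (by omega)]
  have hz3 := hp3.le
  rw [wp_seq]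
  refine wp_mapLoop (n * n) (fun y => o₃ + y) (fun y => σ₃.arr 30 y) (by rw [v3 16 (by norm_num), hD.v16])
    (by norm_num) (by omega) h1W (fun _ _ _ _ h => by omega) (fun i hi σ' h1 h2 h3 h4 h5 => by
      have := hz3 i hi
      simp [h1, h2, h3, v3, h24]; omega) ?_
  intro σ₄ τ₄ v4 _ a4 b4 c4 t4
  have v4' : ∀ x, x < 27 → σ₄.var x = σ.var x := fun x hx => by
    rw [v4 x (by omega), v3 x hx]
  have c4' : ∀ y, y < o₃ ∨ o₃ + n * n ≤ y → σ₄.arr 2 y = σ.arr 2 y := fun y hy => by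
    rw [c4 y fun i hi => by omega, a3 2 (by norm_num)]
  have htr : ∀ i < n * n, i % n * n + i / n < n * n := fun i hi =>
    flat_lt (mod_lt_of_lt_sq hi) (div_lt_of_lt_sq hi)
  have fits_tr : ∀ (σ' : RamState) (i : ℕ), i < n * n → σ'.var 27 = i → σ'.var 10 = n →
      transposed.Fits W σ' ∧ transposed.eval σ' = i % n * n + i / n := by
    intro σ' i hi h1 h2
    have e1 := htr i hi
    have e2 := mod_lt_of_lt_sq hi
    have e3 := div_lt_of_lt_sq hi
    have e4 : i % n * n ≤ n * n := Nat.mul_le_mul_right _ e2.le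
    simp [transposed, h1, h2]; omega
  have cost_tr : transposed.cost = 9 := rfl
  rw [wp_seq]
  refine wp_mapLoop (n * n) id (fun y => σ.arr 2 (o₂ + (y % n * n + y / n)))
    (by rw [v4' 16 (by norm_num), hD.v16]) (by norm_num) (by omega) h1W (fun _ _ _ _ h => h)
    (fun i hi σ' h1 h2 h3 h4 h5 => by
      obtain ⟨f1, f2⟩ := fits_tr σ' i hi h1 (by rw [h2 10 (by norm_num), v4' 10 (by norm_num), hD.v10])
      have e1 := htr i hi
      have e2 := hRr _ e1
      have e3 := c4' (o₂ + (i % n * n + i / n)) (by omega)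
      simp [h1, h2, h3, v4', h23, f1, f2, e3]; omega) ?_
  intro σ₅ τ₅ v5 _ a5 b5 _ t5
  rw [wp_seq]
  refine wp_mapLoop (n * n) id (fun y => σ.arr 2 (o₁ + (y % n * n + y / n)))
    (by rw [v5 16 (by norm_num), v4' 16 (by norm_num), hD.v16]) (by norm_num) (by omega) h1W
    (fun _ _ _ _ h => h)
    (fun i hi σ' h1 h2 h3 h4 h5 => by
      obtain ⟨f1, f2⟩ := fits_tr σ' i hi h1
        (by rw [h2 10 (by norm_num), v5 10 (by norm_num), v4' 10 (by norm_num), hD.v10])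
      have e1 := htr i hi
      have e2 := hL _ e1
      have e3 := c4' (o₁ + (i % n * n + i / n)) (by omega)
      simp [h1, h2, h3, v4', v5, a5, h22, f1, f2, e3]; omega) ?_
  intro σ₆ τ₆ v6 _ a6 b6 _ t6
  have v6' : ∀ x, x ≠ 27 → σ₆.var x = σ₃.var x := fun x hx => by rw [v6 x hx, v5 x hx, v4 x hx]
  have a6' : ∀ b, b ≠ 2 → b ≠ 10 → b ≠ 11 → σ₆.arr b = σ₃.arr b := fun b h1 h2 h3 => by
    rw [a6 b h3, a5 b h2, a4 b h1]
  have a62 : σ₆.arr 2 = σ₄.arr 2 := by rw [a6 2 (by norm_num), a5 2 (by norm_num)]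
  have y10 : ∀ y < n * n, σ₆.arr 10 y = σ.arr 2 (o₂ + (y % n * n + y / n)) := fun y hy => by
    rw [a6 10 (by norm_num)]; exact b5 y hy
  have y11 : ∀ y < n * n, σ₆.arr 11 y = σ.arr 2 (o₁ + (y % n * n + y / n)) := b6
  have b660 : σ₆.var 60 = σ₃.var 60 := v6' 60 (by norm_num)
  rw [wp_seq]
  refine (h.wp_halfProg (hD.agree (v := 27) (a := 0) (by norm_num)
      ⟨fun x hx => by rw [v6' x (by omega), v3 x hx], fun b hb => absurd hb (Nat.not_lt_zero _)⟩)
    (fun a y hy => by rw [a6' _ (by omega) (by omega) (by omega)]; exact be3 a y (by omega))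
    (fun e he => by rw [y10 e he]; exact hRr _ (htr e he))
    (fun e he => by rw [y11 e he]; exact hL _ (htr e he))
    (by omega)).mono ?_
  rintro σ₇ τ₇ ⟨ag7, be7, b7, hp7, t7⟩
  have v7 : ∀ x, x < 27 → σ₇.var x = σ.var x := fun x hx => by
    rw [ag7.1 x (by omega), v6' x (by omega), v3 x hx]
  have a72 : σ₇.arr 2 = σ₄.arr 2 := by rw [ag7.2 2 (by norm_num), a62]
  have b4' : ∀ y < n * n, σ₇.arr 2 (o₃ + y) = σ₃.arr 30 y := fun y hy => by rw [a72]; exact b4 y hy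
  refine wp_mapLoop (n * n) (fun y => o₃ + y)
    (fun y => min (σ₃.arr 30 y) (σ₇.arr 30 (y % n * n + y / n)))
    (by rw [v7 16 (by norm_num), hD.v16]) (by norm_num) (by omega) h1W (fun _ _ _ _ h => by omega)
    (fun i hi σ' h1 h2 h3 h4 h5 => by
      obtain ⟨f1, f2⟩ := fits_tr σ' i hi h1 (by rw [h2 10 (by norm_num), v7 10 (by norm_num), hD.v10])
      have e1 := htr i hi
      have e2 := hp7.le _ e1
      have e3 := hz3 i hi
      have e4 : σ'.arr 2 (o₃ + i) = σ₃.arr 30 i := by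
        rw [h5 _ fun i' hi' => by omega, b4' i hi]
      simp [h1, h2, h3, v7, h24, f1, f2, e4]; omega) ?_
  intro σ₈ τ₈ v8 _ a8 b8 c8 t8
  refine ⟨fun x hx => by rw [v8 x (by omega), v7 x hx], fun b hb hb2 => ?_, fun y hy => ?_,
    fun a y hy => ?_, ?_, ?_, ?_⟩
  · rw [a8 b hb2, ag7.2 b (by omega), a6' b hb2 (by omega) (by omega), a3 b hb]
  · rw [c8 y fun i hi => by omega, a72, c4' y hy]
  · rw [a8 _ (by omega)]; rw [v8 60 (by norm_num)] at hy; exact be7 a y hy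
  · rw [v8 60 (by norm_num)]; omega
  · have k1 : HalfProduct n M (fun y => σ.arr 2 (o₁ + y)) (fun y => σ.arr 2 (o₂ + y)) (σ₃.arr 30) := by
      refine ⟨hp3.le, fun i hi j hj hlt => ?_, fun i hi k hk j hj hle => ?_⟩
      · obtain ⟨k, hk, h1, h2⟩ := hp3.sound i hi j hj hlt
        rw [x10 _ (flat_lt hi hk)] at h1
        rw [x11 _ (flat_lt hk hj)] at h2
        exact ⟨k, hk, h1, h2⟩
      · have := hp3.complete i hi k hk j hj
        rw [x10 _ (flat_lt hi hk), x11 _ (flat_lt hk hj)] at this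
        exact this hle
    have tr : ∀ i < n, ∀ k < n, (k * n + i) % n * n + (k * n + i) / n = i * n + k :=
      fun i hi k hk => by rw [flat_mod hi, flat_div hi]
    refine MinMaxProduct.of_half (fun i hi k hk => ?_) (fun k hk j hj => ?_) k1 hp7
      fun i hi j hj => ?_
    · rw [y11 _ (flat_lt hk hi), tr i hi k hk]
    · rw [y10 _ (flat_lt hj hk), tr k hk j hj]
    · rw [b8 _ (flat_lt hi hj), tr j hj i hi]
  · simp [cost_tr] at t1 t2 t4 t5 t6 t8
    omega

end

/-! ### Walks and distances -/

section
variable {V : Type*} {G H : Digraph V} {s t : V} {k a b : ℕ}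

theorem hasWalk_zero : HasWalk G s t 0 ↔ s = t := by
  constructor
  · rintro ⟨p, h0, h1, -⟩
    rw [← h0, ← h1]; rfl
  · rintro rfl
    exact ⟨fun _ => s, rfl, rfl, fun l => l.elim0⟩

theorem hasWalk_succ : HasWalk G s t (k + 1) ↔ ∃ w, HasWalk G s w k ∧ G.Adj w t := by
  constructor
  · rintro ⟨p, h0, h1, h2⟩
    refine ⟨p (Fin.last k).castSucc, ⟨fun l => p l.castSucc, by simpa using h0, rfl, fun l => ?_⟩, ?_⟩
    · have := h2 l.castSucc
      rwa [Fin.succ_castSucc] at this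
    · have := h2 (Fin.last k)
      rw [Fin.succ_last, h1] at this
      exact this
  · rintro ⟨w, ⟨p, h0, h1, h2⟩, h3⟩
    refine ⟨Fin.snoc p t, ?_, by simp, fun l => ?_⟩
    · rw [← Fin.castSucc_zero, Fin.snoc_castSucc, h0]
    · induction l using Fin.lastCases with
      | last => rw [Fin.snoc_castSucc, Fin.succ_last, Fin.snoc_last, h1]; exact h3
      | cast l => rw [Fin.snoc_castSucc, Fin.succ_castSucc, Fin.snoc_castSucc]; exact h2 l

theorem hasWalk_add : HasWalk G s t (a + b) ↔ ∃ w, HasWalk G s w a ∧ HasWalk G w t b := by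
  induction b generalizing t with
  | zero => simp [hasWalk_zero]
  | succ b ih =>
    rw [← add_assoc, hasWalk_succ]
    simp only [ih, hasWalk_succ]
    constructor
    · rintro ⟨x, ⟨w, h1, h2⟩, h3⟩; exact ⟨w, h1, x, h2, h3⟩
    · rintro ⟨w, h1, x, h2, h3⟩; exact ⟨x, ⟨w, h1, h2⟩, h3⟩

theorem HasWalk.mono (h : HasWalk G s t k) (hGH : ∀ u v, G.Adj u v → H.Adj u v) :
    HasWalk H s t k :=
  let ⟨p, h0, h1, h2⟩ := h
  ⟨p, h0, h1, fun l => hGH _ _ (h2 l)⟩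

/-- A walk can be shortened until it visits no vertex twice. -/
theorem HasWalk.exists_lt_card [Fintype V] (h : HasWalk G s t k) :
    ∃ k' < Fintype.card V, k' ≤ k ∧ HasWalk G s t k' := by
  induction k using Nat.strong_induction_on with
  | _ k ih =>
    by_cases hk : k < Fintype.card V
    · exact ⟨k, hk, le_rfl, h⟩
    · have hcut : ∀ a : Fin (k + 1), ∃ w, HasWalk G s w a ∧ HasWalk G w t (k - a) := fun a => by
        have ha : (a : ℕ) + (k - a) = k := by have := a.isLt; omega
        rw [← ha] at h
        simpa using hasWalk_add.1 h
      choose f hf1 hf2 using hcut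
      obtain ⟨a, b, hab, heq⟩ := Fintype.exists_ne_map_eq_of_card_lt f (by simp; omega)
      wlog hlt : a < b generalizing a b
      · exact this b a hab.symm heq.symm (lt_of_le_of_ne (not_lt.1 hlt) hab.symm)
      have hw : HasWalk G s t (a + (k - b)) := hasWalk_add.2 ⟨f a, hf1 a, heq ▸ hf2 b⟩
      have h1 : (a : ℕ) < b := hlt
      have h2 := b.isLt
      obtain ⟨k', h3, h4, h5⟩ := ih _ (by omega) hw
      exact ⟨k', h3, by omega, h5⟩

theorem HasWalk.ddist_le (h : HasWalk G s t k) : ddist G s t ≤ k := iInf₂_le k h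

theorem exists_hasWalk_of_ddist (h : ddist G s t ≠ ⊤) :
    ∃ k : ℕ, ddist G s t = k ∧ HasWalk G s t k := by
  classical
  have hex : ∃ k, HasWalk G s t k := by
    by_contra hc
    push Not at hc
    exact h (by simp [ddist, hc])
  refine ⟨Nat.find hex, le_antisymm (Nat.find_spec hex).ddist_le ?_, Nat.find_spec hex⟩
  exact le_iInf₂ fun k hk => by exact_mod_cast Nat.find_min' hex hk

theorem reflTransGen_iff_hasWalk : Relation.ReflTransGen G.Adj s t ↔ ∃ k, HasWalk G s t k := by
  constructor
  · intro h
    induction h with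
    | refl => exact ⟨0, hasWalk_zero.2 rfl⟩
    | tail _ hbc ih => obtain ⟨k, hk⟩ := ih; exact ⟨k + 1, hasWalk_succ.2 ⟨_, hk, hbc⟩⟩
  · rintro ⟨k, hk⟩
    induction k generalizing t with
    | zero => rw [hasWalk_zero.1 hk]
    | succ k ih =>
      obtain ⟨w, h1, h2⟩ := hasWalk_succ.1 hk
      exact (ih h1).tail h2

theorem ddist_ne_top_iff : ddist G s t ≠ ⊤ ↔ Relation.ReflTransGen G.Adj s t := by
  rw [reflTransGen_iff_hasWalk]
  constructor
  · intro h; obtain ⟨k, -, hk⟩ := exists_hasWalk_of_ddist h; exact ⟨k, hk⟩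
  · rintro ⟨k, hk⟩ h
    have := hk.ddist_le
    rw [h] at this
    exact absurd (top_le_iff.1 this) (ENat.natCast_ne_top k)

end

/-! ### The table of levels -/

/-- `T` tells for each pair of vertices after how many insertions of the predicted sequence there is
a walk of at most `ℓ` edges; it is `m + 1` if there is none in the end. -/
def IsLevel {n m : ℕ} (ê : Fin m → Fin n × Fin n) (ℓ : ℕ) (T : ℕ → ℕ) : Prop :=
  ∀ u v : Fin n, T (u * n + v) ≤ m + 1 ∧
    ∀ j ≤ m, T (u * n + v) ≤ j ↔ ∃ k ≤ ℓ, HasWalk (graphAt ê j) u v k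

section
variable {n m : ℕ} {ê : Fin m → Fin n × Fin n} {a b : ℕ} {A B T Z : ℕ → ℕ}

/-- A walk of at most `a + b` edges consists of two walks of at most `a` and `b` edges, and both are
there as soon as the later one is. -/
theorem IsLevel.mul (hA : IsLevel ê a A) (hB : IsLevel ê b B)
    (hZ : MinMaxProduct n (m + 1) A B Z) : IsLevel ê (a + b) Z := by
  intro u v
  refine ⟨hZ.le _ (flat_lt u.isLt v.isLt), fun j hj => ⟨fun h => ?_, ?_⟩⟩
  · obtain ⟨k, hk, h1, h2⟩ := hZ.sound u u.isLt v v.isLt (by omega)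
    obtain ⟨x, hx, hw⟩ := ((hA u ⟨k, hk⟩).2 j hj).1 (h1.trans h)
    obtain ⟨y, hy, hw'⟩ := ((hB ⟨k, hk⟩ v).2 j hj).1 (h2.trans h)
    exact ⟨x + y, by omega, hasWalk_add.2 ⟨_, hw, hw'⟩⟩
  · rintro ⟨k, hk, hw⟩
    have hspl : k = min k a + (k - min k a) := by omega
    rw [hspl] at hw
    obtain ⟨w, h1, h2⟩ := hasWalk_add.1 hw
    refine (hZ.complete u u.isLt w w.isLt v v.isLt).trans (max_le ?_ ?_)
    · exact ((hA u w).2 j hj).2 ⟨_, min_le_right _ _, h1⟩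
    · exact ((hB w v).2 j hj).2 ⟨_, by omega, h2⟩

theorem isLevel_zero (hT : ∀ u v : Fin n, T (u * n + v) = if u = v then 0 else m + 1) :
    IsLevel ê 0 T := by
  intro u v
  rw [hT]
  refine ⟨by split_ifs <;> omega, fun j hj => ⟨fun h => ⟨0, le_rfl, hasWalk_zero.2 ?_⟩, ?_⟩⟩
  · by_contra hc
    rw [if_neg hc] at h; omega
  · rintro ⟨k, hk, hw⟩
    obtain rfl : k = 0 := by omega
    rw [if_pos (hasWalk_zero.1 hw)]; exact Nat.zero_le _

theorem isLevel_one (hê : Function.Injective ê)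
    (hd : ∀ u : Fin n, T (u * n + u) = 0)
    (he : ∀ p : Fin m, (ê p).1 ≠ (ê p).2 → T ((ê p).1 * n + (ê p).2) = p + 1)
    (ho : ∀ u v : Fin n, u ≠ v → (∀ p, ê p ≠ (u, v)) → T (u * n + v) = m + 1) :
    IsLevel ê 1 T := by
  intro u v
  by_cases huv : u = v
  · subst huv
    rw [hd]
    exact ⟨Nat.zero_le _, fun j hj => ⟨fun _ => ⟨0, Nat.zero_le _, hasWalk_zero.2 rfl⟩,
      fun _ => Nat.zero_le _⟩⟩
  · by_cases hp : ∃ p, ê p = (u, v)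
    · obtain ⟨p, hp⟩ := hp
      have hT : T (u * n + v) = p + 1 := by simpa [hp] using he p (by rw [hp]; exact huv)
      rw [hT]
      refine ⟨by have := p.isLt; omega, fun j hj => ⟨fun h => ⟨1, le_rfl, ?_⟩, ?_⟩⟩
      · exact hasWalk_succ.2 ⟨u, hasWalk_zero.2 rfl, p, h, hp⟩
      · rintro ⟨k, hk, hw⟩
        rcases Nat.le_one_iff_eq_zero_or_eq_one.1 hk with rfl | rfl
        · exact absurd (hasWalk_zero.1 hw) huv
        · obtain ⟨w, h1, q, hq, hqe⟩ := hasWalk_succ.1 hw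
          obtain rfl := hasWalk_zero.1 h1
          rw [hê (hp.trans hqe.symm)]
          exact hq
    · push Not at hp
      rw [ho u v huv hp]
      refine ⟨le_rfl, fun j hj => ⟨fun h => by omega, ?_⟩⟩
      rintro ⟨k, hk, hw⟩
      rcases Nat.le_one_iff_eq_zero_or_eq_one.1 hk with rfl | rfl
      · exact absurd (hasWalk_zero.1 hw) huv
      · obtain ⟨w, h1, q, hq, hqe⟩ := hasWalk_succ.1 hw
        obtain rfl := hasWalk_zero.1 h1
        exact absurd hqe (hp q)

end

/-! ### The grid of lengths -/

/-- The lengths for which tables are computed: all numbers up to `2 * K`, and from there on `K`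
numbers between a number and its double. -/
def gridLen (K g : ℕ) : ℕ :=
  if h : 2 * K < g ∧ 0 < K then 2 * gridLen K (g - K) else g
termination_by g
decreasing_by omega

section
variable {K g : ℕ}

theorem gridLen_of_le (h : g ≤ 2 * K) : gridLen K g = g := by
  rw [gridLen, dif_neg (by omega)]

theorem gridLen_of_lt (hK : 0 < K) (h : 2 * K < g) : gridLen K g = 2 * gridLen K (g - K) := by
  rw [gridLen, dif_pos ⟨h, hK⟩]

/-- Neighbouring lengths differ by a factor of at most `1 + 1 / K`. -/
theorem gridLen_ratio (hK : 0 < K) (hg : K ≤ g) :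
    K * gridLen K (g + 1) ≤ (K + 1) * gridLen K g := by
  induction g using Nat.strong_induction_on with
  | _ g ih =>
    rcases lt_or_ge g (2 * K) with h | h
    · rw [gridLen_of_le (by omega), gridLen_of_le (by omega)]
      nlinarith
    · have h1 := ih (g - K) (by omega) (by omega)
      have h2 : gridLen K g = 2 * gridLen K (g - K) := by
        rcases eq_or_lt_of_le h with rfl | h
        · rw [gridLen_of_le le_rfl, gridLen_of_le (by omega)]; omega
        · exact gridLen_of_lt hK h
      rw [gridLen_of_lt hK (by omega), h2, show g + 1 - K = g - K + 1 by omega]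
      linarith

theorem gridLen_le_succ (hK : 0 < K) : gridLen K g ≤ gridLen K (g + 1) := by
  induction g using Nat.strong_induction_on with
  | _ g ih =>
    rcases lt_or_ge g (2 * K) with h | h
    · rw [gridLen_of_le (by omega), gridLen_of_le (by omega)]; omega
    · have h1 := ih (g - K) (by omega)
      have h2 : gridLen K g = 2 * gridLen K (g - K) := by
        rcases eq_or_lt_of_le h with rfl | h
        · rw [gridLen_of_le le_rfl, gridLen_of_le (by omega)]; omega
        · exact gridLen_of_lt hK h
      rw [h2, gridLen_of_lt (g := g + 1) hK (by omega), show g + 1 - K = g - K + 1 by omega]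
      omega

theorem gridLen_mono (hK : 0 < K) : Monotone (gridLen K) :=
  monotone_nat_of_le_succ fun _ => gridLen_le_succ hK

theorem le_gridLen_mul (hK : 0 < K) (t : ℕ) : K * 2 ^ t ≤ gridLen K (K * (t + 1)) := by
  induction t with
  | zero => rw [gridLen_of_le (by omega)]; omega
  | succ t ih =>
    rcases Nat.eq_zero_or_pos t with rfl | ht
    · rw [gridLen_of_le (by omega)]; omega
    · have h1 : K * (t + 1 + 1) = K * t + 2 * K := by ring
      have h2 : 0 < K * t := Nat.mul_pos hK ht
      rw [gridLen_of_lt hK (by omega), show K * (t + 1 + 1) - K = K * (t + 1) by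
        rw [h1, show K * (t + 1) = K * t + K by ring]; omega, pow_succ]
      linarith

theorem gridLen_le_pow (hK : 0 < K) : gridLen K g ≤ K * 2 ^ (g / K) := by
  induction g using Nat.strong_induction_on with
  | _ g ih =>
    rcases le_or_gt g (2 * K) with h | h
    · rw [gridLen_of_le h]
      rcases lt_or_ge g K with h1 | h1
      · exact h1.le.trans (Nat.le_mul_of_pos_right _ (by positivity))
      · have h2 : 1 ≤ g / K := (Nat.le_div_iff_mul_le hK).2 (by omega)
        calc g ≤ K * 2 ^ 1 := by omega
          _ ≤ _ := Nat.mul_le_mul_left _ (Nat.pow_le_pow_right (by norm_num) h2)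
    · have h1 := ih (g - K) (by omega)
      have h2 : g / K = (g - K) / K + 1 := by
        rw [Nat.div_eq_sub_div hK (by omega)]
      rw [gridLen_of_lt hK h, h2, pow_succ]
      linarith

end

/-! ### Estimates of distances -/

/-- The number `e` is an estimate of the distance from `u` to `v`, up to a factor of `1 + 1 / K`;
numbers from `I` on stand for infinity. -/
structure Estimates {V : Type*} (G : Digraph V) (K I : ℕ) (u v : V) (e : ℕ) : Prop where
  sound : e < I → ∃ k ≤ e, HasWalk G u v k
  upper : ∀ k, HasWalk G u v k → K * e ≤ (K + 1) * k

section
variable {n m : ℕ} {ê : Fin m → Fin n × Fin n} {K Γ j e : ℕ} {T : ℕ → ℕ → ℕ} {u v : Fin n}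

/-- The value `2 * n` is safe as infinity: a distance is less than `n`, and the factor `1 + 1 / K` is at
most `2`. -/
theorem Estimates.lt_of_hasWalk {G : Digraph (Fin n)} {k : ℕ} (hK : 0 < K)
    (h : Estimates G K (2 * n) u v e) (hw : HasWalk G u v k) : e < 2 * n := by
  obtain ⟨k', h1, -, h2⟩ := hw.exists_lt_card
  rw [Fintype.card_fin] at h1
  have h3 := h.upper k' h2
  by_contra hc
  have h4 : K * (2 * n) ≤ K * e := Nat.mul_le_mul_left _ (by omega)
  have h5 : (K + 1) * k' ≤ 2 * K * k' := Nat.mul_le_mul_right _ (by omega)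
  have h6 : 2 * K * k' < 2 * K * n := Nat.mul_lt_mul_of_pos_left h1 (by omega)
  have h7 : K * (2 * n) = 2 * K * n := by ring
  omega

/-- The first level at which the table value is at most `j` gives an estimate. -/
theorem estimates_of_least (hK : 0 < K) (hT : ∀ g < Γ, IsLevel ê (gridLen K g) (T g)) (hj : j ≤ m)
    {g : ℕ} (hg : g < Γ) (hle : T g (u * n + v) ≤ j) (hlt : ∀ g' < g, j < T g' (u * n + v)) :
    Estimates (graphAt ê j) K (2 * n) u v (gridLen K g) := by
  refine ⟨fun _ => ((hT g hg u v).2 j hj).1 hle, fun k hk => ?_⟩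
  rcases Nat.eq_zero_or_pos g with rfl | hg0
  · rw [gridLen_of_le (by omega)]; omega
  · obtain ⟨g, rfl⟩ : ∃ g', g = g' + 1 := ⟨g - 1, by omega⟩
    have h1 : gridLen K g < k := by
      by_contra hc
      have := ((hT g (by omega) u v).2 j hj).2 ⟨k, by omega, hk⟩
      have := hlt g (by omega)
      omega
    rcases lt_or_ge g K with h2 | h2
    · rw [gridLen_of_le (by omega)] at h1 ⊢
      calc K * (g + 1) ≤ K * k := Nat.mul_le_mul_left _ h1
        _ ≤ _ := Nat.mul_le_mul_right _ (by omega)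
    · exact (gridLen_ratio hK h2).trans (Nat.mul_le_mul_left _ h1.le)

/-- If even the table for a length `≥ n` shows no walk, there is none. -/
theorem estimates_of_none (hT : ∀ g < Γ, IsLevel ê (gridLen K g) (T g)) (hj : j ≤ m)
    {g : ℕ} (hg : g < Γ) (hn : n ≤ gridLen K g) (hlt : j < T g (u * n + v)) :
    Estimates (graphAt ê j) K (2 * n) u v (2 * n) := by
  refine ⟨fun h => absurd h (lt_irrefl _), fun k hk => ?_⟩
  obtain ⟨k', h1, -, h2⟩ := hk.exists_lt_card
  rw [Fintype.card_fin] at h1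
  have := ((hT g hg u v).2 j hj).2 ⟨k', by omega, h2⟩
  omega

end

section
variable {V : Type*} {G H : Digraph V} {K I η ans : ℕ} {s t : V} {xs ys : ℕ → V}
  {est : V → V → ℕ} {D : ℕ → ℕ}

/-- The number `D c` is a bound for the distance from `s` to the head of the edge `(xs c, ys c)`,
along a walk that ends with this edge. If no edge can improve these bounds, they yield an estimate
of the distance from `s` to `t`. -/
theorem estimates_of_fixpoint
    (hH : ∀ u v, H.Adj u v → G.Adj u v ∨ ∃ c < η, xs c = u ∧ ys c = v)
    (hest : ∀ u v, Estimates G K I u v (est u v))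
    (hstart : ∀ c < η, D c ≤ est s (xs c) + 1)
    (hstep : ∀ c < η, ∀ c' < η, D c' ≤ D c + (est (ys c) (xs c') + 1))
    (hans : ans ≤ est s t) (hans' : ∀ c < η, ans ≤ D c + est (ys c) t)
    (hsound : ans < I → ∃ k ≤ ans, HasWalk H s t k) : Estimates H K I s t ans := by
  -- A walk either avoids the edges `(xs c, ys c)`, or it is split at the last of them.
  have key : ∀ k x, HasWalk H s x k → HasWalk G s x k ∨ ∃ c < η, ∃ k₁ k₂, k₁ + k₂ = k ∧
      K * D c ≤ (K + 1) * k₁ ∧ HasWalk G (ys c) x k₂ := by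
    intro k
    induction k with
    | zero => intro x hx; rw [hasWalk_zero] at hx ⊢; exact Or.inl hx
    | succ k ih =>
      intro y hy
      obtain ⟨x, hx, hxy⟩ := hasWalk_succ.1 hy
      rcases hH x y hxy with hG | ⟨c', hc', rfl, rfl⟩
      · rcases ih x hx with h | ⟨c, hc, k₁, k₂, h1, h2, h3⟩
        · exact Or.inl (hasWalk_succ.2 ⟨x, h, hG⟩)
        · exact Or.inr ⟨c, hc, k₁, k₂ + 1, by omega, h2, hasWalk_succ.2 ⟨x, h3, hG⟩⟩
      · refine Or.inr ⟨c', hc', k + 1, 0, rfl, ?_, hasWalk_zero.2 rfl⟩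
        rcases ih _ hx with h | ⟨c, hc, k₁, k₂, h1, h2, h3⟩
        · have e1 := (hest _ _).upper _ h
          have e2 := Nat.mul_le_mul_left K (hstart c' hc')
          linarith
        · have e1 := (hest _ _).upper _ h3
          have e2 := Nat.mul_le_mul_left K (hstep c hc c' hc')
          rw [← h1]
          linarith
  refine ⟨hsound, fun k hk => ?_⟩
  rcases key k t hk with h | ⟨c, hc, k₁, k₂, h1, h2, h3⟩
  · exact (Nat.mul_le_mul_left _ hans).trans ((hest _ _).upper _ h)
  · have e1 := (hest _ _).upper _ h3
    have e2 := Nat.mul_le_mul_left K (hans' c hc)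
    rw [← h1]
    linarith

end

theorem Estimates.approxDistOk {n K e : ℕ} {ε : ℝ} {G : Digraph (Fin n)} {s t : Fin n} {a : ℕ∞}
    (h : Estimates G K (2 * n) s t e) (hK : 0 < K) (hε : 1 ≤ K * ε)
    (ha : a = if e < 2 * n then (e : ℕ∞) else ⊤) : ApproxDistOk ε G s t a := by
  by_cases hd : ddist G s t = ⊤
  · have he : ¬ e < 2 * n := fun hlt => by
      obtain ⟨k, -, hk⟩ := h.sound hlt
      have := hk.ddist_le
      rw [hd] at this
      exact absurd (top_le_iff.1 this) (ENat.natCast_ne_top k)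
    have hε0 : 0 < ε := by
      have : (0 : ℝ) < K := by exact_mod_cast hK
      by_contra hc
      have : (K : ℝ) * ε ≤ 0 := mul_nonpos_of_nonneg_of_nonpos this.le (not_lt.1 hc)
      linarith
    rw [ha, if_neg he, ApproxDistOk, hd]
    refine ⟨le_rfl, ?_⟩
    rw [ENat.toENNReal_top, ENNReal.mul_top (by
      rw [Ne, ENNReal.ofReal_eq_zero]; linarith)]
  · obtain ⟨k, hk, hw⟩ := exists_hasWalk_of_ddist hd
    have he := h.lt_of_hasWalk hK hw
    obtain ⟨k', hk', hw'⟩ := h.sound he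
    have h1 : k ≤ e := by
      have := hw'.ddist_le
      rw [hk] at this
      have h2 : k ≤ k' := by exact_mod_cast this
      omega
    have h2 : (e : ℝ) ≤ (1 + ε) * k := by
      have h3 : (K : ℝ) * e ≤ (K + 1) * k := by exact_mod_cast h.upper k hw
      have hK' : (0 : ℝ) < K := by exact_mod_cast hK
      have hk0 : (0 : ℝ) ≤ k := Nat.cast_nonneg k
      refine le_of_mul_le_mul_left (h3.trans ?_) hK'
      nlinarith [mul_le_mul_of_nonneg_right hε hk0]
    rw [ha, if_pos he, ApproxDistOk, hk]
    constructor
    · exact_mod_cast h1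
    · have h3 := ENNReal.ofReal_le_ofReal h2
      rw [ENNReal.ofReal_mul' (Nat.cast_nonneg k), ENNReal.ofReal_natCast, ENNReal.ofReal_natCast] at h3
      simpa using h3

/-! ### The inserted edges and their predicted positions -/

/-- The inserted edges, given by their predicted positions (`I p` says that the edge predicted at
position `p` has been inserted), are stored in the slots `< k` of `A`, and `S p` is the slot of
position `p` plus one, or `0` if this edge has not been inserted. An edge that is predicted at a
position `< f` is stored in the slot of that number. There are `d` positions `< f` whose edges
have not been inserted. -/
structure Slots (m k f d : ℕ) (I : ℕ → Prop) (A S : ℕ → ℕ) : Prop where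
  slot : ∀ y < k, A y < m ∧ S (A y) = y + 1
  back : ∀ p < m, S p ≠ 0 → ∃ y < k, S p = y + 1 ∧ A y = p
  home : ∀ p < m, p < f → S p ≠ 0 → A p = p
  mem : ∀ p < m, S p ≠ 0 ↔ I p
  missing : Nat.count (fun p => S p = 0) f = d

section
variable {m k f d p i j : ℕ} {I : ℕ → Prop} {A S A' S' : ℕ → ℕ}

theorem Nat.count_congr_lt {P Q : ℕ → Prop} [DecidablePred P] [DecidablePred Q] {n : ℕ}
    (h : ∀ y < n, P y ↔ Q y) : Nat.count P n = Nat.count Q n := by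
  induction n with
  | zero => simp
  | succ n ih =>
    rw [Nat.count_succ, Nat.count_succ, ih fun y hy => h y (by omega)]
    simp only [h n (Nat.lt_succ_self n)]

/-- Removing one element from the counted set. -/
theorem Nat.count_remove {P Q : ℕ → Prop} [DecidablePred P] [DecidablePred Q] {n x : ℕ} (hx : x < n)
    (hP : P x) (hQ : ¬ Q x) (h : ∀ y < n, y ≠ x → (P y ↔ Q y)) :
    Nat.count Q n + 1 = Nat.count P n := by
  induction n with
  | zero => omega
  | succ n ih =>
    rw [Nat.count_succ, Nat.count_succ]
    by_cases hxn : x = n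
    · subst hxn
      rw [if_pos hP, if_neg hQ, Nat.count_congr_lt fun y hy => h y (by omega) (by omega)]
    · have := ih (by omega) fun y hy => h y (by omega)
      simp only [h n (Nat.lt_succ_self n) (fun hc => hxn hc.symm)]
      omega

/-- Insertion of a late edge: it is put into the new slot. -/
theorem Slots.insert_late (h : Slots m k k d I A S) (hp : p < m) (hkp : k ≤ p) (hI : ¬ I p)
    (hA : A' = Function.update A k p) (hS : S' = Function.update S p (k + 1)) :
    Slots m (k + 1) k d (fun q => I q ∨ q = p) A' S' := by
  have hS0 : S p = 0 := by by_contra hc; exact hI ((h.mem p hp).1 hc)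
  have hAp : ∀ y < k, A y ≠ p := fun y hy hc => by
    have := (h.slot y hy).2; rw [hc, hS0] at this; omega
  subst hA hS
  refine ⟨fun y hy => ?_, fun q hq hne => ?_, fun q hq hqk hne => ?_, fun q hq => ?_, ?_⟩
  · by_cases hyk : y = k
    · subst hyk; simp [hp]
    · have hy' : y < k := by omega
      rw [Function.update_of_ne hyk, Function.update_of_ne (hAp y hy')]
      exact h.slot y hy'
  · by_cases hqp : q = p
    · subst hqp; exact ⟨k, by omega, by simp, by simp⟩
    · rw [Function.update_of_ne hqp] at hne ⊢
      obtain ⟨y, hy, h1, h2⟩ := h.back q hq hne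
      exact ⟨y, by omega, h1, by rw [Function.update_of_ne (by omega)]; exact h2⟩
  · have hqp : q ≠ p := by omega
    rw [Function.update_of_ne hqp] at hne
    rw [Function.update_of_ne (by omega)]
    exact h.home q hq hqk hne
  · by_cases hqp : q = p
    · subst hqp; simp
    · rw [Function.update_of_ne hqp, h.mem q hq]; simp [hqp]
  · rw [← h.missing]
    exact Nat.count_congr_lt fun y hy => by rw [Function.update_of_ne (by omega)]

/-- Insertion of an early edge: the edge in its slot moves to the new slot. -/
theorem Slots.insert_early (h : Slots m k k d I A S) (hp : p < m) (hkp : p < k) (hI : ¬ I p)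
    (hA : A' = Function.update (Function.update A k (A p)) p p)
    (hS : S' = Function.update (Function.update S (A p) (k + 1)) p (p + 1)) :
    0 < d ∧ Slots m (k + 1) k (d - 1) (fun q => I q ∨ q = p) A' S' := by
  have hS0 : S p = 0 := by by_contra hc; exact hI ((h.mem p hp).1 hc)
  have hAp : ∀ y < k, A y ≠ p := fun y hy hc => by
    have := (h.slot y hy).2; rw [hc, hS0] at this; omega
  obtain ⟨hq, hSq⟩ := h.slot p hkp
  have hqp := hAp p hkp
  set q₀ := A p with hq₀
  have hcount : Nat.count (fun y => S' y = 0) k + 1 = Nat.count (fun y => S y = 0) k := by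
    refine Nat.count_remove hkp hS0 (by simp [hS]) fun y hy hyp => ?_
    rw [hS, Function.update_of_ne hyp]
    by_cases hyq : y = q₀
    · rw [hyq, Function.update_self, hSq]; simp
    · rw [Function.update_of_ne hyq]
  have hmiss := h.missing
  refine ⟨by omega, ?_⟩
  have hinj : ∀ y < k, A y = q₀ → y = p := fun y hy hc => by
    have := (h.slot y hy).2; rw [hc, hSq] at this; omega
  refine ⟨fun y hy => ?_, fun q hq' hne => ?_, fun q hq' hqk hne => ?_, fun q hq' => ?_, by omega⟩
  · by_cases hyp : y = p
    · subst hyp; simp [hA, hS, hp]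
    by_cases hyk : y = k
    · subst hyk; simp [hA, hS, hyp, hq, hqp]
    · have hy' : y < k := by omega
      have h1 : A y ≠ q₀ := fun hc => hyp (hinj y hy' hc)
      rw [hA, hS, Function.update_of_ne hyp, Function.update_of_ne hyk,
        Function.update_of_ne (hAp y hy'), Function.update_of_ne h1]
      exact h.slot y hy'
  · by_cases hqp' : q = p
    · subst hqp'; exact ⟨q, by omega, by simp [hS], by simp [hA]⟩
    by_cases hqq : q = q₀
    · refine ⟨k, by omega, by simp [hS, hqq, hqp], ?_⟩
      rw [hA, Function.update_of_ne (by omega), Function.update_self, hqq]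
    · rw [hS, Function.update_of_ne hqp', Function.update_of_ne hqq] at hne ⊢
      obtain ⟨y, hy, h1, h2⟩ := h.back q hq' hne
      refine ⟨y, by omega, h1, ?_⟩
      rw [hA, Function.update_of_ne (fun hc => hqq (by rw [← h2, hc])), Function.update_of_ne (by omega)]
      exact h2
  · by_cases hqp' : q = p
    · subst hqp'; simp [hA]
    by_cases hqq : q = q₀
    · have h1 := h.home q₀ hq (by omega) (by omega)
      have h2 := hinj q₀ (by omega) h1
      exact absurd (hqq.trans h2) hqp'
    · rw [hS, Function.update_of_ne hqp', Function.update_of_ne hqq] at hne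
      rw [hA, Function.update_of_ne hqp', Function.update_of_ne (by omega)]
      exact h.home q hq' hqk hne
  · by_cases hqp' : q = p
    · subst hqp'; simp [hS]
    by_cases hqq : q = q₀
    · have : I q := (h.mem q hq').1 (by rw [hqq, hSq]; omega)
      simp [hS, hqq, hqp]
      rw [← hqq]; exact this
    · rw [hS, Function.update_of_ne hqp', Function.update_of_ne hqq, h.mem q hq']; simp [hqp']

/-- The edge of the newest slot's number has not been inserted. -/
theorem Slots.skip (h : Slots m (k + 1) k d I A S) (hk : S k = 0) :
    Slots m (k + 1) (k + 1) (d + 1) I A S where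
  slot := h.slot
  back := h.back
  home p hp hpk hne := by
    have : p ≠ k := fun hc => hne (hc ▸ hk)
    exact h.home p hp (by omega) hne
  mem := h.mem
  missing := by rw [Nat.count_succ, if_pos hk, h.missing]

/-- The edge of the newest slot's number has been inserted; it is brought to its slot. -/
theorem Slots.swap (h : Slots m (k + 1) k d I A S) (hkm : k < m) (hk : S k ≠ 0)
    (hA : A' = Function.update (Function.update A (S k - 1) (A k)) k k)
    (hS : S' = Function.update (Function.update S (A k) (S k - 1 + 1)) k (k + 1)) :
    Slots m (k + 1) (k + 1) d I A' S' := by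
  obtain ⟨r, hr, hSk, hAr⟩ := h.back k hkm hk
  obtain ⟨hq, hSq⟩ := h.slot k (Nat.lt_succ_self k)
  have hr1 : S k - 1 = r := by omega
  rw [hr1] at hA hS
  set q₀ := A k with hq₀
  have hinj : ∀ y < k + 1, ∀ y' < k + 1, A y = A y' → y = y' := fun y hy y' hy' hc => by
    have h1 := (h.slot y hy).2
    have h2 := (h.slot y' hy').2
    rw [hc] at h1; omega
  have hrk : r = k ↔ q₀ = k := by
    constructor
    · rintro rfl; exact hAr
    · intro hc; exact hinj r hr k (Nat.lt_succ_self k) (hAr.trans hc.symm)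
  have hne0 : ∀ p, S' p = 0 ↔ S p = 0 := fun p => by
    rw [hS]
    by_cases hpk : p = k
    · subst hpk; simp [hk]
    · rw [Function.update_of_ne hpk]
      by_cases hpq : p = q₀
      · rw [hpq, Function.update_self, hSq]; simp
      · rw [Function.update_of_ne hpq]
  refine ⟨fun y hy => ?_, fun p hp hne => ?_, fun p hp hpk hne => ?_, fun p hp => ?_, ?_⟩
  · by_cases hyk : y = k
    · subst hyk; simp [hA, hS, hkm]
    by_cases hyr : y = r
    · have h1 : q₀ ≠ k := fun hc => hyk (hyr.trans (hrk.2 hc))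
      rw [hA, Function.update_of_ne hyk, hyr, Function.update_self, hS, Function.update_of_ne h1,
        Function.update_self]
      exact ⟨hq, rfl⟩
    · have h1 : A y ≠ k := fun hc => hyr (hinj y hy r hr (hc.trans hAr.symm))
      have h2 : A y ≠ q₀ := fun hc => hyk (hinj y hy k (Nat.lt_succ_self k) hc)
      rw [hA, hS, Function.update_of_ne hyk, Function.update_of_ne hyr, Function.update_of_ne h1,
        Function.update_of_ne h2]
      exact h.slot y hy
  · by_cases hpk : p = k
    · subst hpk; exact ⟨p, by omega, by simp [hS], by simp [hA]⟩
    by_cases hpq : p = q₀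
    · have h1 : r ≠ k := fun hc => hpk (hpq.trans (hrk.1 hc))
      refine ⟨r, hr, by rw [hS, Function.update_of_ne hpk, hpq, Function.update_self], ?_⟩
      rw [hA, Function.update_of_ne h1, Function.update_self, hpq]
    · rw [Ne, hne0] at hne
      obtain ⟨y, hy, h1, h2⟩ := h.back p hp hne
      refine ⟨y, hy, by rw [hS, Function.update_of_ne hpk, Function.update_of_ne hpq]; exact h1, ?_⟩
      rw [hA, Function.update_of_ne (fun hc => hpq (by rw [← h2, hc])),
        Function.update_of_ne (fun hc => hpk (by rw [← h2, hc, hAr]))]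
      exact h2
  · by_cases hpk' : p = k
    · subst hpk'; simp [hA]
    · rw [Ne, hne0] at hne
      have h1 := h.home p hp (by omega) hne
      have h2 : p ≠ r := fun hc => hpk' (by rw [← h1, hc, hAr])
      rw [hA, Function.update_of_ne hpk', Function.update_of_ne h2]; exact h1
  · rw [Ne, hne0]; exact h.mem p hp
  · rw [Nat.count_congr_lt (Q := fun p => S p = 0) fun y _ => hne0 y, Nat.count_succ, if_neg hk,
      Nat.add_zero, h.missing]

/-- A slot contains the edge predicted at its own number exactly if this edge has been inserted. -/
theorem Slots.home_iff (h : Slots m k k d I A S) (hkm : k ≤ m) {y : ℕ} (hy : y < k) :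
    A y = y ↔ S y ≠ 0 := by
  constructor
  · intro hc
    have := (h.slot y hy).2
    rw [hc] at this; omega
  · exact h.home y (by omega) hy

/-- The predicted position of the first edge that is missing. -/
theorem Slots.isGreatest_prefix (h : Slots m k k d I A S) (hkm : k ≤ m) {j : ℕ} (hj : j ≤ k)
    (h0 : ∀ y < j, S y ≠ 0) (h1 : j = k ∨ S j = 0) :
    IsGreatest {j' : ℕ | j' ≤ m ∧ ∀ p < m, p < j' → I p} j := by
  refine ⟨⟨hj.trans hkm, fun p hp hpj => (h.mem p hp).1 (h0 p hpj)⟩, fun j' ⟨h2, h3⟩ => ?_⟩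
  by_contra hc
  have hjm : j < m := by omega
  have h4 := (h.mem j hjm).2 (h3 j hjm (by omega))
  rcases h1 with rfl | h1
  · obtain ⟨y, hy, -, hyj⟩ := h.back j hjm h4
    have := (h.home_iff hkm hy).2 (h0 y hy)
    omega
  · exact h4 h1

end

section
variable {V : Type*} {n m i j d : ℕ} {ê : Fin m → V × V} {τ : Equiv.Perm (Fin m)} {A S : ℕ → ℕ}

/-- The predicted positions of the first `i` edges that are inserted. -/
def Inserted {m : ℕ} (τ : Equiv.Perm (Fin m)) (i p : ℕ) : Prop :=
  ∃ l : Fin m, (l : ℕ) < i ∧ (τ l : ℕ) = p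

theorem inserted_succ (hi : i < m) (p : ℕ) :
    Inserted τ (i + 1) p ↔ Inserted τ i p ∨ p = τ ⟨i, hi⟩ := by
  constructor
  · rintro ⟨l, hl, rfl⟩
    by_cases hli : (l : ℕ) = i
    · exact Or.inr (by congr 2; exact Fin.ext hli)
    · exact Or.inl ⟨l, by omega, rfl⟩
  · rintro (⟨l, hl, rfl⟩ | rfl)
    · exact ⟨l, by omega, rfl⟩
    · exact ⟨⟨i, hi⟩, Nat.lt_succ_self i, rfl⟩

theorem not_inserted (hi : i < m) : ¬ Inserted τ i (τ ⟨i, hi⟩) := by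
  rintro ⟨l, hl, h⟩
  have := τ.injective (Fin.ext h)
  rw [this] at hl
  exact absurd hl (lt_irrefl i)

theorem insertedPrefix_set (hê : Function.Injective ê) :
    {j : ℕ | j ≤ m ∧ ∀ k : Fin m, (k : ℕ) < j → ∃ l : Fin m, (l : ℕ) < i ∧ (ê ∘ τ) l = ê k} =
      {j : ℕ | j ≤ m ∧ ∀ p < m, p < j → Inserted τ i p} := by
  ext j
  refine and_congr_right fun _ => ⟨fun h p hp hpj => ?_, fun h k hk => ?_⟩
  · obtain ⟨l, hl, he⟩ := h ⟨p, hp⟩ hpj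
    exact ⟨l, hl, by rw [hê he]⟩
  · obtain ⟨l, hl, he⟩ := h k k.isLt hk
    exact ⟨l, hl, congrArg ê (Fin.ext he)⟩

theorem Slots.insertedPrefix_eq (h : Slots m i i d (Inserted τ i) A S) (hê : Function.Injective ê)
    (him : i ≤ m) (hj : j ≤ i) (h0 : ∀ y < j, S y ≠ 0) (h1 : j = i ∨ S j = 0) :
    insertedPrefix ê (ê ∘ τ) i = j := by
  rw [insertedPrefix, insertedPrefix_set hê]
  exact (h.isGreatest_prefix him hj h0 h1).csSup_eq

/-- The current graph consists of the graph of the prefix and of the edges in the last slots. -/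
theorem Slots.adj_iff (h : Slots m i i d (Inserted τ i) A S) (him : i ≤ m) (hj : j ≤ i)
    (h0 : ∀ y < j, S y ≠ 0) (u v : V) : (graphAt (ê ∘ τ) i).Adj u v ↔
      (graphAt ê j).Adj u v ∨ ∃ c < i - j, ∃ hA : A (j + c) < m, ê ⟨A (j + c), hA⟩ = (u, v) := by
  have hlow : ∀ y < j, A y = y := fun y hy => (h.home_iff him (by omega)).2 (h0 y hy)
  constructor
  · rintro ⟨l, hl, he⟩
    have hS := (h.mem (τ l) (τ l).isLt).2 ⟨l, hl, rfl⟩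
    obtain ⟨y, hy, -, hA⟩ := h.back _ (τ l).isLt hS
    rcases lt_or_ge y j with hyj | hyj
    · refine Or.inl ⟨τ l, ?_, he⟩
      rw [← hA, hlow y hyj]; exact hyj
    · refine Or.inr ⟨y - j, by omega, ?_⟩
      have e1 : j + (y - j) = y := by omega
      rw [e1]
      exact ⟨by rw [hA]; exact (τ l).isLt, by rw [← he]; exact congrArg ê (Fin.ext hA)⟩
  · rintro (⟨p, hp, he⟩ | ⟨c, hc, hA, he⟩)
    · obtain ⟨l, hl, hl'⟩ := (h.mem p p.isLt).1 (h0 p hp)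
      exact ⟨l, hl, by rw [← he]; exact congrArg ê (Fin.ext hl')⟩
    · have hS := (h.slot (j + c) (by omega)).2
      obtain ⟨l, hl, hl'⟩ := (h.mem _ hA).1 (by omega)
      exact ⟨l, hl, by rw [← he]; exact congrArg ê (Fin.ext hl')⟩

/-- An edge predicted at a position `< i - etaInf τ` is inserted at a time `< i`. -/
theorem etaBar_le_etaInf (hê : Function.Injective ê) (τ : Equiv.Perm (Fin m)) {i : ℕ} (hi : i ≤ m) :
    etaBar ê (ê ∘ τ) i ≤ etaInf τ := by
  have hle : i - etaInf τ ≤ insertedPrefix ê (ê ∘ τ) i := by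
    rw [insertedPrefix, insertedPrefix_set hê]
    refine le_csSup ⟨m, fun j hj => hj.1⟩ ⟨by omega, fun p hp hpi => ?_⟩
    refine ⟨τ.symm ⟨p, hp⟩, ?_, by simp⟩
    have h1 : _ ≤ etaInf τ := Finset.le_sup (f := fun j : Fin m => ((j : ℤ) - (τ j : ℤ)).natAbs)
      (Finset.mem_univ (τ.symm ⟨p, hp⟩))
    simp only [Equiv.apply_symm_apply] at h1
    omega
  rw [etaBar]
  omega

end

/-! ### The preprocessing -/

/-- `var 19 := (var 17 + 2) ^ c`. -/
def powProg : ℕ → RamProg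
  | 0 => .assign 19 (.const 1)
  | c + 1 => powProg c ;; .assign 19 (.var 19 * (.var 17 + .const 2))

open RamExpr in
/-- Compute the dimensions, the address range of the simulated program and the number of levels. -/
def setupProg (K c : ℕ) : RamProg :=
  .assign 10 (var 0) ;; .assign 11 (var 1) ;; .assign 16 (var 10 * var 10) ;;
  .assign 17 (var 10 + var 10) ;; .assign 18 (var 11 + const 1) ;; .assign 20 (var 16 + var 16) ;;
  .assign 21 (var 18 + var 18 + const 2) ;; powProg c ;;
  .assign 22 (const 1) ;; .assign 12 (const (K + 2)) ;;
  .loop ((var 22).less (var 10 + const 1)) (.assign 22 (var 22 + var 22) ;;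
    .assign 12 (var 12 + const K))

/-- The number of levels. -/
def gridSize (K n : ℕ) : ℕ := K * (lg n + 1) + 2

open RamExpr in
/-- The value `var 18` off the diagonal, `0` on the diagonal. -/
def offDiagonal : RamExpr := var 18 * (const 1 - (var 27 / var 10).same (var 27 % var 10))

open RamExpr in
/-- The index of the predicted edge `var 27`. -/
def edgeIndex : RamExpr := read 0 (var 27) * var 10 + read 1 (var 27)

open RamExpr in
/-- The predicted position of each edge, and the levels `0` and `1`. -/
def baseProg : RamProg :=
  mapLoop 27 11 4 edgeIndex (var 27) ;;
  mapLoop 27 16 2 (var 27) offDiagonal ;;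
  mapLoop 27 16 2 (var 16 + var 27) offDiagonal ;;
  mapLoop 27 11 2 (var 16 + edgeIndex)
    ((var 27 + const 1) * (const 1 - (read 0 (var 27)).same (read 1 (var 27)))) ;;
  .write 3 (const 0) (const 0) ;; .write 3 (const 1) (const 1)

open RamExpr in
/-- The other levels. -/
def gridProg (K : ℕ) (P : RamProg) : RamProg :=
  forLoop 26 12 (.ite ((var 26).less (const 2)) .skip
    (.ite ((const (2 * K)).less (var 26))
      (.assign 22 ((var 26 - const K) * var 16) ;; .assign 23 (var 22) ;;
        .write 3 (var 26) (const 2 * read 3 (var 26 - const K)))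
      (.assign 22 ((var 26 - const 1) * var 16) ;; .assign 23 (var 16) ;;
        .write 3 (var 26) (read 3 (var 26 - const 1) + const 1)) ;;
     .assign 24 (var 26 * var 16) ;; minMaxProg P))

/-- The preprocessing. -/
def preprocessProg (K c : ℕ) (P : RamProg) : RamProg :=
  setupProg K c ;; baseProg ;; gridProg K P

section
variable {n m K c N B W T F R : ℕ} {σ : RamState} {τ : ℕ}

theorem powProg_above (c : ℕ) : (powProg c).Above 19 0 := by
  induction c with
  | zero => simp [powProg, RamProg.Above]
  | succ c ih => exact ⟨ih, by simp [RamProg.Above]⟩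

theorem powProg_below (c : ℕ) : (powProg c).Below 20 0 := by
  induction c with
  | zero => simp [powProg, RamProg.Below]
  | succ c ih => exact ⟨ih, by simp [RamProg.Below]⟩

theorem wp_powProg {b : ℕ} (hb : σ.var 17 + 2 = b) (hW : b ^ (c + 1) < W) (hW2 : 2 < W) :
    wp W (powProg c) (fun σ' τ' => σ'.var 19 = b ^ c ∧ τ' = τ + 6 * c + 2) σ τ := by
  induction c with
  | zero => rw [powProg, wp_assign]; simp; omega
  | succ c ih =>
    have hb0 : 0 < b := by omega
    have h1 : b ^ (c + 1) ≤ b ^ (c + 1 + 1) := Nat.pow_le_pow_right hb0 (by omega)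
    have h2 : b ^ c ≤ b ^ (c + 1) := Nat.pow_le_pow_right hb0 (by omega)
    have h3 : b ≤ b ^ (c + 1) := Nat.le_self_pow (by omega) b
    rw [powProg, wp_seq]
    refine (ih (by omega)).frame (powProg_above c) ?_
    rintro σ' τ' ag ⟨e1, e2⟩
    have e3 : σ'.var 17 + 2 = b := by rw [ag.1 17 (by norm_num), hb]
    rw [wp_assign]
    refine ⟨?_, ?_, ?_⟩
    · simp [e1, e3, ← pow_succ]; omega
    · simp [e1, e3, ← pow_succ]
    · simp; omega

theorem lg_eq {a : ℕ} (h1 : n < 2 ^ a) (h2 : a = 0 ∨ 2 ^ (a - 1) ≤ n) (hn : 0 < n) : lg n = a := by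
  rcases Nat.eq_zero_or_pos a with rfl | ha
  · simp at h1; omega
  · rw [lg, (Nat.log_eq_iff (m := a - 1) (Or.inr ⟨by norm_num, hn.ne'⟩)).2 ⟨by
      rcases h2 with h | h
      · omega
      · exact h, by rwa [Nat.sub_add_cancel ha]⟩]
    omega

theorem lg_le : lg n ≤ n + 1 := by
  rw [lg]
  have := Nat.log_le_self 2 n
  omega

theorem two_pow_lg_le (hn : 0 < n) : 2 ^ lg n ≤ 2 * n := by
  rw [lg, pow_succ]
  have := Nat.pow_log_le_self 2 hn.ne'
  omega

theorem lt_two_pow_lg : n < 2 ^ lg n := Nat.lt_pow_succ_log_self (by norm_num) n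

theorem wp_setupProg (h0 : σ.var 0 = n) (h1 : σ.var 1 = m) (hn : 0 < n)
    (hW : (2 * n + 2) ^ (c + 1) < W) (hW1 : 2 * (n * n) + 2 * m + 4 < W)
    (hW2 : gridSize K n < W) (hW3 : 4 * n < W) :
    wp W (setupProg K c) (fun σ' τ' => Dims n (2 * n) (m + 1) ((2 * n + 2) ^ c) σ' ∧
      σ'.var 11 = m ∧ σ'.var 12 = gridSize K n ∧ (∀ x, x = 14 ∨ x = 15 ∨ 22 < x → σ'.var x = σ.var x) ∧
      τ' ≤ τ + 6 * c + 60 + 20 * lg n) σ τ := by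
  have hnn : n ≤ n * n := Nat.le_mul_self n
  have hpow : (2 * n + 2) ^ c ≤ (2 * n + 2) ^ (c + 1) := Nat.pow_le_pow_right (by omega) (by omega)
  simp only [setupProg, wp_seq, wp_assign]
  refine ⟨by simp [h0]; omega, by simp [h1]; omega, by simp [h0]; omega, by simp [h0]; omega,
    by simp [h1]; omega, by simp [h0]; omega, by simp [h1]; omega, ?_⟩
  set σ₁ := RamState.setVar _ 21 _ with hσ₁
  refine ((wp_powProg (b := 2 * n + 2) (by simp [hσ₁, h0]; omega) hW (by omega)).frame_above
    (Q' := fun σ' τ' => (∀ x, 20 ≤ x → σ'.var x = σ₁.var x) ∧ _) (powProg_below c)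
    (fun _ _ h1 _ h3 => ⟨h1, h3⟩)).frame (powProg_above c) ?_
  rintro σ₂ τ₂ ag ⟨u2, p2, t2⟩
  have hK : gridSize K n = K * lg n + K + 2 := by rw [gridSize]; ring
  simp only [wp_seq, wp_assign]
  refine ⟨by simp; omega, by simp; omega, ?_⟩
  set σ₃ := RamState.setVar _ 12 _ with hσ₃
  have e10 : σ₃.var 10 = n := by simp [hσ₃, ag.1 10 (by norm_num), hσ₁, h0]
  refine wp_loop (v := 0) (a := 0) (fun σ' τ' => ∃ a, (∀ x, x ≠ 22 → x ≠ 12 → σ'.var x = σ₃.var x) ∧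
    σ'.var 22 = 2 ^ a ∧ σ'.var 12 = K * a + K + 2 ∧ (a = 0 ∨ 2 ^ (a - 1) ≤ n) ∧
    τ' ≤ τ + 6 * c + 50 + 20 * a) (fun σ' => 2 * n + 1 - σ'.var 22) ?_ ?_ ?_
  · simp [RamProg.Above]
  · refine ⟨0, fun _ _ _ => rfl, by simp [hσ₃], by simp [hσ₃], Or.inl rfl, ?_⟩
    simp at t2 ⊢; omega
  · rintro σ' τ' - ⟨a, i1, i2, i3, i4, i5⟩
    have e10' : σ'.var 10 = n := by rw [i1 10 (by norm_num) (by norm_num), e10]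
    have hpa : 2 ^ a ≤ 2 * n := by
      rcases i4 with rfl | h
      · simp; omega
      · rcases Nat.eq_zero_or_pos a with rfl | ha
        · simp; omega
        · rw [show a = a - 1 + 1 by omega, pow_succ]; omega
    have hp0 : 0 < 2 ^ a := by positivity
    refine ⟨by simp [e10', i2]; split_ifs <;> omega, fun hne => ?_, fun hend => ?_⟩
    · simp [e10', i2] at hne
      have halt : a + 1 ≤ lg n := by
        have h3 : 2 ^ a < 2 ^ lg n := lt_of_le_of_lt (by omega) lt_two_pow_lg
        exact (Nat.pow_lt_pow_iff_right (by norm_num : 1 < 2)).1 h3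
      have hKa : K * (a + 1) ≤ K * lg n := Nat.mul_le_mul_left _ halt
      have hKe : K * (a + 1) = K * a + K := by ring
      simp only [wp_seq, wp_assign]
      refine ⟨by simp [i2]; omega, by simp [i3]; omega, ⟨a + 1, fun x h1 h2 => ?_, ?_, ?_, ?_, ?_⟩, ?_⟩
      · simp [h1, h2, i1 x h1 h2]
      · simp [i2, pow_succ]; omega
      · simp [i3]; omega
      · right; simpa using (by omega : 2 ^ a ≤ n)
      · simp; omega
      · simp [i2]; omega
    · simp [e10', i2] at hend
      have hlg := lg_eq (by omega) i4 hn
      have w : ∀ x, x < 19 → x ≠ 12 → σ'.var x = σ₁.var x := fun x h1 h2 => by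
        have h4 : x ≠ 22 := by omega
        rw [i1 x h4 h2]; simp [hσ₃, h2, h4, ag.1 x h1]
      have w' : ∀ x, 19 < x → x ≠ 22 → σ'.var x = σ₁.var x := fun x h1 h2 => by
        have h4 : x ≠ 12 := by omega
        rw [i1 x h2 h4]; simp [hσ₃, h2, h4, u2 x (by omega)]
      refine ⟨⟨by rw [e10'], ?_, ?_, ?_, ?_, ?_, ?_⟩, ?_, ?_, fun x hx => ?_, ?_⟩
      · rw [w 16 (by norm_num) (by norm_num)]; simp [hσ₁, h0]
      · rw [w 17 (by norm_num) (by norm_num)]; simp [hσ₁, h0]; omega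
      · rw [w 18 (by norm_num) (by norm_num)]; simp [hσ₁, h1]
      · rw [i1 19 (by norm_num) (by norm_num)]; simp [hσ₃, p2]
      · rw [w' 20 (by norm_num) (by norm_num)]; simp [hσ₁, h0]; omega
      · rw [w' 21 (by norm_num) (by norm_num)]; simp [hσ₁, h1]; omega
      · rw [w 11 (by norm_num) (by norm_num)]; simp [hσ₁, h1]
      · rw [i3, hK, hlg]
      · rcases hx with rfl | rfl | hx
        · rw [w 14 (by norm_num) (by norm_num)]; simp [hσ₁]
        · rw [w 15 (by norm_num) (by norm_num)]; simp [hσ₁]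
        · have q1 : x ≠ 10 := by omega
          have q2 : x ≠ 11 := by omega
          have q3 : x ≠ 16 := by omega
          have q4 : x ≠ 17 := by omega
          have q5 : x ≠ 18 := by omega
          have q6 : x ≠ 20 := by omega
          have q7 : x ≠ 21 := by omega
          rw [w' x (by omega) (by omega)]; simp [hσ₁, q1, q2, q3, q4, q5, q6, q7]
      · rw [hlg]; simp; omega

end

/-! ### Computing the tables -/

section
variable {n m K c N B W T F R : ℕ} {σ : RamState} {τ : ℕ} {ê : Fin m → Fin n × Fin n}

/-- The predicted edges are stored in the arrays `0` and `1`. -/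
structure EdgeArrays {n m : ℕ} (ê : Fin m → Fin n × Fin n) (σ : RamState) : Prop where
  tail : ∀ p : Fin m, σ.arr 0 p = (ê p).1
  head : ∀ p : Fin m, σ.arr 1 p = (ê p).2

/-- The flat index of the predicted edge at position `p`. -/
def flatEdge {n m : ℕ} (ê : Fin m → Fin n × Fin n) (p : ℕ) : ℕ :=
  if h : p < m then (ê ⟨p, h⟩).1 * n + (ê ⟨p, h⟩).2 else 0

theorem flatEdge_eq (p : Fin m) : flatEdge ê p = (ê p).1 * n + (ê p).2 := by
  rw [flatEdge, dif_pos p.isLt]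

theorem flatEdge_lt {p : ℕ} (hp : p < m) : flatEdge ê p < n * n := by
  rw [flatEdge, dif_pos hp]; exact flat_lt (Fin.isLt _) (Fin.isLt _)

theorem flatEdge_inj (hê : Function.Injective ê) {p q : ℕ} (hp : p < m) (hq : q < m)
    (h : flatEdge ê p = flatEdge ê q) : p = q := by
  rw [flatEdge, flatEdge, dif_pos hp, dif_pos hq] at h
  obtain ⟨h1, h2⟩ := flat_inj (Fin.isLt _) (Fin.isLt _) h
  have := hê (Prod.ext (Fin.ext h1) (Fin.ext h2))
  simpa using this

theorem edges_le (hê : Function.Injective ê) : m ≤ n * n := by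
  have := Fintype.card_le_of_injective ê hê
  simpa using this

theorem EdgeArrays.edgeIndex (h : EdgeArrays ê σ) {p : ℕ} (hp : p < m) (h27 : σ.var 27 = p)
    (h10 : σ.var 10 = n) (hW : n * n + m < W) :
    edgeIndex.Fits W σ ∧ edgeIndex.eval σ = flatEdge ê p := by
  have h1 := h.tail ⟨p, hp⟩
  have h2 := h.head ⟨p, hp⟩
  simp only at h1 h2
  have h3 := (ê ⟨p, hp⟩).1.isLt
  have h4 := (ê ⟨p, hp⟩).2.isLt
  have h5 := flat_lt h3 h4
  have h6 : n ≤ n * n := Nat.le_mul_self n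
  rw [flatEdge, dif_pos hp]
  simp [_root_.edgeIndex, h27, h1, h2, h10]
  omega

theorem offDiagonal_eval {i M : ℕ} (h27 : σ.var 27 = i) (h10 : σ.var 10 = n) (h18 : σ.var 18 = M)
    (hi : i < n * n) (hW : n * n + M + 1 < W) :
    offDiagonal.Fits W σ ∧ offDiagonal.eval σ = if i / n = i % n then 0 else M := by
  have h1 := div_lt_of_lt_sq hi
  have h2 := mod_lt_of_lt_sq hi
  have h6 : n ≤ n * n := Nat.le_mul_self n
  by_cases h : i / n = i % n
  · simp [offDiagonal, h27, h10, h18, h]; omega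
  · simp [offDiagonal, h27, h10, h18, h]; omega

theorem wp_baseProg (hD : Dims n N (m + 1) B σ) (h11 : σ.var 11 = m) (hE : EdgeArrays ê σ)
    (hê : Function.Injective ê) (hn : 0 < n) (hW : 2 * (n * n) + 2 * m + 4 < W) :
    wp W baseProg (fun σ' τ' => (∀ x, x ≠ 27 → σ'.var x = σ.var x) ∧
      (∀ b, b < 2 ∨ 4 < b → σ'.arr b = σ.arr b) ∧
      (∀ p : Fin m, σ'.arr 4 ((ê p).1 * n + (ê p).2) = p) ∧
      σ'.arr 3 0 = 0 ∧ σ'.arr 3 1 = 1 ∧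
      IsLevel ê 0 (fun y => σ'.arr 2 y) ∧ IsLevel ê 1 (fun y => σ'.arr 2 (n * n + y)) ∧
      τ' ≤ τ + 200 * (n * n)) σ τ := by
  have hm := edges_le hê
  have hnn : n ≤ n * n := Nat.le_mul_self n
  have h1W : 1 < W := by omega
  rw [baseProg, wp_seq]
  refine wp_mapLoop m (flatEdge ê) id h11 (by norm_num) (by omega) h1W
    (fun p hp q hq h => flatEdge_inj hê hp hq h) (fun p hp σ' h1 h2 h3 h4 h5 => by
      obtain ⟨f1, f2⟩ := EdgeArrays.edgeIndex (W := W) (σ := σ') (ê := ê)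
        ⟨by rw [h3 0 (by norm_num)]; exact hE.tail, by rw [h3 1 (by norm_num)]; exact hE.head⟩ hp h1
        (by rw [h2 10 (by norm_num), hD.v10]) (by omega)
      exact ⟨f1, by simp [h1]; omega, f2, by simp [h1]⟩) ?_
  intro σ₁ τ₁ v1 _ a1 b1 _ t1
  rw [wp_seq]
  refine wp_mapLoop (n * n) id (fun i => if i / n = i % n then 0 else m + 1)
    (by rw [v1 16 (by norm_num), hD.v16]) (by norm_num) (by omega) h1W (fun _ _ _ _ h => h)
    (fun i hi σ' h1 h2 h3 h4 h5 => by
      obtain ⟨f1, f2⟩ := offDiagonal_eval (W := W) h1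
        (by rw [h2 10 (by norm_num), v1 10 (by norm_num), hD.v10])
        (by rw [h2 18 (by norm_num), v1 18 (by norm_num), hD.v18]) hi (by omega)
      exact ⟨by simp [h1]; omega, f1, by simp [h1], f2⟩) ?_
  intro σ₂ τ₂ v2 _ a2 b2 _ t2
  rw [wp_seq]
  refine wp_mapLoop (n * n) (fun i => n * n + i) (fun i => if i / n = i % n then 0 else m + 1)
    (by rw [v2 16 (by norm_num), v1 16 (by norm_num), hD.v16]) (by norm_num) (by omega) h1W
    (fun _ _ _ _ h => by omega)
    (fun i hi σ' h1 h2 h3 h4 h5 => by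
      obtain ⟨f1, f2⟩ := offDiagonal_eval (W := W) h1
        (by rw [h2 10 (by norm_num), v2 10 (by norm_num), v1 10 (by norm_num), hD.v10])
        (by rw [h2 18 (by norm_num), v2 18 (by norm_num), v1 18 (by norm_num), hD.v18]) hi (by omega)
      exact ⟨by simp [h1, h2, v2, v1, hD.v16]; omega, f1, by simp [h1, h2, v2, v1, hD.v16], f2⟩) ?_
  intro σ₃ τ₃ v3 _ a3 b3 c3 t3
  have v3' : ∀ x, x ≠ 27 → σ₃.var x = σ.var x := fun x hx => by rw [v3 x hx, v2 x hx, v1 x hx]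
  have a3' : ∀ b, b ≠ 2 → b ≠ 4 → σ₃.arr b = σ.arr b := fun b h1 h2 => by
    rw [a3 b h1, a2 b h1, a1 b h2]
  rw [wp_seq]
  refine wp_mapLoop m (fun p => n * n + flatEdge ê p)
    (fun p => if σ.arr 0 p = σ.arr 1 p then 0 else p + 1)
    (by rw [v3' 11 (by norm_num), h11]) (by norm_num) (by omega) h1W
    (fun p hp q hq h => flatEdge_inj hê hp hq (by omega)) (fun p hp σ' h1 h2 h3 h4 h5 => by
      have e0 : σ'.arr 0 = σ.arr 0 := by rw [h3 0 (by norm_num), a3' 0 (by norm_num) (by norm_num)]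
      have e1 : σ'.arr 1 = σ.arr 1 := by rw [h3 1 (by norm_num), a3' 1 (by norm_num) (by norm_num)]
      obtain ⟨f1, f2⟩ := EdgeArrays.edgeIndex (W := W) (σ := σ') (ê := ê)
        ⟨by rw [e0]; exact hE.tail, by rw [e1]; exact hE.head⟩ hp h1
        (by rw [h2 10 (by norm_num), v3' 10 (by norm_num), hD.v10]) (by omega)
      have f3 := flatEdge_lt (ê := ê) hp
      have k1 : σ.arr 0 p < n := by rw [hE.tail ⟨p, hp⟩]; exact Fin.isLt _
      have k2 : σ.arr 1 p < n := by rw [hE.head ⟨p, hp⟩]; exact Fin.isLt _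
      have v16 : σ'.var 16 = n * n := by rw [h2 16 (by norm_num), v3' 16 (by norm_num), hD.v16]
      refine ⟨by simp [f1, f2, v16]; omega, ?_, by simp [f2, v16], ?_⟩
      · by_cases h : σ.arr 0 p = σ.arr 1 p
        · simp [h1, e0, e1, h]; omega
        · simp [h1, e0, e1, h]; omega
      · by_cases h : σ.arr 0 p = σ.arr 1 p
        · simp [h1, e0, e1, h]
        · simp [h1, e0, e1, h]) ?_
  intro σ₄ τ₄ v4 _ a4 b4 c4 t4
  have hfl : ∀ (u v : Fin n), ((u : ℕ) * n + v) / n = u ∧ ((u : ℕ) * n + v) % n = v :=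
    fun u v => ⟨flat_div v.isLt, flat_mod v.isLt⟩
  have hT0 : ∀ u v : Fin n, σ₄.arr 2 (u * n + v) = if u = v then 0 else m + 1 := fun u v => by
    have huv := flat_lt u.isLt v.isLt
    rw [c4 _ fun p _ => by omega, c3 _ fun p _ => by omega]
    have := b2 _ huv
    simp only [id, (hfl u v).1, (hfl u v).2] at this
    rw [this]; simp only [Fin.ext_iff]
  have hT1 : ∀ u v : Fin n, (∀ p, ê p ≠ (u, v)) →
      σ₄.arr 2 (n * n + (u * n + v)) = if u = v then 0 else m + 1 := fun u v hp => by
    have huv := flat_lt u.isLt v.isLt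
    rw [c4 _ fun p hpm hc => ?_]
    · have := b3 _ huv
      simp only [(hfl u v).1, (hfl u v).2] at this
      rw [this]; simp only [Fin.ext_iff]
    · rw [flatEdge, dif_pos hpm] at hc
      obtain ⟨h1, h2⟩ := flat_inj v.isLt (Fin.isLt _)
        (show (u : ℕ) * n + v = (ê ⟨p, hpm⟩).1 * n + (ê ⟨p, hpm⟩).2 by omega)
      exact hp ⟨p, hpm⟩ (Prod.ext (Fin.ext h1.symm) (Fin.ext h2.symm))
  have hT1e : ∀ p : Fin m, σ₄.arr 2 (n * n + ((ê p).1 * n + (ê p).2)) =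
      if (ê p).1 = (ê p).2 then 0 else (p : ℕ) + 1 := fun p => by
    have := b4 p p.isLt
    rw [flatEdge_eq, hE.tail, hE.head] at this
    rw [this]; simp only [Fin.ext_iff]
  simp only [wp_seq, wp_write]
  refine ⟨by simp; omega, by simp; omega, by simp; omega, by simp; omega, fun x hx => ?_,
    fun b hb => ?_, fun p => ?_, by simp, by simp, ?_, ?_, ?_⟩
  · simp [v4 x hx, v3' x hx]
  · have i1 : b ≠ 3 := by omega
    simp [i1, a4 b (by omega), a3' b (by omega) (by omega)]
  · have := b1 p p.isLt
    rw [flatEdge_eq] at this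
    simp [a4, a3, a2, this]
  · exact isLevel_zero fun u v => by simpa using hT0 u v
  · refine isLevel_one hê (fun u => ?_) (fun p hp => ?_) (fun u v huv hp => ?_)
    · by_cases hp : ∃ p, ê p = (u, u)
      · obtain ⟨p, hp⟩ := hp
        have := hT1e p
        rw [hp] at this
        simpa using this
      · push Not at hp
        simpa using hT1 u u hp
    · simpa [hp] using hT1e p
    · simpa [huv] using hT1 u v hp
  · have e1 : edgeIndex.cost = 7 := rfl
    have e2 : offDiagonal.cost = 11 := rfl
    simp [e1, e2] at t1 t2 t3 t4 ⊢
    omega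

/-- The tables that the preprocessing leaves behind. -/
structure Tables {n m : ℕ} (ê : Fin m → Fin n × Fin n) (K Γ : ℕ) (σ : RamState) : Prop where
  len : ∀ g < Γ, σ.arr 3 g = gridLen K g
  level : ∀ g < Γ, IsLevel ê (gridLen K g) (fun y => σ.arr 2 (g * (n * n) + y))

theorem IsLevel.le {ℓ : ℕ} {T : ℕ → ℕ} (h : IsLevel ê ℓ T) {y : ℕ} (hy : y < n * n) :
    T y ≤ m + 1 := by
  have := (h ⟨y / n, div_lt_of_lt_sq hy⟩ ⟨y % n, mod_lt_of_lt_sq hy⟩).1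
  simp only [Nat.div_add_mod'] at this
  exact this

theorem gridProg_bound {Γ g : ℕ} (hg : g < Γ) : g * (n * n) + n * n ≤ Γ * (n * n) := by
  calc g * (n * n) + n * n = (g + 1) * (n * n) := by ring
    _ ≤ _ := Nat.mul_le_mul_right _ hg

/-- Starting with the tables for the lengths `0` and `1`, every further table is the product of two that
have been computed before. -/
theorem wp_gridProg {P : RamProg} {Γ : ℕ} (hH : HalfParams P n N (m + 1) B W T F R)
    (hD : Dims n N (m + 1) B σ) (hR : ∀ a y, σ.var 60 + B ≤ y → σ.arr (a + 40) y = 0)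
    (h12 : σ.var 12 = Γ) (hK : 0 < K) (h30 : σ.arr 3 0 = 0) (h31 : σ.arr 3 1 = 1)
    (hT0 : IsLevel ê 0 (fun y => σ.arr 2 y)) (hT1 : IsLevel ê 1 (fun y => σ.arr 2 (n * n + y)))
    (hW : σ.var 60 + Γ * (2 * growth n B R) < W) (hW2 : Γ * (n * n) < W)
    (hW3 : ∀ g < Γ, gridLen K g < W) (hW4 : 2 * K + Γ + 2 < W) :
    wp W (gridProg K P) (fun σ' τ' => (∀ x < 22, σ'.var x = σ.var x) ∧
      (∀ b < 10, b ≠ 2 → b ≠ 3 → σ'.arr b = σ.arr b) ∧ Tables ê K Γ σ' ∧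
      τ' ≤ τ + Γ * (2 * halfTime P (m + 1) F R + 300 * (n * n)) + 10) σ τ := by
  have hn := hH.pos
  have hn2 : 0 < n * n := Nat.mul_pos hn hn
  have h1W : 1 < W := by omega
  set q := 2 * halfTime P (m + 1) F R + 300 * (n * n) with hq
  set r := 2 * growth n B R with hr
  refine wp_forLoop (v := 22) (a := 2) (fun g σ' τ' => (∀ x < 22, σ'.var x = σ.var x) ∧
      (∀ b < 10, b ≠ 2 → b ≠ 3 → σ'.arr b = σ.arr b) ∧
      (∀ g', g' < 2 ∨ g' < g → σ'.arr 3 g' = gridLen K g') ∧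
      (∀ g', g' < 2 ∨ g' < g → IsLevel ê (gridLen K g') (fun y => σ'.arr 2 (g' * (n * n) + y))) ∧
      (∀ a y, σ'.var 60 + B ≤ y → σ'.arr (a + 40) y = 0) ∧ σ'.var 60 ≤ σ.var 60 + g * r ∧
      τ' ≤ τ + g * q + 2) Γ ?_ (by norm_num) (by norm_num) h12 (by omega) h1W ?_ ?_ ?_
  · have h1 := (halfProg_above P).mono (v' := 22) (a' := 2) (by norm_num) (by norm_num)
    simp [RamProg.Above, minMaxProg, mapLoop_above, h1]
  · have two : ∀ g', g' < 2 ∨ g' < 0 → g' = 0 ∨ g' = 1 := fun g' h => by omega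
    refine ⟨fun x hx => ?_, fun _ _ _ _ => rfl, fun g' hg' => ?_, fun g' hg' => ?_, ?_, ?_, by simp⟩
    · have : x ≠ 26 := by omega
      simp [this]
    · rcases two g' hg' with rfl | rfl
      · rw [gridLen_of_le (by omega)]; exact h30
      · rw [gridLen_of_le (by omega)]; exact h31
    · rcases two g' hg' with rfl | rfl
      · rw [gridLen_of_le (by omega)]; simpa using hT0
      · rw [gridLen_of_le (by omega)]; simpa using hT1
    · simpa using hR
    · simp
  · rintro g hg σ₁ τ₁ hx ag ⟨i1, i2, i3, i4, i5, i6, i7⟩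
    have hD1 : Dims n N (m + 1) B σ₁ := hD.agree (v := 22) (a := 0) le_rfl
      ⟨i1, fun b hb => absurd hb (Nat.not_lt_zero _)⟩
    rw [wp_ite]
    refine ⟨by simp [hx, h1W]; omega, fun hlt => ?_, fun hge => ?_⟩
    · simp [hx] at hlt
      rw [wp_skip]
      refine ⟨hx, fun x hx' => ?_, i2, fun g' hg' => i3 g' (by omega), fun g' hg' => i4 g' (by omega),
        by simpa using i5, ?_, ?_⟩
      · have : x ≠ 26 := by omega
        simp [this, i1 x hx']
      · have e1 : (g + 1) * r = g * r + r := by ring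
        simp; omega
      · have e1 : (g + 1) * q = g * q + q := by ring
        simp; omega
    · simp [hx] at hge
      -- The two factors are levels `g₁` and `g₂`.
      suffices hmid : ∃ g₁ g₂, g₁ < g ∧ g₂ < g ∧ gridLen K g₁ + gridLen K g₂ = gridLen K g ∧
          wp W (.ite ((RamExpr.const (2 * K)).less (RamExpr.var 26))
            (.assign 22 ((RamExpr.var 26 - RamExpr.const K) * RamExpr.var 16) ;;
              .assign 23 (RamExpr.var 22) ;;
              .write 3 (RamExpr.var 26) (RamExpr.const 2 * RamExpr.read 3 (RamExpr.var 26 - RamExpr.const K)))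
            (.assign 22 ((RamExpr.var 26 - RamExpr.const 1) * RamExpr.var 16) ;;
              .assign 23 (RamExpr.var 16) ;;
              .write 3 (RamExpr.var 26) (RamExpr.read 3 (RamExpr.var 26 - RamExpr.const 1) + RamExpr.const 1)))
            (fun σ' τ' => (∀ x, x ≠ 22 → x ≠ 23 → σ'.var x = σ₁.var x) ∧ σ'.var 22 = g₁ * (n * n) ∧
              σ'.var 23 = g₂ * (n * n) ∧ σ'.arr = (σ₁.setArr 3 g (gridLen K g)).arr ∧
              τ' ≤ τ₁ + 40) σ₁ (τ₁ + 4 + (((RamExpr.var 26).less (RamExpr.const 2)).cost + 1)) by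
        obtain ⟨g₁, g₂, hg₁, hg₂, hsum, hmid⟩ := hmid
        rw [wp_seq]
        refine hmid.mono ?_
        rintro σ₂ τ₂ ⟨v2, w22, w23, a2, t2⟩
        have e26 : σ₂.var 26 = g := by rw [v2 26 (by norm_num) (by norm_num), hx]
        have e16 : σ₂.var 16 = n * n := by rw [v2 16 (by norm_num) (by norm_num), hD1.v16]
        have bg := gridProg_bound (n := n) hg
        rw [wp_seq, wp_assign]
        refine ⟨by simp [e26, e16]; omega, ?_⟩
        set σ₃ := σ₂.setVar 24 ((RamExpr.var 26 * RamExpr.var 16).eval σ₂) with hσ₃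
        have v3 : ∀ x, x < 22 ∨ 24 < x → σ₃.var x = σ₁.var x := fun x hx => by
          have j1 : x ≠ 24 := by omega
          simp [hσ₃, j1, v2 x (by omega) (by omega)]
        have a3 : ∀ b, b ≠ 3 → σ₃.arr b = σ₁.arr b := fun b hb => by simp [hσ₃, a2, hb]
        have e60 := v3 60 (by norm_num)
        have bound : ∀ g', g' < g → g' * (n * n) + n * n ≤ g * (n * n) := fun g' h => gridProg_bound h
        have hgr : (g + 1) * r ≤ Γ * r := Nat.mul_le_mul_right _ hg
        have e1 : (g + 1) * r = g * r + r := by ring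
        refine (wp_minMaxProg hH (hD1.agree (v := 22) (a := 0) le_rfl
          ⟨fun x hx => v3 x (Or.inl hx), fun b hb => absurd hb (Nat.not_lt_zero _)⟩)
          (fun a y hy => by rw [a3 _ (by omega)]; exact i5 a y (by omega))
          (o₁ := g₁ * (n * n)) (o₂ := g₂ * (n * n)) (o₃ := g * (n * n)) (by simp [hσ₃, w22])
          (by simp [hσ₃, w23]) (by simp [hσ₃, e26, e16])
          (fun y hy => by rw [a3 2 (by norm_num)]; exact (i4 g₁ (Or.inr hg₁)).le hy)
          (fun y hy => by rw [a3 2 (by norm_num)]; exact (i4 g₂ (Or.inr hg₂)).le hy)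
          (bound g₁ hg₁) (bound g₂ hg₂) (by omega) (by omega)).mono ?_
        rintro σ₄ τ₄ ⟨v4, a4, c4, be4, b4, z4, t4⟩
        refine ⟨by rw [v4 26 (by norm_num), v3 26 (by norm_num), hx], fun x hx' => ?_, fun b hb h2 h3 => ?_,
          fun g' hg' => ?_, fun g' hg' => ?_, by simpa using be4, ?_, ?_⟩
        · have : x ≠ 26 := by omega
          simp [this, v4 x (by omega), v3 x (Or.inl hx'), i1 x hx']
        · rw [RamState.arr_setVar, a4 b hb h2, a3 b h3, i2 b hb h2 h3]
        · rw [RamState.arr_setVar, a4 3 (by norm_num) (by norm_num)]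
          by_cases hgg : g' = g
          · subst hgg; simp [hσ₃, a2]
          · simp [hσ₃, a2, hgg, i3 g' (by omega)]
        · by_cases hgg : g' = g
          · subst hgg
            rw [a3 2 (by norm_num)] at z4
            rw [← hsum]
            exact (i4 g₁ (Or.inr hg₁)).mul (i4 g₂ (Or.inr hg₂)) z4
          · have hlow : g' < g := by omega
            intro u v
            have := i4 g' (Or.inr hlow) u v
            simp only [RamState.arr_setVar]
            rw [c4 _ (Or.inl (by have := bound g' hlow; have := flat_lt u.isLt v.isLt; omega)),
              a3 2 (by norm_num)]
            exact this
        · simp; omega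
        · have e2 : (g + 1) * q = g * q + q := by ring
          simp at t4
          omega
      have e16 := hD1.v16
      by_cases hc : 2 * K < g
      · refine ⟨g - K, g - K, by omega, by omega, by rw [gridLen_of_lt hK hc]; ring, ?_⟩
        have bg := gridProg_bound (n := n) (show g - K < Γ by omega)
        have k1 := hW3 g hg
        rw [gridLen_of_lt hK hc] at k1 ⊢
        have k2 := i3 (g - K) (by omega)
        rw [wp_ite]
        refine ⟨by simp [hx, hc]; omega, fun _ => ?_, fun h0 => absurd h0 (by simp [hx, hc])⟩
        simp only [wp_seq, wp_assign, wp_write]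
        refine ⟨by simp [hx, e16]; omega, by simp [hx, e16]; omega, by simp [hx]; omega,
          by simp [hx, k2]; omega, fun x h1 h2 => by simp [h1, h2], by simp [hx, e16],
          by simp [hx, e16], ?_, by simp⟩
        funext b
        simp [RamState.setArr, RamState.setVar, hx, k2]
      · refine ⟨g - 1, 1, by omega, by omega, ?_, ?_⟩
        · rw [gridLen_of_le (by omega), gridLen_of_le (by omega), gridLen_of_le (by omega)]; omega
        have bg := gridProg_bound (n := n) (show g - 1 < Γ by omega)
        have k1 := hW3 g hg
        have k2 := i3 (g - 1) (by omega)
        have k3 : gridLen K g = gridLen K (g - 1) + 1 := by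
          rw [gridLen_of_le (by omega), gridLen_of_le (by omega)]; omega
        rw [wp_ite]
        refine ⟨by simp [hx, hc]; omega, fun h0 => absurd h0 (by simp [hx, hc]), fun _ => ?_⟩
        simp only [wp_seq, wp_assign, wp_write]
        refine ⟨by simp [hx, e16]; omega, by simp [e16]; omega, by simp [hx]; omega,
          by simp [hx, k2]; omega, fun x h1 h2 => by simp [h1, h2], by simp [hx, e16],
          by simp [e16], ?_, by simp⟩
        funext b
        simp [RamState.setArr, RamState.setVar, hx, k2, k3]
  · rintro σ' τ' hx ag ⟨i1, i2, i3, i4, i5, i6, i7⟩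
    exact ⟨i1, i2, ⟨fun g hg => i3 g (Or.inr hg), fun g hg => i4 g (Or.inr hg)⟩, by omega⟩

end

/-! ### The memory between requests -/

section
variable {n m K c N B W T F R : ℕ} {σ : RamState} {t₀ : ℕ} {ê : Fin m → Fin n × Fin n}
  {τ : Equiv.Perm (Fin m)} {i : ℕ}

/-- The memory after the preprocessing and `i` insertions. -/
structure Online {n m : ℕ} (ê : Fin m → Fin n × Fin n) (τ : Equiv.Perm (Fin m)) (K i : ℕ)
    (σ : RamState) : Prop where
  v10 : σ.var 10 = n
  v12 : σ.var 12 = gridSize K n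
  v14 : σ.var 14 = i
  v16 : σ.var 16 = n * n
  v17 : σ.var 17 = 2 * n
  edges : EdgeArrays ê σ
  tables : Tables ê K (gridSize K n) σ
  pos : ∀ p : Fin m, σ.arr 4 ((ê p).1 * n + (ê p).2) = p
  slots : Slots m i i (σ.var 15) (Inserted τ i) (σ.arr 5) (σ.arr 6)

theorem wp_preprocessProg {P : RamProg} (hê : Function.Injective ê) (hK : 0 < K)
    (hH : HalfParams P n (2 * n) (m + 1) ((2 * n + 2) ^ c) W T F R)
    (hW1 : (2 * n + 2) ^ (c + 1) < W)
    (hW2 : gridSize K n * (2 * growth n ((2 * n + 2) ^ c) R) < W)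
    (hW3 : gridSize K n * (n * n) < W) (hW4 : ∀ g < gridSize K n, gridLen K g < W)
    (hW5 : 2 * K + gridSize K n + 2 < W) (hW6 : 4 * n < W) :
    wp W (preprocessProg K c P) (fun σ' t => (∀ τ, Online ê τ K 0 σ') ∧
      t ≤ 6 * c + 100 + 20 * lg n + 200 * (n * n) +
        gridSize K n * (2 * halfTime P (m + 1) F R + 300 * (n * n))) (predictionInput ê) 0 := by
  have hn := hH.pos
  have hs := hH.sort_lt
  have hmul : n * n ≤ (2 * (m + 1) + 2) * (2 * (n * n)) := by nlinarith [Nat.zero_le (n * n)]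
  have hedges : EdgeArrays ê (predictionInput ê) :=
    ⟨fun p => by simp [predictionInput], fun p => by simp [predictionInput]⟩
  have hzero : ∀ b, 2 ≤ b → ∀ y, (predictionInput ê).arr b y = 0 := fun b hb y => by
    have h1 : b ≠ 0 := by omega
    have h2 : b ≠ 1 := by omega
    simp [predictionInput, h1, h2]
  have hvar : ∀ x, 2 ≤ x → (predictionInput ê).var x = 0 := fun x hx => by
    have h1 : x ≠ 0 := by omega
    have h2 : x ≠ 1 := by omega
    simp [predictionInput, h1, h2]
  have hb : (setupProg K c).Below 23 0 := by
    have := powProg_below c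
    have h2 : (powProg c).Below 23 0 := by
      clear * -
      induction c with
      | zero => simp [powProg, RamProg.Below]
      | succ c ih => exact ⟨ih, by simp [RamProg.Below]⟩
    simp [setupProg, RamProg.Below, h2]
  rw [preprocessProg, wp_seq]
  refine (wp_setupProg (n := n) (m := m) (K := K) (c := c) (by simp [predictionInput]) (by simp [predictionInput]) hn
    hW1 (by omega) (by omega) hW6).frame_above hb ?_
  rintro σ₁ t₁ u1 a1 ⟨D1, w11, w12, v1, h1⟩
  have a1' : σ₁.arr = (predictionInput ê).arr := funext fun b => a1 b (Nat.zero_le b)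
  have hE1 : EdgeArrays ê σ₁ := ⟨by rw [a1']; exact hedges.tail, by rw [a1']; exact hedges.head⟩
  rw [wp_seq]
  refine (wp_baseProg D1 w11 hE1 hê hn (by omega)).mono ?_
  rintro σ₂ t₂ ⟨v2, a2, pos2, len0, len1, lev0, lev1, h2⟩
  have b60 : σ₂.var 60 = 0 := by
    rw [v2 60 (by norm_num), v1 60 (by omega), hvar 60 (by norm_num)]
  have a2' : ∀ b, 4 < b → ∀ y, σ₂.arr b y = 0 := fun b hb y => by
    rw [a2 b (Or.inr hb), a1']; exact hzero b (by omega) y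
  refine (wp_gridProg (ê := ê) (Γ := gridSize K n) hH (D1.agree (v := 22) (a := 0) le_rfl
    ⟨fun x hx => v2 x (by omega), fun b hb => absurd hb (Nat.not_lt_zero _)⟩)
    (fun a y _ => a2' _ (by omega) y) (by rw [v2 12 (by norm_num), w12]) hK len0 len1 lev0 lev1
    (by omega) hW3 hW4 hW5).mono ?_
  rintro σ₃ t₃ ⟨v3, a3, tab, h3⟩
  have e : ∀ x, x < 22 → σ₃.var x = σ₁.var x := fun x hx => by rw [v3 x hx, v2 x (by omega)]
  refine ⟨fun τ => ⟨?_, ?_, ?_, ?_, ?_, ⟨fun p => ?_, fun p => ?_⟩, tab, fun p => ?_, ?_⟩, by omega⟩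
  · rw [e 10 (by norm_num), D1.v10]
  · rw [e 12 (by norm_num), w12]
  · rw [e 14 (by norm_num), v1 14 (by omega), hvar 14 (by norm_num)]
  · rw [e 16 (by norm_num), D1.v16]
  · rw [e 17 (by norm_num), D1.v17]
  · rw [a3 0 (by norm_num) (by norm_num) (by norm_num), a2 0 (by norm_num)]; exact hE1.tail p
  · rw [a3 1 (by norm_num) (by norm_num) (by norm_num), a2 1 (by norm_num)]; exact hE1.head p
  · rw [a3 4 (by norm_num) (by norm_num) (by norm_num)]; exact pos2 p
  · have z6 : ∀ y, σ₃.arr 6 y = 0 := fun y => by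
      rw [a3 6 (by norm_num) (by norm_num) (by norm_num)]; exact a2' 6 (by norm_num) y
    refine ⟨fun y hy => absurd hy (Nat.not_lt_zero _), fun p _ h => absurd (z6 p) h,
      fun p _ hp => absurd hp (Nat.not_lt_zero _), fun p _ => ?_, ?_⟩
    · refine iff_of_false (not_not.2 (z6 p)) ?_
      rintro ⟨l, hl, -⟩
      exact absurd hl (Nat.not_lt_zero _)
    · rw [e 15 (by norm_num), v1 15 (by omega), hvar 15 (by norm_num)]; simp

/-! ### Insertions -/

open RamExpr in
/-- Put the edge with predicted position `var 22` into the new slot `var 14`, unless the slot with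
the number `var 22` exists; then it goes there, and its content goes to the new slot. -/
def placeProg : RamProg :=
  .ite ((var 22).less (var 14))
    (.assign 23 (read 5 (var 22)) ;; .write 5 (var 14) (var 23) ;;
      .write 6 (var 23) (var 14 + const 1) ;; .write 5 (var 22) (var 22) ;;
      .write 6 (var 22) (var 22 + const 1) ;; .assign 15 (var 15 - const 1))
    (.write 5 (var 14) (var 22) ;; .write 6 (var 22) (var 14 + const 1))

open RamExpr in
/-- If the edge with predicted position `var 14` has been inserted, bring it to its slot. -/
def settleProg : RamProg :=
  .assign 23 (read 6 (var 14)) ;;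
  .ite (var 23)
    (.assign 24 (var 23 - const 1) ;; .assign 25 (read 5 (var 14)) ;; .write 5 (var 24) (var 25) ;;
      .write 6 (var 25) (var 24 + const 1) ;; .write 5 (var 14) (var 14) ;;
      .write 6 (var 14) (var 14 + const 1))
    (.assign 15 (var 15 + const 1)) ;;
  .assign 14 (var 14 + const 1)

open RamExpr in
/-- Insert the edge from `var 0` to `var 1`. -/
def insertProg : RamProg :=
  .assign 22 (read 4 (var 0 * var 10 + var 1)) ;; placeProg ;; settleProg

theorem Slots.d_le {m k f d : ℕ} {I : ℕ → Prop} {A S : ℕ → ℕ} (h : Slots m k f d I A S) : d ≤ f := by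
  rw [← h.missing]; exact Nat.count_le _

theorem wp_placeProg {p d : ℕ} (h14 : σ.var 14 = i) (h22 : σ.var 22 = p) (h15 : σ.var 15 = d)
    (hS : Slots m i i d (Inserted τ i) (σ.arr 5) (σ.arr 6)) (him : i < m) (hp : p < m)
    (hI : ¬ Inserted τ i p) (hW : m + 2 < W) :
    wp W placeProg (fun σ' t => (∀ x, x ≠ 15 → x ≠ 23 → σ'.var x = σ.var x) ∧
      (∀ b, b ≠ 5 → b ≠ 6 → σ'.arr b = σ.arr b) ∧
      Slots m (i + 1) i (σ'.var 15) (fun q => Inserted τ i q ∨ q = p) (σ'.arr 5) (σ'.arr 6) ∧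
      t ≤ t₀ + 40) σ t₀ := by
  have hd := hS.d_le
  rw [placeProg, wp_ite]
  refine ⟨by simp [h22, h14]; split_ifs <;> omega, fun hlt => ?_, fun hge => ?_⟩
  · simp [h22, h14] at hlt
    obtain ⟨hd0, hS'⟩ := hS.insert_early hp hlt hI rfl rfl
    have hA := (hS.slot p hlt).1
    simp only [wp_seq, wp_assign, wp_write]
    refine ⟨by simp [h22]; omega, by simp [h14]; omega, by simp [h22]; omega,
      by simp [h22]; omega, by simp [h14]; omega, by simp [h22]; omega, by simp [h22]; omega,
      by simp [h22]; omega, by simp [h22]; omega, by simp [h15]; omega,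
      fun x h1 h2 => by simp [h1, h2], fun b h1 h2 => by simp [h1, h2], ?_, by simp⟩
    simpa [h22, h14, h15] using hS'
  · simp [h22, h14] at hge
    have hS' := hS.insert_late hp hge hI rfl rfl
    simp only [wp_seq, wp_write]
    refine ⟨by simp [h14]; omega, by simp [h22]; omega, by simp [h22]; omega, by simp [h14]; omega,
      fun x h1 h2 => by simp, fun b h1 h2 => by simp [h1, h2], ?_, by simp⟩
    simpa [h22, h14, h15] using hS'

theorem wp_settleProg {I : ℕ → Prop} (h14 : σ.var 14 = i)
    (hS : Slots m (i + 1) i (σ.var 15) I (σ.arr 5) (σ.arr 6)) (him : i < m) (hW : m + 2 < W) :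
    wp W settleProg (fun σ' t => (∀ x, x < 14 ∨ 15 < x → x < 22 → σ'.var x = σ.var x) ∧
      (∀ b, b ≠ 5 → b ≠ 6 → σ'.arr b = σ.arr b) ∧ σ'.var 14 = i + 1 ∧
      Slots m (i + 1) (i + 1) (σ'.var 15) I (σ'.arr 5) (σ'.arr 6) ∧
      t ≤ t₀ + 60) σ t₀ := by
  have hd := hS.d_le
  have hSi : σ.arr 6 i ≤ m := by
    by_cases h : σ.arr 6 i = 0
    · omega
    · obtain ⟨y, hy, h1, -⟩ := hS.back i him h; omega
  rw [settleProg, wp_seq, wp_assign]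
  refine ⟨by simp [h14]; omega, ?_⟩
  set σ₁ := σ.setVar 23 ((RamExpr.read 6 (RamExpr.var 14)).eval σ) with hσ₁
  have e23 : σ₁.var 23 = σ.arr 6 i := by simp [hσ₁, h14]
  have e14 : σ₁.var 14 = i := by simp [hσ₁, h14]
  rw [wp_seq, wp_ite]
  refine ⟨by rw [RamExpr.fits_var, e23]; omega, fun hne => ?_, fun h0 => ?_⟩
  · simp [e23] at hne
    have hS' := hS.swap him hne rfl rfl
    have hA := (hS.slot i (Nat.lt_succ_self i)).1
    simp only [wp_seq, wp_assign, wp_write]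
    refine ⟨by simp [e23]; omega, by simp [hσ₁, h14]; omega, by simp [e23]; omega,
      by simp [hσ₁, h14]; omega, by simp [hσ₁, h14]; omega, by simp [e23]; omega,
      by simp [e14]; omega, by simp [e14]; omega, by simp [e14]; omega, by simp [e14]; omega,
      by simp [e14]; omega, fun x h1 h2 => ?_, fun b h1 h2 => ?_, ?_, ?_, ?_⟩
    · have j1 : x ≠ 14 := by omega
      have j2 : x ≠ 23 := by omega
      have j3 : x ≠ 24 := by omega
      have j4 : x ≠ 25 := by omega
      simp [hσ₁, j1, j2, j3, j4]
    · simp [h1, h2, hσ₁]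
    · simp [e14]
    · simpa [e14, e23, h14, hσ₁] using hS'
    · simp
  · simp [e23] at h0
    have hS' := hS.skip h0
    simp only [wp_assign]
    refine ⟨by simp [hσ₁]; omega, by simp [e14]; omega, fun x h1 h2 => ?_, fun b h1 h2 => ?_, ?_, ?_, ?_⟩
    · have j1 : x ≠ 14 := by omega
      have j2 : x ≠ 23 := by omega
      have j3 : x ≠ 15 := by omega
      simp [hσ₁, j1, j2, j3]
    · simp [hσ₁]
    · simp [e14]
    · simpa [hσ₁] using hS'
    · simp

theorem wp_insertProg (h : Online ê τ K i σ) (hi : i < m) (hm : n * n + m + 2 < W) :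
    wp W insertProg (fun σ' t => Online ê τ K (i + 1) σ' ∧ t ≤ 120)
      (σ.withPair (ê (τ ⟨i, hi⟩))) 0 := by
  set p := τ ⟨i, hi⟩ with hp
  have hfl := flat_lt (ê p).1.isLt (ê p).2.isLt
  have hnn : n ≤ n * n := Nat.le_mul_self n
  have h1 := (ê p).1.isLt
  have h2 := (ê p).2.isLt
  have hpm := p.isLt
  set σ₀ := σ.withPair (ê p) with hσ₀
  have v0 : ∀ x, 1 < x → σ₀.var x = σ.var x := fun x hx => by
    have j1 : x ≠ 0 := by omega
    have j2 : x ≠ 1 := by omega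
    simp [hσ₀, RamState.withPair, j1, j2]
  have e0 : σ₀.var 0 = (ê p).1 := by simp [hσ₀, RamState.withPair]
  have e1 : σ₀.var 1 = (ê p).2 := by simp [hσ₀, RamState.withPair]
  have a0 : σ₀.arr = σ.arr := rfl
  have e10 : σ₀.var 10 = n := by rw [v0 10 (by norm_num), h.v10]
  rw [insertProg, wp_seq, wp_assign]
  refine ⟨by simp [e0, e1, e10, a0, h.pos]; omega, ?_⟩
  set σ₁ := σ₀.setVar 22 ((RamExpr.read 4 (RamExpr.var 0 * RamExpr.var 10 + RamExpr.var 1)).eval σ₀)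
    with hσ₁
  have v1 : ∀ x, 1 < x → x ≠ 22 → σ₁.var x = σ.var x := fun x hx hx' => by simp [hσ₁, hx', v0 x hx]
  have e22 : σ₁.var 22 = p := by simp [hσ₁, e0, e1, e10, a0, h.pos]
  rw [wp_seq]
  refine (wp_placeProg (τ := τ) (by rw [v1 14 (by norm_num) (by norm_num), h.v14]) e22
    (v1 15 (by norm_num) (by norm_num)) h.slots hi hpm (not_inserted hi) (by omega)).mono ?_
  rintro σ₂ t₂ ⟨v2, a2, hS, ht⟩
  refine (wp_settleProg (by rw [v2 14 (by norm_num) (by norm_num), v1 14 (by norm_num) (by norm_num),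
    h.v14]) hS hi (by omega)).mono ?_
  rintro σ₃ t₃ ⟨v3, a3, e14, hS3, ht3⟩
  have v : ∀ x, 1 < x → x < 14 ∨ 15 < x → x < 22 → σ₃.var x = σ.var x := fun x h1 h2 h3 => by
    rw [v3 x h2 h3, v2 x (by omega) (by omega), v1 x h1 (by omega)]
  have a : ∀ b, b ≠ 5 → b ≠ 6 → σ₃.arr b = σ.arr b := fun b h1 h2 => by
    rw [a3 b h1 h2, a2 b h1 h2]; rfl
  refine ⟨⟨?_, ?_, e14, ?_, ?_, ⟨?_, ?_⟩, ⟨?_, ?_⟩, ?_, ?_⟩, ?_⟩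
  · rw [v 10 (by norm_num) (by norm_num) (by norm_num), h.v10]
  · rw [v 12 (by norm_num) (by norm_num) (by norm_num), h.v12]
  · rw [v 16 (by norm_num) (by norm_num) (by norm_num), h.v16]
  · rw [v 17 (by norm_num) (by norm_num) (by norm_num), h.v17]
  · rw [a 0 (by norm_num) (by norm_num)]; exact h.edges.tail
  · rw [a 1 (by norm_num) (by norm_num)]; exact h.edges.head
  · rw [a 3 (by norm_num) (by norm_num)]; exact h.tables.len
  · rw [a 2 (by norm_num) (by norm_num)]; exact h.tables.level
  · rw [a 4 (by norm_num) (by norm_num)]; exact h.pos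
  · have : Inserted τ (i + 1) = fun q => Inserted τ i q ∨ q = p := by
      funext q; exact propext (inserted_succ hi q)
    rw [this]; exact hS3
  · simp at ht; omega

end

/-! ### Binary search for an estimate -/

open Classical in
/-- The length of the first of the `Γ` levels whose value at the flat index `y` is at most `j`, and
`2 * n` if there is none. The levels are stored in `T` one after the other. -/
noncomputable def tableEstimate (n K Γ j : ℕ) (T : ℕ → ℕ) (y : ℕ) : ℕ :=
  if h : ∃ g, g < Γ ∧ T (g * (n * n) + y) ≤ j then gridLen K (Nat.find h) else 2 * n

section
variable {n m K Γ j η s t W E : ℕ} {T xs ys : ℕ → ℕ} {σ σ' : RamState} {t₀ : ℕ}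
  {ê : Fin m → Fin n × Fin n}

theorem tableEstimate_of_least {y g : ℕ} (hg : g < Γ) (hle : T (g * (n * n) + y) ≤ j)
    (hlt : ∀ g' < g, j < T (g' * (n * n) + y)) : tableEstimate n K Γ j T y = gridLen K g := by
  have h : ∃ g, g < Γ ∧ T (g * (n * n) + y) ≤ j := ⟨g, hg, hle⟩
  rw [tableEstimate, dif_pos h]
  congr 1
  rw [Nat.find_eq_iff]
  exact ⟨⟨hg, hle⟩, fun g' hg' hc => absurd hc.2 (not_le.2 (hlt g' hg'))⟩

theorem tableEstimate_of_none {y : ℕ} (hlt : ∀ g < Γ, j < T (g * (n * n) + y)) :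
    tableEstimate n K Γ j T y = 2 * n := by
  rw [tableEstimate, dif_neg]
  rintro ⟨g, hg, h⟩
  exact absurd h (not_le.2 (hlt g hg))

theorem le_gridLen_last (hK : 0 < K) : n ≤ gridLen K (gridSize K n - 1) := by
  have h1 := le_gridLen_mul (K := K) hK (lg n)
  have h2 := lt_two_pow_lg (n := n)
  have h3 : 2 ^ lg n ≤ K * 2 ^ lg n := Nat.le_mul_of_pos_left _ hK
  have h4 : gridLen K (K * (lg n + 1)) ≤ gridLen K (gridSize K n - 1) :=
    gridLen_mono hK (by rw [gridSize]; omega)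
  omega

/-- The least tabulated length whose table has an entry `≤ j` estimates the distance in the graph of the
first `j` predicted edges. -/
theorem Tables.estimates (h : Tables ê K (gridSize K n) σ) (hK : 0 < K) (hj : j ≤ m) (u v : Fin n) :
    Estimates (graphAt ê j) K (2 * n) u v
      (tableEstimate n K (gridSize K n) j (σ.arr 2) (u * n + v)) := by
  classical
  have hpos : gridSize K n - 1 < gridSize K n := by rw [gridSize]; omega
  by_cases hex : ∃ g, g < gridSize K n ∧ σ.arr 2 (g * (n * n) + (u * n + v)) ≤ j
  · rw [tableEstimate, dif_pos hex]
    obtain ⟨h1, h2⟩ := Nat.find_spec hex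
    refine estimates_of_least hK h.level hj h1 h2 fun g' hg' => ?_
    have h3 := Nat.find_min hex hg'
    by_contra hc
    exact h3 ⟨by omega, not_lt.1 hc⟩
  · rw [tableEstimate, dif_neg hex]
    refine estimates_of_none h.level hj hpos (le_gridLen_last hK) ?_
    by_contra hc
    exact hex ⟨_, hpos, not_lt.1 hc⟩

theorem Tables.mono (h : Tables ê K Γ σ) (hK : 0 < K) (hj : j ≤ m) {y g g' : ℕ} (hy : y < n * n)
    (hgg : g ≤ g') (hg' : g' < Γ) (hle : σ.arr 2 (g * (n * n) + y) ≤ j) :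
    σ.arr 2 (g' * (n * n) + y) ≤ j := by
  have h1 := (h.level g (by omega) ⟨y / n, div_lt_of_lt_sq hy⟩ ⟨y % n, mod_lt_of_lt_sq hy⟩).2 j hj
  have h2 := (h.level g' hg' ⟨y / n, div_lt_of_lt_sq hy⟩ ⟨y % n, mod_lt_of_lt_sq hy⟩).2 j hj
  simp only [Nat.div_add_mod'] at h1 h2
  obtain ⟨k, hk, hw⟩ := h1.1 hle
  exact h2.2 ⟨k, hk.trans (gridLen_mono hK hgg), hw⟩

/-- The numbers that occur in the service of a query: the graph of the first `j` predicted edges is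
given by the tables `T`, the `η` further edges lead from `xs c` to `ys c`. The predicate
collects what the word size has to accommodate, and that the levels are nested. -/
structure QueryBounds (n K j η s t W E : ℕ) (T xs ys : ℕ → ℕ) : Prop where
  s_lt : s < n
  t_lt : t < n
  xs_lt : ∀ c < η, xs c < n
  ys_lt : ∀ c < η, ys c < n
  table_lt : ∀ g < gridSize K n, ∀ y < n * n, T (g * (n * n) + y) < W
  mono : ∀ y < n * n, ∀ g g', g ≤ g' → g' < gridSize K n → T (g * (n * n) + y) ≤ j →
    T (g' * (n * n) + y) ≤ j
  len_le : ∀ g < gridSize K n, gridLen K g ≤ E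
  dim_le : 2 * n ≤ E
  lt : 3 * E + 5 < W
  index_lt : gridSize K n * (n * n) + 2 * gridSize K n + 2 < W
  slot_lt : j + η + 2 < W

/-- The memory while a query is served. -/
structure QueryState (n K j η s t W : ℕ) (T xs ys : ℕ → ℕ) (σ : RamState) : Prop where
  v0 : σ.var 0 = s
  v1 : σ.var 1 = t
  v10 : σ.var 10 = n
  v12 : σ.var 12 = gridSize K n
  v16 : σ.var 16 = n * n
  v17 : σ.var 17 = 2 * n
  v22 : σ.var 22 = j
  v23 : σ.var 23 = η
  table : σ.arr 2 = T
  len : ∀ g < gridSize K n, σ.arr 3 g = gridLen K g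
  slot : ∀ c < η, σ.arr 5 (j + c) < W ∧ σ.arr 0 (σ.arr 5 (j + c)) = xs c ∧
    σ.arr 1 (σ.arr 5 (j + c)) = ys c

theorem QueryState.agree {v a : ℕ} (h : QueryState n K j η s t W T xs ys σ) (hA : Agree v a σ σ')
    (hv : 24 ≤ v) (ha : 7 ≤ a) : QueryState n K j η s t W T xs ys σ' := by
  have hv' : ∀ x < 24, σ'.var x = σ.var x := fun x hx => hA.1 x (by omega)
  have ha' : ∀ b < 7, σ'.arr b = σ.arr b := fun b hb => hA.2 b (by omega)
  refine ⟨?_, ?_, ?_, ?_, ?_, ?_, ?_, ?_, ?_, ?_, ?_⟩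
  · rw [hv' 0 (by norm_num), h.v0]
  · rw [hv' 1 (by norm_num), h.v1]
  · rw [hv' 10 (by norm_num), h.v10]
  · rw [hv' 12 (by norm_num), h.v12]
  · rw [hv' 16 (by norm_num), h.v16]
  · rw [hv' 17 (by norm_num), h.v17]
  · rw [hv' 22 (by norm_num), h.v22]
  · rw [hv' 23 (by norm_num), h.v23]
  · rw [ha' 2 (by norm_num), h.table]
  · rw [ha' 3 (by norm_num)]; exact h.len
  · rw [ha' 5 (by norm_num), ha' 0 (by norm_num), ha' 1 (by norm_num)]; exact h.slot

theorem tableEstimate_le (hB : QueryBounds n K j η s t W E T xs ys) (y : ℕ) :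
    tableEstimate n K (gridSize K n) j T y ≤ E := by
  classical
  rw [tableEstimate]
  split_ifs with h
  · exact hB.len_le _ (Nat.find_spec h).1
  · exact hB.dim_le

open RamExpr in
/-- Binary search for the estimate at the flat index `var 31`, which goes to `var 32`. -/
def estProg : RamProg :=
  .assign 32 (const 0) ;; .assign 33 (var 12) ;;
  .loop ((var 32).less (var 33))
    (.assign 34 ((var 32 + var 33) / const 2) ;;
      .ite ((var 22).less (read 2 (var 34 * var 16 + var 31)))
        (.assign 32 (var 34 + const 1)) (.assign 33 (var 34))) ;;
  .ite ((var 32).less (var 12)) (.assign 32 (read 3 (var 32))) (.assign 32 (var 17))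

theorem estProg_above : estProg.Above 32 10 := by simp [estProg, RamProg.Above]

/-- The time of a binary search over the levels. -/
def searchTime (K n : ℕ) : ℕ := 26 * lg (gridSize K n) + 20

theorem wp_estProg {y : ℕ} (hB : QueryBounds n K j η s t W E T xs ys)
    (hQ : QueryState n K j η s t W T xs ys σ) (h31 : σ.var 31 = y) (hy : y < n * n) :
    wp W estProg (fun σ' t' => σ'.var 32 = tableEstimate n K (gridSize K n) j T y ∧
      t' ≤ t₀ + searchTime K n) σ t₀ := by
  have hlt := hB.lt
  have hidx := hB.index_lt
  have hsl := hB.slot_lt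
  have hd := hB.dim_le
  have h1W : 1 < W := by omega
  set Γ := gridSize K n with hΓ
  have hΓpos : 2 ≤ Γ := by rw [hΓ, gridSize]; omega
  have hst : searchTime K n = 26 * lg Γ + 20 := rfl
  simp only [estProg, wp_seq, wp_assign]
  refine ⟨by simp; omega, by simp [hQ.v12, ← hΓ]; omega, ?_⟩
  refine wp_loop (v := 32) (a := 10) (fun σ' t' => ∃ lo hi r, σ'.var 32 = lo ∧ σ'.var 33 = hi ∧
    lo ≤ hi ∧ hi ≤ Γ ∧ (∀ g < lo, j < T (g * (n * n) + y)) ∧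
    (∀ g, hi ≤ g → g < Γ → T (g * (n * n) + y) ≤ j) ∧ hi - lo < 2 ^ r ∧
    t' + 26 * r ≤ t₀ + 26 * lg Γ + 4) (fun σ' => σ'.var 33 - σ'.var 32)
    (by simp [RamProg.Above]) ?_ ?_
  · refine ⟨0, Γ, lg Γ, by simp, by simp [hQ.v12, hΓ], Nat.zero_le _, le_rfl,
      fun g hg => absurd hg (Nat.not_lt_zero _), fun g h1 h2 => absurd h1 (not_le.2 h2), ?_, ?_⟩
    · exact lt_two_pow_lg
    · simp; omega
  rintro σ₁ t₁ hag ⟨lo, hi, r, h32, h33, hle, hhi, hlo', hhi', hr, ht⟩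
  have hv : ∀ x < 32, σ₁.var x = σ.var x := fun x hx => by
    have j1 : x ≠ 32 := by omega
    have j2 : x ≠ 33 := by omega
    rw [hag.1 x hx]; simp [j1, j2]
  have ha : ∀ b < 10, σ₁.arr b = σ.arr b := fun b hb => by rw [hag.2 b hb]; rfl
  have e12 : σ₁.var 12 = Γ := by rw [hv 12 (by norm_num), hQ.v12]
  have e16 : σ₁.var 16 = n * n := by rw [hv 16 (by norm_num), hQ.v16]
  have e17 : σ₁.var 17 = 2 * n := by rw [hv 17 (by norm_num), hQ.v17]
  have e22 : σ₁.var 22 = j := by rw [hv 22 (by norm_num), hQ.v22]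
  have e31 : σ₁.var 31 = y := by rw [hv 31 (by norm_num), h31]
  have a2 : σ₁.arr 2 = T := by rw [ha 2 (by norm_num), hQ.table]
  refine ⟨by simp [h32, h33, h1W]; omega, fun hc => ?_, fun hc => ?_⟩
  · simp [h32, h33] at hc
    have hr0 : r ≠ 0 := by rintro rfl; simp at hr; omega
    obtain ⟨r, rfl⟩ := Nat.exists_eq_succ_of_ne_zero hr0
    rw [Nat.succ_eq_add_one, pow_succ] at hr
    set mid := (lo + hi) / 2 with hmid
    have hm1 : mid < hi := by omega
    have hm2 : lo ≤ mid := by omega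
    have hb := gridProg_bound (n := n) (Γ := Γ) (g := mid) (by omega)
    have htab := hB.table_lt mid (by omega) y hy
    simp only [wp_seq, wp_assign, wp_ite]
    refine ⟨by simp [h32, h33]; omega, by simp [h32, h33, e22, e16, e31, a2, h1W, ← hmid]; omega, ?_, ?_⟩
    · intro hc2
      simp [h32, h33, e22, e16, e31, a2, ← hmid] at hc2
      refine ⟨by simp [h32, h33]; omega, ⟨mid + 1, hi, r, by simp [h32, h33, hmid], by simp [h33],
        by omega, hhi, fun g hg => ?_, hhi', by omega, by simp; omega⟩,
        by simp [h32, h33]; omega⟩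
      by_contra hcon
      have := hB.mono y hy g mid (by omega) (by omega) (not_lt.1 hcon)
      omega
    · intro hc2
      simp [h32, h33, e22, e16, e31, a2, ← hmid] at hc2
      refine ⟨by simp [h32, h33]; omega, ⟨lo, mid, r, by simp [h32], by simp [h32, h33, hmid],
        by omega, by omega, hlo', fun g hg1 hg2 => ?_, by omega, by simp; omega⟩,
        by simp [h32, h33]; omega⟩
      exact hB.mono y hy mid g hg1 hg2 hc2
  · simp [h32, h33] at hc
    have heq : lo = hi := by omega
    rw [wp_ite]
    refine ⟨by simp [h32, e12, h1W]; omega, fun hc2 => ?_, fun hc2 => ?_⟩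
    · simp [h32, e12] at hc2
      have hlen := hB.len_le lo hc2
      have e3 : σ₁.arr 3 lo = gridLen K lo := by rw [ha 3 (by norm_num), hQ.len lo hc2]
      rw [wp_assign]
      refine ⟨by simp [h32, e3]; omega, ?_, ?_⟩
      · simp only [RamState.var_setVar, if_true, RamExpr.eval_read, RamExpr.eval_var, h32, e3]
        exact (tableEstimate_of_least hc2 (hhi' lo (by omega) hc2) hlo').symm
      · simp [hst]; omega
    · simp [h32, e12] at hc2
      rw [wp_assign]
      refine ⟨by simp [e17]; omega, ?_, ?_⟩
      · simp only [RamState.var_setVar, if_true, RamExpr.eval_var, e17]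
        exact (tableEstimate_of_none fun g hg => hlo' g (by omega)).symm
      · simp [hst]; omega

/-! ### The shortest-path algorithm on the edges outside of the prefix -/

/-- The invariant of Dijkstra's algorithm on the nodes `< η`, with edge lengths `w`, initial
distances `start`, and finished nodes `F`. The soundness `P c d` of a distance `d` is left open. -/
structure Dijkstra (η : ℕ) (w : ℕ → ℕ → ℕ) (start : ℕ → ℕ) (P : ℕ → ℕ → Prop) (F : Finset ℕ)
    (D : ℕ → ℕ) : Prop where
  step : ∀ c ∈ F, ∀ c' < η, D c' ≤ D c + w c c'
  le : ∀ c ∈ F, ∀ c' < η, c' ∉ F → D c ≤ D c'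
  start : ∀ c < η, D c ≤ start c
  sound : ∀ c < η, P c (D c)

/-- One round of Dijkstra's algorithm finishes a node `c` of least distance. The edge lengths need only
be nonnegative, so they may come from estimates that violate the triangle inequality. -/
theorem Dijkstra.settle {w : ℕ → ℕ → ℕ} {start : ℕ → ℕ} {P : ℕ → ℕ → Prop} {F : Finset ℕ}
    {D D' : ℕ → ℕ} {c : ℕ} (h : Dijkstra η w start P F D) (hF : F ⊆ Finset.range η) (hc : c < η)
    (hcF : c ∉ F) (hmin : ∀ c' < η, c' ∉ F → D c ≤ D c')
    (hD : ∀ c' < η, D' c' = min (D c') (D c + w c c'))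
    (hs : ∀ c' < η, P c (D c) → P c' (D c + w c c')) :
    Dijkstra η w start P (insert c F) D' := by
  have hDc : D' c = D c := by rw [hD c hc]; omega
  have hDF : ∀ a ∈ F, D' a = D a := fun a ha => by
    rw [hD a (Finset.mem_range.1 (hF ha))]
    have := h.le a ha c hc hcF
    omega
  refine ⟨fun a ha c' hc' => ?_, fun a ha c' hc' hcF' => ?_, fun c' hc' => ?_, fun c' hc' => ?_⟩
  · rcases Finset.mem_insert.1 ha with rfl | ha
    · rw [hDc, hD c' hc']; omega
    · have := h.step a ha c' hc'
      rw [hDF a ha, hD c' hc']; omega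
  · rw [Finset.mem_insert, not_or] at hcF'
    have h1 := hmin c' hc' hcF'.2
    rcases Finset.mem_insert.1 ha with rfl | ha
    · rw [hDc, hD c' hc']; omega
    · have := h.le a ha c hc hcF
      rw [hDF a ha, hD c' hc']; omega
  · have := h.start c' hc'
    rw [hD c' hc']; omega
  · rw [hD c' hc']
    rcases min_choice (D c') (D c + w c c') with h1 | h1
    · rw [h1]; exact h.sound c' hc'
    · rw [h1]; exact hs c' hc' (h.sound c hc)

end

section
variable {n m K Γ j η s t W E d i : ℕ} {T xs ys D A S : ℕ → ℕ} {σ σ' : RamState} {t₀ : ℕ}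
  {ê : Fin m → Fin n × Fin n} {I : ℕ → Prop}

open RamExpr in
/-- Find the first slot that does not hold the edge with its number, by walking down from slot
`var 14` until all the `var 15` slots of this kind are passed. The slot goes to `var 22`, the number
of the slots from there on to `var 23`. -/
def prefixProg : RamProg :=
  .assign 22 (var 14) ;; .assign 23 (var 15) ;;
  .loop (var 23)
    (.assign 22 (var 22 - const 1) ;;
      .ite ((read 5 (var 22)).same (var 22)) .skip (.assign 23 (var 23 - const 1))) ;;
  .assign 23 (var 14 - var 22)

theorem wp_prefixProg (h14 : σ.var 14 = i) (h15 : σ.var 15 = d)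
    (hS : Slots m i i d I (σ.arr 5) S) (him : i ≤ m) (hW : m + 2 < W) :
    wp W prefixProg (fun σ' t' => ∃ j ≤ i, σ'.var 22 = j ∧ σ'.var 23 = i - j ∧
      (∀ y < j, S y ≠ 0) ∧ (j = i ∨ S j = 0) ∧ t' ≤ t₀ + 20 * (i - j) + 20) σ t₀ := by
  have hd := hS.d_le
  have h1W : 1 < W := by omega
  simp only [prefixProg, wp_seq, wp_assign]
  refine ⟨by simp [h14]; omega, by simp [h15]; omega, ?_⟩
  refine wp_loop (v := 22) (a := 10) (fun σ' t' => ∃ y ≤ i, σ'.var 22 = y ∧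
      σ'.var 23 = Nat.count (fun p => S p = 0) y ∧ (y = i ∨ S y = 0 ∨ 0 < σ'.var 23) ∧
      t' ≤ t₀ + 20 * (i - y) + 4) (fun σ' => σ'.var 22) (by simp [RamProg.Above]) ?_ ?_
  · exact ⟨i, le_rfl, by simp [h14], by simp [h15, hS.missing], Or.inl rfl, by simp⟩
  rintro σ₁ t₁ hag ⟨y, hy, h22, h23, hor, ht⟩
  have e14 : σ₁.var 14 = i := by rw [hag.1 14 (by norm_num)]; simp [h14]
  have e5 : σ₁.arr 5 = σ.arr 5 := by rw [hag.2 5 (by norm_num)]; rfl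
  have hcle : Nat.count (fun p => S p = 0) y ≤ y := Nat.count_le _
  refine ⟨by rw [RamExpr.fits_var, h23]; omega, fun hc => ?_, fun hc => ?_⟩
  · rw [RamExpr.eval_var, h23] at hc
    obtain ⟨y, rfl⟩ : ∃ z, y = z + 1 := ⟨y - 1, by omega⟩
    have hA := (hS.slot y (by omega)).1
    have hiff := hS.home_iff him (y := y) (by omega)
    rw [Nat.count_succ] at h23 hc hcle
    simp only [wp_seq, wp_assign, wp_ite, wp_skip]
    refine ⟨by simp [h22]; omega, by simp [h22, e5, h1W]; omega, fun hc2 => ?_, fun hc2 => ?_⟩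
    · simp [h22, e5] at hc2
      rw [if_neg (hiff.1 hc2)] at h23 hc
      exact ⟨⟨y, by omega, by simp [h22], by simp [h23], Or.inr (Or.inr (by simp; omega)),
        by simp; omega⟩, by simp [h22]⟩
    · simp [h22, e5] at hc2
      have hS0 : S y = 0 := by by_contra hcon; exact hc2 (hiff.2 hcon)
      rw [if_pos hS0] at h23 hcle
      exact ⟨by simp [h23]; omega, ⟨y, by omega, by simp [h22], by simp [h23], Or.inr (Or.inl hS0),
        by simp; omega⟩, by simp [h22]⟩
  · rw [RamExpr.eval_var] at hc
    rw [wp_assign]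
    refine ⟨by simp [e14, h22]; omega, y, hy, by simp [h22], by simp [e14, h22], ?_, by omega,
      by simp; omega⟩
    intro z hz hS0
    have h1 : Nat.count (fun p => S p = 0) (z + 1) ≤ Nat.count (fun p => S p = 0) y :=
      Nat.count_monotone _ hz
    rw [Nat.count_succ, if_pos hS0] at h1
    omega

open RamExpr in
/-- The tail of the edge in the slot with number `e` outside of the prefix. -/
def tailExpr (e : RamExpr) : RamExpr := read 0 (read 5 (var 22 + e))

open RamExpr in
/-- The head of the edge in the slot with number `e` outside of the prefix. -/
def headExpr (e : RamExpr) : RamExpr := read 1 (read 5 (var 22 + e))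

theorem QueryState.tailExpr (hQ : QueryState n K j η s t W T xs ys σ)
    (hB : QueryBounds n K j η s t W E T xs ys) {e : RamExpr} {c : ℕ} (he : e.eval σ = c)
    (hc : c < η) (hf : e.Fits W σ) :
    (tailExpr e).Fits W σ ∧ (tailExpr e).eval σ = xs c := by
  obtain ⟨h1, h2, h3⟩ := hQ.slot c hc
  have h4 := hB.xs_lt c hc
  have h5 := hB.slot_lt
  have h6 := hB.lt
  have h7 := hB.dim_le
  simp [_root_.tailExpr, hQ.v22, he, h2, hf, h1]
  omega

theorem QueryState.headExpr (hQ : QueryState n K j η s t W T xs ys σ)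
    (hB : QueryBounds n K j η s t W E T xs ys) {e : RamExpr} {c : ℕ} (he : e.eval σ = c)
    (hc : c < η) (hf : e.Fits W σ) :
    (headExpr e).Fits W σ ∧ (headExpr e).eval σ = ys c := by
  obtain ⟨h1, h2, h3⟩ := hQ.slot c hc
  have h4 := hB.ys_lt c hc
  have h5 := hB.slot_lt
  have h6 := hB.lt
  have h7 := hB.dim_le
  simp [_root_.headExpr, hQ.v22, he, h3, hf, h1]
  omega

open RamExpr in
/-- The estimate of the distance from `e` to `f` in the graph of the prefix goes to `var 32`. -/
def distProg (e f : RamExpr) : RamProg := .assign 31 (e * var 10 + f) ;; estProg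

theorem wp_distProg {e f : RamExpr} {u v : ℕ} {Q : RamState → ℕ → Prop}
    (hB : QueryBounds n K j η s t W E T xs ys)
    (hQ : QueryState n K j η s t W T xs ys σ) (he : e.Fits W σ ∧ e.eval σ = u)
    (hf : f.Fits W σ ∧ f.eval σ = v) (hu : u < n) (hv : v < n)
    (hPost : ∀ σ' t', Agree 31 10 σ σ' →
      σ'.var 32 = tableEstimate n K (gridSize K n) j T (u * n + v) →
      t' ≤ t₀ + (searchTime K n + e.cost + f.cost + 5) → Q σ' t') :
    wp W (distProg e f) Q σ t₀ := by
  have hfl := flat_lt hu hv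
  have hidx := hB.index_lt
  have h1 : 1 * (n * n) ≤ gridSize K n * (n * n) :=
    Nat.mul_le_mul_right _ (by rw [gridSize]; omega)
  have hnn : n ≤ n * n := Nat.le_mul_self n
  have h2 := he.1.eval_lt
  have h3 := hf.1.eval_lt
  rw [distProg, wp_seq, wp_assign]
  refine ⟨?_, ?_⟩
  · simp only [RamExpr.fits_add, RamExpr.fits_mul, RamExpr.fits_var, RamExpr.eval_mul,
      RamExpr.eval_var, he, hf, hQ.v10, true_and]
    refine ⟨⟨by omega, by omega⟩, by omega⟩
  have hag : Agree 31 10 σ (σ.setVar 31 ((e * RamExpr.var 10 + f).eval σ)) :=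
    ⟨fun x hx => by have : x ≠ 31 := by omega
                    simp [this], fun b hb => rfl⟩
  refine (wp_estProg hB (hQ.agree hag (by norm_num) (by norm_num)) (y := u * n + v)
    (by simp [he, hf, hQ.v10]) hfl).frame estProg_above ?_
  rintro σ₁ t₁ hag1 ⟨h32, ht⟩
  refine hPost σ₁ t₁ (hag.trans ⟨fun x hx => hag1.1 x (by omega), hag1.2⟩) h32 ?_
  simp at ht; omega

open RamExpr in
/-- Initialize the distances in array `7`, and the marks of the finished nodes in array `8`. -/
def startProg : RamProg :=
  forLoop 30 23 (distProg (var 0) (tailExpr (var 30)) ;; .write 7 (var 30) (var 32 + const 1) ;;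
    .write 8 (var 30) (const 0))

theorem startProg_above : startProg.Above 30 7 := by
  simp [startProg, forLoop_above, distProg, estProg, RamProg.Above]

theorem wp_startProg (hB : QueryBounds n K j η s t W E T xs ys)
    (hQ : QueryState n K j η s t W T xs ys σ) :
    wp W startProg (fun σ' t' => (∀ c < η,
        σ'.arr 7 c = tableEstimate n K (gridSize K n) j T (s * n + xs c) + 1 ∧ σ'.arr 8 c = 0) ∧
      t' ≤ t₀ + η * (searchTime K n + 40) + 10) σ t₀ := by
  have hlt := hB.lt
  have hd := hB.dim_le
  have hsl := hB.slot_lt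
  have hs := hB.s_lt
  have h1W : 1 < W := by omega
  refine wp_forLoop (v := 30) (a := 7) (fun c σ' t' => (∀ c' < c,
      σ'.arr 7 c' = tableEstimate n K (gridSize K n) j T (s * n + xs c') + 1 ∧ σ'.arr 8 c' = 0) ∧
      t' ≤ t₀ + c * (searchTime K n + 40) + 2) η
    (by simp [distProg, estProg, RamProg.Above]) le_rfl (by norm_num) hQ.v23 (by omega) h1W
    (by simp) ?_ ?_
  · rintro c hc σ₁ t₁ h30 hag ⟨hD, ht⟩
    have hQ1 := hQ.agree hag (by norm_num) (by norm_num)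
    rw [wp_seq]
    refine wp_distProg hB hQ1 (u := s) (v := xs c) ⟨by simp [hQ1.v0]; omega, hQ1.v0⟩
      (hQ1.tailExpr hB h30 hc (by simp [h30]; omega)) hs (hB.xs_lt c hc) ?_
    intro σ₂ t₂ hag2 h32 ht2
    have hle := tableEstimate_le hB (s * n + xs c)
    have e30 : σ₂.var 30 = c := by rw [hag2.1 30 (by norm_num), h30]
    simp only [wp_seq, wp_write]
    refine ⟨by simp [e30]; omega, by simp [h32]; omega, by simp [e30]; omega, by simp; omega,
      by simp [e30], fun c' hc' => ?_, ?_⟩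
    · rcases Nat.lt_succ_iff_lt_or_eq.1 hc' with h | rfl
      · have hne : c' ≠ c := by omega
        simp [e30, hne, hag2.2 7 (by norm_num), hag2.2 8 (by norm_num), hD c' h]
      · simp [e30, h32]
    · simp [tailExpr] at ht2 ⊢
      rw [Nat.add_mul]; omega
  · rintro σ₁ t₁ - - ⟨h1, h2⟩
    exact ⟨h1, by omega⟩

open RamExpr in
/-- The unfinished node of smallest distance goes to `var 26`; it is `var 23` if there is none. -/
def selectProg : RamProg :=
  .assign 26 (var 23) ;;
  forLoop 30 23 (.ite (read 8 (var 30)) .skip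
    (.ite ((var 26).less (var 23))
      (.ite ((read 7 (var 30)).less (read 7 (var 26))) (.assign 26 (var 30)) .skip)
      (.assign 26 (var 30))))

theorem selectProg_above : selectProg.Above 26 10 := by
  simp [selectProg, forLoop_above, RamProg.Above]

theorem wp_selectProg {F : Finset ℕ} (h23 : σ.var 23 = η)
    (hD : ∀ c < η, σ.arr 7 c < W) (hF : ∀ c < η, σ.arr 8 c < W ∧ (σ.arr 8 c ≠ 0 ↔ c ∈ F))
    (hex : ∃ c < η, c ∉ F) (hW : η + 2 < W) :
    wp W selectProg (fun σ' t' => (∃ c < η, σ'.var 26 = c ∧ c ∉ F ∧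
      ∀ c' < η, c' ∉ F → σ.arr 7 c ≤ σ.arr 7 c') ∧ t' ≤ t₀ + η * 40 + 10) σ t₀ := by
  have h1W : 1 < W := by omega
  rw [selectProg, wp_seq, wp_assign]
  refine ⟨by simp [h23]; omega, ?_⟩
  set σ₀ := σ.setVar 26 ((RamExpr.var 23).eval σ) with hσ₀
  have e26 : σ₀.var 26 = η := by simp [hσ₀, h23]
  refine wp_forLoop (v := 26) (a := 10) (fun c σ' t' =>
      ((σ'.var 26 = η ∧ ∀ c' < c, c' ∈ F) ∨ (σ'.var 26 < η ∧ σ'.var 26 ∉ F ∧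
        ∀ c' < c, c' ∉ F → σ.arr 7 (σ'.var 26) ≤ σ.arr 7 c')) ∧ t' ≤ t₀ + c * 40 + 4) η
    (by simp [RamProg.Above]) (by norm_num) (by norm_num) (by simp [hσ₀, h23]) (by omega) h1W
    ⟨Or.inl ⟨by simp [e26], by simp⟩, by simp⟩ ?_ ?_
  · rintro c hc σ₁ t₁ h30 hag ⟨hor, ht⟩
    have a7 : σ₁.arr 7 = σ.arr 7 := by rw [hag.2 7 (by norm_num)]; rfl
    have a8 : σ₁.arr 8 = σ.arr 8 := by rw [hag.2 8 (by norm_num)]; rfl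
    have e23 : σ₁.var 23 = η := by rw [hag.1 23 (by norm_num)]; simp [hσ₀, h23]
    have hDc := hD c hc
    obtain ⟨hF1, hF2⟩ := hF c hc
    have h26 : σ₁.var 26 ≤ η := by omega
    simp only [wp_ite, wp_skip, wp_assign]
    refine ⟨by simp [h30, a8]; omega, fun hc1 => ?_, fun hc1 => ?_⟩
    · simp only [RamExpr.eval_read, RamExpr.eval_var, h30, a8] at hc1
      have hcF := hF2.1 hc1
      refine ⟨h30, ?_, by simp; omega⟩
      rcases hor with ⟨h1, h2⟩ | ⟨h1, h2, h3⟩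
      · refine Or.inl ⟨by simpa using h1, fun c' hc' => ?_⟩
        rcases Nat.lt_succ_iff_lt_or_eq.1 hc' with h | rfl
        · exact h2 c' h
        · exact hcF
      · refine Or.inr ⟨by simpa using h1, by simpa using h2, fun c' hc' hn => ?_⟩
        rcases Nat.lt_succ_iff_lt_or_eq.1 hc' with h | rfl
        · simpa using h3 c' h hn
        · exact absurd hcF hn
    · simp only [RamExpr.eval_read, RamExpr.eval_var, h30, a8] at hc1
      have hcF : c ∉ F := fun h => absurd hc1 (hF2.2 h)
      refine ⟨by simp [e23, h1W]; omega, fun hc2 => ?_, fun hc2 => ?_⟩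
      · simp [e23] at hc2
        have hD2 := hD _ hc2
        obtain ⟨h2, h3⟩ : σ₁.var 26 ∉ F ∧
            ∀ c' < c, c' ∉ F → σ.arr 7 (σ₁.var 26) ≤ σ.arr 7 c' := by
          rcases hor with ⟨h1, -⟩ | ⟨-, h⟩
          · omega
          · exact h
        refine ⟨by simp [h30, a7, h1W]; omega, fun hc3 => ?_, fun hc3 => ?_⟩
        · simp [h30, a7] at hc3
          refine ⟨by simp [h30]; omega, by simp [h30], Or.inr ⟨by simp [h30]; omega,
            by simpa [h30] using hcF, fun c' hc' hn => ?_⟩, by simp; omega⟩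
          rcases Nat.lt_succ_iff_lt_or_eq.1 hc' with h | rfl
          · have := h3 c' h hn
            simp [h30]; omega
          · simp [h30]
        · simp [h30, a7] at hc3
          refine ⟨h30, Or.inr ⟨by simpa using hc2, by simpa using h2, fun c' hc' hn => ?_⟩,
            by simp; omega⟩
          rcases Nat.lt_succ_iff_lt_or_eq.1 hc' with h | rfl
          · simpa using h3 c' h hn
          · simpa using hc3
      · simp [e23] at hc2
        have hall : ∀ c' < c, c' ∈ F := by
          rcases hor with ⟨-, h⟩ | ⟨h, -⟩
          · exact h
          · omega
        refine ⟨by simp [h30]; omega, by simp [h30], Or.inr ⟨by simp [h30]; omega,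
          by simpa [h30] using hcF, fun c' hc' hn => ?_⟩, by simp; omega⟩
        rcases Nat.lt_succ_iff_lt_or_eq.1 hc' with h | rfl
        · exact absurd (hall c' h) hn
        · simp [h30]
  · rintro σ₁ t₁ - - ⟨hor, ht⟩
    refine ⟨?_, by omega⟩
    rcases hor with ⟨-, h⟩ | ⟨h1, h2, h3⟩
    · obtain ⟨c, hc, hn⟩ := hex
      exact absurd (h c hc) hn
    · exact ⟨_, h1, rfl, h2, h3⟩

open RamExpr in
/-- Relax the edges that leave the node `var 26`. -/
def relaxProg : RamProg :=
  forLoop 30 23 (distProg (headExpr (var 26)) (tailExpr (var 30)) ;;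
    .assign 32 (read 7 (var 26) + (var 32 + const 1)) ;;
    .ite ((var 32).less (read 7 (var 30))) (.write 7 (var 30) (var 32)) .skip)

theorem relaxProg_above : relaxProg.Above 30 7 := by
  simp [relaxProg, forLoop_above, distProg, estProg, RamProg.Above]

theorem wp_relaxProg {a : ℕ} (hB : QueryBounds n K j η s t W E T xs ys)
    (hQ : QueryState n K j η s t W T xs ys σ) (h26 : σ.var 26 = a) (ha : a < η)
    (hD : ∀ c < η, σ.arr 7 c ≤ E + 1) :
    wp W relaxProg (fun σ' t' => (∀ c < η, σ'.arr 7 c = min (σ.arr 7 c)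
        (σ.arr 7 a + (tableEstimate n K (gridSize K n) j T (ys a * n + xs c) + 1))) ∧
      σ'.arr 8 = σ.arr 8 ∧ t' ≤ t₀ + η * (searchTime K n + 50) + 10) σ t₀ := by
  have hlt := hB.lt
  have hd := hB.dim_le
  have hsl := hB.slot_lt
  have h1W : 1 < W := by omega
  have hDa := hD a ha
  refine wp_forLoop (v := 30) (a := 7) (fun c σ' t' =>
      (∀ c' < c, σ'.arr 7 c' = min (σ.arr 7 c')
        (σ.arr 7 a + (tableEstimate n K (gridSize K n) j T (ys a * n + xs c') + 1))) ∧
      (∀ c', c ≤ c' → σ'.arr 7 c' = σ.arr 7 c') ∧ σ'.arr 8 = σ.arr 8 ∧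
      t' ≤ t₀ + c * (searchTime K n + 50) + 2) η
    (by simp [distProg, estProg, RamProg.Above]) le_rfl (by norm_num) hQ.v23 (by omega) h1W
    (by simp) ?_ ?_
  · rintro c hc σ₁ t₁ h30 hag ⟨hlow, hhigh, h8, ht⟩
    have hQ1 := hQ.agree hag (by norm_num) (by norm_num)
    have e26 : σ₁.var 26 = a := by rw [hag.1 26 (by norm_num), h26]
    -- The distance of the node `a` itself is not changed by the relaxation.
    have hDa1 : σ₁.arr 7 a = σ.arr 7 a := by
      rcases lt_or_ge a c with h | h
      · rw [hlow a h]; omega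
      · exact hhigh a h
    have hDc1 := hhigh c le_rfl
    have hDc := hD c hc
    rw [wp_seq]
    refine wp_distProg hB hQ1 (u := ys a) (v := xs c)
      (hQ1.headExpr hB e26 ha (by simp [e26]; omega))
      (hQ1.tailExpr hB h30 hc (by simp [h30]; omega)) (hB.ys_lt a ha) (hB.xs_lt c hc) ?_
    intro σ₂ t₂ hag2 h32 ht2
    have hle := tableEstimate_le hB (ys a * n + xs c)
    have g30 : σ₂.var 30 = c := by rw [hag2.1 30 (by norm_num), h30]
    have g26 : σ₂.var 26 = a := by rw [hag2.1 26 (by norm_num), e26]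
    have g7 := hag2.2 7 (by norm_num)
    have g8 := hag2.2 8 (by norm_num)
    simp only [tailExpr, headExpr, RamExpr.cost_read, RamExpr.cost_add, RamExpr.cost_var] at ht2
    simp only [wp_seq, wp_assign, wp_ite, wp_write, wp_skip]
    refine ⟨by simp [g26, g7, hDa1, h32]; omega,
      by simp [g26, g30, g7, hDa1, hDc1, h32, h1W]; omega, fun hc1 => ?_, fun hc1 => ?_⟩
    · simp [g26, g30, g7, hDa1, hDc1, h32] at hc1
      refine ⟨by simp [g30]; omega, by simp [g26, g7, hDa1, h32]; omega, by simp [g30],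
        fun c' hc' => ?_, fun c' hc' => ?_, by simp [g8, h8], by simp; rw [Nat.add_mul]; omega⟩
      · rcases Nat.lt_succ_iff_lt_or_eq.1 hc' with h | rfl
        · have hne : c' ≠ c := by omega
          simp [g30, hne, g7, hlow c' h]
        · simp [g30, g26, g7, hDa1, h32]; omega
      · have hne : c' ≠ c := by omega
        simp [g30, hne, g7, hhigh c' (by omega)]
    · simp [g26, g30, g7, hDa1, hDc1, h32] at hc1
      refine ⟨by simp [g30], fun c' hc' => ?_, fun c' hc' => ?_, by simp [g8, h8],
        by simp; rw [Nat.add_mul]; omega⟩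
      · rcases Nat.lt_succ_iff_lt_or_eq.1 hc' with h | rfl
        · simp [g7, hlow c' h]
        · simp [g7, hDc1]; omega
      · simp [g7, hhigh c' (by omega)]
  · rintro σ₁ t₁ - - ⟨h1, -, h3, h4⟩
    exact ⟨h1, h3, by omega⟩

open RamExpr in
/-- The estimate of the distance from `var 0` to `var 1` goes to `var 24`. -/
def closeProg : RamProg :=
  distProg (var 0) (var 1) ;; .assign 24 (var 32) ;;
  forLoop 30 23 (distProg (headExpr (var 30)) (var 1) ;;
    .assign 32 (read 7 (var 30) + var 32) ;;
    .ite ((var 32).less (var 24)) (.assign 24 (var 32)) .skip)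

theorem wp_closeProg {P : ℕ → Prop} (hB : QueryBounds n K j η s t W E T xs ys)
    (hQ : QueryState n K j η s t W T xs ys σ) (hD : ∀ c < η, σ.arr 7 c ≤ E + 1)
    (h0 : P (tableEstimate n K (gridSize K n) j T (s * n + t)))
    (hP : ∀ c < η, P (σ.arr 7 c + tableEstimate n K (gridSize K n) j T (ys c * n + t))) :
    wp W closeProg (fun σ' t' => P (σ'.var 24) ∧ σ'.var 24 ≤ E ∧
      σ'.var 24 ≤ tableEstimate n K (gridSize K n) j T (s * n + t) ∧
      (∀ c < η, σ'.var 24 ≤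
        σ.arr 7 c + tableEstimate n K (gridSize K n) j T (ys c * n + t)) ∧
      t' ≤ t₀ + (η + 1) * (searchTime K n + 40) + 10) σ t₀ := by
  have hlt := hB.lt
  have hd := hB.dim_le
  have hsl := hB.slot_lt
  have hs := hB.s_lt
  have ht := hB.t_lt
  have h1W : 1 < W := by omega
  rw [closeProg, wp_seq]
  refine wp_distProg hB hQ (u := s) (v := t) ⟨by simp [hQ.v0]; omega, hQ.v0⟩
    ⟨by simp [hQ.v1]; omega, hQ.v1⟩ hs ht ?_
  intro σ₁ t₁ hag1 h32 ht1
  have hle := tableEstimate_le hB (s * n + t)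
  rw [wp_seq, wp_assign]
  refine ⟨by simp [h32]; omega, ?_⟩
  set σ₂ := σ₁.setVar 24 ((RamExpr.var 32).eval σ₁) with hσ₂
  have hag2 : Agree 24 10 σ σ₂ := ⟨fun x hx => by
    have : x ≠ 24 := by omega
    simp [hσ₂, this, hag1.1 x (by omega)], fun b hb => by simp [hσ₂, hag1.2 b hb]⟩
  have e24 : σ₂.var 24 = tableEstimate n K (gridSize K n) j T (s * n + t) := by simp [hσ₂, h32]
  have hQ2 := hQ.agree hag2 (by norm_num) (by norm_num)
  refine wp_forLoop (v := 24) (a := 10) (fun c σ' t' => P (σ'.var 24) ∧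
      σ'.var 24 ≤ tableEstimate n K (gridSize K n) j T (s * n + t) ∧
      (∀ c' < c, σ'.var 24 ≤
        σ.arr 7 c' + tableEstimate n K (gridSize K n) j T (ys c' * n + t)) ∧
      t' ≤ t₀ + (c + 1) * (searchTime K n + 40) + 2) η
    (by simp [distProg, estProg, RamProg.Above]) (by norm_num) (by norm_num) hQ2.v23 (by omega) h1W
    ⟨by simpa [e24] using h0, by simp [e24], by simp, by simp at ht1 ⊢; omega⟩ ?_ ?_
  · rintro c hc σ₃ t₃ h30 hag3 ⟨hP3, hle3, hall, ht3⟩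
    have hQ3 := hQ2.agree hag3 (by norm_num) (by norm_num)
    have a7 : σ₃.arr 7 = σ.arr 7 := by rw [hag3.2 7 (by norm_num), hag2.2 7 (by norm_num)]
    have hDc := hD c hc
    rw [wp_seq]
    refine wp_distProg hB hQ3 (u := ys c) (v := t)
      (hQ3.headExpr hB h30 hc (by simp [h30]; omega)) ⟨by simp [hQ3.v1]; omega, hQ3.v1⟩
      (hB.ys_lt c hc) ht ?_
    intro σ₄ t₄ hag4 h32 ht4
    have hle4 := tableEstimate_le hB (ys c * n + t)
    have g30 : σ₄.var 30 = c := by rw [hag4.1 30 (by norm_num), h30]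
    have g24 := hag4.1 24 (by norm_num)
    have g7 := hag4.2 7 (by norm_num)
    simp only [headExpr, RamExpr.cost_read, RamExpr.cost_add, RamExpr.cost_var] at ht4
    simp only [wp_seq, wp_assign, wp_ite, wp_skip]
    refine ⟨by simp [g30, g7, a7, h32]; omega, by simp [g30, g24, g7, a7, h32, h1W]; omega,
      fun hc1 => ?_, fun hc1 => ?_⟩
    · simp [g30, g24, g7, a7, h32] at hc1
      refine ⟨by simp [g30, g7, a7, h32]; omega, by simp [g30],
        by simpa [g30, g7, a7, h32] using hP c hc, by simp [g30, g7, a7, h32]; omega,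
        fun c' hc' => ?_, by simp; rw [Nat.add_mul (c + 1)]; omega⟩
      simp only [RamState.var_setVar, RamExpr.eval_var, RamExpr.eval_add, RamExpr.eval_read, g30, g7,
        a7, h32]
      norm_num
      rcases Nat.lt_succ_iff_lt_or_eq.1 hc' with h | rfl
      · have := hall c' h; omega
      · exact le_rfl
    · simp [g30, g24, g7, a7, h32] at hc1
      refine ⟨by simp [g30], by simpa [g24] using hP3, by simpa [g24] using hle3, fun c' hc' => ?_,
        by simp; rw [Nat.add_mul (c + 1)]; omega⟩
      simp only [RamState.var_setVar, g24]
      norm_num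
      rcases Nat.lt_succ_iff_lt_or_eq.1 hc' with h | rfl
      · exact hall c' h
      · exact hc1
  · rintro σ₃ t₃ - - ⟨h1, h2, h3, h4⟩
    exact ⟨h1, by omega, h2, h3, by omega⟩

end

/-! ### Queries -/

open RamExpr in
/-- Dijkstra's algorithm on the edges outside of the prefix. -/
def dijkstraProg : RamProg :=
  forLoop 25 23 (selectProg ;; .write 8 (var 26) (const 1) ;; relaxProg)

theorem dijkstraProg_above : dijkstraProg.Above 25 7 := by
  simp [dijkstraProg, selectProg, relaxProg, forLoop_above, distProg, estProg, RamProg.Above]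

open RamExpr in
/-- Answer a query from `var 0` to `var 1`. -/
def queryProg : RamProg :=
  (prefixProg ;; startProg ;; dijkstraProg ;; closeProg) ;;
    .assign 0 ((var 24).less (var 17)) ;; .assign 1 (var 24)

section
variable {n m K j η s t W E i : ℕ} {T xs ys : ℕ → ℕ} {σ : RamState} {t₀ : ℕ}
  {ê : Fin m → Fin n × Fin n} {τ : Equiv.Perm (Fin m)}

theorem wp_dijkstraProg {P : ℕ → ℕ → Prop} (hB : QueryBounds n K j η s t W E T xs ys)
    (hQ : QueryState n K j η s t W T xs ys σ)
    (hD : ∀ c < η, σ.arr 7 c = tableEstimate n K (gridSize K n) j T (s * n + xs c) + 1)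
    (h8 : ∀ c < η, σ.arr 8 c = 0)
    (h0 : ∀ c < η, P c (tableEstimate n K (gridSize K n) j T (s * n + xs c) + 1))
    (hP : ∀ c < η, ∀ c' < η, ∀ d, P c d →
      P c' (d + (tableEstimate n K (gridSize K n) j T (ys c * n + xs c') + 1))) :
    wp W dijkstraProg (fun σ' t' => Dijkstra η
        (fun c c' => tableEstimate n K (gridSize K n) j T (ys c * n + xs c') + 1)
        (fun c => tableEstimate n K (gridSize K n) j T (s * n + xs c) + 1) P (Finset.range η)
        (σ'.arr 7) ∧
      t' ≤ t₀ + η * (η * (searchTime K n + 90) + 40) + 10) σ t₀ := by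
  have hlt := hB.lt
  have hd := hB.dim_le
  have hsl := hB.slot_lt
  have h1W : 1 < W := by omega
  refine wp_forLoop (v := 25) (a := 7) (fun r σ' t' => ∃ F ⊆ Finset.range η, F.card = r ∧
      Dijkstra η (fun c c' => tableEstimate n K (gridSize K n) j T (ys c * n + xs c') + 1)
        (fun c => tableEstimate n K (gridSize K n) j T (s * n + xs c) + 1) P F (σ'.arr 7) ∧
      (∀ c < η, σ'.arr 8 c < W ∧ (σ'.arr 8 c ≠ 0 ↔ c ∈ F)) ∧
      t' ≤ t₀ + r * (η * (searchTime K n + 90) + 40) + 2) η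
    (by simp [selectProg, relaxProg, forLoop_above, distProg, estProg, RamProg.Above])
    (by norm_num) (by norm_num) hQ.v23 (by omega) h1W ?_ ?_ ?_
  · refine ⟨∅, by simp, rfl, ⟨by simp, by simp, fun c hc => ?_, fun c hc => ?_⟩, fun c hc => ?_,
      by simp⟩
    · simp [hD c hc]
    · simpa [hD c hc] using h0 c hc
    · simp [h8 c hc]; omega
  · rintro r hr σ₁ t₁ h25 hag ⟨F, hF, hcard, hDij, h8, ht⟩
    have hQ1 := hQ.agree hag (by norm_num) (by norm_num)
    have hDle : ∀ c < η, σ₁.arr 7 c ≤ E + 1 := fun c hc => by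
      have h1 := hDij.start c hc
      have h2 := tableEstimate_le hB (s * n + xs c)
      omega
    have hex : ∃ c < η, c ∉ F := by
      by_contra hcon
      push Not at hcon
      have : Finset.range η ⊆ F := fun c hc => hcon c (Finset.mem_range.1 hc)
      have := Finset.card_le_card this
      rw [Finset.card_range] at this
      omega
    rw [wp_seq]
    refine (wp_selectProg hQ1.v23 (fun c hc => by have := hDle c hc; omega) h8 hex
      (by omega)).frame selectProg_above ?_
    rintro σ₂ t₂ hag2 ⟨⟨a, ha, h26, haF, hmin⟩, ht2⟩
    rw [wp_seq, wp_write]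
    refine ⟨by simp [h26]; omega, by simp; omega, ?_⟩
    set σ₃ := σ₂.setArr 8 ((RamExpr.var 26).eval σ₂) ((RamExpr.const 1).eval σ₂) with hσ₃
    have hQ3 : QueryState n K j η s t W T xs ys σ₃ :=
      (hQ1.agree hag2 (by norm_num) (by norm_num)).agree (v := 24) (a := 7)
        ⟨fun x _ => rfl, fun b hb => by
          have : b ≠ 8 := by omega
          simp [hσ₃, this]⟩ le_rfl le_rfl
    have a7 : σ₃.arr 7 = σ₁.arr 7 := by rw [← hag2.2 7 (by norm_num)]; simp [hσ₃]
    have a8 : σ₃.arr 8 = Function.update (σ₁.arr 8) a 1 := by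
      rw [← hag2.2 8 (by norm_num)]; simp [hσ₃, h26]
    refine (wp_relaxProg hB hQ3 (a := a) h26 ha (fun c hc => by rw [a7]; exact hDle c hc)).frame
      relaxProg_above ?_
    rintro σ₄ t₄ hag4 ⟨h7, h84, ht4⟩
    refine ⟨?_, insert a F, ?_, ?_, ?_, ?_, ?_⟩
    · rw [hag4.1 25 (by norm_num), ← h25, ← hag2.1 25 (by norm_num)]; rfl
    · exact Finset.insert_subset (Finset.mem_range.2 ha) hF
    · rw [Finset.card_insert_of_notMem haF, hcard]
    · rw [RamState.arr_setVar]
      refine hDij.settle hF ha haF hmin (fun c hc => ?_) fun c hc h => hP a ha c hc _ h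
      rw [h7 c hc, a7]
    · intro c hc
      rw [RamState.arr_setVar, h84, a8, Function.update_apply, Finset.mem_insert]
      by_cases hca : c = a
      · simp [hca, h1W]
      · simpa [hca] using h8 c hc
    · simp at ht4
      have e1 : η * (searchTime K n + 90) = η * (searchTime K n + 50) + η * 40 := by ring
      rw [Nat.add_mul r, one_mul]; omega
  · rintro σ₁ t₁ - - ⟨F, hF, hcard, hDij, -, ht⟩
    have : F = Finset.range η := Finset.eq_of_subset_of_card_le hF (by simp [hcard])
    rw [this] at hDij
    exact ⟨hDij, by omega⟩

theorem Online.of_agree {σ' : RamState} (h : Online ê τ K i σ)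
    (hv : ∀ x, 1 < x → x < 22 → σ'.var x = σ.var x) (ha : ∀ b < 7, σ'.arr b = σ.arr b) :
    Online ê τ K i σ' := by
  refine ⟨?_, ?_, ?_, ?_, ?_, ⟨?_, ?_⟩, ⟨?_, ?_⟩, ?_, ?_⟩
  · rw [hv 10 (by norm_num) (by norm_num), h.v10]
  · rw [hv 12 (by norm_num) (by norm_num), h.v12]
  · rw [hv 14 (by norm_num) (by norm_num), h.v14]
  · rw [hv 16 (by norm_num) (by norm_num), h.v16]
  · rw [hv 17 (by norm_num) (by norm_num), h.v17]
  · rw [ha 0 (by norm_num)]; exact h.edges.tail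
  · rw [ha 1 (by norm_num)]; exact h.edges.head
  · rw [ha 3 (by norm_num)]; exact h.tables.len
  · rw [ha 2 (by norm_num)]; exact h.tables.level
  · rw [ha 4 (by norm_num)]; exact h.pos
  · rw [ha 5 (by norm_num), ha 6 (by norm_num), hv 15 (by norm_num) (by norm_num)]; exact h.slots

/-- With `η` edges outside of the prefix, a query needs `(η + 1) ^ 2` estimates, each by a binary search
that takes time `searchTime K n`. -/
theorem wp_queryProg {u v : Fin n} (h : Online ê τ K i σ) (hê : Function.Injective ê) (him : i ≤ m)
    (hK : 0 < K) (hlen : ∀ g < gridSize K n, gridLen K g ≤ E) (hE : 2 * n ≤ E)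
    (hW : 3 * E + 5 < W) (hW1 : gridSize K n * (n * n) + 2 * gridSize K n + 2 < W)
    (hW2 : m + 2 < W) :
    wp W queryProg (fun σ' t' => Online ê τ K i σ' ∧
      (∃ e, Estimates (graphAt (ê ∘ τ) i) K (2 * n) u v e ∧
        σ'.answer = if e < 2 * n then (e : ℕ∞) else ⊤) ∧
      t' ≤ (etaBar ê (ê ∘ τ) i + 1) ^ 2 * (searchTime K n + 200)) (σ.withPair (u, v)) 0 := by
  have hn : 0 < n := u.pos
  have h1W : 1 < W := by omega
  set σ₀ := σ.withPair (u, v) with hσ₀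
  have v0 : ∀ x, 1 < x → σ₀.var x = σ.var x := fun x hx => by
    have j1 : x ≠ 0 := by omega
    have j2 : x ≠ 1 := by omega
    simp [hσ₀, RamState.withPair, j1, j2]
  have e0 : σ₀.var 0 = u := by simp [hσ₀, RamState.withPair]
  have e1 : σ₀.var 1 = v := by simp [hσ₀, RamState.withPair]
  have hO : Online ê τ K i σ₀ := h.of_agree (fun x hx _ => v0 x hx) fun b _ => rfl
  have habove : (prefixProg ;; startProg ;; dijkstraProg ;; closeProg).Above 22 7 := by
    simp [prefixProg, startProg, dijkstraProg, closeProg, selectProg, relaxProg, forLoop_above,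
      distProg, estProg, RamProg.Above]
  have main : wp W (prefixProg ;; startProg ;; dijkstraProg ;; closeProg) (fun σ' t' =>
      Estimates (graphAt (ê ∘ τ) i) K (2 * n) u v (σ'.var 24) ∧ σ'.var 24 ≤ E ∧
      t' + 12 ≤ (etaBar ê (ê ∘ τ) i + 1) ^ 2 * (searchTime K n + 200)) σ₀ 0 := by
    rw [wp_seq]
    refine (wp_prefixProg hO.v14 rfl hO.slots him hW2).frame
      (v := 22) (a := 10) (by simp [prefixProg, RamProg.Above]) ?_
    rintro σ₁ t₁ hag1 ⟨j, hj, h22, h23, hS0, hS1, ht1⟩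
    have hηeq : etaBar ê (ê ∘ τ) i = i - j := by
      rw [etaBar, hO.slots.insertedPrefix_eq hê him hj hS0 hS1]
    rw [hηeq]
    set η := i - j with hη
    have hadj := hO.slots.adj_iff (ê := ê) him hj hS0
    set A := σ₀.arr 5 with hA
    have hAm : ∀ c < η, A (j + c) < m := fun c hc => (hO.slots.slot (j + c) (by omega)).1
    -- The end points of the edges outside of the prefix.
    set x : ℕ → Fin n := fun c => if hc : A (j + c) < m then (ê ⟨A (j + c), hc⟩).1 else u with hx
    set y : ℕ → Fin n := fun c => if hc : A (j + c) < m then (ê ⟨A (j + c), hc⟩).2 else u with hy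
    set est : Fin n → Fin n → ℕ :=
      fun a b => tableEstimate n K (gridSize K n) j (σ₀.arr 2) (a * n + b) with hest
    have hedge : ∀ c < η, (graphAt (ê ∘ τ) i).Adj (x c) (y c) := fun c hc =>
      (hadj _ _).2 (Or.inr ⟨c, hc, hAm c hc, by simp [hx, hy, hAm c hc]⟩)
    have hsub : ∀ a b, (graphAt ê j).Adj a b → (graphAt (ê ∘ τ) i).Adj a b :=
      fun a b hab => (hadj a b).2 (Or.inl hab)
    have hestimates : ∀ a b, Estimates (graphAt ê j) K (2 * n) a b (est a b) :=
      fun a b => hO.tables.estimates hK (hj.trans him) a b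
    have hB : QueryBounds n K j η u v W E (σ₀.arr 2) (fun c => x c) (fun c => y c) := by
      refine ⟨u.isLt, v.isLt, fun c _ => (x c).isLt, fun c _ => (y c).isLt, fun g hg b hb => ?_,
        fun b hb g g' hgg hg' => hO.tables.mono hK (hj.trans him) hb hgg hg', hlen, hE, hW, hW1,
        by omega⟩
      have := (hO.tables.level g hg).le hb
      omega
    have hQ1 : QueryState n K j η u v W (σ₀.arr 2) (fun c => x c) (fun c => y c) σ₁ := by
      refine ⟨?_, ?_, ?_, ?_, ?_, ?_, h22, h23, ?_, ?_, fun c hc => ?_⟩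
      · rw [hag1.1 0 (by norm_num), e0]
      · rw [hag1.1 1 (by norm_num), e1]
      · rw [hag1.1 10 (by norm_num), hO.v10]
      · rw [hag1.1 12 (by norm_num), hO.v12]
      · rw [hag1.1 16 (by norm_num), hO.v16]
      · rw [hag1.1 17 (by norm_num), hO.v17]
      · exact hag1.2 2 (by norm_num)
      · rw [hag1.2 3 (by norm_num)]; exact hO.tables.len
      · have hm := hAm c hc
        rw [hag1.2 5 (by norm_num), hag1.2 0 (by norm_num), hag1.2 1 (by norm_num), ← hA]
        refine ⟨by omega, ?_, ?_⟩
        · rw [hO.edges.tail ⟨_, hm⟩]; simp [hx, hm]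
        · rw [hO.edges.head ⟨_, hm⟩]; simp [hy, hm]
    rw [wp_seq]
    refine (wp_startProg hB hQ1).frame startProg_above ?_
    rintro σ₂ t₂ hag2 ⟨hD2, ht2⟩
    have hQ2 := hQ1.agree hag2 (by norm_num) (by norm_num)
    rw [wp_seq]
    refine (wp_dijkstraProg (P := fun c d => d < 2 * n → ∃ k ≤ d,
      HasWalk (graphAt (ê ∘ τ) i) u (y c) k) hB hQ2 (fun c hc => (hD2 c hc).1)
      (fun c hc => (hD2 c hc).2) (fun c hc hlt => ?_) fun c hc c' hc' d hd hlt => ?_).frame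
      dijkstraProg_above ?_
    · obtain ⟨k, hk, hw⟩ := (hestimates u (x c)).sound (by simp only [hest]; omega)
      exact ⟨k + 1, by simp only [hest] at hk; omega,
        hasWalk_succ.2 ⟨_, hw.mono hsub, hedge c hc⟩⟩
    · obtain ⟨k₁, hk₁, hw₁⟩ := hd (by omega)
      obtain ⟨k₂, hk₂, hw₂⟩ := (hestimates (y c) (x c')).sound (by simp only [hest]; omega)
      exact ⟨k₁ + k₂ + 1, by simp only [hest] at hk₂; omega,
        hasWalk_succ.2 ⟨_, hasWalk_add.2 ⟨_, hw₁, hw₂.mono hsub⟩, hedge c' hc'⟩⟩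
    rintro σ₃ t₃ hag3 ⟨hDij, ht3⟩
    have hQ3 := hQ2.agree hag3 (by norm_num) (by norm_num)
    refine (wp_closeProg (P := fun d => d < 2 * n → ∃ k ≤ d,
      HasWalk (graphAt (ê ∘ τ) i) u v k) hB hQ3 (fun c hc => ?_) (fun hlt => ?_)
      fun c hc hlt => ?_).mono ?_
    · have := hDij.start c hc
      have := tableEstimate_le hB (u * n + x c)
      omega
    · obtain ⟨k, hk, hw⟩ := (hestimates u v).sound hlt
      exact ⟨k, hk, hw.mono hsub⟩
    · obtain ⟨k₁, hk₁, hw₁⟩ := hDij.sound c hc (by omega)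
      obtain ⟨k₂, hk₂, hw₂⟩ := (hestimates (y c) v).sound (by simp only [hest]; omega)
      exact ⟨k₁ + k₂, by simp only [hest] at hk₂; omega, hasWalk_add.2 ⟨_, hw₁, hw₂.mono hsub⟩⟩
    rintro σ₄ t₄ ⟨hsound, hle, hans, hans', ht4⟩
    refine ⟨estimates_of_fixpoint (G := graphAt ê j) (xs := x) (ys := y) (est := est)
      (D := σ₃.arr 7) (η := η) (fun a b hab => ?_) hestimates hDij.start
      (fun c hc c' hc' => hDij.step c (Finset.mem_range.2 hc) c' hc') hans hans' hsound, hle, ?_⟩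
    · rcases (hadj a b).1 hab with h1 | ⟨c, hc, hm, h1⟩
      · exact Or.inl h1
      · exact Or.inr ⟨c, hc, by simp only [hx, dif_pos hm, h1], by simp only [hy, dif_pos hm, h1]⟩
    · have e1 : (η + 1) ^ 2 * (searchTime K n + 200) = η * (η * (searchTime K n + 90) + 40) +
          η * (searchTime K n + 40) + (η + 1) * (searchTime K n + 40) + (110 * (η * η) +
          280 * η + 160) := by ring
      rw [e1]; omega
  rw [queryProg, wp_seq]
  refine main.frame habove ?_
  rintro σ₁ t₁ hag ⟨hEst, hle, ht⟩
  have e17 : σ₁.var 17 = 2 * n := by rw [hag.1 17 (by norm_num), hO.v17]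
  simp only [wp_seq, wp_assign]
  refine ⟨by simp [h1W, e17]; omega, by simp; omega, ?_, ⟨_, hEst, ?_⟩, by simp; omega⟩
  · refine hO.of_agree (fun x hx hx' => ?_) fun b hb => by simp [hag.2 b hb]
    have j1 : x ≠ 0 := by omega
    have j2 : x ≠ 1 := by omega
    simp [j1, j2, hag.1 x hx']
  · by_cases hc : σ₁.var 24 < 2 * n
    · simp [RamState.answer, e17, hc]
    · simp [RamState.answer, e17, not_lt.1 hc]

end

/-! ### The exponent of matrix multiplication -/

section
variable {n W : ℕ} {p : RamProg} {σ σ' : RamState} {t : ℕ} {ω : ℝ}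

/-- In `t` steps, at most `t` array entries are changed. -/
theorem RamExec.exists_changed (h : RamExec W p σ t σ') :
    ∃ s : Finset (ℕ × ℕ), s.card ≤ t ∧ ∀ a y, (a, y) ∉ s → σ'.arr a y = σ.arr a y := by
  induction h with
  | skip σ => exact ⟨∅, by simp, by simp⟩
  | assign x e σ he => exact ⟨∅, by simp, by simp⟩
  | write a i e σ hi he =>
    refine ⟨{(a, i.eval σ)}, by simp, fun b y hy => ?_⟩
    simp only [Finset.mem_singleton, Prod.mk.injEq, not_and] at hy
    by_cases hb : b = a
    · simp [hb, hy hb]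
    · simp [hb]
  | seq p q σ₁ σ₂ σ₃ t₁ t₂ _ _ ih₁ ih₂ =>
    obtain ⟨s₁, h₁, h₁'⟩ := ih₁
    obtain ⟨s₂, h₂, h₂'⟩ := ih₂
    refine ⟨s₁ ∪ s₂, (Finset.card_union_le _ _).trans (by omega), fun a y hy => ?_⟩
    rw [Finset.mem_union, not_or] at hy
    rw [h₂' a y hy.2, h₁' a y hy.1]
  | iteTrue _ _ _ _ _ _ _ _ _ ih =>
    obtain ⟨s, h, h'⟩ := ih
    exact ⟨s, by omega, h'⟩
  | iteFalse _ _ _ _ _ _ _ _ _ ih =>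
    obtain ⟨s, h, h'⟩ := ih
    exact ⟨s, by omega, h'⟩
  | loopTrue _ _ _ _ _ _ _ _ _ _ _ ih₁ ih₂ =>
    obtain ⟨s₁, h₁, h₁'⟩ := ih₁
    obtain ⟨s₂, h₂, h₂'⟩ := ih₂
    refine ⟨s₁ ∪ s₂, (Finset.card_union_le _ _).trans (by omega), fun a y hy => ?_⟩
    rw [Finset.mem_union, not_or] at hy
    rw [h₂' a y hy.2, h₁' a y hy.1]
  | loopFalse => exact ⟨∅, by simp, by simp⟩

/-- All entries of the product of two matrices of ones have to be written. -/
theorem MatMulInTime.two_le (h : MatMulInTime ω) : 2 ≤ ω := by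
  obtain ⟨P, c, C, hP⟩ := h
  have key : ∀ n : ℕ, 1 ≤ n → (n : ℝ) ^ (2 - ω) ≤ C := by
    intro n hn
    obtain ⟨t, σ, hx, ht, hσ⟩ := hP n hn (.of fun _ _ => 1) (.of fun _ _ => 1) (by simp) (by simp)
    obtain ⟨s, hs, hs'⟩ := hx.exists_changed
    have hsub : (Finset.univ : Finset (Fin n × Fin n)).image
        (fun q => ((2, (q.1 : ℕ) * n + q.2) : ℕ × ℕ)) ⊆ s := by
      intro x hx
      obtain ⟨⟨i, j⟩, -, rfl⟩ := Finset.mem_image.1 hx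
      by_contra hc
      have h1 := hs' _ _ hc
      rw [hσ i j, Matrix.mul_apply] at h1
      simp [matMulInput] at h1
      omega
    have hcard := Finset.card_le_card hsub
    rw [Finset.card_image_of_injective] at hcard
    · have hn0 : (0 : ℝ) < n := by exact_mod_cast hn
      have h2 : n * n ≤ t := by simpa using hcard.trans hs
      have h3 : ((n : ℝ)) ^ (2 : ℝ) ≤ t := by
        rw [Real.rpow_two, sq]; exact_mod_cast h2
      rw [Real.rpow_sub hn0, div_le_iff₀ (Real.rpow_pos_of_pos hn0 _)]
      exact h3.trans ht
    · rintro ⟨a, b⟩ ⟨a', b'⟩ hab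
      simp only [Prod.mk.injEq, true_and] at hab
      obtain ⟨h1, h2⟩ := flat_inj b.isLt b'.isLt hab
      exact Prod.ext (Fin.ext h1) (Fin.ext h2)
  by_contra hc
  have hlim := (tendsto_rpow_atTop (y := 2 - ω) (by linarith)).comp tendsto_natCast_atTop_atTop
  obtain ⟨n, hn, hn1⟩ := ((hlim.eventually_gt_atTop (C : ℝ)).and
    (Filter.eventually_ge_atTop 1)).exists
  exact absurd (key n hn1) (not_le.2 hn)

open RamExpr in
/-- Schoolbook matrix multiplication. -/
def schoolbookProg : RamProg :=
  .assign 1 (var 0 * var 0) ;;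
  forLoop 2 1 (.assign 3 (const 0) ;;
    forLoop 4 0 (.assign 3 (var 3 + read 0 (var 2 / var 0 * var 0 + var 4) *
      read 1 (var 4 * var 0 + var 2 % var 0))) ;;
    .write 2 (var 2) (var 3))

theorem wp_schoolbookProg (h0 : σ.var 0 = n) (h1 : ∀ a y, σ.arr a y ≤ 1) (hn : 0 < n)
    (hW : 2 * (n * n) + n + 1 < W) :
    wp W schoolbookProg (fun σ' t' => (∀ y < n * n, σ'.arr 2 y = ∑ k ∈ Finset.range n,
      σ.arr 0 (y / n * n + k) * σ.arr 1 (k * n + y % n)) ∧ t' ≤ 100 * (n * n * n)) σ 0 := by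
  have hnn : n ≤ n * n := Nat.le_mul_self n
  have hn3 : n * n ≤ n * n * n := Nat.le_mul_of_pos_right _ hn
  have h1W : 1 < W := by omega
  rw [schoolbookProg, wp_seq, wp_assign]
  refine ⟨by simp [h0]; omega, ?_⟩
  set σ₀ := σ.setVar 1 ((RamExpr.var 0 * RamExpr.var 0).eval σ) with hσ₀
  set f : ℕ → ℕ → ℕ := fun y l => ∑ k ∈ Finset.range l,
    σ.arr 0 (y / n * n + k) * σ.arr 1 (k * n + y % n) with hf
  have hfle : ∀ y l, f y l ≤ l := fun y l => by
    refine (Finset.sum_le_card_nsmul _ _ 1 fun k _ => ?_).trans (by simp)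
    exact (Nat.mul_le_mul (h1 _ _) (h1 _ _)).trans (by simp)
  refine wp_forLoop (v := 2) (a := 2) (fun y σ' t' => (∀ y' < y, σ'.arr 2 y' = f y' n) ∧
    t' ≤ y * (40 * n + 20) + 10) (n * n) (by simp [forLoop_above, RamProg.Above]) le_rfl
    (by norm_num) (by simp [hσ₀, h0]) (by omega) h1W (by simp) ?_ ?_
  · rintro y hy σ₁ t₁ h2 hag ⟨hlow, ht⟩
    rw [wp_seq, wp_assign]
    refine ⟨by simp; omega, ?_⟩
    rw [wp_seq]
    have e0 : σ₁.var 0 = n := by rw [hag.1 0 (by norm_num)]; simp [hσ₀, h0]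
    refine wp_forLoop (v := 3) (a := 3) (fun l σ' t' => σ'.var 3 = f y l ∧ t' ≤ t₁ + l * 40 + 8) n
      (by simp [RamProg.Above]) (by norm_num) (by norm_num) (by simp [e0]) (by omega) h1W
      ⟨by simp [hf], by simp⟩ ?_ ?_
    · rintro l hl σ₂ t₂ h4 hag2 ⟨h3, ht2⟩
      have g0 : σ₂.var 0 = n := by rw [hag2.1 0 (by norm_num)]; simp [e0]
      have g2 : σ₂.var 2 = y := by rw [hag2.1 2 (by norm_num)]; simp [h2]
      have a0 : σ₂.arr 0 = σ.arr 0 := by rw [hag2.2 0 (by norm_num)]; exact hag.2 0 (by norm_num)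
      have a1 : σ₂.arr 1 = σ.arr 1 := by rw [hag2.2 1 (by norm_num)]; exact hag.2 1 (by norm_num)
      have hl1 := hfle y l
      have hl2 := flat_lt (div_lt_of_lt_sq hy) hl
      have hl3 := flat_lt hl (mod_lt_of_lt_sq hy)
      have hl4 := mod_lt_of_lt_sq hy
      have hl5 := div_lt_of_lt_sq hy
      have b0 := h1 0 (y / n * n + l)
      have b1 := h1 1 (l * n + y % n)
      have b2 := Nat.mul_le_mul b0 b1
      rw [wp_assign]
      refine ⟨by simp [g0, g2, a0, a1, h3, h4]; omega, by simpa using h4, ?_, by simp; omega⟩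
      simp [g0, g2, a0, a1, h3, h4, hf, Finset.sum_range_succ]
    · rintro σ₂ t₂ - hag2 ⟨h3, ht2⟩
      have g2 : σ₂.var 2 = y := by rw [hag2.1 2 (by norm_num)]; simp [h2]
      have a2 : σ₂.arr 2 = σ₁.arr 2 := by rw [hag2.2 2 (by norm_num)]; rfl
      have hfn := hfle y n
      rw [wp_write]
      refine ⟨by simp [g2]; omega, by simp [h3]; omega, by simpa using g2, fun y' hy' => ?_, ?_⟩
      · rcases Nat.lt_succ_iff_lt_or_eq.1 hy' with h | rfl
        · have : y' ≠ y := by omega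
          simp [g2, a2, this, hlow y' h]
        · simp [g2, h3]
      · simp; rw [Nat.add_mul y]; omega
  · rintro σ₁ t₁ - - ⟨hlow, ht⟩
    refine ⟨hlow, ?_⟩
    have : n * n * (40 * n + 20) = 40 * (n * n * n) + 20 * (n * n) := by ring
    omega

/-- Schoolbook multiplication takes cubic time. -/
theorem matMulInTime_three : MatMulInTime 3 := by
  refine ⟨schoolbookProg, 4, 100, fun n hn A B hA hB => ?_⟩
  have hentry : ∀ a y, (matMulInput A B).arr a y ≤ 1 := fun a y => by
    simp only [matMulInput]
    split_ifs with h h0 h1 <;> first | exact hA _ _ | exact hB _ _ | exact Nat.zero_le _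
  have e : ∀ (X : Matrix (Fin n) (Fin n) ℕ) (i j : Fin n), ∃ h : (i : ℕ) * n + j < n * n,
      X (finProdFinEquiv.symm ⟨i * n + j, h⟩).1 (finProdFinEquiv.symm ⟨i * n + j, h⟩).2 = X i j := by
    intro X i j
    refine ⟨flat_lt i.isLt j.isLt, ?_⟩
    have : (⟨i * n + j, flat_lt i.isLt j.isLt⟩ : Fin (n * n)) = finProdFinEquiv (i, j) :=
      Fin.ext (by simp [mul_comm, add_comm])
    rw [this, Equiv.symm_apply_apply]
  obtain ⟨t, σ, hx, hσ, ht⟩ := wp_schoolbookProg (W := wordBound 4 n) (σ := matMulInput A B) (n := n)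
    (by simp [matMulInput]) hentry hn (by
      rw [wordBound]
      have h1 : n ≤ n * n := Nat.le_mul_self n
      nlinarith [Nat.zero_le (n ^ 4), Nat.zero_le (n ^ 3)])
  refine ⟨t, σ, hx, ?_, fun i j => ?_⟩
  · rw [zero_add] at ht
    have h3 : ((n : ℝ)) ^ (3 : ℝ) = (n * n * n : ℕ) := by
      rw [show (3 : ℝ) = ((3 : ℕ) : ℝ) by norm_num, Real.rpow_natCast]; push_cast; ring
    rw [h3]; exact_mod_cast ht
  · have hdiv : ((i : ℕ) * n + j) / n = i := by
      rw [mul_comm, Nat.mul_add_div hn, Nat.div_eq_of_lt j.isLt, add_zero]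
    have hmod : ((i : ℕ) * n + j) % n = j := by
      rw [mul_comm, Nat.mul_add_mod, Nat.mod_eq_of_lt j.isLt]
    rw [hσ _ (flat_lt i.isLt j.isLt), hdiv, hmod, Finset.sum_range, Matrix.mul_apply]
    refine Finset.sum_congr rfl fun k _ => ?_
    obtain ⟨h1, h2⟩ := e A i k
    obtain ⟨h3, h4⟩ := e B k j
    rw [← h2, ← h4]
    simp only [matMulInput, dif_pos h1, dif_pos h3]
    simp

end

/-! ### The parameters -/

section
variable {n m K A B c T F R : ℕ} {P : RamProg} {ω : ℝ}

theorem sq_le_rpow (hω : 2 ≤ ω) (hn : 1 ≤ n) : ((n : ℝ)) ^ 2 ≤ (n : ℝ) ^ ω := by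
  rw [← Real.rpow_natCast]
  exact Real.rpow_le_rpow_of_exponent_le (by exact_mod_cast hn) (by simpa using hω)

/-- The parameters of the half products, apart from the word size. The square of the time bound `F`
is proportional to `n ^ 3 * n ^ ω`. -/
theorem MatMulInTime.exists_params (hω : MatMulInTime ω) (h3 : ω ≤ 3) :
    ∃ (P : RamProg) (c A : ℕ), 2 ≤ c ∧ ∀ n : ℕ, 1 ≤ n → ∃ T F : ℕ,
      Multiplies P (2 * n) ((2 * n + 2) ^ c) T ∧ n * n * n * (8 * (T + 4 * (n * n))) ≤ F * F ∧
      n * n ≤ F ∧ T ≤ F ∧ 8 * (T + 4 * (n * n)) ≤ A * n ^ 3 ∧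
      (F : ℝ) ≤ (A + 1) * (n : ℝ) ^ ((3 + ω) / 2) := by
  have h2 := hω.two_le
  obtain ⟨P, c, C, hP⟩ := hω
  refine ⟨P, c + 2, 64 * C + 32, by omega, fun n hn => ?_⟩
  have hn1 : (1 : ℝ) ≤ n := by exact_mod_cast hn
  have hn0 : (0 : ℝ) < n := by linarith
  set y := (n : ℝ) ^ ω with hy
  set x := (n : ℝ) ^ ((3 + ω) / 2) with hx
  set T := ⌊(C : ℝ) * ((2 * n : ℕ) : ℝ) ^ ω⌋₊ with hT
  set a : ℝ := ((64 * C + 32 : ℕ) : ℝ) with ha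
  have ha' : a = 64 * C + 32 := by rw [ha]; push_cast; ring
  have hC0 : (0 : ℝ) ≤ C := Nat.cast_nonneg C
  have hy2 : (n : ℝ) ^ 2 ≤ y := sq_le_rpow h2 hn
  have hx2 : (n : ℝ) ^ 2 ≤ x := sq_le_rpow (by linarith) hn
  have hyx : y ≤ x := Real.rpow_le_rpow_of_exponent_le hn1 (by linarith)
  have hy3 : y ≤ (n : ℝ) ^ 3 := by
    rw [← Real.rpow_natCast]
    exact Real.rpow_le_rpow_of_exponent_le hn1 (by simpa using h3)
  have hxx : x * x = (n : ℝ) ^ 3 * y := by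
    rw [hx, hy, ← Real.rpow_natCast, ← Real.rpow_add hn0, ← Real.rpow_add hn0]
    congr 1; push_cast; ring
  have hy0 : 0 ≤ y := (sq_nonneg _).trans hy2
  have hx1 : 1 ≤ x := le_trans (by nlinarith) hx2
  have hTy : (T : ℝ) ≤ 8 * C * y := by
    refine (Nat.floor_le (by positivity)).trans ?_
    have h8 : (2 : ℝ) ^ ω ≤ 8 := by
      calc (2 : ℝ) ^ ω ≤ (2 : ℝ) ^ (3 : ℝ) := Real.rpow_le_rpow_of_exponent_le (by norm_num) h3
        _ = 8 := by norm_num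
    rw [Nat.cast_mul, Real.mul_rpow (by norm_num) hn0.le, Nat.cast_ofNat, ← hy]
    have := mul_le_mul_of_nonneg_left (mul_le_mul_of_nonneg_right h8 hy0) hC0
    linarith
  have hQ : (8 * (T + 4 * (n * n)) : ℝ) ≤ a * y := by rw [ha']; nlinarith
  have hF : a * x ≤ ⌈a * x⌉₊ := Nat.le_ceil _
  have hF' : (⌈a * x⌉₊ : ℝ) < a * x + 1 := Nat.ceil_lt_add_one (by rw [ha']; positivity)
  refine ⟨T, ⌈a * x⌉₊, fun X Y hX hY => ?_, ?_, ?_, ?_, ?_, ?_⟩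
  · obtain ⟨t, σ, h1, h4, h5⟩ := hP (2 * n) (by omega) X Y hX hY
    refine ⟨t, σ, h1.mono ?_, Nat.le_floor h4, h5⟩
    exact Nat.pow_le_pow_right (by omega) (by omega)
  · have h1 : (n * n * n * (8 * (T + 4 * (n * n))) : ℝ) ≤ ⌈a * x⌉₊ * ⌈a * x⌉₊ := by
      have ha1 : 1 ≤ a := by rw [ha']; linarith
      calc (n * n * n * (8 * (T + 4 * (n * n))) : ℝ) ≤ n * n * n * (a * y) :=
            mul_le_mul_of_nonneg_left hQ (by positivity)
        _ = a * (x * x) := by rw [hxx]; ring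
        _ ≤ a * (a * (x * x)) := by
            have : 0 ≤ a * (x * x) := by positivity
            nlinarith
        _ = (a * x) * (a * x) := by ring
        _ ≤ _ := mul_le_mul hF hF (by positivity) (by positivity)
    exact_mod_cast h1
  · have h1 : (n * n : ℝ) ≤ ⌈a * x⌉₊ := by rw [ha'] at hF ⊢; nlinarith
    exact_mod_cast h1
  · have h1 : (T : ℝ) ≤ ⌈a * x⌉₊ := by rw [ha'] at hF ⊢; nlinarith
    exact_mod_cast h1
  · have h1 : (8 * (T + 4 * (n * n)) : ℝ) ≤ a * (n : ℝ) ^ 3 :=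
      hQ.trans (mul_le_mul_of_nonneg_left hy3 (by rw [ha']; positivity))
    rw [ha] at h1
    exact_mod_cast h1
  · linarith

/-- The exponent of the word bound. -/
def wordExponent (K A c : ℕ) : ℕ := 2 * c + A + 48 * K + 40

theorem lt_wordBound {x e c' : ℕ} (hx : x ≤ (n + 2) ^ e) (he : e < c') : x < wordBound c' n :=
  hx.trans_lt (Nat.pow_lt_pow_right (by omega) he)

theorem const_mul_le_pow (k e : ℕ) : k * (n + 2) ^ e ≤ (n + 2) ^ (k + e) := by
  rw [pow_add]
  exact Nat.mul_le_mul_right _ (Nat.lt_pow_self (by omega)).le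

theorem gridSize_le : gridSize K n ≤ (2 * K + 2) * lg n := by
  have h1 : 1 ≤ lg n := by rw [lg]; omega
  rw [gridSize]; nlinarith

theorem gridSize_le_pow : gridSize K n ≤ (n + 2) ^ (2 * K + 3) := by
  have h1 := lg_le (n := n)
  calc gridSize K n ≤ (2 * K + 2) * lg n := gridSize_le
    _ ≤ (2 * K + 2) * (n + 2) ^ 1 := Nat.mul_le_mul_left _ (by rw [pow_one]; omega)
    _ ≤ _ := const_mul_le_pow _ _

theorem gridLen_le (hK : 0 < K) (hn : 1 ≤ n) {g : ℕ} (hg : g < gridSize K n) :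
    gridLen K g ≤ 16 * K * n := by
  have h1 : g / K ≤ lg n + 3 := by
    rw [gridSize] at hg
    rw [← Nat.lt_succ_iff, Nat.div_lt_iff_lt_mul hK]
    nlinarith
  calc gridLen K g ≤ K * 2 ^ (g / K) := gridLen_le_pow hK
    _ ≤ K * 2 ^ (lg n + 3) := Nat.mul_le_mul_left _ (Nat.pow_le_pow_right (by norm_num) h1)
    _ ≤ 16 * K * n := by
      have := two_pow_lg_le (n := n) hn
      rw [pow_add]
      nlinarith

theorem lg_gridSize_le : lg (gridSize K n) ≤ 2 * K + 2 + lg (lg n) := by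
  have h1 : gridSize K n < 2 ^ (2 * K + 2 + lg (lg n)) := by
    calc gridSize K n ≤ (2 * K + 2) * lg n := gridSize_le
      _ < 2 ^ (2 * K + 2) * 2 ^ lg (lg n) :=
        Nat.mul_lt_mul'' (Nat.lt_pow_self (by norm_num)) lt_two_pow_lg
      _ = _ := (pow_add 2 (2 * K + 2) _).symm
  have h2 := Nat.log_lt_of_lt_pow (by rw [gridSize]; omega) h1
  rw [lg]; omega

theorem searchTime_le : searchTime K n + 200 ≤ (52 * K + 300) * lg (lg n) := by
  have h1 := lg_gridSize_le (K := K) (n := n)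
  have h2 : 1 ≤ lg (lg n) := by rw [lg]; omega
  have h3 : 52 * K * 1 ≤ 52 * K * lg (lg n) := Nat.mul_le_mul_left _ h2
  rw [searchTime, Nat.add_mul]; omega

theorem growth_lt : gridSize K n * (2 * growth n ((2 * n + 2) ^ c) (A + 3 * lg n)) <
    wordBound (wordExponent K A c) n := by
  have h1 := lg_le (n := n)
  have hR : A + 3 * lg n + 2 ≤ (n + 2) ^ (A + 5 + 1) := by
    refine le_trans ?_ (const_mul_le_pow (A + 5) 1)
    rw [pow_one]; nlinarith
  have h2 : 2 * n + 4 ≤ (n + 2) ^ 2 := by nlinarith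
  have h3 : (2 * n + 2) ^ c ≤ (n + 2) ^ (2 * c) := by
    rw [pow_mul]; exact Nat.pow_le_pow_left (by omega) c
  have h4 : 2 ≤ (n + 2) ^ 1 := by rw [pow_one]; omega
  have h5 := Nat.mul_le_mul (gridSize_le_pow (K := K) (n := n))
    (Nat.mul_le_mul h4 (Nat.mul_le_mul hR (Nat.mul_le_mul h2 h3)))
  simp only [← pow_add] at h5
  exact lt_wordBound h5 (by rw [wordExponent]; omega)

theorem gridSize_mul_lt : gridSize K n * (n * n) + 2 * gridSize K n + 2 <
    wordBound (wordExponent K A c) n := by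
  have h1 := gridSize_le_pow (K := K) (n := n)
  have h2 : 1 ≤ (n + 2) ^ (2 * K + 3) := Nat.one_le_pow _ _ (by omega)
  have h3 : gridSize K n * (n * n) + 2 * gridSize K n + 2 ≤ (n + 2) ^ (2 * K + 3) * (n + 2) ^ 2 := by
    have : gridSize K n * (n * n + 2) ≤ (n + 2) ^ (2 * K + 3) * (n * n + 2) :=
      Nat.mul_le_mul_right _ h1
    nlinarith
  rw [← pow_add] at h3
  exact lt_wordBound h3 (by rw [wordExponent]; omega)

theorem halfParams_lt {Q : ℕ} (hQ : Q ≤ A * n ^ 3) :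
    (2 * n + n * n + 2) * (Q + 1) < wordBound (wordExponent K A c) n := by
  have h1 : 2 * n + n * n + 2 ≤ (n + 2) ^ 2 := by nlinarith
  have h2 : Q + 1 ≤ (n + 2) ^ (A + 1 + 3) := by
    refine le_trans ?_ (const_mul_le_pow (A + 1) 3)
    have h3 : n ^ 3 ≤ (n + 2) ^ 3 := Nat.pow_le_pow_left (by omega) 3
    have h4 : 1 ≤ (n + 2) ^ 3 := Nat.one_le_pow _ _ (by omega)
    nlinarith
  have h5 := Nat.mul_le_mul h1 h2
  rw [← pow_add] at h5
  exact lt_wordBound h5 (by rw [wordExponent]; omega)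

theorem sort_lt_wordBound (hm : m ≤ n * n) :
    (2 * (m + 1) + 2) * (2 * (n * n)) + 2 * (m + 1) + 2 * (n * n) + 3 <
      wordBound (wordExponent K A c) n := by
  have h1 : 2 * (m + 1) + 2 ≤ 2 * (n * n) + 4 := by omega
  have h2 := Nat.mul_le_mul_right (2 * (n * n)) h1
  have h3 : (2 * (n * n) + 4) * (2 * (n * n)) + 4 * (n * n) + 5 ≤ 4 * (n + 2) ^ 4 := by
    have : 4 * (n + 2) ^ 4 = (2 * (n * n) + 4) * (2 * (n * n)) + 32 * n ^ 3 + 88 * (n * n) + 128 * n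
      + 64 := by ring
    omega
  exact lt_wordBound ((by omega : _ ≤ 4 * (n + 2) ^ 4).trans (const_mul_le_pow 4 4))
    (by rw [wordExponent]; omega)

theorem linear_lt_wordBound : 48 * K * n + 4 * n + 4 * K + gridSize K n + 10 <
    wordBound (wordExponent K A c) n := by
  have h1 := lg_le (n := n)
  have h2 : gridSize K n ≤ (2 * K + 2) * (n + 2) :=
    gridSize_le.trans (Nat.mul_le_mul_left _ (by omega))
  have h3 : 48 * K * n + 4 * n + 4 * K + gridSize K n + 10 ≤ (48 * K + 2 * K + 11) * (n + 2) ^ 1 := by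
    rw [pow_one]; nlinarith
  have h5 : (48 * K + 2 * K + 11) * (n + 2) ^ 1 ≤ (48 * K + 11) * (n + 2) ^ 2 := by
    rw [pow_one, sq, ← mul_assoc]
    exact Nat.mul_le_mul_right _ (by nlinarith [Nat.zero_le (K * n)])
  exact lt_wordBound (h3.trans (h5.trans (const_mul_le_pow _ _))) (by rw [wordExponent]; omega)

theorem edges_lt_wordBound (hm : m ≤ n * n) :
    n * n + m + 2 < wordBound (wordExponent K A c) n := by
  have : n * n + m + 2 ≤ 2 * (n + 2) ^ 2 := by nlinarith
  exact lt_wordBound (this.trans (const_mul_le_pow 2 2)) (by rw [wordExponent]; omega)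

theorem pow_lt_wordBound : (2 * n + 2) ^ (c + 1) < wordBound (wordExponent K A c) n := by
  have : (2 * n + 2) ^ (c + 1) ≤ (n + 2) ^ (2 * (c + 1)) := by
    rw [pow_mul]; exact Nat.pow_le_pow_left (by nlinarith) _
  exact lt_wordBound this (by rw [wordExponent]; omega)

/-- The time of the preprocessing. Each of the `O(log n)` levels takes time
`O(n ^ ((3 + ω) / 2) * log n)`. -/
theorem preprocess_time (hω : 2 ≤ ω) (hn : 1 ≤ n) (hm : m ≤ n * n)
    (hF : (F : ℝ) ≤ (A + 1) * (n : ℝ) ^ ((3 + ω) / 2)) {t : ℕ}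
    (ht : t ≤ 6 * c + 100 + 20 * lg n + 200 * (n * n) +
      gridSize K n * (2 * halfTime P (m + 1) F (A + 3 * lg n) + 300 * (n * n))) :
    (t : ℝ) ≤ ((6 * c + 320 + (2 * K + 2) *
      (2 * (600 + 5 * (8 * productCost P + 6000) * ((A + 4) * (A + 1))) + 300) : ℕ) : ℝ) *
      (n : ℝ) ^ ((3 + ω) / 2) * (lg n : ℝ) ^ 2 := by
  obtain ⟨x, hx⟩ : ∃ x : ℝ, x = (n : ℝ) ^ ((3 + ω) / 2) := ⟨_, rfl⟩
  obtain ⟨H, hH⟩ : ∃ H, H = 600 + 5 * (8 * productCost P + 6000) * ((A + 4) * (A + 1)) := ⟨_, rfl⟩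
  rw [← hx] at hF ⊢
  rw [← hH]
  have hx2 : (n : ℝ) ^ 2 ≤ x := by rw [hx]; exact sq_le_rpow (by linarith) hn
  have hn1 : (1 : ℝ) ≤ n := by exact_mod_cast hn
  have hx1 : 1 ≤ x := le_trans (by nlinarith) hx2
  have hL : (1 : ℝ) ≤ lg n := by rw [lg]; push_cast; linarith [Nat.cast_nonneg (α := ℝ) (Nat.log 2 n)]
  obtain ⟨L, hLdef⟩ : ∃ L : ℝ, L = lg n := ⟨_, rfl⟩
  rw [← hLdef] at hL ⊢
  have hm' : (m : ℝ) ≤ (n : ℝ) ^ 2 := by rw [sq]; exact_mod_cast hm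
  have hxL : x ≤ x * L := by nlinarith
  have hxL2 : x * L ≤ x * L ^ 2 := by nlinarith
  have hhalf : (halfTime P (m + 1) F (A + 3 * lg n) : ℝ) ≤ H * (x * L) := by
    rw [halfTime, hH]
    push_cast
    have h1 : ((A : ℝ) + 3 * L + 1) * F ≤ (A + 4) * L * ((A + 1) * x) := by
      have hA : (0 : ℝ) ≤ A := Nat.cast_nonneg A
      exact mul_le_mul (by nlinarith) hF (Nat.cast_nonneg F) (by positivity)
    have h2 : (0 : ℝ) ≤ 5 * (8 * productCost P + 6000) := by positivity
    have h3 := mul_le_mul_of_nonneg_left h1 h2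
    have h4 : (200 : ℝ) * (m + 1 + 1) ≤ 600 * (x * L) := by linarith
    rw [← hLdef]
    linarith
  have hG : (gridSize K n : ℝ) ≤ (2 * K + 2) * L := by
    rw [hLdef]; exact_mod_cast gridSize_le
  have hlevel : (2 * halfTime P (m + 1) F (A + 3 * lg n) + 300 * (n * n) : ℝ) ≤
      (2 * H + 300) * (x * L) := by linarith
  have hall : (gridSize K n : ℝ) * (2 * halfTime P (m + 1) F (A + 3 * lg n) + 300 * (n * n)) ≤
      (2 * K + 2) * L * ((2 * H + 300) * (x * L)) :=
    mul_le_mul hG hlevel (by positivity) (by positivity)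
  have hLx : L ≤ x * L ^ 2 := by nlinarith
  have ht' : (t : ℝ) ≤ 6 * c + 100 + 20 * L + 200 * (n * n) +
      gridSize K n * (2 * halfTime P (m + 1) F (A + 3 * lg n) + 300 * (n * n)) := by
    rw [hLdef]; exact_mod_cast ht
  have hc : (0 : ℝ) ≤ c := Nat.cast_nonneg c
  have h6 : (6 * c + 100 : ℝ) ≤ (6 * c + 100) * (x * L ^ 2) :=
    le_mul_of_one_le_right (by positivity) (by linarith)
  push_cast
  calc (t : ℝ) ≤ _ := ht'
    _ ≤ (6 * c + 100) * (x * L ^ 2) + 20 * (x * L ^ 2) + 200 * (x * L ^ 2) +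
        (2 * K + 2) * L * ((2 * H + 300) * (x * L)) := by linarith
    _ = _ := by ring

end

/-! ### The dynamic algorithm -/

section
variable {n m c : ℕ} {D : DynAlg} {W : ℕ} {e : Fin m → Fin n × Fin n} {tIns : ℝ} {tQry : ℕ → ℝ}
  {ok ok' : Digraph (Fin n) → Fin n → Fin n → ℕ∞ → Prop}

/-- An invariant that is kept by insertions and queries allows to serve all sequences. -/
theorem serves_of_invariant (Inv : ℕ → RamState → Prop)
    (hins : ∀ i σ, ∀ hi : i < m, Inv i σ → ∃ t σ', RamExec W D.insert (σ.withPair (e ⟨i, hi⟩)) t σ' ∧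
      (t : ℝ) ≤ tIns ∧ Inv (i + 1) σ')
    (hqry : ∀ i σ u v, i ≤ m → Inv i σ → ∃ t σ', RamExec W D.query (σ.withPair (u, v)) t σ' ∧
      (t : ℝ) ≤ tQry i ∧ ok (graphAt e i) u v σ'.answer ∧ Inv i σ')
    (rs : List (Request n)) {i : ℕ} {σ : RamState} (hi : i ≤ m) (h : Inv i σ) :
    Serves D W e tIns tQry ok i σ rs := by
  induction rs generalizing i σ with
  | nil => trivial
  | cons r rs ih =>
    cases r with
    | insert =>
      intro hi'
      obtain ⟨t, σ', h1, h2, h3⟩ := hins i σ hi' h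
      exact ⟨t, σ', h1, h2, ih hi' h3⟩
    | query u v =>
      obtain ⟨t, σ', h1, h2, h3, h4⟩ := hqry i σ u v hi h
      exact ⟨t, σ', h1, h2, h3, ih hi h4⟩

theorem Serves.mono (hok : ∀ G u v a, ok G u v a → ok' G u v a) {rs : List (Request n)} {i : ℕ}
    {σ : RamState} (h : Serves D W e tIns tQry ok i σ rs) : Serves D W e tIns tQry ok' i σ rs := by
  induction rs generalizing i σ with
  | nil => trivial
  | cons r rs ih =>
    cases r with
    | insert =>
      intro hi
      obtain ⟨t, σ', h1, h2, h3⟩ := h hi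
      exact ⟨t, σ', h1, h2, ih h3⟩
    | query u v =>
      obtain ⟨t, σ', h1, h2, h3, h4⟩ := h
      exact ⟨t, σ', h1, h2, hok _ _ _ _ h3, ih h4⟩

end

theorem ApproxDistOk.reachabilityOk {ε : ℝ} {n : ℕ} {G : Digraph (Fin n)} {s t : Fin n} {a : ℕ∞}
    (h : ApproxDistOk ε G s t a) : ReachabilityOk G s t a := by
  rw [ReachabilityOk, ← ddist_ne_top_iff]
  refine ⟨fun ha hd => ?_, fun hd ha => ?_⟩
  · have h1 := h.1
    rw [hd, ENat.toENNReal_top, top_le_iff, ENat.toENNReal_eq_top] at h1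
    exact ha h1
  · have h1 := h.2
    rw [ha, ENat.toENNReal_top, top_le_iff] at h1
    exact ENNReal.mul_ne_top ENNReal.ofReal_ne_top (by simpa using hd) h1

/-- An exponent `ω ≤ 3` suffices: it makes the time of a single product of slot matrices at most
`n ^ ((3 + ω) / 2)`. -/
theorem MatMulInTime.exists_solves {ω : ℝ} (hω : MatMulInTime ω) (h3 : ω ≤ 3) {ε : ℝ} (hε : 0 < ε) :
    ∃ (D : DynAlg) (c C : ℕ), SolvesIncremental D c
      (fun n => C * (n : ℝ) ^ ((3 + ω) / 2) * (lg n : ℝ) ^ 2)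
      (fun n => C * (lg n : ℝ))
      (fun n η => C * ((η : ℝ) + 1) ^ 2 * (lg (lg n) : ℝ)) (ApproxDistOk ε) := by
  obtain ⟨P, c, A, hc, hP⟩ := hω.exists_params h3
  obtain ⟨K, hKε⟩ := exists_nat_ge (1 / ε)
  have hK : 0 < K := by
    have : (0 : ℝ) < K := (by positivity : 0 < 1 / ε).trans_le hKε
    exact_mod_cast this
  have hKε' : 1 ≤ (K : ℝ) * ε := by rwa [div_le_iff₀ hε] at hKε
  obtain ⟨Cp, hCp⟩ : ∃ Cp, Cp = 6 * c + 320 + (2 * K + 2) *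
      (2 * (600 + 5 * (8 * productCost P + 6000) * ((A + 4) * (A + 1))) + 300) := ⟨_, rfl⟩
  refine ⟨⟨preprocessProg K c P, insertProg, queryProg⟩, wordExponent K A c,
    Cp + 120 + (52 * K + 300), fun n m hn ê hê => ?_⟩
  obtain ⟨T, F, hmul, hsqF, hleF, hTF, hQ, hF⟩ := hP n hn
  have hm := edges_le hê
  have hL1 : 1 ≤ lg n := by rw [lg]; omega
  obtain ⟨W, hW⟩ : ∃ W, W = wordBound (wordExponent K A c) n := ⟨_, rfl⟩
  have hlin := linear_lt_wordBound (n := n) (K := K) (A := A) (c := c)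
  have hgrid := gridSize_mul_lt (n := n) (K := K) (A := A) (c := c)
  have hedge := edges_lt_wordBound (K := K) (A := A) (c := c) hm
  have hpow := pow_lt_wordBound (n := n) (K := K) (A := A) (c := c)
  have hgrow := growth_lt (n := n) (K := K) (A := A) (c := c)
  have hsort := sort_lt_wordBound (K := K) (A := A) (c := c) hm
  have hprod := halfParams_lt (K := K) (c := c) hQ
  rw [← hW] at hlin hgrid hedge hpow hgrow hsort hprod ⊢
  have hlen : ∀ g < gridSize K n, gridLen K g ≤ 16 * K * n := fun g hg => gridLen_le hK hn hg
  have hKn : n ≤ K * n := Nat.le_mul_of_pos_left n hK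
  have e16 : 16 * K * n = 16 * (K * n) := by ring
  have e48 : 48 * K * n = 48 * (K * n) := by ring
  have hH : HalfParams P n (2 * n) (m + 1) ((2 * n + 2) ^ c) W T F
      (A + 3 * lg n) := by
    refine ⟨hmul, hn, rfl, ?_, hsqF, hleF, hTF, ?_, hsort, hprod⟩
    · have h1 : 2 * n * (2 * n) ≤ (2 * n + 2) ^ 2 := by
        rw [sq]; exact Nat.mul_le_mul (Nat.le_add_right _ 2) (Nat.le_add_right _ 2)
      have h2 : 0 < 2 * n + 2 := Nat.succ_pos _
      exact h1.trans (Nat.pow_le_pow_right h2 hc)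
    · have h1 : A ≤ 2 ^ A := (Nat.lt_pow_self one_lt_two).le
      have h2 : n ≤ 2 ^ lg n := lt_two_pow_lg.le
      rw [pow_add, mul_comm 3, pow_mul]
      exact hQ.trans (Nat.mul_le_mul h1 (Nat.pow_le_pow_left h2 3))
  obtain ⟨t, σ, hx, hO, ht⟩ := wp_preprocessProg hê hK hH hpow hgrow
    (by omega) (fun g hg => by have := hlen g hg; omega) (by omega) (by omega)
  rw [zero_add] at ht
  refine ⟨t, σ, hx, ?_, fun τ rs => ?_⟩
  · have h1 := preprocess_time hω.two_le hn hm hF ht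
    rw [← hCp] at h1
    refine h1.trans ?_
    have h2 : (Cp : ℝ) ≤ ((Cp + 120 + (52 * K + 300) : ℕ) : ℝ) := by
      exact_mod_cast (by omega : Cp ≤ Cp + 120 + (52 * K + 300))
    exact mul_le_mul_of_nonneg_right (mul_le_mul_of_nonneg_right h2 (by positivity)) (by positivity)
  · refine serves_of_invariant (Online ê τ K) (fun i σ hi h => ?_) (fun i σ u v hi h => ?_) rs
      (Nat.zero_le m) (hO τ)
    · obtain ⟨t, σ', h1, h2, h4⟩ := wp_insertProg h hi hedge
      refine ⟨t, σ', h1, ?_, h2⟩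
      rw [zero_add] at h4
      have : t ≤ (Cp + 120 + (52 * K + 300)) * lg n :=
        (h4.trans (by omega)).trans (Nat.le_mul_of_pos_right _ hL1)
      beta_reduce; exact_mod_cast this
    · obtain ⟨t, σ', h1, h2, ⟨e, h4, h5⟩, h6⟩ := wp_queryProg (u := u) (v := v) h hê hi hK hlen
        (by omega) (by omega) hgrid (by omega)
      refine ⟨t, σ', h1, ?_, h4.approxDistOk hK hKε' h5, h2⟩
      rw [zero_add] at h6
      have h7 : t ≤ (Cp + 120 + (52 * K + 300)) * (etaBar ê (ê ∘ τ) i + 1) ^ 2 * lg (lg n) := by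
        refine h6.trans ((Nat.mul_le_mul_left _ searchTime_le).trans ?_)
        rw [mul_comm (Cp + 120 + _), mul_assoc]
        exact Nat.mul_le_mul_left _ (Nat.mul_le_mul_right _ (by omega))
      beta_reduce; exact_mod_cast h7

theorem theorem3p1 (ω : ℝ) (hω : MatMulInTime ω) :
    (∀ ε : ℝ, 0 < ε → ∃ (D : DynAlg) (c C : ℕ),
      SolvesIncremental D c
        (fun n => C * (n : ℝ) ^ ((3 + ω) / 2) * (lg n : ℝ) ^ 2)
        (fun n => C * (lg n : ℝ))
        (fun n η => C * ((η : ℝ) + 1) ^ 2 * (lg (lg n) : ℝ))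
        (ApproxDistOk ε)) ∧
    (∃ (D : DynAlg) (c C : ℕ),
      SolvesIncremental D c
        (fun n => C * (n : ℝ) ^ ((3 + ω) / 2) * (lg n : ℝ) ^ 2)
        (fun n => C * (lg n : ℝ))
        (fun n η => C * ((η : ℝ) + 1) ^ 2 * (lg (lg n) : ℝ))
        ReachabilityOk) ∧
    (∀ (n m : ℕ) (ê : Fin m → Fin n × Fin n), Function.Injective ê →
      ∀ (τ : Equiv.Perm (Fin m)) (i : ℕ), i ≤ m → etaBar ê (ê ∘ τ) i ≤ etaInf τ) := by
  have key : ∀ ε : ℝ, 0 < ε → ∃ (D : DynAlg) (c C : ℕ), SolvesIncremental D c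
      (fun n => C * (n : ℝ) ^ ((3 + ω) / 2) * (lg n : ℝ) ^ 2)
      (fun n => C * (lg n : ℝ))
      (fun n η => C * ((η : ℝ) + 1) ^ 2 * (lg (lg n) : ℝ)) (ApproxDistOk ε) := by
    intro ε hε
    rcases le_total ω 3 with h3 | h3
    · exact hω.exists_solves h3 hε
    · -- If `ω` exceeds `3`, then schoolbook multiplication is faster.
      obtain ⟨D, c, C, h⟩ := matMulInTime_three.exists_solves le_rfl hε
      refine ⟨D, c, C, fun n m hn ê hê => ?_⟩
      obtain ⟨t, σ, h1, h2, h4⟩ := h n m hn ê hê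
      refine ⟨t, σ, h1, h2.trans ?_, h4⟩
      have : (n : ℝ) ^ (((3 : ℝ) + 3) / 2) ≤ (n : ℝ) ^ ((3 + ω) / 2) :=
        Real.rpow_le_rpow_of_exponent_le (by exact_mod_cast hn) (by linarith)
      exact mul_le_mul_of_nonneg_right (mul_le_mul_of_nonneg_left this (by positivity))
        (by positivity)
  refine ⟨key, ?_, fun n m ê hê τ i hi => etaBar_le_etaInf hê τ hi⟩
  obtain ⟨D, c, C, h⟩ := key 1 one_pos
  refine ⟨D, c, C, fun n m hn ê hê => ?_⟩
  obtain ⟨t, σ, h1, h2, h3⟩ := h n m hn ê hê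
  exact ⟨t, σ, h1, h2, fun τ rs => (h3 τ rs).mono fun _ _ _ _ h => h.reachabilityOk⟩
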